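/- Let $p$ be a prime, let $\mathcal F$ be a saturated fusion system over a finite $p$-group $S$, and let $H\le S$ be $\mathcal F$-centric and fully $\mathcal F$-normalized. Write $N_S=N_S(H)$ and let $N_{\mathcal F}=N_{\mathcal F}(H)$ be the normalizer fusion system over $N_S$ (its morphisms $A\to B$ are those of $\mathcal F$ which extend to a morphism $AH\to BH$ of $\mathcal F$ mapping $H$ to $H$). For $K\le S$ let $\mathcal F_K(K)$ be the fusion system over $K$ whose morphisms are the conjugations by elements of $K$. Let $\mathcal R$ be a commutative $p$-local ring, i.e. every prime $q\ne p$ is invertible in $\mathcal R$, and let $M$ be a centric Mackey functor over $\mathcal F$ on $\mathcal R$: a finitely generated left module over the Mackey algebra $\mu_{\mathcal R}(\mathcal F)$ (that is, $\mathcal R\otimes_{\mathbb Z}\mu_{\mathbb Z}(\mathcal F)$, where $\mu_{\mathbb Z}(\mathcal F)$ is the subring generated by the induction bisets $I_A^B$, the restriction bisets $R_A^B$ and the conjugation bisets $c_\varphi$, $A\le B\le S$, $\varphi$ an isomorphism of $\mathcal F$, in the ring of formal differences of isomorphism classes of finite bisets over pairs of subgroups of $S$) such that $I_K^KM=0$ for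 every $K\le S$ which is not $\mathcal F$-centric. For a fusion subsystem $\mathcal E\subseteq\mathcal F$ over $P\le S$ let $M\!\downarrow_{\mathcal E}=1_{\mu_{\mathcal R}(\mathcal E)}M$, a $\mu_{\mathcal R}(\mathcal E)$-module, where $1_{\mu_{\mathcal R}(\mathcal E)}=\sum_{K\le P}I_K^K$. For $\mathcal E$-centric $A,K\le P$ let $[A\times_{\mathcal E}K]$ be a set of representatives of the maximal pairs $(B,\overline\varphi)$, with $B\le A$ $\mathcal E$-centric and $\overline\varphi\colon B\to K$ a morphism of the orbit category $\mathcal O(\mathcal E)$, where $(B,\overline\varphi)\precsim(C,\overline\psi)$ if there is $a\in A$ with $B^a\le C$ and $\overline\varphi\,\overline{c_a}=\overline\psi\,\overline{\iota_{B^a}^{C}}$. For $\mathcal E\in\{\mathcal F,N_{\mathcal F}\}$ and an $\mathcal F$-centric $A\le S$ with $\mathcal F_A(A)\subseteq\mathcal E$, the transfer $\operatorname{tr}_{\mathcal F_A(A)}^{\mathcal E}\colon\operatorname{End}(M\!\downarrow_{\mathcal F_A(A)})\to\operatorname{End}(M\!\downarrow_{\mathcal E})$ is given, for every $\mathcal E$-centric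 $K$ and $x\in I_K^KM$, by $$\operatorname{tr}_{\mathcal F_A(A)}^{\mathcal E}(f)(x)=\sum_{(B,\overline\varphi)\in[A\times_{\mathcal E}K]}I_{\varphi(B)}^Kc_\varphi\,f\bigl(c_{\varphi^{-1}}R_{\varphi(B)}^K\,x\bigr),$$ and $\operatorname{Tr}_H^{\mathcal E}:=\operatorname{tr}_{\mathcal F_H(H)}^{\mathcal E}\bigl(\operatorname{End}(M\!\downarrow_{\mathcal F_H(H)})\bigr)$. Let $(\overline S\,\cdot):=\operatorname{tr}_{\mathcal F_S(S)}^{\mathcal F}(\mathrm{Id})\in\operatorname{End}(M)$ be the action of the class of $S$ in the centric Burnside ring. For a morphism $\varphi\colon A\to S$ of $\mathcal F$ with $A\le N_S$ $\mathcal F$-centric put $${}_\varphi N=\{y\in N_S(\varphi(A)) : \varphi^{-1}c_y\varphi\in\operatorname{Aut}_{N_{\mathcal F}}(A)\},$$ $$N_\varphi=\{x\in N_{N_S}(A) : \varphi c_x\varphi^{-1}\in\operatorname{Aut}_{{}_\varphi N}(\varphi(A))\};$$ $\varphi$ is called its own $N_{\mathcal F}$-top if $A$ is fully $N_{\mathcal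 F}$-normalized and $\varphi\operatorname{Aut}_{N_\varphi}(A)\varphi^{-1}=\operatorname{Aut}_{{}_\varphi N}(\varphi(A))$. Let $[N_{\mathcal F}\times S]\subseteq[H\times_{\mathcal F}S]$ consist of exactly one element $(A,\overline\varphi)$ from each class of the relation "$(A,\overline\varphi)\sim(B,\overline\psi)$ if $\overline\varphi=\overline\psi\,\overline\theta$ for some isomorphism $\theta\colon A\to B$ of $N_{\mathcal F}$", chosen with $A$ fully $N_{\mathcal F}$-normalized and $\varphi$ its own $N_{\mathcal F}$-top. Then such a set $[N_{\mathcal F}\times S]$ exists in every choice of $[H\times_{\mathcal F}S]$, the endomorphism $(\overline S\,\cdot)$ of $M$ is invertible, and for all choices of the sets of representatives the formulas above for $\operatorname{tr}_{\mathcal F_H(H)}^{\mathcal F}$, for $\operatorname{tr}_{\mathcal F_H(H)}^{N_{\mathcal F}}$, and $$\operatorname{tr}_{N_{\mathcal F}}^{\mathcal F}(g):=(\overline S\,\cdot)^{-1}\sum_{(A,\overline\varphi)\in[N_{\mathcal F}\times S]}\operatorname{tr}_{\mathcal F_{N_\varphi}(N_\varphi)}^{\mathcal F}\bigl(g|_{M\downarrow_{\mathcal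 F_{N_\varphi}(N_\varphi)}}\bigr)$$ define maps $\operatorname{End}(M\!\downarrow_{\mathcal F_H(H)})\to\operatorname{End}(M)$, $\operatorname{End}(M\!\downarrow_{\mathcal F_H(H)})\to\operatorname{End}(M\!\downarrow_{N_{\mathcal F}})$ and $\operatorname{End}(M\!\downarrow_{N_{\mathcal F}})\to\operatorname{End}(M)$ respectively, which satisfy $$\operatorname{tr}_{N_{\mathcal F}}^{\mathcal F}\circ\operatorname{tr}_{\mathcal F_H(H)}^{N_{\mathcal F}}=\operatorname{tr}_{\mathcal F_H(H)}^{\mathcal F}.$$ In particular $\operatorname{tr}_{N_{\mathcal F}}^{\mathcal F}$ maps $\operatorname{Tr}_H^{N_{\mathcal F}}$ onto $\operatorname{Tr}_H^{\mathcal F}$. -/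

import Mathlib

open scoped TensorProduct

universe u v w

noncomputable section

namespace FusionMackey

/-! ## Finite bisets and their composition -/

set_option linter.unusedSectionVars false

section Bisets

/-- A finite `(G, H)`-biset. The left action of `g : G` and the right action of `h : H` are recorded
together as an action of `G × H`, with `(g, h) • x = g · x · h⁻¹`. -/
structure Biset (G H : Type u) [Group G] [Group H] where
  carrier : Type u
  [finite : Finite carrier]
  [action : MulAction (G × H) carrier]

attribute [instance] Biset.finite Biset.action

variable {G H J K : Type u} [Group G] [Group H] [Group J] [Group K]

/-- Two bisets are isomorphic if there is an equivariant bijection between them. -/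
def Biset.Iso (X Y : Biset G H) : Prop :=
  ∃ e : X.carrier ≃ Y.carrier, ∀ (a : G × H) (x : X.carrier), e (a • x) = a • e x

instance Biset.setoid (G H : Type u) [Group G] [Group H] : Setoid (Biset G H) where
  r := Biset.Iso
  iseqv :=
    { refl := fun X => ⟨Equiv.refl _, fun _ _ => rfl⟩
      symm := by
        rintro X Y ⟨e, he⟩
        refine ⟨e.symm, fun a y => ?_⟩
        rw [Equiv.symm_apply_eq, he, Equiv.apply_symm_apply]
      trans := by
        rintro X Y Z ⟨e, he⟩ ⟨f, hf⟩
        exact ⟨e.trans f, fun a x => by simp [he, hf]⟩ }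

/-- The empty biset. -/
def Biset.empty (G H : Type u) [Group G] [Group H] : Biset G H :=
  letI : MulAction (G × H) PEmpty.{u + 1} :=
    { smul := fun _ x => x, one_smul := fun _ => rfl, mul_smul := fun _ _ _ => rfl }
  ⟨PEmpty⟩

/-- The disjoint union of two bisets. -/
def Biset.sum (X Y : Biset G H) : Biset G H := ⟨X.carrier ⊕ Y.carrier⟩

/-- The transitive `(G, H)`-biset `(G × H) / D`. -/
def Biset.coset [Finite G] [Finite H] (D : Subgroup (G × H)) : Biset G H := ⟨(G × H) ⧸ D⟩

/-- The relation `(x · j⁻¹, j · y) ∼ (x, y)` on `X × Y`. -/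
instance Biset.compSetoid (X : Biset G J) (Y : Biset J H) :
    Setoid (X.carrier × Y.carrier) where
  r p q := ∃ j : J, q = (((1 : G), j) • p.1, (j, (1 : H)) • p.2)
  iseqv :=
    { refl := fun p => ⟨1, by simp [← Prod.one_eq_mk]⟩
      symm := by
        rintro p q ⟨j, rfl⟩
        exact ⟨j⁻¹, by simp [smul_smul, ← Prod.one_eq_mk]⟩
      trans := by
        rintro p q r ⟨j, rfl⟩ ⟨k, rfl⟩
        exact ⟨k * j, by simp [smul_smul]⟩ }

/-- The action of `G × H` on `X ×_J Y`. -/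
instance Biset.compAction (X : Biset G J) (Y : Biset J H) :
    MulAction (G × H) (Quotient (Biset.compSetoid X Y)) where
  smul a := Quotient.map (fun p => ((a.1, (1 : J)) • p.1, ((1 : J), a.2) • p.2)) (by
    rintro p q ⟨j, rfl⟩
    exact ⟨j, by simp [smul_smul]⟩)
  one_smul := by
    rintro ⟨p⟩
    exact congrArg (Quotient.mk _) (by simp [← Prod.one_eq_mk])
  mul_smul := by
    rintro a b ⟨p⟩
    exact congrArg (Quotient.mk _) (by simp [smul_smul])

theorem Biset.comp_smul_mk (X : Biset G J) (Y : Biset J H) (a : G × H)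
    (p : X.carrier × Y.carrier) :
    a • (Quotient.mk (Biset.compSetoid X Y) p) =
      Quotient.mk (Biset.compSetoid X Y) ((a.1, (1 : J)) • p.1, ((1 : J), a.2) • p.2) := rfl

/-- The composition (product) `X ×_J Y` of a `(G, J)`-biset and a `(J, H)`-biset. -/
def Biset.comp (X : Biset G J) (Y : Biset J H) : Biset G H :=
  ⟨Quotient (Biset.compSetoid X Y)⟩

theorem Biset.sum_congr {X X' Y Y' : Biset G H} (hX : X.Iso X') (hY : Y.Iso Y') :
    (X.sum Y).Iso (X'.sum Y') := by
  obtain ⟨e, he⟩ := hX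
  obtain ⟨f, hf⟩ := hY
  refine ⟨Equiv.sumCongr e f, ?_⟩
  rintro a (x | x)
  · exact congrArg Sum.inl (he a x)
  · exact congrArg Sum.inr (hf a x)

theorem Biset.comp_congr {X X' : Biset G J} {Y Y' : Biset J H} (hX : X.Iso X') (hY : Y.Iso Y') :
    (X.comp Y).Iso (X'.comp Y') := by
  obtain ⟨e, he⟩ := hX
  obtain ⟨f, hf⟩ := hY
  refine ⟨Quotient.congr (Equiv.prodCongr e f) ?_, ?_⟩
  · rintro p q
    constructor
    · rintro ⟨j, rfl⟩
      exact ⟨j, by simp [he, hf]⟩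
    · rintro ⟨j, h⟩
      refine ⟨j, ?_⟩
      apply (Equiv.prodCongr e f).injective
      rw [h]
      simp [he, hf]
  · rintro a ⟨p⟩
    exact congrArg (Quotient.mk _) (by simp [he, hf])

/-- Isomorphism classes of finite `(G, H)`-bisets. -/
def BisetClass (G H : Type u) [Group G] [Group H] : Type (u + 1) := Quotient (Biset.setoid G H)

/-- The isomorphism class of a biset. -/
def BisetClass.mk (X : Biset G H) : BisetClass G H := Quotient.mk _ X

theorem BisetClass.mk_eq {X Y : Biset G H} (h : X.Iso Y) : BisetClass.mk X = BisetClass.mk Y :=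
  Quotient.sound h

instance : Add (BisetClass G H) :=
  ⟨Quotient.map₂ Biset.sum (fun _ _ hX _ _ hY => Biset.sum_congr hX hY)⟩

instance : Zero (BisetClass G H) := ⟨BisetClass.mk (Biset.empty G H)⟩

/-- Isomorphism classes of bisets form a commutative monoid under disjoint union. -/
instance : AddCommMonoid (BisetClass G H) where
  add_assoc := by
    rintro ⟨X⟩ ⟨Y⟩ ⟨Z⟩
    refine BisetClass.mk_eq ⟨Equiv.sumAssoc _ _ _, ?_⟩
    rintro a ((x | x) | x) <;> rfl
  zero_add := by
    rintro ⟨X⟩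
    refine BisetClass.mk_eq ⟨Equiv.emptySum PEmpty _, ?_⟩
    rintro a (x | x)
    · exact x.elim
    · rfl
  add_zero := by
    rintro ⟨X⟩
    refine BisetClass.mk_eq ⟨Equiv.sumEmpty _ PEmpty, ?_⟩
    rintro a (x | x)
    · rfl
    · exact x.elim
  add_comm := by
    rintro ⟨X⟩ ⟨Y⟩
    refine BisetClass.mk_eq ⟨Equiv.sumComm _ _, ?_⟩
    rintro a (x | x) <;> rfl
  nsmul := nsmulRec

theorem BisetClass.mk_add (X Y : Biset G H) :
    BisetClass.mk X + BisetClass.mk Y = BisetClass.mk (X.sum Y) := rfl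

/-- Composition of isomorphism classes of bisets. -/
def BisetClass.comp : BisetClass G J → BisetClass J H → BisetClass G H :=
  Quotient.map₂ Biset.comp (fun _ _ hX _ _ hY => Biset.comp_congr hX hY)

theorem BisetClass.zero_comp (Y : BisetClass J H) : (0 : BisetClass G J).comp Y = 0 := by
  obtain ⟨Y⟩ := Y
  refine BisetClass.mk_eq ⟨⟨fun x => ?_, fun x => x.elim, ?_, ?_⟩, ?_⟩
  · exact Quotient.liftOn x (fun p => p.1) (fun p => p.1.elim)
  · rintro ⟨p⟩
    exact p.1.elim
  · rintro ⟨⟩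
  · rintro a ⟨p⟩
    exact p.1.elim

theorem BisetClass.comp_zero (X : BisetClass G J) : X.comp (0 : BisetClass J H) = 0 := by
  obtain ⟨X⟩ := X
  refine BisetClass.mk_eq ⟨⟨fun x => ?_, fun x => x.elim, ?_, ?_⟩, ?_⟩
  · exact Quotient.liftOn x (fun p => p.2) (fun p => p.2.elim)
  · rintro ⟨p⟩
    exact p.2.elim
  · rintro ⟨⟩
  · rintro a ⟨p⟩
    exact p.2.elim

theorem BisetClass.add_comp (X Y : BisetClass G J) (Z : BisetClass J H) :
    (X + Y).comp Z = X.comp Z + Y.comp Z := by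
  obtain ⟨X⟩ := X
  obtain ⟨Y⟩ := Y
  obtain ⟨Z⟩ := Z
  refine (BisetClass.mk_eq ⟨⟨?_, ?_, ?_, ?_⟩, ?_⟩ :
    BisetClass.mk ((X.sum Y).comp Z) = BisetClass.mk ((X.comp Z).sum (Y.comp Z)))
  · refine fun x => Quotient.liftOn x (fun p => Sum.elim
      (fun x => Sum.inl (Quotient.mk (Biset.compSetoid X Z) (x, p.2)))
      (fun y => Sum.inr (Quotient.mk (Biset.compSetoid Y Z) (y, p.2))) p.1) ?_
    rintro ⟨x | y, z⟩ q ⟨j, rfl⟩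
    · exact congrArg Sum.inl (Quotient.sound ⟨j, rfl⟩)
    · exact congrArg Sum.inr (Quotient.sound ⟨j, rfl⟩)
  · refine Sum.elim (Quotient.map (fun p => (Sum.inl p.1, p.2)) ?_)
      (Quotient.map (fun p => (Sum.inr p.1, p.2)) ?_)
    · rintro p q ⟨j, rfl⟩
      exact ⟨j, rfl⟩
    · rintro p q ⟨j, rfl⟩
      exact ⟨j, rfl⟩
  · rintro ⟨x | y, z⟩ <;> rfl
  · rintro (⟨x, z⟩ | ⟨y, z⟩) <;> rfl
  · rintro a ⟨x | y, z⟩ <;> rfl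

theorem BisetClass.comp_add (X : BisetClass G J) (Y Z : BisetClass J H) :
    X.comp (Y + Z) = X.comp Y + X.comp Z := by
  obtain ⟨X⟩ := X
  obtain ⟨Y⟩ := Y
  obtain ⟨Z⟩ := Z
  refine (BisetClass.mk_eq ⟨⟨?_, ?_, ?_, ?_⟩, ?_⟩ :
    BisetClass.mk (X.comp (Y.sum Z)) = BisetClass.mk ((X.comp Y).sum (X.comp Z)))
  · refine fun x => Quotient.liftOn x (fun p => Sum.elim
      (fun y => Sum.inl (Quotient.mk (Biset.compSetoid X Y) (p.1, y)))
      (fun z => Sum.inr (Quotient.mk (Biset.compSetoid X Z) (p.1, z))) p.2) ?_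
    rintro ⟨x, y | z⟩ q ⟨j, rfl⟩
    · exact congrArg Sum.inl (Quotient.sound ⟨j, rfl⟩)
    · exact congrArg Sum.inr (Quotient.sound ⟨j, rfl⟩)
  · refine Sum.elim (Quotient.map (fun p => (p.1, Sum.inl p.2)) ?_)
      (Quotient.map (fun p => (p.1, Sum.inr p.2)) ?_)
    · rintro p q ⟨j, rfl⟩
      exact ⟨j, rfl⟩
    · rintro p q ⟨j, rfl⟩
      exact ⟨j, rfl⟩
  · rintro ⟨x, y | z⟩ <;> rfl
  · rintro (⟨x, y⟩ | ⟨x, z⟩) <;> rfl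
  · rintro a ⟨x, y | z⟩ <;> rfl

theorem BisetClass.comp_assoc (X : BisetClass G J) (Y : BisetClass J K) (Z : BisetClass K H) :
    (X.comp Y).comp Z = X.comp (Y.comp Z) := by
  obtain ⟨X⟩ := X
  obtain ⟨Y⟩ := Y
  obtain ⟨Z⟩ := Z
  refine (BisetClass.mk_eq ⟨⟨?_, ?_, ?_, ?_⟩, ?_⟩ :
    BisetClass.mk ((X.comp Y).comp Z) = BisetClass.mk (X.comp (Y.comp Z)))
  · refine fun t => Quotient.liftOn t (fun p => Quotient.liftOn p.1
      (fun q => Quotient.mk (Biset.compSetoid X (Y.comp Z))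
        (q.1, Quotient.mk (Biset.compSetoid Y Z) (q.2, p.2))) ?_) ?_
    · rintro ⟨x, y⟩ q ⟨j, rfl⟩
      refine Quotient.sound ⟨j, ?_⟩
      exact Prod.ext rfl (congrArg (Quotient.mk _)
        (Prod.ext rfl (one_smul (K × H) p.2).symm))
    · rintro ⟨⟨x, y⟩, z⟩ q ⟨k, rfl⟩
      refine congrArg (Quotient.mk _) (Prod.ext (one_smul (G × J) x).symm ?_)
      exact Quotient.sound ⟨k, rfl⟩
  · refine fun t => Quotient.liftOn t (fun p => Quotient.liftOn p.2
      (fun q => Quotient.mk (Biset.compSetoid (X.comp Y) Z)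
        (Quotient.mk (Biset.compSetoid X Y) (p.1, q.1), q.2)) ?_) ?_
    · rintro ⟨y, z⟩ q ⟨k, rfl⟩
      refine Quotient.sound ⟨k, ?_⟩
      exact Prod.ext (congrArg (Quotient.mk _)
        (Prod.ext (one_smul (G × J) p.1).symm rfl)) rfl
    · rintro ⟨x, ⟨y, z⟩⟩ q ⟨j, rfl⟩
      refine congrArg (Quotient.mk _) (Prod.ext ?_ (one_smul (K × H) z).symm)
      exact Quotient.sound ⟨j, rfl⟩
  · rintro ⟨⟨⟨x, y⟩⟩, z⟩
    rfl
  · rintro ⟨x, ⟨⟨y, z⟩⟩⟩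
    rfl
  · rintro a ⟨⟨⟨x, y⟩⟩, z⟩
    refine congrArg (Quotient.mk _) (Prod.ext rfl ?_)
    exact congrArg (Quotient.mk _) (Prod.ext rfl rfl)

theorem BisetClass.one_comp [Finite J] (D : Subgroup (J × J)) (hD : ∀ p, p ∈ D ↔ p.1 = p.2)
    (Y : BisetClass J H) : (BisetClass.mk (Biset.coset D)).comp Y = Y := by
  obtain ⟨Y⟩ := Y
  refine (BisetClass.mk_eq ⟨⟨?_, ?_, ?_, ?_⟩, ?_⟩ :
    BisetClass.mk ((Biset.coset D).comp Y) = BisetClass.mk Y)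
  · refine fun t => Quotient.liftOn t (fun p => Quotient.liftOn p.1
      (fun q : J × J => (q.1 * q.2⁻¹, (1 : H)) • p.2) ?_) ?_
    · intro q r hqr
      have h : q.1⁻¹ * r.1 = q.2⁻¹ * r.2 := (hD _).1 (QuotientGroup.leftRel_apply.1 hqr)
      have e : r.1 = q.1 * (q.2⁻¹ * r.2) := by rw [← h, mul_inv_cancel_left]
      have : q.1 * q.2⁻¹ = r.1 * r.2⁻¹ := by rw [e]; group
      simp only [this]
    · rintro ⟨⟨q⟩, y⟩ r ⟨j, rfl⟩
      change (q.1 * q.2⁻¹, (1 : H)) • y = ((1 * q.1) * (j * q.2)⁻¹, (1 : H)) • (j, (1 : H)) • y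
      simp [smul_smul, mul_assoc]
  · exact fun y => Quotient.mk (Biset.compSetoid (Biset.coset D) Y)
      ((QuotientGroup.mk (1 : J × J) : (J × J) ⧸ D), y)
  · rintro ⟨⟨q⟩, y⟩
    refine (Quotient.sound ?_).symm
    refine ⟨q.1 * q.2⁻¹, Prod.ext ?_ rfl⟩
    refine QuotientGroup.eq.2 ((hD _).2 ?_)
    simp
  · intro y
    change ((1 : J) * (1 : J)⁻¹, (1 : H)) • y = y
    simp [← Prod.one_eq_mk]
  · rintro a ⟨⟨q⟩, y⟩
    change ((a.1 * q.1) * (1 * q.2)⁻¹, (1 : H)) • ((1 : J), a.2) • y =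
      a • (q.1 * q.2⁻¹, (1 : H)) • y
    rw [smul_smul, smul_smul]
    congr 1
    exact Prod.ext (by simp [mul_assoc]) (by simp)

theorem BisetClass.comp_one [Finite J] (D : Subgroup (J × J)) (hD : ∀ p, p ∈ D ↔ p.1 = p.2)
    (X : BisetClass G J) : X.comp (BisetClass.mk (Biset.coset D)) = X := by
  obtain ⟨X⟩ := X
  refine (BisetClass.mk_eq ⟨⟨?_, ?_, ?_, ?_⟩, ?_⟩ :
    BisetClass.mk (X.comp (Biset.coset D)) = BisetClass.mk X)
  · refine fun t => Quotient.liftOn t (fun p => Quotient.liftOn p.2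
      (fun q : J × J => ((1 : G), q.2 * q.1⁻¹) • p.1) ?_) ?_
    · intro q r hqr
      have h : q.1⁻¹ * r.1 = q.2⁻¹ * r.2 := (hD _).1 (QuotientGroup.leftRel_apply.1 hqr)
      have e : r.1 = q.1 * (q.2⁻¹ * r.2) := by rw [← h, mul_inv_cancel_left]
      have : q.2 * q.1⁻¹ = r.2 * r.1⁻¹ := by rw [e]; group
      simp only [this]
    · rintro ⟨x, ⟨q⟩⟩ r ⟨j, rfl⟩
      change ((1 : G), q.2 * q.1⁻¹) • x = ((1 : G), (1 * q.2) * (j * q.1)⁻¹) • ((1 : G), j) • x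
      simp [smul_smul, mul_assoc]
  · exact fun x => Quotient.mk (Biset.compSetoid X (Biset.coset D))
      (x, (QuotientGroup.mk (1 : J × J) : (J × J) ⧸ D))
  · rintro ⟨x, ⟨q⟩⟩
    refine (Quotient.sound ?_).symm
    refine ⟨q.2 * q.1⁻¹, Prod.ext rfl ?_⟩
    refine QuotientGroup.eq.2 ((hD _).2 ?_)
    simp
  · intro x
    change ((1 : G), (1 : J) * (1 : J)⁻¹) • x = x
    simp [← Prod.one_eq_mk]
  · rintro a ⟨x, ⟨q⟩⟩
    change ((1 : G), (a.2 * q.2) * (1 * q.1)⁻¹) • (a.1, (1 : J)) • x =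
      a • ((1 : G), q.2 * q.1⁻¹) • x
    rw [smul_smul, smul_smul]
    congr 1
    exact Prod.ext (by simp) (by simp [mul_assoc])

end Bisets

/-! ## The biset ring of a finite group `S`: formal differences of bisets over pairs of subgroups -/

section Ring

open Algebra

/-- The Grothendieck group of finite `(G, H)`-bisets. -/
abbrev BisetGroup (G H : Type u) [Group G] [Group H] : Type (u + 1) :=
  GrothendieckAddGroup (BisetClass G H)

variable {G H J K : Type u} [Group G] [Group H] [Group J] [Group K]

/-- Composition of bisets, as a biadditive map. -/
def BisetClass.compHom : BisetClass G J →+ BisetClass J H →+ BisetClass G H where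
  toFun X :=
    { toFun := fun Y => X.comp Y
      map_zero' := X.comp_zero
      map_add' := X.comp_add }
  map_zero' := AddMonoidHom.ext BisetClass.zero_comp
  map_add' X Y := AddMonoidHom.ext (BisetClass.add_comp X Y)

theorem BisetGroup.lift_of {A : Type*} [AddCommGroup A] (f : BisetClass G H →+ A)
    (X : BisetClass G H) :
    GrothendieckAddGroup.lift f (GrothendieckAddGroup.of X) = f X :=
  DFunLike.congr_fun (GrothendieckAddGroup.lift.symm_apply_apply f) X

theorem BisetGroup.exists_sub (x : BisetGroup G H) :
    ∃ X Y : BisetClass G H, x = GrothendieckAddGroup.of X - GrothendieckAddGroup.of Y := by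
  induction x using AddLocalization.ind with
  | _ p =>
    obtain ⟨X, Y, hY⟩ := p
    refine ⟨X, Y, ?_⟩
    rw [eq_sub_iff_add_eq]
    simp only [AddLocalization.mk_eq_addMonoidOf_mk']
    exact (AddLocalization.addMonoidOf ⊤).mk'_spec X ⟨Y, hY⟩

theorem BisetGroup.hom_ext {A : Type*} [AddCommGroup A] {f g : BisetGroup G H →+ A}
    (h : ∀ X, f (GrothendieckAddGroup.of X) = g (GrothendieckAddGroup.of X)) : f = g :=
  GrothendieckAddGroup.lift.symm.injective (AddMonoidHom.ext h)

/-- Composition, extended biadditively to the Grothendieck groups. -/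
def BisetGroup.comp : BisetGroup G J →+ BisetGroup J H →+ BisetGroup G H :=
  GrothendieckAddGroup.lift
    { toFun := fun X => GrothendieckAddGroup.lift
        ((GrothendieckAddGroup.of).comp (BisetClass.compHom X))
      map_zero' := BisetGroup.hom_ext fun Y => by
        rw [BisetGroup.lift_of]; simp
      map_add' := fun X Y => BisetGroup.hom_ext fun Z => by
        rw [AddMonoidHom.add_apply, BisetGroup.lift_of, BisetGroup.lift_of, BisetGroup.lift_of]
        simp }

theorem BisetGroup.comp_of (X : BisetClass G J) (Y : BisetClass J H) :
    BisetGroup.comp (GrothendieckAddGroup.of X) (GrothendieckAddGroup.of Y) =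
      GrothendieckAddGroup.of (X.comp Y) := by
  rw [BisetGroup.comp, BisetGroup.lift_of]
  exact BisetGroup.lift_of _ Y

theorem BisetGroup.comp_assoc (x : BisetGroup G J) (y : BisetGroup J K) (z : BisetGroup K H) :
    BisetGroup.comp (BisetGroup.comp x y) z = BisetGroup.comp x (BisetGroup.comp y z) := by
  obtain ⟨X, X', rfl⟩ := x.exists_sub
  obtain ⟨Y, Y', rfl⟩ := y.exists_sub
  obtain ⟨Z, Z', rfl⟩ := z.exists_sub
  simp only [map_sub, AddMonoidHom.sub_apply, BisetGroup.comp_of, BisetClass.comp_assoc]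

variable {S : Type u} [Group S] [Finite S]

instance : Fintype (Subgroup S) := Fintype.ofFinite _

/-- The subgroup `{(b, a) | b = φ a}` of `B × A`, for a homomorphism `φ : A → S`. It is the twisted
diagonal `Δ(A, φ)` if `φ(A) ≤ B`. If `φ` is the inclusion of `A` and `B ≤ A`, it is the diagonal
`Δ(B, id)`. -/
def twistedDiag (B A : Subgroup S) (φ : A →* S) : Subgroup (B × A) :=
  (B.subtype.comp (MonoidHom.fst B A)).eqLocus (φ.comp (MonoidHom.snd B A))

/-- The class of the `(B, A)`-biset `(B × A) / {(b, a) | b = φ a}`. -/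
def twistedClass (B A : Subgroup S) (φ : A →* S) : BisetGroup B A :=
  GrothendieckAddGroup.of (BisetClass.mk (Biset.coset (twistedDiag B A φ)))

theorem one_comp (B A : Subgroup S) (x : BisetGroup B A) :
    BisetGroup.comp (twistedClass B B B.subtype) x = x := by
  obtain ⟨X, X', rfl⟩ := x.exists_sub
  have h : ∀ p, p ∈ twistedDiag B B B.subtype ↔ p.1 = p.2 := fun p => by
    exact Subtype.ext_iff.symm
  simp only [map_sub, twistedClass, BisetGroup.comp_of, BisetClass.one_comp _ h]

theorem comp_one (B A : Subgroup S) (x : BisetGroup B A) :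
    BisetGroup.comp x (twistedClass A A A.subtype) = x := by
  obtain ⟨X, X', rfl⟩ := x.exists_sub
  have h : ∀ p, p ∈ twistedDiag A A A.subtype ↔ p.1 = p.2 := fun p => by
    exact Subtype.ext_iff.symm
  simp only [map_sub, AddMonoidHom.sub_apply, twistedClass, BisetGroup.comp_of,
    BisetClass.comp_one _ h]

variable (S) in
/-- The ring of formal differences of finite bisets over pairs of subgroups of `S`: an element has
for all `B, A ≤ S` a component in the Grothendieck group of finite `(B, A)`-bisets. Bisets
`X` over `(B, J)` and `Y` over `(J', A)` multiply to `X ×_J Y` if `J = J'` and to `0` otherwise. -/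
def BisetRing : Type (u + 1) := ∀ B A : Subgroup S, BisetGroup B A

instance : AddCommGroup (BisetRing S) := inferInstanceAs (AddCommGroup (∀ _ _, _))

open Classical in
/-- The element of the biset ring whose only component is `x`, over the pair `(B, A)`. -/
def BisetRing.single (B A : Subgroup S) (x : BisetGroup B A) : BisetRing S :=
  Pi.single B (Pi.single A x)

instance : Mul (BisetRing S) :=
  ⟨fun f g => fun B A => ∑ J : Subgroup S, BisetGroup.comp (f B J) (g J A)⟩

instance : One (BisetRing S) :=
  ⟨∑ K : Subgroup S, BisetRing.single K K (twistedClass K K K.subtype)⟩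

theorem BisetRing.mul_apply (f g : BisetRing S) (B A : Subgroup S) :
    (f * g) B A = ∑ J : Subgroup S, BisetGroup.comp (f B J) (g J A) := rfl

/-- The component of an element of the biset ring over the pair `(B, A)`. -/
def BisetRing.component (B A : Subgroup S) : BisetRing S →+ BisetGroup B A where
  toFun f := f B A
  map_zero' := rfl
  map_add' _ _ := rfl

theorem BisetRing.add_apply (f g : BisetRing S) (B A : Subgroup S) :
    (f + g) B A = f B A + g B A := map_add (BisetRing.component B A) f g

theorem BisetRing.zero_apply (B A : Subgroup S) : (0 : BisetRing S) B A = 0 :=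
  map_zero (BisetRing.component B A)

open Classical in
theorem BisetRing.one_apply (B A : Subgroup S) :
    (1 : BisetRing S) B A = (Pi.single B (twistedClass B B B.subtype) :
      ∀ A : Subgroup S, BisetGroup B A) A := by
  have h1 : (1 : BisetRing S) B A =
      ∑ K : Subgroup S, BisetRing.single K K (twistedClass K K K.subtype) B A := by
    exact map_sum (BisetRing.component B A) _ _
  rw [h1, Finset.sum_eq_single B]
  · simp [BisetRing.single]
  · intro K _ hK
    simp [BisetRing.single, Pi.single_eq_of_ne hK.symm]
  · simp

instance : Ring (BisetRing S) where
  left_distrib f g h := by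
    funext B A
    simp only [BisetRing.mul_apply, BisetRing.add_apply, map_add, Finset.sum_add_distrib]
  right_distrib f g h := by
    funext B A
    simp only [BisetRing.mul_apply, BisetRing.add_apply, map_add, AddMonoidHom.add_apply,
      Finset.sum_add_distrib]
  zero_mul f := by
    funext B A
    simp only [BisetRing.mul_apply, BisetRing.zero_apply, map_zero, AddMonoidHom.zero_apply,
      Finset.sum_const_zero]
  mul_zero f := by
    funext B A
    simp only [BisetRing.mul_apply, BisetRing.zero_apply, map_zero, Finset.sum_const_zero]
  mul_assoc f g h := by
    funext B A
    simp only [BisetRing.mul_apply, map_sum, AddMonoidHom.finsetSum_apply, BisetGroup.comp_assoc]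
    exact Finset.sum_comm
  one_mul f := by
    classical
    funext B A
    rw [BisetRing.mul_apply, Finset.sum_eq_single B]
    · rw [BisetRing.one_apply, Pi.single_eq_same, FusionMackey.one_comp]
    · intro J _ hJ
      rw [BisetRing.one_apply, Pi.single_eq_of_ne hJ, map_zero, AddMonoidHom.zero_apply]
    · simp
  mul_one f := by
    classical
    funext B A
    rw [BisetRing.mul_apply, Finset.sum_eq_single A]
    · rw [BisetRing.one_apply, Pi.single_eq_same, FusionMackey.comp_one]
    · intro J _ hJ
      rw [BisetRing.one_apply, Pi.single_eq_of_ne hJ.symm, map_zero]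
    · simp
  neg_add_cancel := neg_add_cancel
  zsmul := zsmulRec

end Ring

/-! ## Fusion systems -/

section Fusion

variable {S : Type u} [Group S]

/-- Conjugation `a ↦ g a g⁻¹` as a homomorphism from `A` to the ambient group. -/
def conjHom (g : S) (A : Subgroup S) : A →* S := (MulAut.conj g).toMonoidHom.comp A.subtype

/-- For `φ : A → S`, the elements `x` of `N_L(A)` for which there is `z ∈ Q` such that
`φ (x a x⁻¹) = z φ(a) z⁻¹` for all `a ∈ A`. -/
def transport (L Q : Subgroup S) {A : Subgroup S} (φ : A →* S) :
    Subgroup S where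
  carrier := {x | x ∈ L ⊓ Subgroup.normalizer (A : Set S) ∧
    ∃ z ∈ Q, ∀ a b : A, (b : S) = x * a * x⁻¹ → φ b = z * φ a * z⁻¹}
  one_mem' := ⟨one_mem _, 1, one_mem _, fun a b h => by
    have : b = a := Subtype.ext (by simpa using h)
    simp [this]⟩
  mul_mem' := by
    rintro x y ⟨hx, z, hz, h⟩ ⟨hy, w, hw, h'⟩
    refine ⟨mul_mem hx hy, z * w, mul_mem hz hw, fun a b hb => ?_⟩
    have hc : y * a * y⁻¹ ∈ A := (Subgroup.mem_normalizer_iff.1 hy.2 a).1 a.2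
    rw [h ⟨_, hc⟩ b (by rw [hb]; simp [mul_assoc]), h' a ⟨_, hc⟩ rfl]
    simp [mul_assoc]
  inv_mem' := by
    rintro x ⟨hx, z, hz, h⟩
    refine ⟨inv_mem hx, z⁻¹, inv_mem hz, fun a b hb => ?_⟩
    have := h b a (by rw [hb]; simp [mul_assoc])
    rw [this]
    simp [mul_assoc]

/-- The `φ`-normalizer `N_φ ≤ N_P(A)` of a morphism `φ : A → P`. -/
def phiNormalizer (P : Subgroup S) {A : Subgroup S} (φ : A →* S) : Subgroup S :=
  transport P (P ⊓ Subgroup.normalizer (φ.range : Set S)) φ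

/-- A (not necessarily saturated) fusion system over a subgroup `P` of `S`. Its objects are the
subgroups of `P`. A morphism `A → B` is recorded as its composite `A → S` with the inclusion of `B`
in `S`, so that its image is `φ.range`. -/
structure FusionSystem (P : Subgroup S) where
  Hom : ∀ A : Subgroup S, Subgroup S → Set (A →* S)
  source_le : ∀ {A B : Subgroup S} {φ : A →* S}, φ ∈ Hom A B → A ≤ P
  target_le : ∀ {A B : Subgroup S} {φ : A →* S}, φ ∈ Hom A B → B ≤ P
  apply_mem : ∀ {A B : Subgroup S} {φ : A →* S}, φ ∈ Hom A B → ∀ a, φ a ∈ B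
  injective : ∀ {A B : Subgroup S} {φ : A →* S}, φ ∈ Hom A B → Function.Injective φ
  comp_mem : ∀ {A B C : Subgroup S} {φ : A →* S} {ψ : B →* S} (hφ : φ ∈ Hom A B), ψ ∈ Hom B C →
    ψ.comp (φ.codRestrict B (apply_mem hφ)) ∈ Hom A C
  conj_mem : ∀ {A B : Subgroup S} {g : S}, A ≤ P → B ≤ P → g ∈ P →
    (∀ a, conjHom g A a ∈ B) → conjHom g A ∈ Hom A B
  onto_mem : ∀ {A B : Subgroup S} {φ : A →* S}, φ ∈ Hom A B → φ ∈ Hom A φ.range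
  symm_mem : ∀ {A B : Subgroup S} {φ : A →* S} (hφ : φ ∈ Hom A B),
    A.subtype.comp (MonoidHom.ofInjective (injective hφ)).symm.toMonoidHom ∈ Hom φ.range A

namespace FusionSystem

variable {P : Subgroup S} (E : FusionSystem P)

theorem mem_of_apply_mem {A B C : Subgroup S} {φ : A →* S} (hφ : φ ∈ E.Hom A B) (hC : C ≤ P)
    (h : ∀ a, φ a ∈ C) : φ ∈ E.Hom A C := by
  have h1 := E.onto_mem hφ
  have h2 : conjHom 1 φ.range ∈ E.Hom φ.range C := by
    refine E.conj_mem (E.target_le h1) hC (one_mem P) ?_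
    rintro ⟨_, a, rfl⟩
    simpa [conjHom] using h a
  have h3 := E.comp_mem h1 h2
  convert h3 using 1
  ext a
  simp [conjHom]

theorem exists_inv {A B : Subgroup S} {φ : A →* S} (hφ : φ ∈ E.Hom A B) (hB : φ.range = B) :
    ∃ ψ ∈ E.Hom B A, ∀ (a : A) (b : B), (b : S) = φ a → ψ b = a := by
  subst hB
  refine ⟨_, E.symm_mem hφ, ?_⟩
  intro a b hb
  have : b = MonoidHom.ofInjective (E.injective hφ) a := Subtype.ext hb
  subst this
  simp

/-- `A` and `B` are isomorphic in the fusion system. -/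
def IsConj (A B : Subgroup S) : Prop := ∃ φ ∈ E.Hom A B, φ.range = B

/-- `A` is centric in `E`. -/
def IsCentric (A : Subgroup S) : Prop :=
  A ≤ P ∧ ∀ B, E.IsConj A B → P ⊓ Subgroup.centralizer (B : Set S) ≤ B

/-- `A` is fully `E`-normalized. -/
def IsFullyNormalized (A : Subgroup S) : Prop :=
  A ≤ P ∧ ∀ B, E.IsConj A B → Nat.card (P ⊓ Subgroup.normalizer (B : Set S) : Subgroup S) ≤
    Nat.card (P ⊓ Subgroup.normalizer (A : Set S) : Subgroup S)

/-- The automorphism group `Aut_E(A)` of an object `A ≤ P`. -/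
def aut (A : Subgroup S) : Subgroup (MulAut A) where
  carrier := {α | A ≤ P → A.subtype.comp α.toMonoidHom ∈ E.Hom A A}
  one_mem' hA := by
    have := E.conj_mem hA hA (one_mem P) (fun a => by simp [conjHom])
    convert this using 1
    ext a
    simp [conjHom]
  mul_mem' {α β} hα hβ hA := by
    exact E.comp_mem (hβ hA) (hα hA)
  inv_mem' {α} hα hA := by
    obtain ⟨ψ, hψ, h⟩ := E.exists_inv (hα hA) (by
      ext x
      constructor
      · rintro ⟨a, rfl⟩
        exact (α a).2
      · exact fun hx => ⟨α.symm ⟨x, hx⟩, by simp⟩)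
    convert hψ using 1
    ext a
    exact (h (α⁻¹ a) a (by simp)).symm

/-- Saturation: `Aut_P(P)` is a Sylow `p`-subgroup of `Aut_E(P)`, and every morphism `φ : A → P`
with fully normalized image extends to `N_φ`. -/
structure IsSaturated (p : ℕ) : Prop where
  sylow : ∃ Q : Sylow p (E.aut P),
    (Q : Subgroup (E.aut P)) = (MulAut.conj : P →* MulAut P).range.subgroupOf (E.aut P)
  extend : ∀ (A : Subgroup S) (φ : A →* S), φ ∈ E.Hom A P → E.IsFullyNormalized φ.range →
    ∃ ψ ∈ E.Hom (phiNormalizer P φ) P, ∀ (a : A) (b : phiNormalizer P φ), (b : S) = a → ψ b = φ a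

end FusionSystem

/-- The fusion system `F_H(H)` of the group `H`: its morphisms are the conjugations by elements
of `H`. -/
def innerSystem (H : Subgroup S) : FusionSystem H where
  Hom A B := {φ | A ≤ H ∧ B ≤ H ∧ (∀ a, φ a ∈ B) ∧ ∃ h ∈ H, φ = conjHom h A}
  source_le h := h.1
  target_le h := h.2.1
  apply_mem h := h.2.2.1
  injective := by
    rintro A B _ ⟨_, _, _, h, _, rfl⟩ x y hxy
    exact Subtype.ext ((MulAut.conj h).injective hxy)
  comp_mem := by
    rintro A B C φ ψ ⟨hA, hB, hφ, h, hh, rfl⟩ ⟨_, hC, hψ, k, hk, rfl⟩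
    refine ⟨hA, hC, fun a => hψ _, k * h, mul_mem hk hh, ?_⟩
    ext a
    simp [conjHom]
  conj_mem hA hB hg h := ⟨hA, hB, h, _, hg, rfl⟩
  onto_mem := by
    rintro A B φ ⟨hA, hB, hφ, h⟩
    refine ⟨hA, ?_, fun a => ⟨a, rfl⟩, h⟩
    rintro _ ⟨a, rfl⟩
    exact hB (hφ a)
  symm_mem := by
    rintro A B φ ⟨hA, hB, hφ, h, hh, rfl⟩
    refine ⟨?_, hA, fun a => Subtype.coe_prop _, h⁻¹, inv_mem hh, ?_⟩
    · rintro _ ⟨a, rfl⟩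
      exact hB (hφ a)
    · ext ⟨_, a, rfl⟩
      have : (⟨conjHom h A a, ⟨a, rfl⟩⟩ : (conjHom h A).range) =
        MonoidHom.ofInjective (f := conjHom h A)
          (fun x y hxy => Subtype.ext ((MulAut.conj h).injective hxy)) a := rfl
      rw [this]
      change (((MonoidHom.ofInjective _).symm (MonoidHom.ofInjective _ a) : A) : S) =
        h⁻¹ * (h * a * h⁻¹) * h⁻¹⁻¹
      rw [MulEquiv.symm_apply_apply]
      simp [mul_assoc]

namespace FusionSystem

variable [Finite S]

theorem range_eq_sup {A H : Subgroup S} {φ : A →* S} {ψ : (A ⊔ H : Subgroup S) →* S}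
    (hψ : Function.Injective ψ)
    (h1 : ∀ (a : A) (x : (A ⊔ H : Subgroup S)), (x : S) = a → ψ x = φ a)
    (h2 : ∀ x : (A ⊔ H : Subgroup S), (x : S) ∈ H → ψ x ∈ H) :
    ψ.range = φ.range ⊔ H ∧
      ∀ y ∈ H, ∃ x : (A ⊔ H : Subgroup S), (x : S) ∈ H ∧ ψ x = y := by
  have hs : ∀ y ∈ H, ∃ x : (A ⊔ H : Subgroup S), (x : S) ∈ H ∧ ψ x = y := by
    let f : H → H := fun x =>
      ⟨ψ ⟨x, (le_sup_right : H ≤ A ⊔ H) x.2⟩, h2 _ x.2⟩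
    have hf : Function.Injective f := fun x y hxy =>
      Subtype.ext (congrArg (fun z : (A ⊔ H : Subgroup S) => (z : S))
        (hψ (congrArg Subtype.val hxy)))
    intro y hy
    obtain ⟨x, hx⟩ := Finite.surjective_of_injective hf ⟨y, hy⟩
    exact ⟨_, x.2, congrArg Subtype.val hx⟩
  refine ⟨le_antisymm ?_ (sup_le ?_ ?_), hs⟩
  · have : (A ⊔ H : Subgroup S) ≤ ((φ.range ⊔ H).comap ψ).map (A ⊔ H).subtype := by
      refine sup_le (fun a ha => ?_) (fun a ha => ?_)
      · refine ⟨⟨a, (le_sup_left : A ≤ A ⊔ H) ha⟩, ?_, rfl⟩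
        exact (le_sup_left : φ.range ≤ φ.range ⊔ H) ⟨⟨a, ha⟩, (h1 ⟨a, ha⟩ _ rfl).symm⟩
      · refine ⟨⟨a, (le_sup_right : H ≤ A ⊔ H) ha⟩, ?_, rfl⟩
        exact (le_sup_right : H ≤ φ.range ⊔ H) (h2 _ ha)
    rintro _ ⟨x, rfl⟩
    obtain ⟨y, hy, hyx⟩ := this x.2
    have : y = x := Subtype.ext hyx
    exact this ▸ hy
  · rintro _ ⟨a, rfl⟩
    exact ⟨⟨a, (le_sup_left : A ≤ A ⊔ H) a.2⟩, h1 a _ rfl⟩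
  · intro y hy
    obtain ⟨x, -, rfl⟩ := hs y hy
    exact ⟨x, rfl⟩

/-- The normalizer `N_F(H)`, a fusion system over `N_S(H)`: its morphisms `A → B` are the morphisms
of `F` that extend to a morphism `A H → B H` of `F` mapping `H` to `H`. -/
def normalizer (F : FusionSystem (⊤ : Subgroup S)) (H : Subgroup S) :
    FusionSystem (Subgroup.normalizer (H : Set S)) where
  Hom A B := {φ | A ≤ Subgroup.normalizer (H : Set S) ∧ B ≤ Subgroup.normalizer (H : Set S) ∧
    φ ∈ F.Hom A B ∧ ∃ ψ ∈ F.Hom (A ⊔ H) (B ⊔ H),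
      (∀ (a : A) (x : (A ⊔ H : Subgroup S)), (x : S) = a → ψ x = φ a) ∧
      (∀ x : (A ⊔ H : Subgroup S), (x : S) ∈ H → ψ x ∈ H)}
  source_le h := h.1
  target_le h := h.2.1
  apply_mem h := F.apply_mem h.2.2.1
  injective h := F.injective h.2.2.1
  comp_mem := by
    rintro A B C φ φ' ⟨hA, hB, hφ, ψ, hψ, h1, h2⟩ ⟨_, hC, hφ', ψ', hψ', h1', h2'⟩
    refine ⟨hA, hC, F.comp_mem hφ hφ', _, F.comp_mem hψ hψ', ?_, ?_⟩
    · intro a x hx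
      exact h1' ⟨φ a, F.apply_mem hφ a⟩ _ (h1 a x hx)
    · exact fun x hx => h2' _ (h2 x hx)
  conj_mem := by
    intro A B g hA hB hg h
    refine ⟨hA, hB, F.conj_mem le_top le_top trivial h, conjHom g (A ⊔ H),
      F.conj_mem le_top le_top trivial ?_, ?_, ?_⟩
    · have : (A ⊔ H : Subgroup S) ≤ (B ⊔ H).comap (MulAut.conj g).toMonoidHom := by
        refine sup_le (fun a ha => ?_) (fun a ha => ?_)
        · exact (le_sup_left : B ≤ B ⊔ H) (h ⟨a, ha⟩)
        · exact (le_sup_right : H ≤ B ⊔ H) ((Subgroup.mem_normalizer_iff.1 hg a).1 ha)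
      exact fun a => this a.2
    · intro a x hx
      simp [conjHom, hx]
    · exact fun x hx => (Subgroup.mem_normalizer_iff.1 hg _).1 hx
  onto_mem := by
    rintro A B φ ⟨hA, hB, hφ, ψ, hψ, h1, h2⟩
    refine ⟨hA, ?_, F.onto_mem hφ, ψ, ?_, h1, h2⟩
    · rintro _ ⟨a, rfl⟩
      exact hB (F.apply_mem hφ a)
    · rw [← (range_eq_sup (F.injective hψ) h1 h2).1]
      exact F.onto_mem hψ
  symm_mem := by
    rintro A B φ ⟨hA, hB, hφ, ψ, hψ, h1, h2⟩
    obtain ⟨hr, hs⟩ := range_eq_sup (F.injective hψ) h1 h2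
    have hψ' : ψ ∈ F.Hom (A ⊔ H) (φ.range ⊔ H) := hr ▸ F.onto_mem hψ
    refine ⟨?_, hA, F.symm_mem hφ, ?_⟩
    · rintro _ ⟨a, rfl⟩
      exact hB (F.apply_mem hφ a)
    · obtain ⟨θ, hθ, h⟩ := F.exists_inv hψ' hr
      refine ⟨θ, hθ, ?_, ?_⟩
      · rintro ⟨_, a, rfl⟩ x hx
        have e : (⟨φ a, ⟨a, rfl⟩⟩ : φ.range) = MonoidHom.ofInjective (F.injective hφ) a := rfl
        rw [e, h ⟨a, (le_sup_left : A ≤ A ⊔ H) a.2⟩ x (by rw [hx, h1 a _ rfl])]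
        change (a : S) = ((MonoidHom.ofInjective _).symm (MonoidHom.ofInjective _ a) : A)
        rw [MulEquiv.symm_apply_apply]
      · intro x hx
        obtain ⟨y, hy, hyx⟩ := hs x hx
        rw [h y x hyx.symm]
        exact hy

end FusionSystem

/-! ## Products in the orbit category -/

/-- A pair `(A, φ)` of a subgroup and a homomorphism `φ : A → S`. -/
abbrev Pair (S : Type u) [Group S] : Type u := Σ A : Subgroup S, (A →* S)

namespace FusionSystem

variable {P : Subgroup S} (E : FusionSystem P)

/-- `(A, φ)` represents a pair `(A, φ̄)` with `A ≤ H` centric in `E` and `φ̄ : A → K` a morphism in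
the orbit category of `E`. -/
def IsPair (H K : Subgroup S) (q : Pair S) : Prop :=
  E.IsCentric q.1 ∧ q.1 ≤ H ∧ q.2 ∈ E.Hom q.1 K

/-- The preorder `(A, φ̄) ≾ (B, ψ̄)`: there is `h ∈ H` with `A^h = h⁻¹ A h ≤ B` such that
`φ ∘ c_h = ψ|_{A^h}` in the orbit category, that is up to conjugation by an element `k` of `K`. -/
def _root_.FusionMackey.PairLE (H K : Subgroup S) (q r : Pair S) : Prop :=
  ∃ h ∈ H, ∃ k ∈ K, ∀ a : q.1, ∃ b : r.1, (b : S) = h⁻¹ * a * h ∧ r.2 b = k * q.2 a * k⁻¹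

/-- The pairs that are maximal for the preorder. -/
def IsMaxPair (H K : Subgroup S) (q : Pair S) : Prop :=
  E.IsPair H K q ∧ ∀ r, E.IsPair H K r → PairLE H K q r → PairLE H K r q

/-- `T` is a choice of the set `[H ×_E K]`: it contains exactly one element of each equivalence
class of maximal pairs (with a chosen representative `φ` of each `φ̄`). -/
def IsProduct (H K : Subgroup S) (T : Finset (Pair S)) : Prop :=
  (∀ q ∈ T, E.IsMaxPair H K q) ∧
    ∀ q, E.IsMaxPair H K q → ∃! r, r ∈ T ∧ PairLE H K q r ∧ PairLE H K r q

variable [Finite S] (F : FusionSystem (⊤ : Subgroup S)) (H : Subgroup S)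

/-- For `φ : A → K`, the normalizer after `φ` in `N_F(H)`: the elements `x ∈ N_K(φ(A))` such that
`φ⁻¹ c_x φ` belongs to `Aut_{N_F(H)}(A)`. -/
def normAfter (K : Subgroup S) (q : Pair S) : Subgroup S where
  carrier := {x | x ∈ K ⊓ Subgroup.normalizer (q.2.range : Set S) ∧
    ∃ α ∈ (F.normalizer H).aut q.1, ∀ a, q.2 (α a) = x * q.2 a * x⁻¹}
  one_mem' := ⟨one_mem _, 1, one_mem _, fun a => by simp⟩
  mul_mem' := by
    rintro x y ⟨hx, α, hα, h⟩ ⟨hy, β, hβ, h'⟩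
    refine ⟨mul_mem hx hy, α * β, mul_mem hα hβ, fun a => ?_⟩
    rw [MulAut.mul_apply, h, h']
    simp [mul_assoc]
  inv_mem' := by
    rintro x ⟨hx, α, hα, h⟩
    refine ⟨inv_mem hx, α⁻¹, inv_mem hα, fun a => ?_⟩
    have := h (α⁻¹ a)
    rw [MulAut.apply_inv_self] at this
    rw [this]
    simp [mul_assoc]

/-- For `φ : A → K`, the normalizer before `φ` in `N_F(H)`: the elements `x` of the normalizer of
`A` in `N_S(H)` such that `φ c_x φ⁻¹` is conjugation by an element of the normalizer after `φ`. -/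
def normBefore (K : Subgroup S) (q : Pair S) : Subgroup S :=
  transport (Subgroup.normalizer (H : Set S)) (F.normAfter H K q) q.2

/-- `φ : A → K` equals its `N_F(H)`-top: `A` is fully `N_F(H)`-normalized, and conjugation on `φ(A)`
by any element of the normalizer after `φ` is transported by `φ` from conjugation by an element of
the normalizer before `φ`. -/
def IsTop (K : Subgroup S) (q : Pair S) : Prop :=
  (F.normalizer H).IsFullyNormalized q.1 ∧ ∀ y ∈ F.normAfter H K q, ∃ x ∈ F.normBefore H K q,
    ∀ a b : q.1, (b : S) = x * a * x⁻¹ → q.2 b = y * q.2 a * y⁻¹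

/-- `(A, φ̄) ∼ (B, ψ̄)`: there is an isomorphism `θ : A → B` in `N_F(H)` with `φ̄ = ψ̄ θ̄` in the orbit
category of `F`. -/
def NormEquiv (K : Subgroup S) (q r : Pair S) : Prop :=
  ∃ θ ∈ (F.normalizer H).Hom q.1 r.1, θ.range = r.1 ∧ ∃ k ∈ K,
    ∀ (a : q.1) (b : r.1), (b : S) = θ a → r.2 b = k * q.2 a * k⁻¹

/-- `X` is a choice of the set `[N_F(H) × K] ⊆ T`, where `T` is a choice of `[H ×_F K]`: it contains
exactly one element of each class of the equivalence relation `NormEquiv`, and these elements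
`(A, φ)` are such that `A` is fully `N_F(H)`-normalized and `φ` equals its `N_F(H)`-top. -/
def IsNormProduct (K : Subgroup S) (T X : Finset (Pair S)) : Prop :=
  X ⊆ T ∧ (∀ q ∈ X, F.IsTop H K q) ∧ ∀ q ∈ T, ∃! r, r ∈ X ∧ F.NormEquiv H K q r

end FusionSystem

end Fusion

/-! ## The Mackey algebra and Mackey functors -/

section Mackey

variable {S : Type u} [Group S] [Finite S]

/-- The induction `I_A^B`, the class of the `(B, A)`-biset `(B × A) / Δ(A, id)`, for `A ≤ B`. -/
def ind (A B : Subgroup S) : BisetRing S :=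
  BisetRing.single B A (twistedClass B A A.subtype)

/-- The restriction `R_A^B`, the class of the `(A, B)`-biset `(A × B) / Δ(A, id)`, for `A ≤ B`. -/
def res (A B : Subgroup S) : BisetRing S :=
  BisetRing.single A B (twistedClass A B B.subtype)

/-- The conjugation `c_φ`, the class of the `(φ(A), A)`-biset `(φ(A) × A) / Δ(A, φ)`, for `φ`
seen as an isomorphism onto its image. -/
def cnj {A : Subgroup S} (φ : A →* S) : BisetRing S :=
  BisetRing.single φ.range A (twistedClass φ.range A φ)

/-- The conjugation `c_{φ⁻¹}`, the class of the `(A, φ(A))`-biset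
`(A × φ(A)) / {(a, φ(a)) | a ∈ A} = (A × φ(A)) / Δ(φ(A), φ⁻¹)`. -/
def cnjInv {A : Subgroup S} (φ : A →* S) : BisetRing S :=
  BisetRing.single A φ.range (Algebra.GrothendieckAddGroup.of (BisetClass.mk (Biset.coset
    ((twistedDiag φ.range A φ).comap
      (MulEquiv.prodComm : A × φ.range ≃* φ.range × A).toMonoidHom))))

/-- The elements `I_A^B`, `R_A^B` for `A ≤ B ≤ P` and `c_φ` for isomorphisms `φ` in `E`. -/
def FusionSystem.generators {P : Subgroup S} (E : FusionSystem P) : Set (BisetRing S) :=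
  {x | (∃ A B : Subgroup S, A ≤ B ∧ B ≤ P ∧ (x = ind A B ∨ x = res A B)) ∨
    ∃ (A : Subgroup S) (φ : A →* S), φ ∈ E.Hom A φ.range ∧ x = cnj φ}

/-- The Mackey algebra of `F` over `ℤ`. -/
def FusionSystem.mackeyRing (F : FusionSystem (⊤ : Subgroup S)) : Subring (BisetRing S) :=
  Subring.closure F.generators

/-- The Mackey algebra `μ_R(F) = R ⊗ μ_ℤ(F)`. -/
abbrev MackeyAlgebra (R : Type v) [CommRing R] (F : FusionSystem (⊤ : Subgroup S)) :=
  R ⊗[ℤ] F.mackeyRing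

variable (R : Type v) [CommRing R] (F : FusionSystem (⊤ : Subgroup S))

open Classical in
/-- The element `1 ⊗ x` of the Mackey algebra, for `x` in the Mackey algebra over `ℤ` (and `0` for
all other `x` in the biset ring). -/
def elt (x : BisetRing S) : MackeyAlgebra R F :=
  if h : x ∈ F.mackeyRing then 1 ⊗ₜ[ℤ] ⟨x, h⟩ else 0

/-- The Mackey algebra `μ_R(E)` of a fusion system `E ⊆ F` over `P ≤ S`, as a non-unital subalgebra
of `μ_R(F)`. -/
def subMackey {P : Subgroup S} (E : FusionSystem P) : NonUnitalSubalgebra R (MackeyAlgebra R F) :=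
  NonUnitalAlgebra.adjoin R (elt R F '' E.generators)

open Classical in
/-- The element `∑_{K ≤ P} I_K^K`, which is the identity of `μ_R(E)` for `E` over `P`. -/
def unitOf (P : Subgroup S) : MackeyAlgebra R F :=
  ∑ K : Subgroup S with K ≤ P, elt R F (ind K K)

variable (M : Type w) [AddCommGroup M] [Module (MackeyAlgebra R F) M]

/-- A centric Mackey functor over `F` on `R`: a finitely generated `μ_R(F)`-module `M` such that
`I_K^K M = 0` for every `K` that is not `F`-centric. -/
structure IsCentricMackeyFunctor : Prop where
  finite : Module.Finite (MackeyAlgebra R F) M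
  centric : ∀ K : Subgroup S, ¬ F.IsCentric K → ∀ x : M, elt R F (ind K K) • x = 0

variable [Module R M] [IsScalarTower R (MackeyAlgebra R F) M]

/-- The action of an element of the Mackey algebra on `M`. -/
def act : MackeyAlgebra R F →ₐ[R] Module.End R M := Algebra.lsmul R R M

/-- The restriction of `M` to a fusion system over `P`, which is the subset `1_{μ_R(E)} M` of `M`. -/
def Restr (P : Subgroup S) : Submodule R M := LinearMap.range (act R F M (unitOf R F P))

/-- The projection `x ↦ 1_{μ_R(E)} x` of `M` onto its restriction. -/
def proj (P : Subgroup S) : M →ₗ[R] Restr R F M P := (act R F M (unitOf R F P)).rangeRestrict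

/-- The endomorphisms of the restriction of `M` to `E`, as a `μ_R(E)`-module. -/
def EndRestr {P : Subgroup S} (E : FusionSystem P) : Submodule R (Module.End R (Restr R F M P)) where
  carrier := {f | ∀ a ∈ subMackey R F E, ∀ x y : Restr R F M P,
    (y : M) = a • (x : M) → (f y : M) = a • (f x : M)}
  add_mem' {f g} hf hg a ha x y h := by
    simp [hf a ha x y h, hg a ha x y h]
  zero_mem' a ha x y h := by simp
  smul_mem' r f hf a ha x y h := by
    rw [LinearMap.smul_apply, LinearMap.smul_apply, Submodule.coe_smul, Submodule.coe_smul,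
      hf a ha x y h, smul_comm]

/-- The endomorphisms of `M` as a `μ_R(F)`-module. -/
def EndMackey : Submodule R (Module.End R M) where
  carrier := {f | ∀ (a : MackeyAlgebra R F) (x : M), f (a • x) = a • f x}
  add_mem' {f g} hf hg a x := by simp [hf a x, hg a x]
  zero_mem' a x := by simp
  smul_mem' r f hf a x := by
    rw [LinearMap.smul_apply, LinearMap.smul_apply, hf a x, smul_comm]

/-- An endomorphism of the restriction, extended by `0` on the complement of `1_{μ_R(E)} M`. -/
def extend (P : Subgroup S) : Module.End R (Restr R F M P) →ₗ[R] Module.End R M where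
  toFun f := (Restr R F M P).subtype ∘ₗ f ∘ₗ proj R F M P
  map_add' f g := by ext; simp
  map_smul' r f := by ext; simp

/-- The endomorphism of the restriction induced by an endomorphism of `M` that preserves it. -/
def compress (P : Subgroup S) : Module.End R M →ₗ[R] Module.End R (Restr R F M P) where
  toFun f := proj R F M P ∘ₗ f ∘ₗ (Restr R F M P).subtype
  map_add' f g := by ext; simp
  map_smul' r f := by ext; simp

/-- The restriction map from endomorphisms of the restriction of `M` to a fusion system over `P` to
endomorphisms of its restriction to a fusion system over `Q ≤ P`. -/
def resMap (P Q : Subgroup S) :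
    Module.End R (Restr R F M P) →ₗ[R] Module.End R (Restr R F M Q) :=
  compress R F M Q ∘ₗ extend R F M P

open Classical in
/-- The transfer from `F_H(H)` to `E ⊆ F`, as an endomorphism of `M` that vanishes on the complement
of the restriction of `M` to `E`. Given choices `T K` of the sets `[H ×_E K]`, it sends `f` to the
endomorphism given on `I_K^K M` by `x ↦ ∑_{(A, φ) ∈ T K} I_{φ(A)}^K c_φ f (c_{φ⁻¹} R_{φ(A)}^K x)`. -/
def transfer {P : Subgroup S} (E : FusionSystem P) (H : Subgroup S)
    (T : Subgroup S → Finset (Pair S)) :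
    Module.End R (Restr R F M H) →ₗ[R] Module.End R M :=
  ∑ K : Subgroup S with E.IsCentric K, ∑ q ∈ T K,
    LinearMap.mulLeft R (act R F M (elt R F (ind q.2.range K) * elt R F (cnj q.2))) ∘ₗ
      LinearMap.mulRight R (act R F M (elt R F (cnjInv q.2) * elt R F (res q.2.range K))) ∘ₗ
        extend R F M H

/-- The transfer from `F_H(H)` to `E ⊆ F`, as an endomorphism of the restriction of `M` to `E`. -/
def transferTo {P : Subgroup S} (E : FusionSystem P) (H : Subgroup S)
    (T : Subgroup S → Finset (Pair S)) :
    Module.End R (Restr R F M H) →ₗ[R] Module.End R (Restr R F M P) :=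
  compress R F M P ∘ₗ transfer R F M E H T

/-- The action on `M` of the class of `S` in the centric Burnside ring. It is
`θ_S ∘ θ^S`, the transfer of the identity from `F_S(S)` to `F`. -/
def burnsideS (T : Subgroup S → Finset (Pair S)) : Module.End R M :=
  transfer R F M F ⊤ T 1

/-- The transfer from `N_F(H)` to `F`, for given choices `T A B` of the sets `[A ×_F B]` and a choice
`X ⊆ T H S` of the set `[N_F(H) × S]`: the sum over `(A, φ) ∈ X` of the composites of the
restriction from `N_F(H)` to `F_N(N)` and the transfer from `F_N(N)` to `F`, where `N` is the
normalizer before `φ`, followed by multiplication by the inverse of the class of `S`. -/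
def transferNorm (H : Subgroup S) (T : Subgroup S → Subgroup S → Finset (Pair S))
    (X : Finset (Pair S)) :
    Module.End R (Restr R F M (Subgroup.normalizer (H : Set S))) →ₗ[R] Module.End R M :=
  LinearMap.mulLeft R (Ring.inverse (burnsideS R F M (T ⊤))) ∘ₗ
    ∑ q ∈ X, transfer R F M F (F.normBefore H ⊤ q) (T (F.normBefore H ⊤ q)) ∘ₗ
      resMap R F M (Subgroup.normalizer (H : Set S)) (F.normBefore H ⊤ q)

end Mackey

end FusionMackey

end

open FusionMackey

open scoped TensorProduct

/-! View a pair `(A, φ)` as its graph, a subgroup of `H × K`. Then `PairLE` is inclusion of graphs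
up to conjugation, and the maximal pairs play the role of the orbits of a product. Everything rests
on one fact: a pair with centric source lies below a single class of maximal pairs, by an
essentially unique embedding (`exists_emb_of_isMaxPairIn`). This needs two properties of centric
subgroups `A`: a morphism on `A` extends to every overgroup whose conjugation action it carries into
the target, and two morphisms that agree on `A` differ by conjugation by an element of `Z(A)`. Both
follow from the extension axiom and the Sylow property of `Aut_P(A)` at fully normalized `A`. They
are proved for `F` on its centric subgroups, and for `N_F(H)` on the `F`-centric subgroups of
`N_S(H)`; there the full normalization of `H` gives the Sylow property at `N_S(H)`.

Consequently products restrict like sets: `[H' × K']` consists of the intersections of `H' × K'`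
with the conjugates of the graphs in `[H × K]`, indexed by double cosets (`sum_cut`). Combined with
the Mackey formula for bisets, this shows that transfers commute with the Mackey algebra
(`IsTransfer.isEquivariant`) and yields the double coset formula (`sum_transfer`): the transfer from
`Q` to `F` of the restriction to `Q` of `tr_H^E(f)` is the sum of `tr_A^F(f)` over `(A, φ)` in `[H
×_E Q]`.

This formula is used in two cases. For `Q = S` and `E = F` it expresses the product of the class of
`S` with `tr_H^F(f)` as the sum of `tr_A^F(f)` over `[H ×_F S]`, because `tr_S^F(1) g = tr_S^F(g)`
for an endomorphism `g` of `M`. For `Q = N_φ` and `E = N_F(H)` it turns the sum defining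
`tr_{N_F}^F(tr_H^{N_F}(f))` into a sum of `tr_B^F(f)` over `(A, φ)` in `[N_F × S]` and `(B, ψ)` in
`[H ×_{N_F} N_φ]`. The two index sets match (`sum_isNormProduct`): `ψ` is the restriction of an
element of `Aut_F(H)` and has image `A`, so `φψ` is a maximal pair of `H × S`; every class arises
because `[N_F × S]` represents all classes, and it arises once because `φ` is its own top.
Corresponding sources are `H`-conjugate, hence have the same transfer.

The class of `S` is invertible because on `I_K^K M` it is an integer `n_K` plus maps through proper
subgroups of `K`. Modulo `p`, `n_K` equals `n_{N_S(K)}`, and `n_S` is the index of `Inn(S)` in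
`Aut_F(S)`, so every `n_K` is prime to `p` and a unit in the `p`-local ring. Finally, tops exist
since the automorphisms of a source that become inner after `φ` form a `p`-group, which the Sylow
property conjugates into `Aut_{N_S}`. -/

namespace FusionMackey

set_option linter.unusedSectionVars false

/-! ### Orbit decompositions of bisets and the Mackey formula for transitive bisets -/

section Decomposition

variable {G H J : Type u} [Group G] [Group H] [Group J]

/-- A finite sum of classes of bisets is the class of their disjoint union. -/
theorem BisetClass.exists_sum {α : Type*} (s : Finset α) (X : α → Biset G H) :
    ∃ (Y : Biset G H) (e : Y.carrier → Σ i, (X i).carrier), BisetClass.mk Y = ∑ i ∈ s, BisetClass.mk (X i) ∧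
      Function.Injective e ∧ (∀ z, z ∈ Set.range e ↔ z.1 ∈ s) ∧
      ∀ (a : G × H) y, e (a • y) = ⟨(e y).1, a • (e y).2⟩ := by
  classical
  induction s using Finset.induction_on with
  | empty =>
    refine ⟨Biset.empty G H, fun x => x.elim, rfl, fun x => x.elim, fun z => ?_, fun a x => x.elim⟩
    simp only [Finset.notMem_empty, iff_false]
    rintro ⟨x, -⟩
    exact x.elim
  | insert i s hi ih =>
    obtain ⟨Y, e, hY, hinj, hr, he⟩ := ih
    refine ⟨(X i).sum Y, Sum.elim (fun x => ⟨i, x⟩) e, ?_, ?_, ?_, ?_⟩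
    · rw [Finset.sum_insert hi, ← hY]; rfl
    · rintro (x | x) (y | y) h
      · simp only [Sum.elim_inl] at h
        cases h; rfl
      · exact absurd ((hr ⟨i, x⟩).1 ⟨y, h.symm⟩) hi
      · exact absurd ((hr ⟨i, y⟩).1 ⟨x, h⟩) hi
      · exact congrArg Sum.inr (hinj h)
    · rintro ⟨j, z⟩
      rw [Finset.mem_insert]
      constructor
      · rintro ⟨x | x, h⟩
        · cases h; exact Or.inl rfl
        · exact Or.inr ((hr _).1 ⟨x, h⟩)
      · rintro (h | h)
        · dsimp only at h
          subst h
          exact ⟨Sum.inl z, rfl⟩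
        · obtain ⟨x, hx⟩ := (hr ⟨j, z⟩).2 h
          exact ⟨Sum.inr x, hx⟩
    · rintro a (x | x)
      · rfl
      · exact he a x

/-- The decomposition of a finite biset into orbits. -/
theorem BisetClass.mk_eq_sum_coset [Finite G] [Finite H] (X : Biset G H) {α : Type*} (s : Finset α)
    (x : α → X.carrier) (D : α → Subgroup (G × H))
    (hD : ∀ i ∈ s, ∀ g, g ∈ D i ↔ g • x i = x i)
    (hs : ∀ y, ∃! i, i ∈ s ∧ ∃ g : G × H, g • x i = y) :
    BisetClass.mk X = ∑ i ∈ s, BisetClass.mk (Biset.coset (D i)) := by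
  obtain ⟨Y, e, hY, hinj, hr, he⟩ := BisetClass.exists_sum s fun i => Biset.coset (D i)
  rw [← hY]
  symm
  apply BisetClass.mk_eq
  have key : ∀ i ∈ s, ∀ g g' : G × H, g • x i = g' • x i ↔ (g : (G × H) ⧸ D i) = g' := by
    intro i hi g g'
    rw [QuotientGroup.eq, hD i hi, mul_smul, inv_smul_eq_iff, eq_comm]
  have hex : ∀ z : Σ i, (Biset.coset (D i)).carrier, ∃ g : G × H, (g : (G × H) ⧸ D z.1) = z.2 :=
    fun z => QuotientGroup.mk_surjective z.2
  choose g hg using hex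
  have hmem : ∀ y, (e y).1 ∈ s := fun y => (hr _).1 ⟨y, rfl⟩
  refine ⟨Equiv.ofBijective (fun y => g (e y) • x (e y).1) ⟨?_, ?_⟩, ?_⟩
  · intro y y' h
    dsimp only at h
    have h1 := (hs (g (e y) • x (e y).1)).unique ⟨hmem y, _, rfl⟩ ⟨hmem y', _, h.symm⟩
    apply hinj
    have hm := hmem y
    have h2 := hg (e y)
    have h3 := hg (e y')
    revert h h1 h2 h3 hm
    generalize g (e y) = a
    generalize g (e y') = b
    rcases e y with ⟨i, c⟩
    rcases e y' with ⟨j, d⟩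
    rintro h h1 hm h2 h3
    dsimp only at h1
    subst h1
    exact congrArg (Sigma.mk i) (h2.symm.trans (((key _ hm _ _).1 h).trans h3))
  · intro y
    obtain ⟨i, ⟨hi, a, ha⟩, -⟩ := hs y
    obtain ⟨z, hz⟩ := (hr ⟨i, (a : (G × H) ⧸ D i)⟩).2 hi
    refine ⟨z, ?_⟩
    dsimp only
    rw [← ha]
    have h2 := hg (e z)
    revert h2
    generalize g (e z) = b
    rw [hz]
    intro h2
    exact (key i hi _ _).2 h2
  · intro a y
    change g (e (a • y)) • x (e (a • y)).1 = a • g (e y) • x (e y).1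
    have h2 := hg (e y)
    have h3 := hg (e (a • y))
    revert h3
    generalize g (e (a • y)) = b
    rw [he]
    intro h3
    rw [smul_smul]
    refine (key _ (hmem y) _ _).2 ?_
    rw [h3, ← h2]
    rfl

/-- The Mackey formula for transitive bisets. -/
theorem BisetClass.coset_comp_coset [Finite G] [Finite H] [Finite J] (D₁ : Subgroup (G × J))
    (D₂ : Subgroup (J × H)) (s : Finset J) (D : J → Subgroup (G × H))
    (hD : ∀ r ∈ s, ∀ g, g ∈ D r ↔ ∃ t : J, (g.1, t) ∈ D₁ ∧ (r⁻¹ * t * r, g.2) ∈ D₂)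
    (hs : ∀ j, ∃! r, r ∈ s ∧ ∃ g : G × H, ∃ t : J, (g.1, t) ∈ D₁ ∧ (j⁻¹ * t * r, g.2) ∈ D₂) :
    (BisetClass.mk (Biset.coset D₁)).comp (BisetClass.mk (Biset.coset D₂)) =
      ∑ r ∈ s, BisetClass.mk (Biset.coset (D r)) := by
  let X := (Biset.coset D₁).comp (Biset.coset D₂)
  -- Every orbit contains a point `P j`, and two such points share an orbit exactly if their indices
  -- lie in the same double coset of the projections of `D₁` and `D₂` to `J`.
  let P : J → X.carrier := fun j => Quotient.mk (Biset.compSetoid _ _)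
    (((1 : G × J) : (G × J) ⧸ D₁), (((j, 1) : J × H) : (J × H) ⧸ D₂))
  have hP : ∀ (g : G × H) j j', g • P j = P j' ↔
      ∃ t : J, (g.1, t) ∈ D₁ ∧ (j'⁻¹ * t * j, g.2) ∈ D₂ := by
    intro g j j'
    rw [show g • P j = Quotient.mk (Biset.compSetoid _ _) _ from Biset.comp_smul_mk _ _ _ _]
    refine (Quotient.eq (r := Biset.compSetoid (Biset.coset D₁) (Biset.coset D₂))).trans ?_
    constructor
    · rintro ⟨t, ht⟩
      have h1 := congrArg Prod.fst ht
      have h2 := congrArg Prod.snd ht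
      refine ⟨t, ?_, ?_⟩
      · have h1 : (((1 : G × J)) : (G × J) ⧸ D₁) = (((1, t) * ((g.1, 1) * 1) : G × J) : (G × J) ⧸ D₁) := h1
        rw [QuotientGroup.eq] at h1
        simpa using h1
      · have h2 : (((j', 1) : J × H) : (J × H) ⧸ D₂) = (((t, 1) * ((1, g.2) * (j, 1)) : J × H) : (J × H) ⧸ D₂) := h2
        rw [QuotientGroup.eq] at h2
        simpa [mul_assoc] using h2
    · rintro ⟨t, h1, h2⟩
      refine ⟨t, Prod.ext ?_ ?_⟩
      · change (((1 : G × J)) : (G × J) ⧸ D₁) = (((1, t) * ((g.1, 1) * 1) : G × J) : (G × J) ⧸ D₁)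
        rw [QuotientGroup.eq]
        simpa using h1
      · change (((j', 1) : J × H) : (J × H) ⧸ D₂) = (((t, 1) * ((1, g.2) * (j, 1)) : J × H) : (J × H) ⧸ D₂)
        rw [QuotientGroup.eq]
        simpa [mul_assoc] using h2
  refine BisetClass.mk_eq_sum_coset X s P D (fun r hr g => ?_) ?_
  · rw [hD r hr, hP]
  · intro y
    obtain ⟨j, g₀, hj⟩ : ∃ (j : J) (g : G × H), g • P j = y := by
      obtain ⟨⟨⟨a, b⟩⟩, ⟨⟨c, d⟩⟩⟩ := y
      refine ⟨b⁻¹ * c, (a, d), ?_⟩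
      refine (Biset.comp_smul_mk _ _ _ _).trans (Quotient.sound ⟨b, Prod.ext ?_ ?_⟩)
      · exact congrArg (QuotientGroup.mk (s := D₁))
          (Prod.ext (by simp) (by simp) : ((a, b) : G × J) = (1, b) * ((a, 1) * 1))
      · exact congrArg (QuotientGroup.mk (s := D₂))
          (Prod.ext (by simp) (by simp) : ((c, d) : J × H) = (b, 1) * ((1, d) * (b⁻¹ * c, 1)))
    have : ∀ r, (∃ g : G × H, g • P r = y) ↔
        ∃ g : G × H, ∃ t : J, (g.1, t) ∈ D₁ ∧ (j⁻¹ * t * r, g.2) ∈ D₂ := by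
      intro r
      constructor
      · rintro ⟨g, hg⟩
        refine ⟨g₀⁻¹ * g, (hP _ _ _).1 ?_⟩
        rw [mul_smul, hg, ← hj, inv_smul_smul]
      · rintro ⟨g, t, h⟩
        refine ⟨g₀ * g, ?_⟩
        rw [mul_smul, (hP _ _ _).2 ⟨t, h⟩, hj]
    simpa only [this] using hs j

end Decomposition

/-! ### Bisets attached to homomorphisms and their products -/

section TwistedRing

variable {S : Type u} [Group S] [Finite S]

theorem BisetRing.single_mul_single (B J A : Subgroup S) (x : BisetGroup B J)
    (y : BisetGroup J A) :
    BisetRing.single B J x * BisetRing.single J A y =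
      BisetRing.single B A (BisetGroup.comp x y) := by
  classical
  funext B' A'
  rw [BisetRing.mul_apply, Finset.sum_eq_single J]
  · by_cases hB : B' = B
    · subst hB
      by_cases hA : A' = A
      · subst hA
        simp [BisetRing.single]
      · simp [BisetRing.single, Pi.single_eq_of_ne hA]
    · simp [BisetRing.single, Pi.single_eq_of_ne hB]
  · intro J' _ hJ
    have : BisetRing.single J A y J' A' = 0 := by
      simp [BisetRing.single, Pi.single_eq_of_ne hJ]
    rw [this, map_zero]
  · simp

theorem BisetRing.single_mul_single_of_ne {J J' : Subgroup S} (h : J ≠ J') (B A : Subgroup S)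
    (x : BisetGroup B J) (y : BisetGroup J' A) :
    BisetRing.single B J x * BisetRing.single J' A y = 0 := by
  classical
  funext B' A'
  rw [BisetRing.mul_apply, BisetRing.zero_apply]
  refine Finset.sum_eq_zero fun K _ => ?_
  by_cases hK : K = J
  · subst hK
    have : BisetRing.single J' A y K A' = 0 := by
      simp [BisetRing.single, Pi.single_eq_of_ne h]
    rw [this, map_zero]
  · have : BisetRing.single B J x B' K = 0 := by
      by_cases hB : B' = B
      · subst hB
        simp [BisetRing.single, Pi.single_eq_of_ne hK]
      · simp [BisetRing.single, Pi.single_eq_of_ne hB]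
    rw [this, map_zero, AddMonoidHom.zero_apply]

/-- The class of the transitive `(B, A)`-biset `(B × A) / D` in the biset ring. -/
noncomputable def transitive (B A : Subgroup S) (D : Subgroup (B × A)) : BisetRing S :=
  BisetRing.single B A (Algebra.GrothendieckAddGroup.of (BisetClass.mk (Biset.coset D)))

theorem transitive_mul {B J A : Subgroup S} (D₁ : Subgroup (B × J)) (D₂ : Subgroup (J × A))
    (s : Finset J) (D : J → Subgroup (B × A))
    (hD : ∀ r ∈ s, ∀ g, g ∈ D r ↔ ∃ t : J, (g.1, t) ∈ D₁ ∧ (r⁻¹ * t * r, g.2) ∈ D₂)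
    (hs : ∀ j, ∃! r, r ∈ s ∧ ∃ g : B × A, ∃ t : J, (g.1, t) ∈ D₁ ∧ (j⁻¹ * t * r, g.2) ∈ D₂) :
    transitive B J D₁ * transitive J A D₂ = ∑ r ∈ s, transitive B A (D r) := by
  classical
  rw [transitive, transitive, BisetRing.single_mul_single, BisetGroup.comp_of,
    BisetClass.coset_comp_coset D₁ D₂ s D hD hs, map_sum]
  let f : BisetGroup B A →+ BisetRing S :=
    { toFun := BisetRing.single B A
      map_zero' := by
        unfold BisetRing.single
        rw [Pi.single_zero, Pi.single_zero]; rfl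
      map_add' := fun x y => by
        unfold BisetRing.single
        rw [Pi.single_add, Pi.single_add]; rfl }
  exact map_sum f _ _

/-- The case of a single double coset: by `hs` the projections of `D₁` and `D₂` multiply to the
whole of `J`. -/
theorem transitive_mul_one {B J A : Subgroup S} (D₁ : Subgroup (B × J)) (D₂ : Subgroup (J × A))
    (D : Subgroup (B × A))
    (hD : ∀ g, g ∈ D ↔ ∃ t : J, (g.1, t) ∈ D₁ ∧ (t, g.2) ∈ D₂)
    (hs : ∀ j : J, ∃ g : B × A, ∃ t : J, (g.1, t) ∈ D₁ ∧ (j * t, g.2) ∈ D₂) :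
    transitive B J D₁ * transitive J A D₂ = transitive B A D := by
  rw [transitive_mul D₁ D₂ {1} (fun _ => D), Finset.sum_singleton]
  · intro r hr g
    rw [Finset.mem_singleton] at hr
    simp [hr, hD]
  · intro j
    refine ⟨1, ⟨Finset.mem_singleton_self _, ?_⟩, fun r hr => Finset.mem_singleton.1 hr.1⟩
    simpa using hs j⁻¹

/-- The subgroup `{(b, a) | φ(a) = b}` and its opposite, with classes `I c_φ` and `c_{φ⁻¹} R`. -/
noncomputable def up (B : Subgroup S) {A : Subgroup S} (φ : A →* S) : BisetRing S :=
  transitive B A (twistedDiag B A φ)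

/-- The class of the `(A, B)`-biset `(A × B) / {(a, φ(a))}`. -/
noncomputable def dn (B : Subgroup S) {A : Subgroup S} (φ : A →* S) : BisetRing S :=
  transitive A B ((twistedDiag B A φ).comap (MulEquiv.prodComm : A × B ≃* B × A).toMonoidHom)

theorem mem_twistedDiag {B A : Subgroup S} {φ : A →* S} {g : B × A} :
    g ∈ twistedDiag B A φ ↔ (g.1 : S) = φ g.2 := Iff.rfl

theorem mem_twistedDiag_comap {B A : Subgroup S} {φ : A →* S} {g : A × B} :
    g ∈ (twistedDiag B A φ).comap (MulEquiv.prodComm : A × B ≃* B × A).toMonoidHom ↔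
      (g.2 : S) = φ g.1 := Iff.rfl

theorem ind_eq_up (A B : Subgroup S) : ind A B = up B A.subtype := rfl

theorem cnj_eq_up {A : Subgroup S} (φ : A →* S) : cnj φ = up φ.range φ := rfl

theorem cnjInv_eq_dn {A : Subgroup S} (φ : A →* S) : cnjInv φ = dn φ.range φ := rfl

theorem res_eq_dn (A B : Subgroup S) : res A B = dn B A.subtype := by
  have : twistedDiag A B B.subtype =
      (twistedDiag B A A.subtype).comap (MulEquiv.prodComm : A × B ≃* B × A).toMonoidHom := by
    ext g
    rw [mem_twistedDiag, mem_twistedDiag_comap]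
    exact eq_comm
  rw [res, dn, transitive, ← this, twistedClass]

/-- The composite is passed as `χ` and characterized pointwise, so that the identity applies to any
presentation of it. -/
theorem up_mul_up {A B K : Subgroup S} {φ : A →* S} {ψ : B →* S} {χ : A →* S}
    (hφ : ∀ a, φ a ∈ B) (hψ : ∀ b, ψ b ∈ K) (hχ : ∀ (a : A) (b : B), (b : S) = φ a → χ a = ψ b) :
    up K ψ * up B φ = up K χ := by
  refine transitive_mul_one _ _ _ (fun g => ?_) (fun j => ?_)
  · rw [mem_twistedDiag]
    constructor
    · intro h
      exact ⟨⟨φ g.2, hφ _⟩, by rw [mem_twistedDiag, h]; exact hχ _ _ rfl, rfl⟩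
    · rintro ⟨t, h1, h2⟩
      rw [mem_twistedDiag] at h1 h2
      rw [h1]
      exact (hχ _ _ h2).symm
  · exact ⟨(⟨ψ j⁻¹, hψ _⟩, 1), j⁻¹, rfl, by simp [mem_twistedDiag]⟩

theorem dn_mul_dn {A B K : Subgroup S} {φ : A →* S} {ψ : B →* S} {χ : A →* S}
    (hφ : ∀ a, φ a ∈ B) (hψ : ∀ b, ψ b ∈ K) (hχ : ∀ (a : A) (b : B), (b : S) = φ a → χ a = ψ b) :
    dn B φ * dn K ψ = dn K χ := by
  refine transitive_mul_one _ _ _ (fun g => ?_) (fun j => ?_)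
  · rw [mem_twistedDiag_comap]
    constructor
    · intro h
      exact ⟨⟨φ g.1, hφ _⟩, rfl, by rw [mem_twistedDiag_comap, h]; exact hχ _ _ rfl⟩
    · rintro ⟨t, h1, h2⟩
      rw [mem_twistedDiag_comap] at h1 h2
      rw [h2]
      exact (hχ _ _ h1).symm
  · exact ⟨(1, ⟨ψ j, hψ _⟩), 1, one_mem _, by simp [mem_twistedDiag]⟩

/-- The composite `up K φ * dn L θ` for `φ : A → K` and `θ : A → L`. -/
theorem up_mul_dn {A K L : Subgroup S} {φ θ : A →* S} (hθ : ∀ a, θ a ∈ L)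
    (D : Subgroup (K × L)) (hD : ∀ g, g ∈ D ↔ ∃ a, (g.1 : S) = φ a ∧ (g.2 : S) = θ a) :
    up K φ * dn L θ = transitive K L D := by
  refine transitive_mul_one _ _ _ (fun g => hD g) (fun j => ?_)
  exact ⟨(1, ⟨θ j, hθ _⟩), 1, one_mem _, by simp [mem_twistedDiag]⟩

/-- `s` is a set of representatives of the double cosets `B \ K / A`. -/
def IsDoubleReps (B K A : Subgroup S) (s : Finset S) : Prop :=
  (∀ k ∈ s, k ∈ K) ∧ ∀ k ∈ K, ∃! r, r ∈ s ∧ ∃ b ∈ B, ∃ a ∈ A, k = b * r * a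

theorem exists_isDoubleReps (B K A : Subgroup S) (hB : B ≤ K) (hA : A ≤ K) :
    ∃ s, IsDoubleReps B K A s := by
  classical
  let r : Setoid S :=
    { r := fun k k' => ∃ b ∈ B, ∃ a ∈ A, k = b * k' * a
      iseqv := ⟨fun k => ⟨1, one_mem _, 1, one_mem _, by simp⟩,
        fun {k k'} ⟨b, hb, a, ha, h⟩ => ⟨b⁻¹, inv_mem hb, a⁻¹, inv_mem ha, by simp [h, mul_assoc]⟩,
        fun {k k' k''} ⟨b, hb, a, ha, h⟩ ⟨b', hb', a', ha', h'⟩ =>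
          ⟨b * b', mul_mem hb hb', a' * a, mul_mem ha' ha, by simp [h, h', mul_assoc]⟩⟩ }
  have : Fintype S := Fintype.ofFinite S
  refine ⟨(Finset.univ.filter (· ∈ K)).image fun k => (Quotient.mk r k).out, ?_, ?_⟩
  · intro k hk
    obtain ⟨k', hk', rfl⟩ := Finset.mem_image.1 hk
    obtain ⟨b, hb, a, ha, h⟩ := Quotient.exact (Quotient.out_eq (Quotient.mk r k'))
    rw [h]
    exact mul_mem (mul_mem (hB hb) (Finset.mem_filter.1 hk').2) (hA ha)
  · intro k hk
    refine ⟨(Quotient.mk r k).out, ⟨Finset.mem_image.2 ⟨k, by simp [hk], rfl⟩, ?_⟩, ?_⟩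
    · exact Quotient.exact (Quotient.out_eq (Quotient.mk r k)).symm
    · rintro _ ⟨h1, h2⟩
      obtain ⟨k', hk', rfl⟩ := Finset.mem_image.1 h1
      have h3 : Quotient.mk r k = Quotient.mk r (Quotient.mk r k').out := Quotient.sound h2
      rw [Quotient.out_eq] at h3
      rw [h3]

/-- The Mackey formula. -/
theorem dn_mul_up {A B K : Subgroup S} {φ : A →* S} {ψ : B →* S} (hψ : ∀ b, ψ b ∈ K) {s : Finset S} (hs : IsDoubleReps ψ.range K φ.range s)
    (D : S → Subgroup (B × A))
    (hD : ∀ k ∈ s, ∀ g, g ∈ D k ↔ ψ g.1 = k * φ g.2 * k⁻¹) :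
    dn K ψ * up K φ = ∑ k ∈ s, transitive B A (D k) := by
  classical
  rw [dn, up, transitive_mul _ _ (s.subtype (· ∈ K)) fun k => D k]
  · rw [Finset.sum_subtype_of_mem (fun k => transitive B A (D k)) hs.1]
  · intro r hr g
    rw [Finset.mem_subtype] at hr
    rw [hD r hr]
    constructor
    · intro h
      refine ⟨⟨ψ g.1, hψ _⟩, rfl, ?_⟩
      rw [mem_twistedDiag]
      simp [h, mul_assoc]
    · rintro ⟨t, h1, h2⟩
      rw [mem_twistedDiag_comap] at h1
      rw [mem_twistedDiag] at h2
      dsimp at h1 h2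
      rw [← h1, ← h2]
      simp [mul_assoc]
  · intro j
    have : ∀ r : K, (∃ g : B × A, ∃ t : K,
        (g.1, t) ∈ (twistedDiag K B ψ).comap (MulEquiv.prodComm : B × K ≃* K × B).toMonoidHom ∧
        (j⁻¹ * t * r, g.2) ∈ twistedDiag K A φ) ↔
        ∃ b ∈ ψ.range, ∃ a ∈ φ.range, (j : S) = b * r * a := by
      intro r
      simp only [mem_twistedDiag, mem_twistedDiag_comap]
      constructor
      · rintro ⟨g, t, h1, h2⟩
        refine ⟨ψ g.1, ⟨_, rfl⟩, φ g.2⁻¹, ⟨_, rfl⟩, ?_⟩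
        rw [map_inv, ← h1, ← h2]
        simp [mul_assoc]
      · rintro ⟨_, ⟨b, rfl⟩, _, ⟨a, rfl⟩, h⟩
        refine ⟨(b, a⁻¹), ⟨ψ b, hψ _⟩, rfl, ?_⟩
        simp [h, mul_assoc]
    simp only [this, Finset.mem_subtype]
    obtain ⟨r, ⟨hr, h⟩, hu⟩ := hs.2 j j.2
    exact ⟨⟨r, hs.1 r hr⟩, ⟨hr, h⟩, fun r' hr' => Subtype.ext (hu r' hr')⟩

end TwistedRing

/-! ### Centric families and the maximal pairs over them -/

section FusionBasics

variable {S : Type u} [Group S] {P : Subgroup S} (E : FusionSystem P)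

namespace FusionSystem

theorem comp_mem_of {A B C : Subgroup S} {φ : A →* S} {ψ : B →* S} {χ : A →* S}
    (hφ : φ ∈ E.Hom A B) (hψ : ψ ∈ E.Hom B C)
    (hχ : ∀ (a : A) (b : B), (b : S) = φ a → χ a = ψ b) : χ ∈ E.Hom A C := by
  convert E.comp_mem hφ hψ using 1
  ext a
  exact hχ a _ rfl

theorem conj_mem_of {A B : Subgroup S} {χ : A →* S} {g : S} (hA : A ≤ P) (hB : B ≤ P) (hg : g ∈ P)
    (hχ : ∀ a, χ a = g * a * g⁻¹) (h : ∀ a, χ a ∈ B) : χ ∈ E.Hom A B := by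
  have : χ = conjHom g A := by
    ext a
    simp [hχ, conjHom]
  subst this
  exact E.conj_mem hA hB hg h

theorem subtype_mem {A B : Subgroup S} (hA : A ≤ B) (hB : B ≤ P) : A.subtype ∈ E.Hom A B :=
  E.conj_mem_of (hA.trans hB) hB (one_mem _) (by simp) fun a => hA a.2

theorem restrict_mem {A' A B : Subgroup S} {φ : A →* S} {χ : A' →* S} (hA : A' ≤ A)
    (hφ : φ ∈ E.Hom A B) (hχ : ∀ (a : A') (b : A), (b : S) = a → χ a = φ b) : χ ∈ E.Hom A' B :=
  E.comp_mem_of (E.subtype_mem hA (E.source_le hφ)) hφ fun a b h => hχ a b h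

theorem mem_top {A B : Subgroup S} {φ : A →* S} (hφ : φ ∈ E.Hom A B) : φ ∈ E.Hom A P :=
  E.mem_of_apply_mem hφ le_rfl fun a => E.target_le hφ (E.apply_mem hφ a)

/-- A family `C` of subgroups of `P` which are centric and to which the extension axiom applies. -/
structure IsCentricFamily (C : Set (Subgroup S)) : Prop where
  le : ∀ {A}, A ∈ C → A ≤ P
  up : ∀ {A B}, A ∈ C → A ≤ B → B ≤ P → B ∈ C
  iso : ∀ {A B : Subgroup S} {φ : A →* S}, A ∈ C → φ ∈ E.Hom A B → φ.range ∈ C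
  cent : ∀ {A}, A ∈ C → ∀ g ∈ P, (∀ a ∈ A, g * a = a * g) → g ∈ A
  epi : ∀ {A B : Subgroup S} {φ ψ : B →* S}, A ∈ C → A ≤ B → φ ∈ E.Hom B P → ψ ∈ E.Hom B P →
    (∀ b : B, (b : S) ∈ A → φ b = ψ b) →
    ∃ z ∈ A, (∀ a ∈ A, z * a = a * z) ∧ ∀ b b' : B, (b' : S) = z * b * z⁻¹ → ψ b = φ b'
  ext : ∀ {A K N : Subgroup S} {φ : A →* S}, A ∈ C → φ ∈ E.Hom A K → A ≤ N → N ≤ P →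
    (∀ n ∈ N, ∃ k ∈ K, ∀ a : A, ∃ a' : A, (a' : S) = n * a * n⁻¹ ∧ φ a' = k * φ a * k⁻¹) →
    ∃ χ ∈ E.Hom N K, ∀ (a : A) (n : N), (n : S) = a → χ n = φ a

/-- `q = (A, φ)` with `A ≤ H` in `C` and `φ : A → K`. -/
def IsPairIn (C : Set (Subgroup S)) (H K : Subgroup S) (q : Pair S) : Prop :=
  q.1 ∈ C ∧ q.1 ≤ H ∧ q.2 ∈ E.Hom q.1 K

/-- The maximal elements among the pairs with source in `C`. -/
def IsMaxPairIn (C : Set (Subgroup S)) (H K : Subgroup S) (q : Pair S) : Prop :=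
  E.IsPairIn C H K q ∧ ∀ r, E.IsPairIn C H K r → PairLE H K q r → PairLE H K r q

/-- `T` represents the classes of maximal pairs with source in `C`. -/
def IsProductIn (C : Set (Subgroup S)) (H K : Subgroup S) (T : Finset (Pair S)) : Prop :=
  (∀ q ∈ T, E.IsMaxPairIn C H K q) ∧
    ∀ q, E.IsMaxPairIn C H K q → ∃! r, r ∈ T ∧ PairLE H K q r ∧ PairLE H K r q

end FusionSystem

end FusionBasics

/-- A finite `p`-group is nilpotent, so its proper subgroups are smaller than their normalizers. -/
theorem exists_mem_normalizer_of_lt {G : Type*} [Group G] [Finite G] {p : ℕ} [Fact p.Prime]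
    {B A : Subgroup G} (hA : IsPGroup p A) (h : B < A) :
    ∃ x ∈ A, x ∉ B ∧ x ∈ Subgroup.normalizer (B : Set G) := by
  have := hA.isNilpotent
  have h1 : B.subgroupOf A < ⊤ := by
    rw [lt_top_iff_ne_top]
    intro h2
    exact h.not_ge (Subgroup.subgroupOf_eq_top.1 h2)
  obtain ⟨x, hx, hx'⟩ := SetLike.exists_of_lt (Group.normalizerCondition_of_isNilpotent _ h1)
  refine ⟨x, x.2, fun hxB => hx' hxB, Subgroup.mem_normalizer_iff.2 fun y => ?_⟩
  rw [Subgroup.mem_normalizer_iff] at hx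
  constructor
  · intro hy
    exact (hx ⟨y, h.le hy⟩).1 hy
  · intro hy
    have hyA : y ∈ A := by
      have := mul_mem (mul_mem (inv_mem x.2) (h.le hy)) x.2
      simpa [mul_assoc] using this
    exact (hx ⟨y, hyA⟩).2 hy

/-! ### Embeddings of graphs, and intersections of graphs with product subgroups -/

section Embeddings

variable {S : Type u} [Group S]

/-- Conjugation by `h⁻¹` in the source and by `k` in the target embeds `q` into `r`. -/
def Emb (q r : Pair S) (h k : S) : Prop :=
  ∀ a : q.1, ∃ b : r.1, (b : S) = h⁻¹ * a * h ∧ r.2 b = k * q.2 a * k⁻¹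

theorem Emb.refl (q : Pair S) : Emb q q 1 1 := fun a => ⟨a, by simp, by simp⟩

theorem Emb.trans {q r t : Pair S} {h k h' k' : S} (h₁ : Emb q r h k) (h₂ : Emb r t h' k') :
    Emb q t (h * h') (k' * k) := by
  intro a
  obtain ⟨b, hb, hb'⟩ := h₁ a
  obtain ⟨c, hc, hc'⟩ := h₂ b
  exact ⟨c, by simp [hc, hb, mul_assoc], by simp [hc', hb', mul_assoc]⟩

/-- The graph is a subgroup, so conjugation by the inverse of its element `(a, φ(a))` preserves it.
-/
theorem Emb.inner {q : Pair S} (a : q.1) : Emb q q a (q.2 a)⁻¹ :=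
  fun x => ⟨a⁻¹ * x * a, by simp, by simp⟩

theorem Emb.apply {q r : Pair S} {h k : S} (e : Emb q r h k) (a : q.1) (b : r.1)
    (hb : (b : S) = h⁻¹ * a * h) : r.2 b = k * q.2 a * k⁻¹ := by
  obtain ⟨b', hb', h'⟩ := e a
  have : b = b' := Subtype.ext (hb.trans hb'.symm)
  rw [this, h']

theorem Emb.mem {q r : Pair S} {h k : S} (e : Emb q r h k) {a : S} (ha : a ∈ q.1) :
    h⁻¹ * a * h ∈ r.1 := by
  obtain ⟨b, hb, -⟩ := e ⟨a, ha⟩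
  exact hb ▸ b.2

variable [Finite S]

theorem Emb.card_le {q r : Pair S} {h k : S} (e : Emb q r h k) :
    Nat.card q.1 ≤ Nat.card r.1 := by
  refine Nat.card_le_card_of_injective (fun a : q.1 => (⟨h⁻¹ * a * h, e.mem a.2⟩ : r.1)) ?_
  intro a b hab
  have := congrArg Subtype.val hab
  exact Subtype.ext (by simpa using this)

/-- An injection between finite groups of the same order is bijective, so the embedding can be
reversed. Comparing orders of sources thus decides equivalence of comparable pairs. -/
theorem Emb.symm {q r : Pair S} {h k : S} (e : Emb q r h k) (hc : Nat.card r.1 ≤ Nat.card q.1) :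
    Emb r q h⁻¹ k⁻¹ := by
  intro b
  let f : q.1 → r.1 := fun a => ⟨h⁻¹ * a * h, e.mem a.2⟩
  have hf : Function.Injective f := by
    intro a b hab
    have := congrArg Subtype.val hab
    exact Subtype.ext (by simpa [f] using this)
  have hf' : Function.Bijective f :=
    (Nat.bijective_iff_injective_and_card f).2 ⟨hf, le_antisymm e.card_le hc⟩
  obtain ⟨a, rfl⟩ := hf'.2 b
  refine ⟨a, by simp [f, mul_assoc], ?_⟩
  rw [e.apply a (f a) rfl]
  simp [mul_assoc]

theorem PairLE.refl (H K : Subgroup S) (q : Pair S) : PairLE H K q q :=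
  ⟨1, one_mem _, 1, one_mem _, Emb.refl q⟩

theorem PairLE.trans {H K : Subgroup S} {q r t : Pair S} (h₁ : PairLE H K q r)
    (h₂ : PairLE H K r t) : PairLE H K q t := by
  obtain ⟨h, hh, k, hk, e⟩ := h₁
  obtain ⟨h', hh', k', hk', e'⟩ := h₂
  exact ⟨_, mul_mem hh hh', _, mul_mem hk' hk, Emb.trans e e'⟩

theorem PairLE.card_le {H K : Subgroup S} {q r : Pair S} (h₁ : PairLE H K q r) :
    Nat.card q.1 ≤ Nat.card r.1 := by
  obtain ⟨h, hh, k, hk, e⟩ := h₁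
  exact Emb.card_le e

theorem PairLE.symm {H K : Subgroup S} {q r : Pair S} (h₁ : PairLE H K q r)
    (hc : Nat.card r.1 ≤ Nat.card q.1) : PairLE H K r q := by
  obtain ⟨h, hh, k, hk, e⟩ := h₁
  exact ⟨_, inv_mem hh, _, inv_mem hk, Emb.symm e hc⟩

/-- The source of `cut`. -/
def cutSource (q : Pair S) (H K : Subgroup S) (h k : S) : Subgroup S where
  carrier := {x | x ∈ H ∧ ∃ a : q.1, (a : S) = h⁻¹ * x * h ∧ k * q.2 a * k⁻¹ ∈ K}
  one_mem' := ⟨one_mem _, 1, by simp⟩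
  mul_mem' := by
    rintro x y ⟨hx, a, ha, ha'⟩ ⟨hy, b, hb, hb'⟩
    refine ⟨mul_mem hx hy, a * b, by simp [ha, hb, mul_assoc], ?_⟩
    have := mul_mem ha' hb'
    simpa [mul_assoc] using this
  inv_mem' := by
    rintro x ⟨hx, a, ha, ha'⟩
    refine ⟨inv_mem hx, a⁻¹, by simp [ha, mul_assoc], ?_⟩
    have := inv_mem ha'
    simpa [mul_assoc] using this

theorem conjHom_cutSource_mem (q : Pair S) (H K : Subgroup S) (h k : S) (x : cutSource q H K h k) :
    conjHom h⁻¹ (cutSource q H K h k) x ∈ q.1 := by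
  obtain ⟨x, hx, a, ha, ha'⟩ := x
  have : conjHom h⁻¹ (cutSource q H K h k) ⟨x, hx, a, ha, ha'⟩ = a := by simp [conjHom, ha]
  rw [this]
  exact a.2

/-- The intersection of the graph of `q`, conjugated by `(h, k)`, with `H × K`. -/
def cut (q : Pair S) (H K : Subgroup S) (h k : S) : Pair S :=
  ⟨cutSource q H K h k, (MulAut.conj k).toMonoidHom.comp (q.2.comp
    ((conjHom h⁻¹ (cutSource q H K h k)).codRestrict q.1 (conjHom_cutSource_mem q H K h k)))⟩

theorem mem_cut {q : Pair S} {H K : Subgroup S} {h k x : S} :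
    x ∈ (cut q H K h k).1 ↔ x ∈ H ∧ ∃ a : q.1, (a : S) = h⁻¹ * x * h ∧ k * q.2 a * k⁻¹ ∈ K :=
  Iff.rfl

theorem cut_apply {q : Pair S} {H K : Subgroup S} {h k : S} (x : (cut q H K h k).1) (a : q.1)
    (ha : (a : S) = h⁻¹ * x * h) : (cut q H K h k).2 x = k * q.2 a * k⁻¹ := by
  have e1 : (conjHom h⁻¹ (cutSource q H K h k)).codRestrict q.1
      (conjHom_cutSource_mem q H K h k) x = a := Subtype.ext (by
    rw [ha]
    change h⁻¹ * x * h⁻¹⁻¹ = _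
    rw [inv_inv])
  change k * q.2 _ * k⁻¹ = _
  rw [e1]

theorem cut_le (q : Pair S) (H K : Subgroup S) (h k : S) : (cut q H K h k).1 ≤ H :=
  fun _ hx => hx.1

theorem cut_apply_mem (q : Pair S) (H K : Subgroup S) (h k : S) (x : (cut q H K h k).1) :
    (cut q H K h k).2 x ∈ K := by
  obtain ⟨-, a, ha, ha'⟩ := x.2
  rwa [cut_apply x a ha]

theorem emb_cut (q : Pair S) (H K : Subgroup S) (h k : S) : Emb (cut q H K h k) q h k⁻¹ := by
  intro x
  obtain ⟨-, a, ha, ha'⟩ := x.2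
  exact ⟨a, ha, by rw [cut_apply x a ha]; simp [mul_assoc]⟩

/-- The universal property of the intersection: conjugating by `(g, l)` keeps the graph of `r`
inside `H × K`, so what lands in the conjugate of the graph of `q` lands in the cut. -/
theorem Emb.to_cut {q r : Pair S} {H K : Subgroup S} {h k g l : S} (hr : r.1 ≤ H)
    (hr' : ∀ a, r.2 a ∈ K) (hg : g ∈ H) (hl : l ∈ K) (e : Emb r q (g * h) (k⁻¹ * l)) :
    Emb r (cut q H K h k) g l := by
  intro x
  obtain ⟨a, ha, ha'⟩ := e x
  have h1 : (a : S) = h⁻¹ * (g⁻¹ * x * g) * h := by simp [ha, mul_assoc]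
  have h2 : k * q.2 a * k⁻¹ = l * r.2 x * l⁻¹ := by simp [ha', mul_assoc]
  have h3 : g⁻¹ * x * g ∈ (cut q H K h k).1 :=
    ⟨mul_mem (mul_mem (inv_mem hg) (hr x.2)) hg, a, h1,
      h2 ▸ mul_mem (mul_mem hl (hr' x)) (inv_mem hl)⟩
  exact ⟨⟨_, h3⟩, rfl, by rw [cut_apply ⟨_, h3⟩ a h1, h2]⟩

theorem mem_transport {L Q A : Subgroup S} {φ : A →* S} {x : S} :
    x ∈ transport L Q φ ↔ (x ∈ L ∧ x ∈ Subgroup.normalizer (A : Set S)) ∧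
      ∃ z ∈ Q, ∀ a b : A, (b : S) = x * a * x⁻¹ → φ b = z * φ a * z⁻¹ := Iff.rfl

end Embeddings

/-! ### Uniqueness of the maximal pair above a given pair -/

section Products

variable {S : Type u} [Group S] [Finite S] {P : Subgroup S} {E : FusionSystem P}
  {C : Set (Subgroup S)}

namespace FusionSystem

/-- A strict step in the preorder increases the order of the source, by `PairLE.symm`, so ascending
chains stop. -/
theorem exists_isMaxPairIn {H K : Subgroup S} {p : Pair S} (hp : E.IsPairIn C H K p) :
    ∃ q, E.IsMaxPairIn C H K q ∧ PairLE H K p q := by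
  induction hn : Nat.card S - Nat.card p.1 using Nat.strong_induction_on generalizing p with
  | _ n ih =>
    by_cases hm : E.IsMaxPairIn C H K p
    · exact ⟨p, hm, PairLE.refl _ _ _⟩
    · have : ∃ r, E.IsPairIn C H K r ∧ PairLE H K p r ∧ ¬ PairLE H K r p := by
        by_contra! h
        exact hm ⟨hp, h⟩
      obtain ⟨r, hr, h1, h2⟩ := this
      have h3 : Nat.card p.1 < Nat.card r.1 := by
        by_contra! h
        exact h2 (h1.symm h)
      have h4 := Subgroup.card_le_card_group r.1
      obtain ⟨q, hq, h5⟩ := ih _ (by omega) hr rfl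
      exact ⟨q, hq, h1.trans h5⟩

theorem IsMaxPairIn.card_le {H K : Subgroup S} {q r : Pair S} (hq : E.IsMaxPairIn C H K q)
    (hr : E.IsPairIn C H K r) (h : PairLE H K q r) : Nat.card r.1 ≤ Nat.card q.1 :=
  (hq.2 r hr h).card_le

theorem cut_mem {K H' K' : Subgroup S} {q : Pair S} {h k : S}
    (hq : q.2 ∈ E.Hom q.1 K) (hH : H' ≤ P) (hK : K' ≤ P) (hh : h ∈ P) (hk : k ∈ P) :
    (cut q H' K' h k).2 ∈ E.Hom (cut q H' K' h k).1 K' := by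
  have h0 : (cut q H' K' h k).1 ≤ P := (cut_le _ _ _ _ _).trans hH
  have h1 : conjHom h⁻¹ (cut q H' K' h k).1 ∈ E.Hom (cut q H' K' h k).1 q.1 :=
    E.conj_mem h0 (E.source_le hq) (inv_mem hh) (conjHom_cutSource_mem q H' K' h k)
  have h2 : conjHom k P ∈ E.Hom P P := E.conj_mem le_rfl le_rfl hk fun a =>
    mul_mem (mul_mem hk a.2) (inv_mem hk)
  have h3 := E.comp_mem (E.comp_mem h1 (E.mem_top hq)) h2
  exact E.mem_of_apply_mem h3 hK (cut_apply_mem q H' K' h k)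

theorem IsPairIn.target_le {H K : Subgroup S} {q : Pair S} (hq : E.IsPairIn C H K q) : K ≤ P :=
  E.target_le hq.2.2

theorem IsPairIn.cut (hC : E.IsCentricFamily C) {H K H' K' : Subgroup S} {q : Pair S} {h k : S}
    (hq : E.IsPairIn C H K q) (hH : H' ≤ P) (hK : K' ≤ P) (hh : h ∈ P) (hk : k ∈ P)
    {B : Subgroup S} (hB : B ∈ C) (hB' : B ≤ (cut q H' K' h k).1) :
    E.IsPairIn C H' K' (FusionMackey.cut q H' K' h k) :=
  ⟨hC.up hB hB' ((cut_le _ _ _ _ _).trans hH), cut_le _ _ _ _ _, cut_mem hq.2.2 hH hK hh hk⟩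

theorem IsPairIn.mono {H K H' K' : Subgroup S} {q : Pair S} (hq : E.IsPairIn C H' K' q)
    (hH : H' ≤ H) (hK : K' ≤ K) (hKP : K ≤ P) : E.IsPairIn C H K q :=
  ⟨hq.1, hq.2.1.trans hH, E.mem_of_apply_mem hq.2.2 hKP fun a => hK (E.apply_mem hq.2.2 a)⟩

/-- The extension of a pair to its normalizer. -/
theorem IsPairIn.exists_ext (hC : E.IsCentricFamily C) {H K : Subgroup S} (hH : H ≤ P)
    {p : Pair S} (hp : E.IsPairIn C H K p) :
    ∃ r, E.IsPairIn C H K r ∧ r.1 = transport H K p.2 ∧ p.1 ≤ r.1 ∧ Emb p r 1 1 := by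
  have hle : p.1 ≤ transport H K p.2 := by
    intro a ha
    refine ⟨⟨hp.2.1 ha, Subgroup.le_normalizer ha⟩, p.2 ⟨a, ha⟩, E.apply_mem hp.2.2 _, ?_⟩
    intro x y hxy
    rw [← map_inv, ← map_mul, ← map_mul]
    congr 1
    exact Subtype.ext hxy
  have hP : transport H K p.2 ≤ P := fun x hx => hH hx.1.1
  obtain ⟨χ, hχ, h⟩ := hC.ext hp.1 hp.2.2 hle hP (by
    rintro n ⟨⟨-, hn⟩, k, hk, h⟩
    refine ⟨k, hk, fun a => ⟨⟨n * a * n⁻¹, (Subgroup.mem_normalizer_iff.1 hn a).1 a.2⟩, rfl, ?_⟩⟩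
    exact h a _ rfl)
  refine ⟨⟨_, χ⟩, ⟨hC.up hp.1 hle hP, fun x hx => hx.1.1, hχ⟩, rfl, hle, ?_⟩
  intro a
  exact ⟨⟨a, hle a.2⟩, by simp, by simpa using h a ⟨a, hle a.2⟩ rfl⟩

/-- A conjugation which is compatible with a maximal pair is inner. -/
theorem IsMaxPairIn.mem_of_emb (hC : E.IsCentricFamily C) {H K : Subgroup S} (hH : H ≤ P)
    {q : Pair S} (hq : E.IsMaxPairIn C H K q) {u m : S} (hu : u ∈ H) (hm : m ∈ K)
    (e : Emb q q u m) : u ∈ q.1 := by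
  -- By maximality `q` is its own extension to the normalizer of its graph, and `e` says that `u⁻¹`
  -- is the first coordinate of an element normalizing this graph.
  obtain ⟨r, hr, hr', hle, he⟩ := hq.1.exists_ext hC hH
  have hc := hq.card_le hr ⟨1, one_mem _, 1, one_mem _, he⟩
  have heq : q.1 = r.1 := Subgroup.eq_of_le_of_card_ge hle hc
  rw [heq, hr', ← inv_inv u]
  refine inv_mem (mem_transport.2 ⟨⟨inv_mem hu, ?_⟩, m, hm, ?_⟩)
  · have h1 : ∀ a ∈ q.1, u⁻¹ * a * u ∈ q.1 := fun a ha => e.mem ha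
    have h2 : ∀ a ∈ q.1, u * a * u⁻¹ ∈ q.1 := fun a ha => by
      simpa using (Emb.symm e le_rfl).mem ha
    rw [Subgroup.mem_normalizer_iff]
    intro a
    constructor
    · intro ha
      simpa using h1 a ha
    · intro ha
      simpa [mul_assoc] using h2 _ ha
  · intro a b hab
    exact e.apply a b (by simpa using hab)

variable {p : ℕ} [Fact p.Prime]

/-- Descending induction on the order of `t`. Let `r` be a maximal pair above the extension `r₀` of
`t` to its normalizer. Normalizers grow, so unless `q` has the order of `t`, the part of `q` that
normalizes the source of `t` is strictly larger than `t`; it also maps to `r₀`, and induction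
identifies `q` with `r`. The same holds for `q'`. The target coordinate `k' * k⁻¹` is kept explicit
because it later determines the source coordinate up to an element of `t`. -/
theorem exists_emb_of_isMaxPairIn (hS : IsPGroup p S) (hC : E.IsCentricFamily C) {H K : Subgroup S}
    (hH : H ≤ P) {t q q' : Pair S} (ht : E.IsPairIn C H K t) (hq : E.IsMaxPairIn C H K q)
    (hq' : E.IsMaxPairIn C H K q') {h k h' k' : S} (hh : h ∈ H) (hk : k ∈ K) (hh' : h' ∈ H)
    (hk' : k' ∈ K) (e : Emb t q h k) (e' : Emb t q' h' k') :
    ∃ u ∈ H, Emb q q' u (k' * k⁻¹) := by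
  have hK : K ≤ P := E.target_le ht.2.2
  induction hn : Nat.card S - Nat.card t.1 using Nat.strong_induction_on
    generalizing t q q' h k h' k' with
  | _ n ih =>
    obtain ⟨r₀, hr₀, hr₀', hle₀, he₀⟩ := ht.exists_ext hC hH
    obtain ⟨r, hr, h₂, hh₂, k₂, hk₂, e₂⟩ := exists_isMaxPairIn hr₀
    -- the part of `q` in the normalizer of `t`
    have step : ∀ {q : Pair S} {h k : S}, E.IsMaxPairIn C H K q → h ∈ H → k ∈ K → Emb t q h k →
        Nat.card q.1 ≤ Nat.card t.1 ∨ ∃ u ∈ H, Emb q r u (k₂ * k⁻¹) := by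
      intro q h k hq hh hk e
      let N : Subgroup S := H ⊓ Subgroup.normalizer (t.1 : Set S)
      let t₁ := FusionMackey.cut q N K h k⁻¹
      have hN : t.1 ≤ N := le_inf ht.2.1 Subgroup.le_normalizer
      have e₁ : Emb t t₁ 1 1 := Emb.to_cut hN (E.apply_mem ht.2.2) (one_mem _) (one_mem _)
        (by simpa using e)
      have e₃ : Emb t₁ q h k := by simpa using emb_cut q N K h k⁻¹
      have hle : t.1 ≤ t₁.1 := fun x hx => by simpa using e₁.mem hx
      have ht₁ : E.IsPairIn C H K t₁ :=
        (hq.1.cut hC (inf_le_left.trans hH) hK (hH hh) (inv_mem (hK hk)) ht.1 hle).mono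
          inf_le_left le_rfl hK
      by_cases hlt : Nat.card t.1 < Nat.card t₁.1
      · right
        have hNr : t₁.1 ≤ r₀.1 := by
          rw [hr₀']
          intro x hx
          refine ⟨cut_le _ _ _ _ _ hx, t₁.2 ⟨x, hx⟩, E.apply_mem ht₁.2.2 _, ?_⟩
          intro a b hab
          have h1 := e₁.apply a ⟨a, hle a.2⟩ (by simp)
          have h2 := e₁.apply b ⟨b, hle b.2⟩ (by simp)
          simp only [one_mul, inv_one, mul_one] at h1 h2
          rw [← h1, ← h2, ← map_inv, ← map_mul, ← map_mul]
          congr 1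
          exact Subtype.ext hab
        -- `t₁` and the restriction of `r₀` agree on `t`, so they differ by conjugation by an
        -- element `z` of the centre of the source of `t`.
        obtain ⟨z, hz, hzc, hz'⟩ := hC.epi ht.1 hle
          (E.mem_top (E.restrict_mem (χ := r₀.2.comp (Subgroup.inclusion hNr)) hNr hr₀.2.2
            (fun a b hab => congrArg r₀.2 (Subtype.ext hab.symm)))) (E.mem_top ht₁.2.2) (by
            intro b hb
            have h1 := e₁.apply ⟨b, hb⟩ b (by simp)
            have h2 := he₀.apply ⟨b, hb⟩ (Subgroup.inclusion hNr b) (by simp)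
            rw [h1, MonoidHom.comp_apply, h2])
        have e₄ : Emb t₁ r₀ z⁻¹ 1 := by
          intro b
          have hzb : z * b * z⁻¹ ∈ t₁.1 := mul_mem (mul_mem (hle hz) b.2) (inv_mem (hle hz))
          refine ⟨⟨_, hNr hzb⟩, by simp, ?_⟩
          rw [hz' b ⟨_, hzb⟩ rfl, one_mul, inv_one, mul_one]
          rfl
        have hcS := Subgroup.card_le_card_group t₁.1
        obtain ⟨u, hu, e₅⟩ := ih _ (by omega) ht₁ hq hr hh hk
          (mul_mem (inv_mem (ht.2.1 hz)) hh₂) (mul_mem hk₂ (one_mem _)) e₃ (e₄.trans e₂) rfl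
        exact ⟨u, hu, by simpa using e₅⟩
      · left
        have heq : t.1 = t₁.1 := Subgroup.eq_of_le_of_card_ge hle (not_lt.1 hlt)
        -- If `t₁ = t`, the conjugate `B` of the source of `q` has no elements outside `t` that
        -- normalize `t`. Since normalizers grow in `p`-groups, `B` cannot be larger than `t`.
        by_contra! hcon
        let B := q.1.map (MulAut.conj h).toMonoidHom
        have hB : t.1 < B := by
          rw [lt_iff_le_and_ne]
          constructor
          · intro x hx
            exact ⟨_, e.mem hx, by simp [mul_assoc]⟩
          · intro hB
            have h1 : Nat.card B = Nat.card q.1 :=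
              Subgroup.card_map_of_injective (MulAut.conj h).injective
            rw [hB, h1] at hcon
            exact lt_irrefl _ hcon
        obtain ⟨x, ⟨a, ha, hax⟩, hxt, hxn⟩ := exists_mem_normalizer_of_lt (hS.to_subgroup B) hB
        apply hxt
        rw [heq]
        have hax' : h * a * h⁻¹ = x := hax
        refine mem_cut.2 ⟨Subgroup.mem_inf.2 ⟨?_, hxn⟩, ⟨a, ha⟩, by simp [← hax', mul_assoc], ?_⟩
        · rw [← hax']
          exact mul_mem (mul_mem hh (hq.1.2.1 ha)) (inv_mem hh)
        · exact mul_mem (mul_mem (inv_mem hk) (E.apply_mem hq.1.2.2 _)) (inv_mem (inv_mem hk))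
    rcases step hq hh hk e with h1 | ⟨u, hu, e₁⟩
    · exact ⟨_, mul_mem (inv_mem hh) hh', (Emb.symm e h1).trans e'⟩
    rcases step hq' hh' hk' e' with h1 | ⟨u', hu', e₁'⟩
    · have e₃ := (Emb.symm e' h1).trans e
      have e₄ := Emb.symm e₃ (hq'.card_le hq.1
        ⟨_, mul_mem (inv_mem hh') hh, _, mul_mem hk (inv_mem hk'), e₃⟩)
      exact ⟨_, inv_mem (mul_mem (inv_mem hh') hh), by simpa using e₄⟩
    · have e₃ := Emb.symm e₁' (hq'.card_le hr.1 ⟨_, hu', _, mul_mem hk₂ (inv_mem hk'), e₁'⟩)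
      refine ⟨_, mul_mem hu (inv_mem hu'), ?_⟩
      have := e₁.trans e₃
      simpa [mul_assoc] using this

/-- Two maximal pairs above the same pair differ by a conjugation. -/
theorem exists_emb_of_isMaxPairIn' (hS : IsPGroup p S) (hC : E.IsCentricFamily C)
    {H K : Subgroup S}
    (hH : H ≤ P) {t q q' : Pair S} (ht : E.IsPairIn C H K t) (hq : E.IsMaxPairIn C H K q)
    (hq' : E.IsMaxPairIn C H K q') {h k h' k' : S} (hh : h ∈ H) (hk : k ∈ K) (hh' : h' ∈ H)
    (hk' : k' ∈ K) (e : Emb t q h k) (e' : Emb t q' h' k') :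
    ∃ w ∈ t.1, Emb q q' (h⁻¹ * w * h') (k' * k⁻¹) := by
  obtain ⟨u, hu, e₁⟩ := exists_emb_of_isMaxPairIn hS hC hH ht hq hq' hh hk hh' hk' e e'
  -- The embeddings of `t` in `q'` through `h * u` and `h'` have the same target coordinate. As `q'`
  -- is injective they agree on `t`, so the quotient centralizes the source of `t`, which is
  -- centric.
  refine ⟨h * u * h'⁻¹, ?_, by simpa [mul_assoc] using e₁⟩
  refine hC.cent ht.1 _ (hH (mul_mem (mul_mem hh hu) (inv_mem hh'))) fun a ha => ?_
  have e₂ : Emb t q' (h * u) k' := by simpa using e.trans e₁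
  have h1 := e₂.apply ⟨a, ha⟩ ⟨_, e₂.mem ha⟩ rfl
  have h2 := e'.apply ⟨a, ha⟩ ⟨_, e'.mem ha⟩ rfl
  rw [← h2] at h1
  have h3 := congrArg Subtype.val (E.injective hq'.1.2.2 h1)
  dsimp only at h3
  have h4 : (h * u)⁻¹ * a * (h * u) * h'⁻¹ = h'⁻¹ * a := by rw [h3]; simp [mul_assoc]
  have h5 : h * u * ((h * u)⁻¹ * a * (h * u) * h'⁻¹) = h * u * (h'⁻¹ * a) := by rw [h4]
  simpa [mul_assoc] using h5.symm

end FusionSystem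

end Products

/-! ### Products under restriction to subgroups and under isomorphisms -/

section ProductSums

/-- The bijection is a relation because representatives of products match only up to equivalence. -/
theorem sum_eq_sum_of_rel {ι κ V : Type*} [AddCommMonoid V] (r : ι → κ → Prop) {s : Finset ι}
    {t : Finset κ} {f : ι → V} {g : κ → V} (h₁ : ∀ i ∈ s, ∃! j, j ∈ t ∧ r i j)
    (h₂ : ∀ j ∈ t, ∃! i, i ∈ s ∧ r i j) (hv : ∀ i ∈ s, ∀ j ∈ t, r i j → f i = g j) :
    ∑ i ∈ s, f i = ∑ j ∈ t, g j := by
  choose F hF hF' using h₁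
  refine Finset.sum_bij F (fun i hi => (hF i hi).1) (fun i hi i' hi' h => ?_) (fun j hj => ?_)
    fun i hi => hv i hi _ (hF i hi).1 (hF i hi).2
  · exact (h₂ _ (hF i hi).1).unique ⟨hi, (hF i hi).2⟩ ⟨hi', h ▸ (hF i' hi').2⟩
  · obtain ⟨i, ⟨hi, hr⟩, -⟩ := h₂ j hj
    exact ⟨i, hi, (hF' i hi j ⟨hj, hr⟩).symm⟩

variable {S : Type u} [Group S] [Finite S] {P : Subgroup S} {E : FusionSystem P}
  {C : Set (Subgroup S)}

namespace FusionSystem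

/-- `v` takes the same values at equivalent pairs. -/
def IsInvariant (E : FusionSystem P) (C : Set (Subgroup S)) (H K : Subgroup S) {V : Type*}
    (v : Pair S → V) : Prop :=
  ∀ q r, E.IsPairIn C H K q → E.IsPairIn C H K r → PairLE H K q r → PairLE H K r q → v q = v r

variable {p : ℕ} [Fact p.Prime]

theorem IsProductIn.exists_mem {H K : Subgroup S} {T : Finset (Pair S)}
    (hT : E.IsProductIn C H K T) {t : Pair S} (ht : E.IsPairIn C H K t) :
    ∃ q ∈ T, PairLE H K t q := by
  obtain ⟨m, hm, h⟩ := exists_isMaxPairIn ht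
  obtain ⟨q, ⟨hq, h1, -⟩, -⟩ := hT.2 m hm
  exact ⟨q, hq, h.trans h1⟩

theorem IsProductIn.eq_of_le {H K : Subgroup S} {T : Finset (Pair S)}
    (hT : E.IsProductIn C H K T) {q r : Pair S} (hq : q ∈ T) (hr : r ∈ T) (h : PairLE H K q r) :
    q = r :=
  (hT.2 q (hT.1 q hq)).unique ⟨hq, PairLE.refl _ _ _, PairLE.refl _ _ _⟩
    ⟨hr, h, (hT.1 q hq).2 r (hT.1 r hr).1 h⟩

/-- A pair `r` above the cut lies below some maximal pair `m` of `H × K`. Both `m` and `q` lie above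
the cut, so `m` embeds in `q`; the resulting embedding of `r` in `q` factors through the cut. -/
theorem IsMaxPairIn.cut (hS : IsPGroup p S) (hC : E.IsCentricFamily C) {H K H' K' : Subgroup S}
    (hH : H ≤ P) (hH' : H' ≤ H) (hK' : K' ≤ K) {q : Pair S} (hq : E.IsMaxPairIn C H K q) {h k : S}
    (hh : h ∈ H) (hk : k ∈ K) (ht : (cut q H' K' h k).1 ∈ C) :
    E.IsMaxPairIn C H' K' (cut q H' K' h k) := by
  have hK := hq.1.target_le
  have hp := hq.1.cut hC (hH'.trans hH) (hK'.trans hK) (hH hh) (hK hk) ht le_rfl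
  refine ⟨hp, ?_⟩
  rintro r hr ⟨h₁, hh₁, k₁, hk₁, e⟩
  obtain ⟨m, hm, h₃, hh₃, k₃, hk₃, e₃⟩ := exists_isMaxPairIn (hr.mono hH' hK' hK)
  obtain ⟨w, hw, e₄⟩ := exists_emb_of_isMaxPairIn' hS hC hH (hp.mono hH' hK' hK) hm hq
    (mul_mem (hH' hh₁) hh₃) (mul_mem hk₃ (hK' hk₁)) hh (inv_mem hk) (Emb.trans e e₃)
    (emb_cut q H' K' h k)
  have e₅ := Emb.trans e₃ e₄
  refine ⟨h₁⁻¹ * w, mul_mem (inv_mem hh₁) (cut_le _ _ _ _ _ hw), k₁⁻¹, inv_mem hk₁,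
    Emb.to_cut hr.2.1 (E.apply_mem hr.2.2) (mul_mem (inv_mem hh₁) (cut_le _ _ _ _ _ hw))
      (inv_mem hk₁) ?_⟩
  simpa [mul_assoc] using e₅

/-- Moving `(h, k)` in its double coset only conjugates the cut: elements of the graph of `q`
normalize that graph, and `(g, l)` lies in `H' × K'`. -/
theorem cut_le_cut {H' K' : Subgroup S} {q : Pair S} {h k h' k' g l : S} (a : q.1)
    (hg : g ∈ H') (hl : l ∈ K') (h₁ : h = g * h' * a) (h₂ : k = l * k' * q.2 a) :
    PairLE H' K' (cut q H' K' h k) (cut q H' K' h' k') := by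
  refine ⟨g, hg, l⁻¹, inv_mem hl, Emb.to_cut (cut_le _ _ _ _ _) (cut_apply_mem _ _ _ _ _) hg
    (inv_mem hl) ?_⟩
  have := (emb_cut q H' K' h k).trans (Emb.inner a⁻¹)
  simpa [h₁, h₂, mul_assoc] using this

/-- The cut of `q` embeds in both `q` and `q'`, so the uniqueness of maximal pairs compares them. -/
theorem exists_of_cut_le_cut (hS : IsPGroup p S) (hC : E.IsCentricFamily C)
    {H K H' K' : Subgroup S} (hH : H ≤ P) (hH' : H' ≤ H) (hK' : K' ≤ K) {q q' : Pair S}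
    (hq : E.IsMaxPairIn C H K q) (hq' : E.IsMaxPairIn C H K q') {h k h' k' : S}
    (hh : h ∈ H) (hk : k ∈ K) (hh' : h' ∈ H) (hk' : k' ∈ K) (ht : (cut q H' K' h k).1 ∈ C)
    (hle : PairLE H' K' (cut q H' K' h k) (cut q' H' K' h' k')) :
    ∃ w ∈ (cut q H' K' h k).1, ∃ g ∈ H', ∃ l ∈ K',
      Emb q q' (h⁻¹ * w * (g * h')) (k'⁻¹ * l * k) := by
  have hK := hq.1.target_le
  have hp := hq.1.cut hC (hH'.trans hH) (hK'.trans hK) (hH hh) (hK hk) ht le_rfl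
  obtain ⟨g, hg, l, hl, e⟩ := hle
  obtain ⟨w, hw, e'⟩ := exists_emb_of_isMaxPairIn' hS hC hH (hp.mono hH' hK' hK) hq hq' hh
    (inv_mem hk) (mul_mem (hH' hg) hh') (mul_mem (inv_mem hk') (hK' hl)) (emb_cut q H' K' h k)
    (Emb.trans e (emb_cut q' H' K' h' k'))
  exact ⟨w, hw, g, hg, l, hl, by simpa using e'⟩

/-- The converse of `cut_le_cut`. Comparing the two cuts gives a self-embedding of `q` by some `(u,
m)`, where `u` lies in the source by maximality. Then `m` agrees with `φ(u)⁻¹` up to an element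
centralizing the image, so centricity makes the discrepancy `φ(c)` with `c` central in the source,
and the conjugate of `c` by `h` lies in the cut and hence in `H'`. -/
theorem exists_of_cut_le_cut_self (hS : IsPGroup p S) (hC : E.IsCentricFamily C)
    {H K H' K' : Subgroup S} (hH : H ≤ P) (hH' : H' ≤ H) (hK' : K' ≤ K) {q : Pair S}
    (hq : E.IsMaxPairIn C H K q) {h k h' k' : S}
    (hh : h ∈ H) (hk : k ∈ K) (hh' : h' ∈ H) (hk' : k' ∈ K) (ht : (cut q H' K' h k).1 ∈ C)
    (hle : PairLE H' K' (cut q H' K' h k) (cut q H' K' h' k')) :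
    ∃ a : q.1, ∃ g ∈ H', ∃ l ∈ K', h = g * h' * a ∧ k = l * k' * q.2 a := by
  have hK := hq.1.target_le
  obtain ⟨w, hw, g, hg, l, hl, e⟩ :=
    exists_of_cut_le_cut hS hC hH hH' hK' hq hq hh hk hh' hk' ht hle
  have hu := hq.mem_of_emb hC hH (mul_mem (mul_mem (inv_mem hh) (hH' (cut_le _ _ _ _ _ hw)))
    (mul_mem (hH' hg) hh')) (mul_mem (mul_mem (inv_mem hk') (hK' hl)) hk) e
  set u : q.1 := ⟨_, hu⟩ with hu_def
  set m := k'⁻¹ * l * k with hm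
  have huS : (u : S) = h⁻¹ * w * (g * h') := rfl
  have hcent : q.2 u * m ∈ q.2.range := by
    refine hC.cent (hC.iso hq.1.1 hq.1.2.2) _ ?_ ?_
    · exact mul_mem (hK (E.apply_mem hq.1.2.2 _))
        (hK (mul_mem (mul_mem (inv_mem hk') (hK' hl)) hk))
    · rintro _ ⟨a, rfl⟩
      have h1 := e.apply a (u⁻¹ * a * u) (by simp [huS])
      rw [map_mul, map_mul, map_inv] at h1
      have h2 : q.2 u * ((q.2 u)⁻¹ * q.2 a * q.2 u) * m = q.2 u * (m * q.2 a * m⁻¹) * m := by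
        rw [h1]
      simpa [mul_assoc] using h2.symm
  obtain ⟨c, hc⟩ := hcent
  have hcc : ∀ a : q.1, (c : S) * a = a * c := by
    intro a
    have h1 := e.apply a (u⁻¹ * a * u) (by simp [huS])
    rw [map_mul, map_mul, map_inv] at h1
    have h2 : q.2 (c * a) = q.2 (a * c) := by
      rw [map_mul, map_mul, hc]
      have h2 : q.2 u * ((q.2 u)⁻¹ * q.2 a * q.2 u) * m = q.2 u * (m * q.2 a * m⁻¹) * m := by
        rw [h1]
      simpa [mul_assoc] using h2.symm
    exact congrArg Subtype.val (E.injective hq.1.2.2 h2)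
  have hmem : h * c * h⁻¹ ∈ (cut q H' K' h k).1 := by
    refine hC.cent ht _ (hH (mul_mem (mul_mem hh (hq.1.2.1 c.2)) (inv_mem hh))) ?_
    rintro x ⟨hx, a, ha, -⟩
    have hx' : x = h * a * h⁻¹ := by simp [ha, mul_assoc]
    have := congrArg (fun y => h * y * h⁻¹) (hcc a)
    simpa [hx', mul_assoc] using this
  refine ⟨u⁻¹ * c, (h * c * h⁻¹)⁻¹ * w * g, mul_mem (mul_mem (inv_mem (cut_le _ _ _ _ _ hmem))
    (cut_le _ _ _ _ _ hw)) hg, l⁻¹, inv_mem hl, ?_, ?_⟩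
  · simp [huS, mul_assoc]
  · rw [map_mul, map_inv, hc, hm]
    simp [mul_assoc]

/-- `s` represents the double cosets of `H' × K'` and the graph of `q` in `H × K`. -/
def _root_.FusionMackey.IsGraphReps (H K H' K' : Subgroup S) (q : Pair S) (s : Finset (S × S)) : Prop :=
  (∀ x ∈ s, x.1 ∈ H ∧ x.2 ∈ K) ∧ ∀ h ∈ H, ∀ k ∈ K, ∃! x, x ∈ s ∧
    ∃ a : q.1, ∃ g ∈ H', ∃ l ∈ K', h = g * x.1 * a ∧ k = l * x.2 * q.2 a

/-- The product `H' × K'` consists of the intersections of the conjugates of the components of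
`H × K` with `H' × K'`. -/
theorem sum_cut (hS : IsPGroup p S) (hC : E.IsCentricFamily C) {H K H' K' : Subgroup S}
    (hH : H ≤ P) (hK : K ≤ P) (hH' : H' ≤ H) (hK' : K' ≤ K) {T T' : Finset (Pair S)}
    (hT : E.IsProductIn C H K T) (hT' : E.IsProductIn C H' K' T') {V : Type*} [AddCommMonoid V]
    {v : Pair S → V} (hv : E.IsInvariant C H' K' v) (hv₀ : ∀ q, q.1 ≤ H' → q.1 ∉ C → v q = 0)
    {s : Pair S → Finset (S × S)} (hs : ∀ q ∈ T, IsGraphReps H K H' K' q (s q)) :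
    ∑ q ∈ T, ∑ x ∈ s q, v (cut q H' K' x.1 x.2) = ∑ q ∈ T', v q := by
  classical
  -- Cuts with source outside `C` contribute zero, and the remaining cuts are maximal pairs of `H' ×
  -- K'`.
  rw [Finset.sum_sigma', ← Finset.sum_filter_of_ne
    (p := fun x : Σ _ : Pair S, S × S => (FusionMackey.cut x.1 H' K' x.2.1 x.2.2).1 ∈ C)
    (fun x _ hx => by by_contra h; exact hx (hv₀ _ (cut_le _ _ _ _ _) h))]
  have hmax : ∀ x ∈ (T.sigma s).filter
      (fun x : Σ _ : Pair S, S × S => (FusionMackey.cut x.1 H' K' x.2.1 x.2.2).1 ∈ C),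
      E.IsMaxPairIn C H' K' (FusionMackey.cut x.1 H' K' x.2.1 x.2.2) := by
    intro x hx
    rw [Finset.mem_filter, Finset.mem_sigma] at hx
    have := (hs _ hx.1.1).1 _ hx.1.2
    exact (hT.1 _ hx.1.1).cut hS hC hH hH' hK' this.1 this.2 hx.2
  refine sum_eq_sum_of_rel (fun x r => PairLE H' K' (FusionMackey.cut x.1 H' K' x.2.1 x.2.2) r ∧
    PairLE H' K' r (FusionMackey.cut x.1 H' K' x.2.1 x.2.2)) (fun x hx => ?_) (fun r hr => ?_) ?_
  · exact hT'.2 _ (hmax x hx)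
  · have hrm := hT'.1 r hr
    -- A maximal pair `r` of `H' × K'` lies below some `q` in `T`, hence below a cut of `q`, which
    -- may be moved to the chosen representative of its double coset.
    obtain ⟨q, hq, h, hh, k, hk, e⟩ := hT.exists_mem (hrm.1.mono hH' hK' hK)
    obtain ⟨⟨h', k'⟩, ⟨hx, a, g, hg, l, hl, h1, h2⟩, -⟩ := (hs q hq).2 h hh k⁻¹ (inv_mem hk)
    have e1 : PairLE H' K' r (FusionMackey.cut q H' K' h k⁻¹) :=
      ⟨1, one_mem _, 1, one_mem _, Emb.to_cut hrm.1.2.1 (E.apply_mem hrm.1.2.2) (one_mem _)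
        (one_mem _) (by rw [inv_inv, one_mul, mul_one]; exact e)⟩
    have e2 := e1.trans (cut_le_cut a hg hl h1 h2)
    have hx' := (hs q hq).1 _ hx
    have ht : (FusionMackey.cut q H' K' h' k').1 ∈ C := by
      obtain ⟨g', hg', l', hl', e3⟩ := e2
      have h3 : conjHom g'⁻¹ r.1 ∈ E.Hom r.1 P :=
        E.conj_mem (hC.le hrm.1.1) le_rfl (inv_mem (hH (hH' hg'))) fun a =>
          mul_mem (mul_mem (inv_mem (hH (hH' hg'))) (hC.le hrm.1.1 a.2))
            (inv_mem (inv_mem (hH (hH' hg'))))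
      refine hC.up (hC.iso hrm.1.1 h3) ?_ ((cut_le _ _ _ _ _).trans (hH'.trans hH))
      rintro _ ⟨a, rfl⟩
      have := Emb.mem e3 a.2
      simpa [conjHom] using this
    have hp := (hT.1 q hq).1.cut hC (hH'.trans hH) (hK'.trans hK) (hH hx'.1) (hK hx'.2) ht le_rfl
    refine ⟨⟨q, h', k'⟩, ⟨?_, hrm.2 _ hp e2, e2⟩, ?_⟩
    · rw [Finset.mem_filter, Finset.mem_sigma]
      exact ⟨⟨hq, hx⟩, ht⟩
    -- Uniqueness: comparable cuts come from comparable members of `T`, which are equal, and then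
    -- from the same double coset.
    · rintro ⟨q₁, h₁, k₁⟩ ⟨hmem, e3, -⟩
      rw [Finset.mem_filter, Finset.mem_sigma] at hmem
      have hx₁ := (hs q₁ hmem.1.1).1 _ hmem.1.2
      have e4 := e3.trans e2
      obtain ⟨w, hw, g₁, hg₁, l₁, hl₁, e5⟩ := exists_of_cut_le_cut hS hC hH hH' hK'
        (hT.1 _ hmem.1.1) (hT.1 _ hq) hx₁.1 hx₁.2 hx'.1 hx'.2 hmem.2 e4
      have heq : q₁ = q := hT.eq_of_le hmem.1.1 hq ⟨_, mul_mem (mul_mem (inv_mem hx₁.1)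
        (hH' (cut_le _ _ _ _ _ hw))) (mul_mem (hH' hg₁) hx'.1), _,
        mul_mem (mul_mem (inv_mem hx'.2) (hK' hl₁)) hx₁.2, e5⟩
      subst heq
      obtain ⟨b, g₂, hg₂, l₂, hl₂, h4, h5⟩ := exists_of_cut_le_cut_self hS hC hH hH' hK'
        (hT.1 _ hq) hx₁.1 hx₁.2 hx'.1 hx'.2 hmem.2 e4
      have := ((hs q₁ hq).2 h₁ hx₁.1 k₁ hx₁.2).unique
        ⟨hmem.1.2, 1, 1, one_mem _, 1, one_mem _, by simp, by simp⟩ ⟨hx, b, g₂, hg₂, l₂, hl₂, h4, h5⟩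
      rw [Prod.mk.injEq] at this
      rw [this.1, this.2]
  · rintro x hx r hr ⟨h1, h2⟩
    exact hv _ _ (hmax x hx).1 (hT'.1 r hr).1 h1 h2

/-- The case of a subgroup of the second factor. -/
theorem sum_cut_right (hS : IsPGroup p S) (hC : E.IsCentricFamily C) {H K L : Subgroup S}
    (hH : H ≤ P) (hK : K ≤ P) (hL : L ≤ K) {T T' : Finset (Pair S)}
    (hT : E.IsProductIn C H K T) (hT' : E.IsProductIn C H L T') {V : Type*} [AddCommMonoid V]
    {v : Pair S → V} (hv : E.IsInvariant C H L v) (hv₀ : ∀ q, q.1 ≤ H → q.1 ∉ C → v q = 0)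
    {s : Pair S → Finset S} (hs : ∀ q ∈ T, IsDoubleReps L K q.2.range (s q)) :
    ∑ q ∈ T, ∑ k ∈ s q, v (cut q H L 1 k) = ∑ q ∈ T', v q := by
  classical
  -- The first factor is unchanged and absorbs the first coordinate, so the double cosets of `H × L`
  -- and the graph in `H × K` are those of `L` and `φ(A)` in `K`.
  rw [← sum_cut hS hC hH hK le_rfl hL hT hT' hv hv₀
    (s := fun q => (s q).map ⟨fun k => (1, k), fun k k' h => congrArg Prod.snd h⟩)]
  · refine Finset.sum_congr rfl fun q _ => ?_
    rw [Finset.sum_map]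
    rfl
  · intro q hq
    constructor
    · intro x hx
      obtain ⟨k, hk, rfl⟩ := Finset.mem_map.1 hx
      exact ⟨one_mem _, (hs q hq).1 k hk⟩
    · intro h hh k hk
      obtain ⟨r, ⟨hr, l, hl, _, ⟨a, rfl⟩, h1⟩, hu⟩ := (hs q hq).2 k hk
      refine ⟨(1, r), ⟨Finset.mem_map_of_mem _ hr, a, h * (a : S)⁻¹,
        mul_mem hh (inv_mem ((hT.1 q hq).1.2.1 a.2)), l, hl, by simp, h1⟩, ?_⟩
      rintro x ⟨hx, b, g, hg, l', hl', h2, h3⟩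
      obtain ⟨r', hr', rfl⟩ := Finset.mem_map.1 hx
      exact congrArg (Prod.mk 1) (hu r' ⟨hr', l', hl', _, ⟨b, rfl⟩, h3⟩)

/-- The case of a subgroup of the first factor. -/
theorem sum_cut_left (hS : IsPGroup p S) (hC : E.IsCentricFamily C) {H K L : Subgroup S}
    (hH : H ≤ P) (hK : K ≤ P) (hL : L ≤ H) {T T' : Finset (Pair S)}
    (hT : E.IsProductIn C H K T) (hT' : E.IsProductIn C L K T') {V : Type*} [AddCommMonoid V]
    {v : Pair S → V} (hv : E.IsInvariant C L K v) (hv₀ : ∀ q, q.1 ≤ L → q.1 ∉ C → v q = 0)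
    {s : Pair S → Finset S} (hs : ∀ q ∈ T, IsDoubleReps L H q.1 (s q)) :
    ∑ q ∈ T, ∑ h ∈ s q, v (cut q L K h 1) = ∑ q ∈ T', v q := by
  classical
  rw [← sum_cut hS hC hH hK hL le_rfl hT hT' hv hv₀
    (s := fun q => (s q).map ⟨fun k => (k, 1), fun k k' h => congrArg Prod.fst h⟩)]
  · refine Finset.sum_congr rfl fun q _ => ?_
    rw [Finset.sum_map]
    rfl
  · intro q hq
    constructor
    · intro x hx
      obtain ⟨k, hk, rfl⟩ := Finset.mem_map.1 hx
      exact ⟨(hs q hq).1 k hk, one_mem _⟩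
    · intro h hh k hk
      obtain ⟨r, ⟨hr, l, hl, a, ha, h1⟩, hu⟩ := (hs q hq).2 h hh
      refine ⟨(r, 1), ⟨Finset.mem_map_of_mem _ hr, ⟨a, ha⟩, l, hl, k * (q.2 ⟨a, ha⟩)⁻¹,
        mul_mem hk (inv_mem (E.apply_mem (hT.1 q hq).1.2.2 _)), h1, by simp⟩, ?_⟩
      rintro x ⟨hx, b, g, hg, l', hl', h2, h3⟩
      obtain ⟨r', hr', rfl⟩ := Finset.mem_map.1 hx
      exact congrArg (fun y => (y, (1 : S))) (hu r' ⟨hr', g, hg, b, b.2, h2⟩)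

/-- The pairs in `H × K` and in `H' × K'` that correspond to each other under isomorphisms. -/
def _root_.FusionMackey.Corr {H K H' K' : Subgroup S} (η : H ≃* H') (κ : K ≃* K') (q r : Pair S) : Prop :=
  (∀ a : q.1, ∃ b : r.1, ∃ x : H, ∃ y : K, (x : S) = a ∧ (y : S) = q.2 a ∧ (b : S) = η x ∧
    r.2 b = κ y) ∧
  ∀ b : r.1, ∃ a : q.1, ∃ x : H, ∃ y : K, (x : S) = a ∧ (y : S) = q.2 a ∧ (b : S) = η x ∧
    r.2 b = κ y

theorem _root_.FusionMackey.Corr.symm {H K H' K' : Subgroup S} {η : H ≃* H'} {κ : K ≃* K'} {q r : Pair S}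
    (h : Corr η κ q r) : Corr η.symm κ.symm r q := by
  constructor
  · intro b
    obtain ⟨a, x, y, h1, h2, h3, h4⟩ := h.2 b
    exact ⟨a, η x, κ y, h3.symm, h4.symm, by simp [h1], by simp [h2]⟩
  · intro a
    obtain ⟨b, x, y, h1, h2, h3, h4⟩ := h.1 a
    exact ⟨b, η x, κ y, h3.symm, h4.symm, by simp [h1], by simp [h2]⟩

theorem _root_.FusionMackey.Corr.pairLE {H K H' K' : Subgroup S} {η : H ≃* H'} {κ : K ≃* K'}
    {q r q' r' : Pair S} (h : Corr η κ q r) (h' : Corr η κ q' r') (hle : PairLE H K q q') :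
    PairLE H' K' r r' := by
  obtain ⟨g, hg, k, hk, e⟩ := hle
  refine ⟨η ⟨g, hg⟩, Subtype.coe_prop _, κ ⟨k, hk⟩, Subtype.coe_prop _, fun b => ?_⟩
  obtain ⟨a, x, y, h1, h2, h3, h4⟩ := h.2 b
  obtain ⟨a', ha', ha''⟩ := e a
  obtain ⟨b', x', y', h1', h2', h3', h4'⟩ := h'.1 a'
  refine ⟨b', ?_, ?_⟩
  · have : x' = ⟨g, hg⟩⁻¹ * x * ⟨g, hg⟩ := Subtype.ext (by simp [h1', ha', h1])
    rw [h3', this, h3]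
    simp
  · have : y' = ⟨k, hk⟩ * y * ⟨k, hk⟩⁻¹ := Subtype.ext (by simp [h2', ha'', h2])
    rw [h4', this, h4]
    simp

/-- The corresponding pair is `κ φ η⁻¹` on `η(A)`. -/
theorem exists_corr (hC : E.IsCentricFamily C) {H K H' K' : Subgroup S}
    {η : H ≃* H'} {κ : K ≃* K'}
    (hη : H'.subtype.comp η.toMonoidHom ∈ E.Hom H H')
    (hκ : K'.subtype.comp κ.toMonoidHom ∈ E.Hom K K') {q : Pair S} (hq : E.IsPairIn C H K q) :
    ∃ r, E.IsPairIn C H' K' r ∧ Corr η κ q r := by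
  let e : q.1 →* S := (H'.subtype.comp η.toMonoidHom).comp (Subgroup.inclusion hq.2.1)
  have he : e ∈ E.Hom q.1 H' := E.restrict_mem hq.2.1 hη fun a b hab => by
    simp only [e, MonoidHom.comp_apply]
    congr 2
    exact Subtype.ext hab.symm
  obtain ⟨ψ, hψ, h⟩ := E.exists_inv (E.onto_mem he) rfl
  let χ : e.range →* S := (K'.subtype.comp κ.toMonoidHom).comp ((q.2.comp
    (ψ.codRestrict q.1 (E.apply_mem hψ))).codRestrict K fun b => E.apply_mem hq.2.2 _)
  have hχ : χ ∈ E.Hom e.range K' := E.comp_mem (E.comp_mem hψ hq.2.2) hκ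
  have hval : ∀ a : q.1, ∃ b : e.range, ∃ x : H, ∃ y : K, (x : S) = a ∧ (y : S) = q.2 a ∧
      (b : S) = η x ∧ χ b = κ y ∧ (b : S) = e a := by
    intro a
    refine ⟨⟨e a, a, rfl⟩, ⟨a, hq.2.1 a.2⟩, ⟨q.2 a, E.apply_mem hq.2.2 a⟩, rfl, rfl, rfl, ?_, rfl⟩
    change ((κ _ : K') : S) = κ _
    congr 2
    refine Subtype.ext ?_
    change q.2 _ = q.2 a
    congr 1
    exact Subtype.ext (h a ⟨e a, a, rfl⟩ rfl)
  refine ⟨⟨e.range, χ⟩, ⟨hC.iso hq.1 he, ?_, hχ⟩, ?_, ?_⟩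
  · rintro _ ⟨a, rfl⟩
    exact E.apply_mem he a
  · intro a
    obtain ⟨b, x, y, h1, h2, h3, h4, -⟩ := hval a
    exact ⟨b, x, y, h1, h2, h3, h4⟩
  · rintro ⟨_, a, rfl⟩
    obtain ⟨b, x, y, h1, h2, h3, h4, h5⟩ := hval a
    have : b = ⟨e a, a, rfl⟩ := Subtype.ext h5
    subst this
    exact ⟨a, x, y, h1, h2, h3, h4⟩

/-- Products are transported along isomorphisms of their factors. -/
theorem sum_corr (hC : E.IsCentricFamily C) {H K H' K' : Subgroup S}
    {η : H ≃* H'} {κ : K ≃* K'}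
    (hη : H'.subtype.comp η.toMonoidHom ∈ E.Hom H H')
    (hκ : K'.subtype.comp κ.toMonoidHom ∈ E.Hom K K')
    (hη' : H.subtype.comp η.symm.toMonoidHom ∈ E.Hom H' H)
    (hκ' : K.subtype.comp κ.symm.toMonoidHom ∈ E.Hom K' K) {T T' : Finset (Pair S)}
    (hT : E.IsProductIn C H K T) (hT' : E.IsProductIn C H' K' T') {V : Type*} [AddCommMonoid V]
    {v v' : Pair S → V} (hv : E.IsInvariant C H' K' v')
    (hvv : ∀ q r, E.IsPairIn C H K q → E.IsPairIn C H' K' r → Corr η κ q r → v q = v' r) :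
    ∑ q ∈ T, v q = ∑ q ∈ T', v' q := by
  classical
  have hmax : ∀ q ∈ T, ∃ r, E.IsMaxPairIn C H' K' r ∧ Corr η κ q r := by
    intro q hq
    obtain ⟨r, hr, hqr⟩ := exists_corr hC hη hκ (hT.1 q hq).1
    refine ⟨r, ⟨hr, fun r' hr' hle => ?_⟩, hqr⟩
    obtain ⟨q', hq', hqr'⟩ := exists_corr hC hη' hκ' hr'
    exact hqr'.symm.pairLE hqr ((hT.1 q hq).2 q' hq' (hqr.symm.pairLE hqr' hle))
  have hmax' : ∀ r ∈ T', ∃ q, E.IsMaxPairIn C H K q ∧ Corr η κ q r := by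
    intro r hr
    obtain ⟨q, hq, hqr⟩ := exists_corr hC hη' hκ' (hT'.1 r hr).1
    refine ⟨q, ⟨hq, fun q' hq' hle => ?_⟩, hqr.symm⟩
    obtain ⟨r', hr', hqr'⟩ := exists_corr hC hη hκ hq'
    exact hqr'.symm.pairLE hqr ((hT'.1 r hr).2 r' hr' (hqr.symm.pairLE hqr' hle))
  refine sum_eq_sum_of_rel (fun q r => ∃ r', E.IsMaxPairIn C H' K' r' ∧ Corr η κ q r' ∧
    PairLE H' K' r' r ∧ PairLE H' K' r r') (fun q hq => ?_) (fun r hr => ?_) ?_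
  · obtain ⟨r', hr', hqr⟩ := hmax q hq
    obtain ⟨r, ⟨hr, h1, h2⟩, hu⟩ := hT'.2 r' hr'
    refine ⟨r, ⟨hr, r', hr', hqr, h1, h2⟩, ?_⟩
    rintro r₁ ⟨hr₁, r₁', hr₁', hqr₁, h3, h4⟩
    have h5 := hqr₁.pairLE hqr (PairLE.refl H K q)
    have h6 := hqr.pairLE hqr₁ (PairLE.refl H K q)
    exact hu r₁ ⟨hr₁, h6.trans h3, h4.trans h5⟩
  · obtain ⟨q', hq', hqr⟩ := hmax' r hr
    obtain ⟨q, ⟨hq, h1, h2⟩, hu⟩ := hT.2 q' hq'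
    obtain ⟨r', hr', hqr'⟩ := hmax q hq
    refine ⟨q, ⟨hq, r', hr', hqr', hqr'.pairLE hqr h2, hqr.pairLE hqr' h1⟩, ?_⟩
    rintro q₁ ⟨hq₁, r₁, hr₁, hqr₁, h3, h4⟩
    exact hu q₁ ⟨hq₁, hqr.symm.pairLE hqr₁.symm h4, hqr₁.symm.pairLE hqr.symm h3⟩
  · rintro q hq r hr ⟨r', hr', hqr, h1, h2⟩
    rw [hvv q r' (hT.1 q hq).1 hr'.1 hqr]
    exact hv r' r hr'.1 (hT'.1 r hr).1 h1 h2

end FusionSystem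

end ProductSums

/-! ### Isomorphisms, full normalization and the Sylow property -/

section Isomorphisms

variable {S : Type u} [Group S] {P : Subgroup S} (E : FusionSystem P)

/-- The automorphisms of `A` induced by conjugation by elements of `P`. -/
def autBy (P A : Subgroup S) : Subgroup (MulAut A) where
  carrier := {α | ∃ g ∈ P, ∀ a, (α a : S) = g * a * g⁻¹}
  one_mem' := ⟨1, one_mem _, fun a => by simp⟩
  mul_mem' := by
    rintro α β ⟨g, hg, h⟩ ⟨g', hg', h'⟩
    exact ⟨g * g', mul_mem hg hg', fun a => by simp [h, h', mul_assoc]⟩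
  inv_mem' := by
    rintro α ⟨g, hg, h⟩
    refine ⟨g⁻¹, inv_mem hg, fun a => ?_⟩
    have := h (α⁻¹ a)
    rw [MulAut.apply_inv_self] at this
    simp [this, mul_assoc]

theorem isPGroup_autBy {p : ℕ} (hS : IsPGroup p S) (P A : Subgroup S) :
    IsPGroup p (autBy P A) := by
  rintro ⟨α, g, hg, h⟩
  obtain ⟨k, hk⟩ := hS g
  refine ⟨k, Subtype.ext ?_⟩
  have : ∀ (n : ℕ) (a : A), ((α ^ n) a : S) = g ^ n * a * (g ^ n)⁻¹ := by
    intro n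
    induction n with
    | zero => simp
    | succ n ih => intro a; rw [pow_succ', MulAut.mul_apply, h, ih]; simp [pow_succ', mul_assoc]
  ext a
  have := this (p ^ k) a
  rw [hk] at this
  simpa using this

/-- `X` lies in a Sylow subgroup of `A`, and all of these are conjugate to `Q`. -/
theorem exists_conj_mem_of_sylow {G : Type*} [Group G] [Finite G] {p : ℕ} [Fact p.Prime]
    {A B X : Subgroup G} (Q : Sylow p A) (hQ : (Q : Subgroup A) = B.subgroupOf A) (hX : X ≤ A)
    (hp : IsPGroup p X) : ∃ γ ∈ A, ∀ x ∈ X, γ * x * γ⁻¹ ∈ B := by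
  have h1 : IsPGroup p (X.subgroupOf A) :=
    hp.of_equiv (Subgroup.subgroupOfEquivOfLe hX).symm
  obtain ⟨Q₁, hQ₁⟩ := h1.exists_le_sylow
  obtain ⟨γ, hγ⟩ := MulAction.exists_smul_eq A Q₁ Q
  refine ⟨γ, γ.2, fun x hx => ?_⟩
  have h2 : (⟨x, hX hx⟩ : A) ∈ Q₁ := hQ₁ hx
  have h3 : γ * ⟨x, hX hx⟩ * γ⁻¹ ∈ (Q : Subgroup A) := by
    rw [← hγ, Sylow.coe_subgroup_smul]
    exact Subgroup.smul_mem_pointwise_smul _ (MulAut.conj γ) _ h2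
  rw [hQ] at h3
  exact h3

namespace FusionSystem

/-- `e` is an isomorphism of the fusion system. -/
def IsIso {A B : Subgroup S} (e : A ≃* B) : Prop := B.subtype.comp e.toMonoidHom ∈ E.Hom A B

variable {E}

theorem IsIso.symm {A B : Subgroup S} {e : A ≃* B} (he : E.IsIso e) : E.IsIso e.symm := by
  have hr : (B.subtype.comp e.toMonoidHom).range = B := by
    ext x
    constructor
    · rintro ⟨a, rfl⟩
      exact (e a).2
    · exact fun hx => ⟨e.symm ⟨x, hx⟩, by simp⟩
  obtain ⟨ψ, hψ, h⟩ := E.exists_inv he hr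
  have : A.subtype.comp e.symm.toMonoidHom = ψ := by
    ext b
    exact (h (e.symm b) b (by simp)).symm
  rw [IsIso, this]
  exact hψ

theorem IsIso.trans {A B D : Subgroup S} {e : A ≃* B} {f : B ≃* D} (he : E.IsIso e)
    (hf : E.IsIso f) : E.IsIso (e.trans f) := E.comp_mem he hf

theorem mem_aut_iff {A : Subgroup S} (hA : A ≤ P) {α : MulAut A} :
    α ∈ E.aut A ↔ E.IsIso (α : A ≃* A) :=
  ⟨fun h => h hA, fun h _ => h⟩

theorem isIso_conj {A B : Subgroup S} {e : A ≃* B} (hA : A ≤ P) (hB : B ≤ P) {g : S} (hg : g ∈ P)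
    (he : ∀ a, (e a : S) = g * a * g⁻¹) : E.IsIso e :=
  E.conj_mem_of hA hB hg he fun a => (e a).2

theorem exists_isIso {A B : Subgroup S} {φ : A →* S} (hφ : φ ∈ E.Hom A B) (hB : φ.range = B) :
    ∃ e : A ≃* B, E.IsIso e ∧ ∀ a, (e a : S) = φ a := by
  subst hB
  exact ⟨MonoidHom.ofInjective (E.injective hφ), E.onto_mem hφ, fun _ => rfl⟩

theorem IsIso.isConj {A B : Subgroup S} {e : A ≃* B} (he : E.IsIso e) : E.IsConj A B := by
  refine ⟨_, he, ?_⟩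
  ext x
  constructor
  · rintro ⟨a, rfl⟩
    exact (e a).2
  · exact fun hx => ⟨e.symm ⟨x, hx⟩, by simp⟩

theorem isConj_iff {A B : Subgroup S} : E.IsConj A B ↔ ∃ e : A ≃* B, E.IsIso e :=
  ⟨fun ⟨_, hφ, h⟩ => (exists_isIso hφ h).imp fun _ h => h.1, fun ⟨_, he⟩ => he.isConj⟩

theorem isConj_refl {A : Subgroup S} (hA : A ≤ P) : E.IsConj A A :=
  isConj_iff.2 ⟨MulEquiv.refl A, isIso_conj hA hA (one_mem P) (by simp)⟩

theorem IsConj.symm {A B : Subgroup S} (h : E.IsConj A B) : E.IsConj B A := by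
  obtain ⟨e, he⟩ := isConj_iff.1 h
  exact he.symm.isConj

theorem IsConj.trans {A B D : Subgroup S} (h : E.IsConj A B) (h' : E.IsConj B D) :
    E.IsConj A D := by
  obtain ⟨e, he⟩ := isConj_iff.1 h
  obtain ⟨f, hf⟩ := isConj_iff.1 h'
  exact (he.trans hf).isConj

theorem IsConj.card_eq {A B : Subgroup S} (h : E.IsConj A B) : Nat.card A = Nat.card B := by
  obtain ⟨e, he⟩ := isConj_iff.1 h
  exact Nat.card_congr e.toEquiv

theorem exists_isFullyNormalized [Finite S] {A : Subgroup S} (hA : A ≤ P) :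
    ∃ B, E.IsFullyNormalized B ∧ E.IsConj A B := by
  obtain ⟨B, hB, h⟩ := Set.exists_max_image {B | E.IsConj A B}
    (fun B => Nat.card (P ⊓ Subgroup.normalizer (B : Set S) : Subgroup S)) (Set.toFinite _)
    ⟨A, isConj_refl hA⟩
  have hBP : B ≤ P := by
    obtain ⟨φ, hφ, -⟩ := id hB
    exact E.target_le hφ
  exact ⟨B, ⟨hBP, fun D hD => h D (IsConj.trans hB hD)⟩, hB⟩

/-- The basic closure properties of a family of subgroups. -/
structure IsClosedFamily (E : FusionSystem P) (C : Set (Subgroup S)) : Prop where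
  le : ∀ {A}, A ∈ C → A ≤ P
  up : ∀ {A B}, A ∈ C → A ≤ B → B ≤ P → B ∈ C
  iso : ∀ {A B : Subgroup S} {φ : A →* S}, A ∈ C → φ ∈ E.Hom A B → φ.range ∈ C
  cent : ∀ {A}, A ∈ C → ∀ g ∈ P, (∀ a ∈ A, g * a = a * g) → g ∈ A
  ext : ∀ {A : Subgroup S} {φ : A →* S}, A ∈ C → φ ∈ E.Hom A P → E.IsFullyNormalized φ.range →
    ∃ ψ ∈ E.Hom (phiNormalizer P φ) P, ∀ (a : A) (b : phiNormalizer P φ), (b : S) = a → ψ b = φ a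

/-- Every `p`-subgroup of `Aut_E(A)` is conjugate to a subgroup of `Aut_P(A)`. -/
def SylowAt (E : FusionSystem P) (p : ℕ) (A : Subgroup S) : Prop :=
  ∀ X ≤ E.aut A, IsPGroup p X → ∃ γ ∈ E.aut A, ∀ x ∈ X, γ * x * γ⁻¹ ∈ autBy P A

theorem IsClosedFamily.mem_of_isIso {C : Set (Subgroup S)} (hC : E.IsClosedFamily C)
    {A B : Subgroup S} {e : A ≃* B} (he : E.IsIso e) (hA : A ∈ C) : B ∈ C := by
  obtain ⟨φ, hφ, rfl⟩ := he.isConj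
  exact hC.iso hA hφ

variable [Finite S] {p : ℕ} [Fact p.Prime]

theorem autBy_le_aut {A : Subgroup S} : autBy P A ≤ E.aut A := by
  rintro α ⟨g, hg, h⟩ hA
  exact isIso_conj hA hA hg h

theorem _root_.FusionMackey.exists_mulAut_conj {A : Subgroup S} {g : S}
    (hg : g ∈ Subgroup.normalizer (A : Set S)) : ∃ β : MulAut A, ∀ a, (β a : S) = g * a * g⁻¹ := by
  refine ⟨⟨⟨fun a => ⟨g * a * g⁻¹, (Subgroup.mem_normalizer_iff.1 hg a).1 a.2⟩,
    fun a => ⟨g⁻¹ * a * g, (Subgroup.mem_normalizer_iff.1 hg _).2 ?_⟩, ?_, ?_⟩, ?_⟩, fun a => rfl⟩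
  · simp [mul_assoc]
  · intro a; exact Subtype.ext (by simp [mul_assoc])
  · intro a; exact Subtype.ext (by simp [mul_assoc])
  · intro a b; exact Subtype.ext (by simp [mul_assoc])

theorem _root_.FusionMackey.mem_normalizer_of_forall {A : Subgroup S} {g : S}
    (h : ∀ a ∈ A, g * a * g⁻¹ ∈ A) : g ∈ Subgroup.normalizer (A : Set S) := by
  have hmap : A.map (MulAut.conj g).toMonoidHom = A := by
    refine Subgroup.eq_of_le_of_card_ge ?_ ?_
    · rintro _ ⟨a, ha, rfl⟩
      exact h a ha
    · rw [Subgroup.card_map_of_injective (MulAut.conj g).injective]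
  rw [Subgroup.mem_normalizer_iff]
  intro a
  refine ⟨h a, fun ha => ?_⟩
  rw [← hmap] at ha
  obtain ⟨b, hb, hba⟩ := ha
  have : b = a := (MulAut.conj g).injective hba
  exact this ▸ hb

theorem exists_aut {A : Subgroup S} {φ : A →* S} (hφ : φ ∈ E.Hom A A) :
    ∃ α ∈ E.aut A, ∀ a, (α a : S) = φ a := by
  have hr : φ.range = A := by
    refine Subgroup.eq_of_le_of_card_ge ?_
      (Nat.card_congr (MonoidHom.ofInjective (E.injective hφ)).toEquiv).le
    rintro _ ⟨a, rfl⟩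
    exact E.apply_mem hφ a
  obtain ⟨e, he, h⟩ := exists_isIso hφ hr
  exact ⟨e, (mem_aut_iff (E.source_le hφ)).2 he, h⟩

/-- By the Chinese remainder theorem `m` is chosen to be `1` modulo `p ^ k` and divisible by the
part of the order of `x` prime to `p`. Such a power has `p`-power order but does not change the
action of `x` wherever that action has order dividing `p ^ k`. -/
theorem exists_pow_eq {G : Type*} [Group G] [Finite G] (x : G) (p : ℕ) [hp : Fact p.Prime] (k : ℕ) :
    ∃ m a : ℕ, m ≡ 1 [MOD p ^ k] ∧ (x ^ m) ^ p ^ a = 1 := by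
  obtain ⟨a, b, hb, hab⟩ := Nat.exists_eq_pow_mul_and_not_dvd (orderOf_pos x).ne' p hp.out.ne_one
  have hco : Nat.Coprime (p ^ k) b :=
    Nat.Coprime.pow_left _ ((Nat.Prime.coprime_iff_not_dvd hp.out).2 hb)
  obtain ⟨m, hm1, hm2⟩ := Nat.chineseRemainder hco 1 0
  refine ⟨m, a, hm1, ?_⟩
  rw [← pow_mul, ← orderOf_dvd_iff_pow_eq_one, hab, mul_comm]
  exact mul_dvd_mul ((Nat.modEq_zero_iff_dvd).1 hm2) dvd_rfl

theorem isPGroup_zpowers {G : Type*} [Group G] {x : G} {p k : ℕ} (h : x ^ p ^ k = 1) :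
    IsPGroup p (Subgroup.zpowers x) := by
  rintro ⟨_, n, rfl⟩
  refine ⟨k, Subtype.ext ?_⟩
  change (x ^ n) ^ p ^ k = 1
  rw [← zpow_natCast, ← zpow_mul, mul_comm, zpow_mul, zpow_natCast, h, one_zpow]

/-- An automorphism of `p`-power order which normalizes `Aut_P(A)`, for `A` fully normalized. -/
theorem mem_autBy_of_normalizes (hS : IsPGroup p S) {C : Set (Subgroup S)}
    (hC : E.IsClosedFamily C) {A : Subgroup S} (hA : A ∈ C) (hAP : A ≠ P)
    (hn : E.IsFullyNormalized A)
    (ih : ∀ B ∈ C, Nat.card A < Nat.card B → E.IsFullyNormalized B → E.SylowAt p B)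
    {α : MulAut A} (hα : α ∈ E.aut A) {k : ℕ} (hk : α ^ p ^ k = 1)
    (hnorm : ∀ β ∈ autBy P A, α * β * α⁻¹ ∈ autBy P A) : α ∈ autBy P A := by
  have hAP' := hC.le hA
  have hφ := (mem_aut_iff hAP').1 hα
  have hr : (A.subtype.comp α.toMonoidHom).range = A := by
    ext x
    constructor
    · rintro ⟨a, rfl⟩
      exact (α a).2
    · exact fun hx => ⟨α.symm ⟨x, hx⟩, by simp⟩
  obtain ⟨ψ, hψ, hext⟩ := hC.ext hA (E.mem_top hφ) (hr.symm ▸ hn)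
  set R := P ⊓ Subgroup.normalizer (A : Set S) with hR
  have hAR : A ≤ R := le_inf hAP' Subgroup.le_normalizer
  have hRP : R ≤ P := inf_le_left
  have hconj : ∀ r ∈ R, ∀ a ∈ A, r * a * r⁻¹ ∈ A := fun r hr a ha =>
    (Subgroup.mem_normalizer_iff.1 hr.2 a).1 ha
  -- As `α` normalizes `Aut_P(A)`, the extension axiom for `α` reaches all of `N_P(A)`.
  have hRle : R ≤ phiNormalizer P (A.subtype.comp α.toMonoidHom) := by
    intro r hr'
    obtain ⟨β, hβ⟩ := exists_mulAut_conj hr'.2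
    obtain ⟨z, hz, hz'⟩ := hnorm β ⟨r, hr'.1, hβ⟩
    have h1 : ∀ a : A, (α (β a) : S) = z * α a * z⁻¹ := fun a => by
      have := hz' (α a)
      simpa using this
    refine mem_transport.2 ⟨hr', z, ⟨hz, ?_⟩, ?_⟩
    · change z ∈ Subgroup.normalizer _
      rw [hr]
      refine mem_normalizer_of_forall fun a ha => ?_
      have := h1 (α⁻¹ ⟨a, ha⟩)
      rw [MulAut.apply_inv_self] at this
      rw [← this]
      exact Subtype.coe_prop _
    · intro a b hab
      have : b = β a := Subtype.ext (by rw [hab, hβ])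
      rw [this]
      exact h1 a
  -- the extension restricts to an automorphism of the normalizer of `A`
  obtain ⟨β, hβ, hβα⟩ : ∃ β ∈ E.aut R, ∀ a : A, ∀ r : R, (r : S) = a → (β r : S) = α a := by
    have h1 : ψ.comp (Subgroup.inclusion hRle) ∈ E.Hom R P :=
      E.restrict_mem hRle hψ fun a b hab => congrArg ψ (Subtype.ext hab.symm)
    have hψa : ∀ (a : A) (r : R), (r : S) = a → ψ (Subgroup.inclusion hRle r) = α a :=
      fun a r h => hext a (Subgroup.inclusion hRle r) h
    have h2 : ∀ r, ψ.comp (Subgroup.inclusion hRle) r ∈ R := by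
      intro r
      refine ⟨E.apply_mem h1 r, mem_normalizer_of_forall fun a ha => ?_⟩
      have h3 := hψa (α⁻¹ ⟨a, ha⟩) ⟨_, hAR (Subtype.coe_prop _)⟩ rfl
      rw [MulAut.apply_inv_self] at h3
      change _ = a at h3
      rw [← h3, MonoidHom.comp_apply, ← map_inv, ← map_inv, ← map_mul, ← map_mul, ← map_mul,
        ← map_mul]
      rw [hψa ⟨_, hconj r r.2 _ (Subtype.coe_prop (α⁻¹ ⟨a, ha⟩))⟩ _ rfl]
      exact Subtype.coe_prop _
    obtain ⟨β, hβ, h⟩ := exists_aut (E.mem_of_apply_mem h1 hRP h2)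
    exact ⟨β, hβ, fun a r har => (h r).trans (hψa a r har)⟩
  -- The extension `β` of `α` to `R = N_P(A)` need not have `p`-power order, but `β ^ m` does, and
  -- it still extends `α`.
  obtain ⟨m, j, hm, hj⟩ := exists_pow_eq β p k
  have hβpow : ∀ (n : ℕ) (a : A) (r : R), (r : S) = a → ((β ^ n) r : S) = (α ^ n) a := by
    intro n
    induction n with
    | zero => intro a r h; exact h
    | succ n ihn =>
      intro a r h
      rw [pow_succ', pow_succ', MulAut.mul_apply, MulAut.mul_apply]
      exact hβα _ _ (ihn a r h)
  have hαm : α ^ m = α := by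
    have h1 : orderOf α ∣ p ^ k := orderOf_dvd_of_pow_eq_one hk
    conv_rhs => rw [← pow_one α]
    exact pow_eq_pow_iff_modEq.2 (hm.of_dvd h1)
  obtain ⟨R', hR'n, hRR'⟩ := exists_isFullyNormalized (E := E) hRP
  obtain ⟨e, he⟩ := isConj_iff.1 hRR'
  have hRC : R ∈ C := hC.up hA hAR hRP
  have hcard : Nat.card A < Nat.card R' := by
    rw [← hRR'.card_eq]
    by_contra! h
    have h1 : A = R := Subgroup.eq_of_le_of_card_ge hAR h
    obtain ⟨x, hx, hxA, hxn⟩ := exists_mem_normalizer_of_lt (hS.to_subgroup P)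
      (lt_of_le_of_ne hAP' hAP)
    apply hxA
    rw [h1]
    exact ⟨hx, hxn⟩
  have hR'P := hR'n.1
  have hX : ((β ^ m) : R ≃* R) |> fun b => (MulAut.congr e b) ∈ E.aut R' := by
    refine (mem_aut_iff hR'P).2 ?_
    exact he.symm.trans (((mem_aut_iff hRP).1 (pow_mem hβ m)).trans he)
  obtain ⟨γ, hγ, hγ'⟩ := ih R' (hC.mem_of_isIso he hRC) hcard hR'n
    (Subgroup.zpowers (MulAut.congr e (β ^ m))) (Subgroup.zpowers_le.2 hX)
    (isPGroup_zpowers (k := j) (by rw [← map_pow, hj, map_one]))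
  obtain ⟨g, hg, hg'⟩ := hγ' _ (Subgroup.mem_zpowers _)
  let f : R ≃* R' := e.trans γ
  have hf : E.IsIso f := he.trans ((mem_aut_iff hR'P).1 hγ)
  have hfg : ∀ r : R, (f ((β ^ m) r) : S) = g * f r * g⁻¹ := by
    intro r
    have := hg' (f r)
    rw [← this]
    simp [f, MulAut.congr]
  -- The isomorphism `f : R → R'` turns `β ^ m` into conjugation by `g`. For `D = f(A)`, `R'` is
  -- contained in `N_P(D)`, whose order is at most that of `N_P(A) = R` because `A` is fully
  -- normalized. So `R' = N_P(D)`, and this contains `g`.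
  have hgD : g ∈ R' := by
    let D : Subgroup S := (R'.subtype.comp (f.toMonoidHom.comp (Subgroup.inclusion hAR))).range
    have hAD : E.IsConj A D := ⟨_, E.onto_mem (E.restrict_mem hAR hf fun a b hab => by
      simp only [MonoidHom.comp_apply]
      congr 2
      exact Subtype.ext hab.symm), rfl⟩
    have h1 : R' ≤ P ⊓ Subgroup.normalizer (D : Set S) := by
      refine le_inf hR'P fun x hx => mem_normalizer_of_forall ?_
      rintro _ ⟨a, rfl⟩
      have h2 : x = f (f.symm ⟨x, hx⟩) := by simp
      refine ⟨⟨_, hconj _ (f.symm ⟨x, hx⟩).2 a a.2⟩, ?_⟩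
      have h3 : Subgroup.inclusion hAR ⟨_, hconj _ (f.symm ⟨x, hx⟩).2 a a.2⟩ =
        f.symm ⟨x, hx⟩ * Subgroup.inclusion hAR a * (f.symm ⟨x, hx⟩)⁻¹ := rfl
      simp only [MonoidHom.comp_apply]
      rw [h3]
      simp
    have h2 : R' = P ⊓ Subgroup.normalizer (D : Set S) := by
      refine Subgroup.eq_of_le_of_card_ge h1 ?_
      rw [← hRR'.card_eq]
      exact hn.2 D hAD
    rw [h2]
    refine ⟨hg, mem_normalizer_of_forall ?_⟩
    rintro _ ⟨a, rfl⟩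
    have h3 := hfg (Subgroup.inclusion hAR a)
    refine ⟨(α ^ m) a, ?_⟩
    have h4 : Subgroup.inclusion hAR ((α ^ m) a) = (β ^ m) (Subgroup.inclusion hAR a) :=
      Subtype.ext (hβpow m a _ rfl).symm
    simp only [MonoidHom.comp_apply]
    rw [h4]
    exact h3
  refine ⟨f.symm ⟨g, hgD⟩, hRP (Subtype.coe_prop _), fun a => ?_⟩
  have h1 := hfg (Subgroup.inclusion hAR a)
  have h2 : f ((β ^ m) (Subgroup.inclusion hAR a)) =
      f (f.symm ⟨g, hgD⟩ * Subgroup.inclusion hAR a * (f.symm ⟨g, hgD⟩)⁻¹) :=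
    Subtype.ext (h1.trans (by simp))
  have h3 := congrArg Subtype.val (f.injective h2)
  rw [hβpow m a _ rfl, hαm] at h3
  exact h3

/-- Descending induction on the order of `A`, starting at `P`. If `Aut_P(A)` were properly contained
in a Sylow subgroup of `Aut_E(A)`, some further element of `p`-power order would normalize it,
contradicting `mem_autBy_of_normalizes`. -/
theorem IsClosedFamily.sylowAt (hS : IsPGroup p S) {C : Set (Subgroup S)}
    (hC : E.IsClosedFamily C) (htop : P ∈ C → E.SylowAt p P) {A : Subgroup S} (hA : A ∈ C)
    (hn : E.IsFullyNormalized A) : E.SylowAt p A := by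
  induction hN : Nat.card S - Nat.card A using Nat.strong_induction_on generalizing A with
  | _ N ih =>
    by_cases hAP : A = P
    · subst hAP
      exact htop hA
    intro X hX hXp
    have h0 : IsPGroup p ((autBy P A).subgroupOf (E.aut A)) :=
      (isPGroup_autBy hS P A).of_equiv (Subgroup.subgroupOfEquivOfLe autBy_le_aut).symm
    obtain ⟨Q, hQ⟩ := h0.exists_le_sylow
    refine exists_conj_mem_of_sylow Q (le_antisymm ?_ hQ) hX hXp
    by_contra hcon
    obtain ⟨x, hx, hx', hxn⟩ := exists_mem_normalizer_of_lt Q.isPGroup'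
      (lt_of_le_not_ge hQ hcon)
    apply hx'
    obtain ⟨k, hk⟩ := Q.isPGroup' ⟨x, hx⟩
    refine mem_autBy_of_normalizes hS hC hA hAP hn (fun B hB hAB hBn => ?_) x.2 (k := k)
      (congrArg (fun y : Q => ((y : E.aut A) : MulAut A)) hk) (fun β hβ => ?_)
    · have := Subgroup.card_le_card_group B
      exact ih _ (by omega) hB hBn rfl
    · exact (Subgroup.mem_normalizer_iff.1 hxn ⟨β, autBy_le_aut hβ⟩).1 hβ

end FusionSystem

end Isomorphisms

/-! ### Extension of morphisms and uniqueness of extensions, from the Sylow property -/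

section Families

variable {S : Type u} [Group S] [Finite S] {P : Subgroup S} {E : FusionSystem P}
  {C : Set (Subgroup S)} {p : ℕ} [Fact p.Prime]

namespace FusionSystem

/-- Every centric subgroup in a closed family satisfies the Sylow condition if it is fully
normalized. -/
def IsClosedFamily.Sylow (E : FusionSystem P) (p : ℕ) (C : Set (Subgroup S)) : Prop :=
  ∀ A ∈ C, E.IsFullyNormalized A → E.SylowAt p A

/-- Here `ψ = φ α` for an automorphism `α` of `B` that is trivial on `A` and moves each element
within its coset of `A`. It has `p`-power order, so the Sylow property makes it conjugation by an
element `g` after an isomorphism `f`. This `g` centralizes `f(A)`, hence lies in it by centricity,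
and `α` is conjugation by the corresponding element of `Z(A)`. -/
theorem IsClosedFamily.epi_of_normal (hS : IsPGroup p S) (hC : E.IsClosedFamily C)
    (hsyl : IsClosedFamily.Sylow E p C) {A B : Subgroup S} {φ ψ : B →* S} (hA : A ∈ C) (hAB : A ≤ B)
    (hn : B ≤ Subgroup.normalizer (A : Set S))
    (hφ : φ ∈ E.Hom B P) (hψ : ψ ∈ E.Hom B P) (h : ∀ b : B, (b : S) ∈ A → φ b = ψ b) :
    ∃ z ∈ A, (∀ a ∈ A, z * a = a * z) ∧ ∀ b b' : B, (b' : S) = z * b * z⁻¹ → ψ b = φ b' := by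
  have hBP := E.source_le hφ
  have hB : B ∈ C := hC.up hA hAB hBP
  have hφA : φ.comp (Subgroup.inclusion hAB) ∈ E.Hom A P :=
    E.restrict_mem hAB hφ fun a b hab => congrArg φ (Subtype.ext hab.symm)
  -- As `B` normalizes `A` and `φ = ψ` on `A`, the elements `φ(b)` and `ψ(b)` act alike on `φ(A)`,
  -- so `φ(b)⁻¹ ψ(b)` lies in the centric subgroup `φ(A)`.
  have hval : ∀ b : B, ∃ a : A, ψ b = φ (b * Subgroup.inclusion hAB a) := by
    intro b
    have : (φ b)⁻¹ * ψ b ∈ (φ.comp (Subgroup.inclusion hAB)).range := by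
      refine hC.cent (hC.iso hA hφA) _ (mul_mem (inv_mem (E.apply_mem hφ b)) (E.apply_mem hψ b)) ?_
      rintro _ ⟨a, rfl⟩
      have h1 : ∀ b : B, ∀ a : A, φ (b * Subgroup.inclusion hAB a * b⁻¹) =
          ψ (b * Subgroup.inclusion hAB a * b⁻¹) := fun b a =>
        h _ ((Subgroup.mem_normalizer_iff.1 (hn b.2) a).1 a.2)
      have h2 := h1 b a
      have h3 := h (Subgroup.inclusion hAB a) a.2
      simp only [map_mul, map_inv, ← h3] at h2
      have h4 : (φ b)⁻¹ * (φ b * φ (Subgroup.inclusion hAB a) * (φ b)⁻¹) * ψ b =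
        (φ b)⁻¹ * (ψ b * φ (Subgroup.inclusion hAB a) * (ψ b)⁻¹) * ψ b := by rw [h2]
      simpa [mul_assoc] using h4.symm
    obtain ⟨a, ha⟩ := this
    refine ⟨a, ?_⟩
    rw [map_mul]
    change φ (Subgroup.inclusion hAB a) = _ at ha
    rw [ha]
    simp
  obtain ⟨ζ, hζ, hζ'⟩ := E.exists_inv (E.onto_mem hφ) rfl
  have hψφ : ∀ b, ψ b ∈ φ.range := fun b => by
    obtain ⟨a, ha⟩ := hval b
    exact ⟨_, ha.symm⟩
  have hψ' : ψ ∈ E.Hom B φ.range := E.mem_of_apply_mem hψ (E.target_le (E.onto_mem hφ)) hψφ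
  obtain ⟨α, hα, hαζ⟩ := exists_aut (E.comp_mem hψ' hζ)
  have hα' : ∀ b, φ (α b) = ψ b := by
    intro b
    obtain ⟨a, ha⟩ := hval b
    have h1 := hζ' (b * Subgroup.inclusion hAB a) ⟨ψ b, hψφ b⟩ ha
    have h2 : α b = b * Subgroup.inclusion hAB a := Subtype.ext ((hαζ b).trans h1)
    rw [h2, ha]
  have hαA : ∀ b : B, (b : S) ∈ A → α b = b := fun b hb =>
    E.injective hφ ((hα' b).trans (h b hb).symm)
  have hpow : ∀ b : B, ∃ a : A, ∀ n : ℕ, (α ^ n) b = b * (Subgroup.inclusion hAB a) ^ n := by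
    intro b
    obtain ⟨a, ha⟩ := hval b
    refine ⟨a, fun n => ?_⟩
    induction n with
    | zero => simp
    | succ n ih =>
      rw [pow_succ', MulAut.mul_apply, ih, map_mul, map_pow, hαA (Subgroup.inclusion hAB a) a.2,
        E.injective hφ ((hα' b).trans ha), pow_succ', mul_assoc]
  obtain ⟨k, hk⟩ := IsPGroup.iff_card.1 hS
  have hαk : α ^ p ^ k = 1 := by
    ext b
    obtain ⟨a, ha⟩ := hpow b
    rw [ha, ← hk]
    have : (Subgroup.inclusion hAB a) ^ Nat.card S = 1 :=
      Subtype.ext (by rw [SubgroupClass.coe_pow, pow_card_eq_one']; rfl)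
    rw [this]
    simp
  obtain ⟨B', hB'n, hBB'⟩ := exists_isFullyNormalized (E := E) hBP
  obtain ⟨e, he⟩ := isConj_iff.1 hBB'
  have hX : MulAut.congr e α ∈ E.aut B' :=
    (mem_aut_iff hB'n.1).2 (he.symm.trans (((mem_aut_iff hBP).1 hα).trans he))
  obtain ⟨γ, hγ, hγ'⟩ := hsyl B' (hC.mem_of_isIso he hB) hB'n
    (Subgroup.zpowers (MulAut.congr e α)) (Subgroup.zpowers_le.2 hX)
    (isPGroup_zpowers (k := k) (by rw [← map_pow, hαk, map_one]))
  obtain ⟨g, hg, hg'⟩ := hγ' _ (Subgroup.mem_zpowers _)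
  let f : B ≃* B' := e.trans γ
  have hf : E.IsIso f := he.trans ((mem_aut_iff hB'n.1).1 hγ)
  have hfg : ∀ r : B, (f (α r) : S) = g * f r * g⁻¹ := by
    intro r
    have := hg' (f r)
    rw [← this]
    simp [f, MulAut.congr]
  let χ : A →* S := B'.subtype.comp (f.toMonoidHom.comp (Subgroup.inclusion hAB))
  have hχ : χ ∈ E.Hom A B' := E.restrict_mem hAB hf fun a b hab => by
    simp only [χ, MonoidHom.comp_apply]
    congr 2
    exact Subtype.ext hab.symm
  obtain ⟨z, hz⟩ : g ∈ χ.range := by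
    refine hC.cent (hC.iso hA hχ) g hg ?_
    rintro _ ⟨a, rfl⟩
    have h1 := hfg (Subgroup.inclusion hAB a)
    rw [hαA _ a.2] at h1
    change χ a = g * χ a * g⁻¹ at h1
    rw [eq_mul_inv_iff_mul_eq] at h1
    exact h1.symm
  have hz' : (f (Subgroup.inclusion hAB z) : S) = g := hz
  have hαz : ∀ b, α b = Subgroup.inclusion hAB z * b * (Subgroup.inclusion hAB z)⁻¹ := by
    intro b
    apply f.injective
    apply Subtype.ext
    rw [hfg, ← hz']
    simp
  refine ⟨z, z.2, fun a ha => ?_, fun b b' hb => ?_⟩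
  · have h1 := hαz ⟨a, hAB ha⟩
    rw [hαA _ ha, eq_mul_inv_iff_mul_eq] at h1
    exact (congrArg Subtype.val h1).symm
  · rw [← hα', hαz]
    congr 1
    exact Subtype.ext hb.symm

/-- Descending induction on the order of `A`. The normal case, applied to `A` in `N_B(A)`, corrects
`φ` to agree with `ψ` on the larger group `N_B(A)`; the second correction centralizes `A`, so by
centricity it lies in `A` too. -/
theorem IsClosedFamily.epi (hS : IsPGroup p S) (hC : E.IsClosedFamily C)
    (hsyl : IsClosedFamily.Sylow E p C) {A B : Subgroup S} {φ ψ : B →* S} (hA : A ∈ C) (hAB : A ≤ B)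
    (hφ : φ ∈ E.Hom B P) (hψ : ψ ∈ E.Hom B P) (h : ∀ b : B, (b : S) ∈ A → φ b = ψ b) :
    ∃ z ∈ A, (∀ a ∈ A, z * a = a * z) ∧ ∀ b b' : B, (b' : S) = z * b * z⁻¹ → ψ b = φ b' := by
  induction hN : Nat.card S - Nat.card A using Nat.strong_induction_on generalizing A φ with
  | _ N ih =>
    have hBP := E.source_le hφ
    by_cases hne : A = B
    · subst hne
      refine ⟨1, one_mem _, by simp, fun b b' hb => ?_⟩
      have : b' = b := Subtype.ext (by simpa using hb)
      rw [this, h b b.2]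
    set D := B ⊓ Subgroup.normalizer (A : Set S) with hD
    have hAD : A ≤ D := le_inf hAB Subgroup.le_normalizer
    have hDB : D ≤ B := inf_le_left
    obtain ⟨z, hz, hzA, hz'⟩ := hC.epi_of_normal hS hsyl
      (φ := φ.comp (Subgroup.inclusion hDB)) (ψ := ψ.comp (Subgroup.inclusion hDB)) hA hAD
      inf_le_right
      (E.restrict_mem hDB hφ fun a b hab => congrArg φ (Subtype.ext hab.symm))
      (E.restrict_mem hDB hψ fun a b hab => congrArg ψ (Subtype.ext hab.symm))
      (fun b hb => h _ hb)
    have hzB : ∀ b : B, conjHom z B b ∈ B := fun b =>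
      mul_mem (mul_mem (hAB hz) b.2) (inv_mem (hAB hz))
    have hcz : conjHom z B ∈ E.Hom B B := E.conj_mem hBP hBP (hBP (hAB hz)) hzB
    obtain ⟨x, hx, hxA, hxn⟩ := exists_mem_normalizer_of_lt (hS.to_subgroup B)
      (lt_of_le_of_ne hAB hne)
    have hcard : Nat.card A < Nat.card D := by
      by_contra! h1
      have h2 : A = D := Subgroup.eq_of_le_of_card_ge hAD h1
      apply hxA
      rw [h2]
      exact ⟨hx, hxn⟩
    have hDS := Subgroup.card_le_card_group D
    obtain ⟨y, hy, hyD, hy'⟩ := ih _ (by omega)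
      (φ := φ.comp ((conjHom z B).codRestrict B hzB)) (hC.up hA hAD (hDB.trans hBP)) hDB
      (E.comp_mem hcz hφ) (by
        intro b hb
        have h1 := hz' ⟨b, hb⟩ ⟨z * b * z⁻¹, mul_mem (mul_mem (hAD hz) hb) (inv_mem (hAD hz))⟩ rfl
        exact h1.symm) rfl
    have hyA : y ∈ A := hC.cent hA y (hBP (hDB hy)) fun a ha => hyD a (hAD ha)
    refine ⟨z * y, mul_mem hz hyA, fun a ha => ?_, fun b b' hb => ?_⟩
    · rw [mul_assoc, hyD a (hAD ha), ← mul_assoc, hzA a ha, mul_assoc]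
    · rw [hy' b ⟨y * b * y⁻¹, mul_mem (mul_mem (hDB hy) b.2) (inv_mem (hDB hy))⟩ rfl]
      change φ _ = φ b'
      congr 1
      apply Subtype.ext
      rw [hb]
      change z * (y * b * y⁻¹) * z⁻¹ = _
      simp [mul_assoc]

/-- The image `φ(A)` need not be fully normalized, so it is first moved to a fully normalized `D` by
a map `χ`. Both `χ` and `θ = χ φ` extend, to `χ₂` on `N_P(φ(A))` and to `θ₂` on `N`. The image of
`θ₂` lies in that of `χ₂`, and `χ₂⁻¹ θ₂` is the extension sought. -/
theorem IsClosedFamily.exists_ext (hC : E.IsClosedFamily C)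
    (hS : IsPGroup p S) (hsyl : IsClosedFamily.Sylow E p C) {A K N : Subgroup S} {φ : A →* S}
    (hA : A ∈ C) (hφ : φ ∈ E.Hom A K) (hAN : A ≤ N) (hNP : N ≤ P)
    (h : ∀ n ∈ N, ∃ k ∈ K, ∀ a : A, ∃ a' : A, (a' : S) = n * a * n⁻¹ ∧ φ a' = k * φ a * k⁻¹) :
    ∃ χ ∈ E.Hom N K, ∀ (a : A) (n : N), (n : S) = a → χ n = φ a := by
  have hKP := E.target_le hφ
  have hA' := hC.iso hA hφ
  have hA'P := hC.le hA'
  set A' := φ.range with hA'def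
  have hφ' : φ ∈ E.Hom A A' := E.onto_mem hφ
  obtain ⟨D, hDn, hAD⟩ := exists_isFullyNormalized (E := E) hA'P
  obtain ⟨e, he⟩ := isConj_iff.1 hAD
  have hDP := hDn.1
  have hX : (autBy P A').map (MulAut.congr e).toMonoidHom ≤ E.aut D := by
    rintro _ ⟨α, hα, rfl⟩
    exact (mem_aut_iff hDP).2 (he.symm.trans (((mem_aut_iff hA'P).1 (autBy_le_aut hα)).trans he))
  -- By the Sylow property the isomorphism `f` onto `D` can be chosen to carry `Aut_P(φ(A))` into
  -- `Aut_P(D)`, so that it extends to the whole normalizer of `φ(A)`.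
  obtain ⟨γ, hγ, hγ'⟩ := hsyl D (hC.mem_of_isIso he hA') hDn _ hX
    ((isPGroup_autBy hS P A').map _)
  let f : A' ≃* D := e.trans γ
  have hf : E.IsIso f := he.trans ((mem_aut_iff hDP).1 hγ)
  have hfg : ∀ α ∈ autBy P A', ∃ g ∈ P, ∀ a : A', (f (α a) : S) = g * f a * g⁻¹ := by
    intro α hα
    obtain ⟨g, hg, hg'⟩ := hγ' _ (Subgroup.mem_map_of_mem _ hα)
    refine ⟨g, hg, fun a => ?_⟩
    rw [← hg' (f a)]
    simp [f, MulAut.congr]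
  let χ : A' →* S := D.subtype.comp f.toMonoidHom
  have hχ : χ ∈ E.Hom A' D := hf
  have hχr : χ.range = D := by
    ext x
    constructor
    · rintro ⟨a, rfl⟩
      exact (f a).2
    · exact fun hx => ⟨f.symm ⟨x, hx⟩, by simp [χ]⟩
  have hDnorm : ∀ g ∈ P, (∀ a : A', ∃ b : A', (f b : S) = g * f a * g⁻¹) →
      g ∈ P ⊓ Subgroup.normalizer (D : Set S) := by
    intro g hg h1
    refine ⟨hg, mem_normalizer_of_forall fun d hd => ?_⟩
    obtain ⟨b, hb⟩ := h1 (f.symm ⟨d, hd⟩)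
    rw [MulEquiv.apply_symm_apply] at hb
    rw [← hb]
    exact (f b).2
  obtain ⟨χ₁, hχ₁, hext₁⟩ := hC.ext hA' (E.mem_top hχ) (hχr.symm ▸ hDn)
  set R := P ⊓ Subgroup.normalizer (A' : Set S) with hR
  have hA'R : A' ≤ R := le_inf hA'P Subgroup.le_normalizer
  have hRle : R ≤ phiNormalizer P χ := by
    intro r hr
    obtain ⟨β, hβ⟩ := exists_mulAut_conj hr.2
    obtain ⟨g, hg, hg'⟩ := hfg β ⟨r, hr.1, hβ⟩
    refine mem_transport.2 ⟨hr, g, ?_, fun a b hab => ?_⟩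
    · rw [hχr]
      exact hDnorm g hg fun a => ⟨_, hg' a⟩
    · have : b = β a := Subtype.ext (by rw [hab, hβ])
      rw [this]
      exact hg' a
  let χ₂ : R →* S := χ₁.comp (Subgroup.inclusion hRle)
  have hχ₂ : χ₂ ∈ E.Hom R P :=
    E.restrict_mem hRle hχ₁ fun a b hab => congrArg χ₁ (Subtype.ext hab.symm)
  have hχ₂' : ∀ a : A', χ₂ (Subgroup.inclusion hA'R a) = f a := fun a => hext₁ a _ rfl
  -- the composite `A → D` and its extension to `N`
  let θ : A →* S := χ.comp (φ.codRestrict A' (E.apply_mem hφ'))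
  have hθ : θ ∈ E.Hom A D := E.comp_mem hφ' hχ
  have hθ' : ∀ (a : A) (b : A'), (b : S) = φ a → θ a = f b := fun a b hab => by
    change χ _ = χ b
    congr 1
    exact Subtype.ext hab.symm
  have hθr : θ.range = D := by
    ext x
    constructor
    · rintro ⟨a, rfl⟩
      exact E.apply_mem hθ a
    · intro hx
      obtain ⟨a, ha⟩ := (f.symm ⟨x, hx⟩).2
      refine ⟨a, ?_⟩
      rw [hθ' a (f.symm ⟨x, hx⟩) ha.symm]
      simp
  obtain ⟨θ₁, hθ₁, hext₂⟩ := hC.ext hA (E.mem_top hθ) (hθr.symm ▸ hDn)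
  have hkR : ∀ n ∈ N, ∀ k ∈ K, (∀ a : A, ∃ a' : A, (a' : S) = n * a * n⁻¹ ∧
      φ a' = k * φ a * k⁻¹) → k ∈ R := by
    intro n hn k hk h1
    refine ⟨hKP hk, mem_normalizer_of_forall ?_⟩
    rintro _ ⟨a, rfl⟩
    obtain ⟨a', -, ha'⟩ := h1 a
    exact ⟨a', ha'⟩
  have hfk : ∀ (k : R) (a a' : A), φ a' = k * φ a * (k : S)⁻¹ →
      θ a' = χ₂ k * θ a * (χ₂ k)⁻¹ := by
    intro k a a' hka
    rw [hθ' a ⟨φ a, a, rfl⟩ rfl, hθ' a' ⟨φ a', a', rfl⟩ rfl, ← hχ₂', ← hχ₂', ← map_inv, ← map_mul,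
      ← map_mul]
    congr 1
    exact Subtype.ext hka
  have hNle : N ≤ phiNormalizer P θ := by
    intro n hn
    obtain ⟨k, hk, h1⟩ := h n hn
    have hkR' := hkR n hn k hk h1
    have hnA : n ∈ Subgroup.normalizer (A : Set S) := mem_normalizer_of_forall fun a ha => by
      obtain ⟨a', ha', -⟩ := h1 ⟨a, ha⟩
      rw [← ha']
      exact a'.2
    refine mem_transport.2 ⟨⟨hNP hn, hnA⟩, χ₂ ⟨k, hkR'⟩, ?_, fun a b hab => ?_⟩
    · rw [hθr]
      refine hDnorm _ (E.apply_mem hχ₂ _) ?_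
      rintro ⟨_, a, rfl⟩
      obtain ⟨a', -, ha'⟩ := h1 a
      refine ⟨⟨φ a', a', rfl⟩, ?_⟩
      rw [← hθ' a ⟨φ a, a, rfl⟩ rfl, ← hθ' a' ⟨φ a', a', rfl⟩ rfl]
      exact hfk _ a a' ha'
    · obtain ⟨a', ha', ha''⟩ := h1 a
      have : b = a' := Subtype.ext (hab.trans ha'.symm)
      rw [this]
      exact hfk _ a a' ha''
  let θ₂ : N →* S := θ₁.comp (Subgroup.inclusion hNle)
  have hθ₂ : θ₂ ∈ E.Hom N P :=
    E.restrict_mem hNle hθ₁ fun a b hab => congrArg θ₁ (Subtype.ext hab.symm)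
  have hθ₂' : ∀ (a : A) (n : N), (n : S) = a → θ₂ n = θ a := fun a n han => hext₂ a _ han
  have hDC : D ∈ C := hC.mem_of_isIso he hA'
  -- If `n` acts as `k` does, then `θ₂(n) χ₂(k)⁻¹` centralizes `D`, so it lies in `D = χ₂(φ(A))`.
  -- Thus `θ₂(n)` is the image under `χ₂` of an element of `φ(A) k`, which lies in `K`.
  have hval : ∀ n : N, ∃ k ∈ K, ∃ r : R, (r : S) = k ∧ θ₂ n = χ₂ r := by
    intro n
    obtain ⟨k, hk, h1⟩ := h n n.2
    have hkR' := hkR n n.2 k hk h1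
    have hD : θ₂ n * (χ₂ ⟨k, hkR'⟩)⁻¹ ∈ D := by
      refine hC.cent hDC _ (mul_mem (E.apply_mem hθ₂ _) (inv_mem (E.apply_mem hχ₂ _))) ?_
      rw [← hθr]
      rintro _ ⟨a, rfl⟩
      obtain ⟨a₀, ha₀⟩ : ∃ a₀ : A, (a₀ : S) = (n : S)⁻¹ * a * n := by
        obtain ⟨k', -, h2⟩ := h _ (inv_mem n.2)
        obtain ⟨a₀, h3, -⟩ := h2 a
        exact ⟨a₀, by simpa using h3⟩
      obtain ⟨a', ha', ha''⟩ := h1 a₀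
      have haa : a' = a := Subtype.ext (by rw [ha', ha₀]; simp [mul_assoc])
      rw [haa] at ha''
      have h4 : θ a = χ₂ ⟨k, hkR'⟩ * θ a₀ * (χ₂ ⟨k, hkR'⟩)⁻¹ := hfk _ a₀ a ha''
      have h5 : θ a = θ₂ n * θ a₀ * (θ₂ n)⁻¹ := by
        rw [← hθ₂' a₀ ⟨a₀, hAN a₀.2⟩ rfl, ← hθ₂' a ⟨a, hAN a.2⟩ rfl, ← map_inv, ← map_mul, ← map_mul]
        congr 1
        exact Subtype.ext (by simp [ha₀, mul_assoc])
      have h6 : (χ₂ ⟨k, hkR'⟩)⁻¹ * θ a = θ a₀ * (χ₂ ⟨k, hkR'⟩)⁻¹ := by rw [h4]; simp [mul_assoc]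
      rw [mul_assoc, h6, h5]
      simp [mul_assoc]
    have h7 : θ₂ n * (χ₂ ⟨k, hkR'⟩)⁻¹ = χ₂ (Subgroup.inclusion hA'R (f.symm ⟨_, hD⟩)) := by
      rw [hχ₂']
      simp
    have hA'K : A' ≤ K := by
      rintro _ ⟨a, rfl⟩
      exact E.apply_mem hφ a
    refine ⟨_, mul_mem (hA'K (f.symm ⟨_, hD⟩).2) hk,
      Subgroup.inclusion hA'R (f.symm ⟨_, hD⟩) * ⟨k, hkR'⟩, rfl, ?_⟩
    rw [map_mul, ← h7]
    simp
  obtain ⟨ζ, hζ, hζ'⟩ := E.exists_inv (E.onto_mem hχ₂) rfl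
  have hθ₃ : θ₂ ∈ E.Hom N χ₂.range := E.mem_of_apply_mem hθ₂ (E.target_le (E.onto_mem hχ₂))
    fun n => by
      obtain ⟨k, -, r, -, hr⟩ := hval n
      exact ⟨r, hr.symm⟩
  have hcomp : ∀ (n : N) (r : R), θ₂ n = χ₂ r →
      ζ.comp (θ₂.codRestrict χ₂.range (E.apply_mem hθ₃)) n = r := fun n r hr =>
    hζ' r ⟨θ₂ n, E.apply_mem hθ₃ n⟩ hr
  refine ⟨_, E.mem_of_apply_mem (E.comp_mem hθ₃ hζ) hKP fun n => ?_, fun a n han => ?_⟩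
  · obtain ⟨k, hk, r, hrk, hr⟩ := hval n
    rw [hcomp n r hr, hrk]
    exact hk
  · refine (hcomp n (Subgroup.inclusion hA'R ⟨φ a, a, rfl⟩) ?_).trans rfl
    rw [hχ₂', hθ₂' a n han]
    exact hθ' a _ rfl

theorem IsClosedFamily.isCentricFamily (hS : IsPGroup p S) (hC : E.IsClosedFamily C)
    (hsyl : IsClosedFamily.Sylow E p C) : E.IsCentricFamily C where
  le := hC.le
  up := hC.up
  iso := hC.iso
  cent := hC.cent
  epi := hC.epi hS hsyl
  ext := hC.exists_ext hS hsyl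

end FusionSystem

end Families

/-! ### The centric families of a saturated fusion system and of the normalizer of `H` -/

section Saturated

variable {S : Type u} [Group S] [Finite S] {p : ℕ} [Fact p.Prime]

namespace FusionSystem

/-- A conjugate of `B` contains a conjugate of `A`, which already contains the centralizer. -/
theorem IsCentric.up {P : Subgroup S} {E : FusionSystem P} {A B : Subgroup S} (hA : E.IsCentric A)
    (hAB : A ≤ B) (hB : B ≤ P) : E.IsCentric B := by
  refine ⟨hB, fun D hD => ?_⟩
  obtain ⟨φ, hφ, rfl⟩ := hD
  have h1 : φ.comp (Subgroup.inclusion hAB) ∈ E.Hom A φ.range :=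
    E.restrict_mem hAB hφ fun a b hab => congrArg φ (Subtype.ext hab.symm)
  have h2 : (φ.comp (Subgroup.inclusion hAB)).range ≤ φ.range := by
    rintro _ ⟨a, rfl⟩
    exact ⟨_, rfl⟩
  refine le_trans (inf_le_inf_left _ (Subgroup.centralizer_le h2)) ?_
  exact (hA.2 _ ⟨_, E.onto_mem h1, rfl⟩).trans h2

theorem IsCentric.isConj {P : Subgroup S} {E : FusionSystem P} {A B : Subgroup S}
    (hA : E.IsCentric A) (h : E.IsConj A B) : E.IsCentric B := by
  obtain ⟨φ, hφ, hB⟩ := id h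
  exact ⟨E.target_le hφ, fun D hD => hA.2 D (h.trans hD)⟩

variable {F : FusionSystem (⊤ : Subgroup S)}

theorem isClosedFamily_centric (hF : F.IsSaturated p) : F.IsClosedFamily {A | F.IsCentric A} where
  le h := h.1
  up hA hAB hB := IsCentric.up hA hAB hB
  iso hA hφ := IsCentric.isConj hA ⟨_, F.onto_mem hφ, rfl⟩
  cent {A} hA _ hg h := hA.2 A (isConj_refl hA.1) ⟨hg, Subgroup.mem_centralizer_iff.2 fun a ha =>
    (h a ha).symm⟩
  ext {A φ} _ hφ hn := hF.extend A φ hφ hn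

theorem sylow_centric (hS : IsPGroup p S) (hF : F.IsSaturated p) :
    IsClosedFamily.Sylow F p {A | F.IsCentric A} := by
  intro A hA hn
  refine (isClosedFamily_centric hF).sylowAt hS ?_ hA hn
  intro _ X hX hXp
  obtain ⟨Q, hQ⟩ := hF.sylow
  obtain ⟨γ, hγ, h⟩ := exists_conj_mem_of_sylow Q hQ hX hXp
  refine ⟨γ, hγ, fun x hx => ?_⟩
  obtain ⟨g, hg⟩ := h x hx
  refine ⟨g, g.2, fun a => ?_⟩
  rw [← hg]
  rfl

theorem isCentricFamily_centric (hS : IsPGroup p S) (hF : F.IsSaturated p) :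
    F.IsCentricFamily {A | F.IsCentric A} :=
  (isClosedFamily_centric hF).isCentricFamily hS (sylow_centric hS hF)

variable {H : Subgroup S}

theorem hom_of_normalizer {A B : Subgroup S} {φ : A →* S} (h : φ ∈ (F.normalizer H).Hom A B) :
    φ ∈ F.Hom A B := h.2.2.1

theorem IsCentric.normalizer {A : Subgroup S} (hA : F.IsCentric A)
    (h : A ≤ Subgroup.normalizer (H : Set S)) : (F.normalizer H).IsCentric A := by
  refine ⟨h, fun B hB => ?_⟩
  obtain ⟨φ, hφ, rfl⟩ := hB
  exact le_trans (inf_le_inf_right _ le_top) (hA.2 _ ⟨φ, hom_of_normalizer hφ, rfl⟩)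

/-- The `F`-centric subgroups of the normalizer of `H`. -/
def centricIn (F : FusionSystem (⊤ : Subgroup S)) (H : Subgroup S) : Set (Subgroup S) :=
  {A | F.IsCentric A ∧ A ≤ Subgroup.normalizer (H : Set S)}

/-- The extension property of the normalizer of `H`. -/
theorem exists_ext_normalizer (hS : IsPGroup p S) (hF : F.IsSaturated p) {A K N : Subgroup S}
    {φ : A →* S} (hA : F.IsCentric A) (hφ : φ ∈ (F.normalizer H).Hom A K) (hAN : A ≤ N)
    (hN : N ≤ Subgroup.normalizer (H : Set S))
    (h : ∀ n ∈ N, ∃ k ∈ K, ∀ a : A, ∃ a' : A, (a' : S) = n * a * n⁻¹ ∧ φ a' = k * φ a * k⁻¹) :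
    ∃ χ ∈ (F.normalizer H).Hom N K, ∀ (a : A) (n : N), (n : S) = a → χ n = φ a := by
  have hC := isCentricFamily_centric hS hF
  obtain ⟨hAP, hKP, hφF, ψ, hψ, h1, h2⟩ := hφ
  have hle : A ≤ A ⊔ H := le_sup_left
  have hAH : F.IsCentric (A ⊔ H) := hA.up hle le_top
  have hψt : ψ ∈ F.Hom (A ⊔ H) ⊤ := F.mem_top hψ
  -- the elements that extend
  have hN' : N ⊔ H ≤ transport ⊤ ⊤ ψ := by
    refine sup_le (fun n hn => ?_) (fun x hx => ?_)
    · obtain ⟨k, hk, hnk⟩ := h n hn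
      have hnorm : ∀ x ∈ A ⊔ H, n * x * n⁻¹ ∈ A ⊔ H := by
        have : A ⊔ H ≤ (A ⊔ H).comap (MulAut.conj n).toMonoidHom := by
          refine sup_le (fun a ha => ?_) (fun a ha => ?_)
          · obtain ⟨a', ha', -⟩ := hnk ⟨a, ha⟩
            refine (le_sup_left : A ≤ A ⊔ H) ?_
            change n * a * n⁻¹ ∈ A
            rw [← ha']
            exact a'.2
          · exact (le_sup_right : H ≤ A ⊔ H) ((Subgroup.mem_normalizer_iff.1 (hN hn) a).1 ha)
        exact this
      have hcn : conjHom n (A ⊔ H) ∈ F.Hom (A ⊔ H) (A ⊔ H) :=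
        F.conj_mem le_top le_top trivial fun a => hnorm a a.2
      have hck : conjHom k⁻¹ ⊤ ∈ F.Hom ⊤ ⊤ :=
        F.conj_mem le_top le_top trivial fun a => trivial
      -- On the centric subgroup `A` the morphism `ψ` agrees with its twist by `n` and `k⁻¹`. So on
      -- `A H` they differ by an element `z` of `A`, and `n` is transported by `ψ` to `k ψ(z)`.
      obtain ⟨z, hz, -, hz'⟩ := hC.epi hA hle hψt (F.comp_mem (F.comp_mem hcn hψt) hck) (by
        intro b hb
        obtain ⟨a', ha', ha''⟩ := hnk ⟨b, hb⟩
        have h3 := h1 a' ⟨n * b * n⁻¹, hnorm b b.2⟩ ha'.symm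
        have h4 := h1 ⟨b, hb⟩ b rfl
        change ψ b = k⁻¹ * ψ ⟨n * b * n⁻¹, _⟩ * k⁻¹⁻¹
        rw [h3, ha'', h4]
        simp [mul_assoc])
      refine mem_transport.2 ⟨⟨trivial, mem_normalizer_of_forall hnorm⟩,
        k * ψ ⟨z, hle hz⟩, trivial, fun a b hab => ?_⟩
      have h3 := hz' a (⟨z, hle hz⟩ * a * ⟨z, hle hz⟩⁻¹) rfl
      change k⁻¹ * ψ ⟨n * a * n⁻¹, _⟩ * k⁻¹⁻¹ = _ at h3
      have h4 : b = ⟨n * a * n⁻¹, hnorm a a.2⟩ := Subtype.ext hab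
      rw [← h4, map_mul, map_mul, map_inv] at h3
      have h5 : ψ b = k * (k⁻¹ * ψ b * k⁻¹⁻¹) * k⁻¹ := by simp [mul_assoc]
      rw [h5, h3]
      simp [mul_assoc]
    · refine mem_transport.2 ⟨⟨trivial, Subgroup.le_normalizer ((le_sup_right : H ≤ A ⊔ H) hx)⟩,
        ψ ⟨x, (le_sup_right : H ≤ A ⊔ H) hx⟩, trivial, fun a b hab => ?_⟩
      rw [← map_inv, ← map_mul, ← map_mul]
      congr 1
      exact Subtype.ext hab
  obtain ⟨χ, hχ, hext⟩ := hC.ext hAH hψt (sup_le_sup_right hAN H) le_top (by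
    intro n hn
    obtain ⟨⟨-, h3⟩, k, hk, h4⟩ := hN' hn
    exact ⟨k, hk, fun a => ⟨⟨n * a * n⁻¹, (Subgroup.mem_normalizer_iff.1 h3 a).1 a.2⟩, rfl,
      h4 _ _ rfl⟩⟩)
  have hNN : N ≤ N ⊔ H := le_sup_left
  have hHN : H ≤ N ⊔ H := le_sup_right
  have hχA : ∀ (a : A) (n : (N ⊔ H : Subgroup S)), (n : S) = a → χ n = φ a := fun a n han => by
    rw [hext ⟨a, hle a.2⟩ n han]
    exact h1 a _ rfl
  have hχK : ∀ n : (N ⊔ H : Subgroup S), (n : S) ∈ N → χ n ∈ K := by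
    intro n hn
    obtain ⟨k, hk, hnk⟩ := h n hn
    have hφr : ∀ y ∈ φ.range, y ∈ K := by
      rintro _ ⟨a, rfl⟩
      exact F.apply_mem hφF a
    -- `χ(n)` and `k` act alike on `φ(A)`, which is centric, so `χ(n)` lies in `k φ(A)` and
    -- therefore in `K`.
    have h3 : k⁻¹ * χ n ∈ φ.range := by
      refine hC.cent (hC.iso hA hφF) _ trivial ?_
      rintro _ ⟨a, rfl⟩
      obtain ⟨a', ha', ha''⟩ := hnk a
      have h4 : φ a' = χ n * φ a * (χ n)⁻¹ := by
        rw [← hχA a ⟨a, hNN (hAN a.2)⟩ rfl, ← hχA a' ⟨a', hNN (hAN a'.2)⟩ rfl, ← map_inv,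
          ← map_mul, ← map_mul]
        congr 1
        exact Subtype.ext ha'
      have h5 : k⁻¹ * (χ n * φ a * (χ n)⁻¹) * χ n = k⁻¹ * (k * φ a * k⁻¹) * χ n := by
        rw [← h4, ha'']
      simpa [mul_assoc] using h5
    have := mul_mem hk (hφr _ h3)
    simpa using this
  have hχH : ∀ n : (N ⊔ H : Subgroup S), (n : S) ∈ H → χ n ∈ H := by
    intro n hn
    rw [hext ⟨n, (le_sup_right : H ≤ A ⊔ H) hn⟩ n rfl]
    exact h2 _ hn
  have hval : ∀ n, χ n ∈ K ⊔ H := by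
    have : (⊤ : Subgroup (N ⊔ H : Subgroup S)) ≤ (K ⊔ H).comap χ := by
      intro n _
      have : (N ⊔ H : Subgroup S) ≤ ((K ⊔ H).comap χ).map (N ⊔ H).subtype := by
        refine sup_le (fun a ha => ?_) (fun a ha => ?_)
        · exact ⟨⟨a, hNN ha⟩, (le_sup_left : K ≤ K ⊔ H) (hχK _ ha), rfl⟩
        · exact ⟨⟨a, hHN ha⟩, (le_sup_right : H ≤ K ⊔ H) (hχH _ ha), rfl⟩
      obtain ⟨y, hy, hyn⟩ := this n.2
      have h3 : y = n := Subtype.ext hyn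
      exact h3 ▸ hy
    exact fun n => this trivial
  have hχN : χ.comp (Subgroup.inclusion hNN) ∈ F.Hom N K :=
    F.mem_of_apply_mem (F.restrict_mem hNN hχ fun a b hab => congrArg χ (Subtype.ext hab.symm))
      le_top fun n => hχK _ n.2
  refine ⟨χ.comp (Subgroup.inclusion hNN), ⟨hN, hKP, hχN, χ,
    F.mem_of_apply_mem hχ le_top hval, fun a x hx => congrArg χ (Subtype.ext hx), hχH⟩, ?_⟩
  intro a n han
  exact hχA a _ han

theorem isClosedFamily_centricIn (hS : IsPGroup p S) (hF : F.IsSaturated p) :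
    (F.normalizer H).IsClosedFamily (centricIn F H) where
  le h := h.2
  up hA hAB hB := ⟨IsCentric.up hA.1 hAB le_top, hB⟩
  iso hA hφ := ⟨IsCentric.isConj hA.1 ⟨_, F.onto_mem (hom_of_normalizer hφ), rfl⟩,
    (F.normalizer H).target_le ((F.normalizer H).onto_mem hφ)⟩
  cent hA g _ h := (isCentricFamily_centric hS hF).cent hA.1 g trivial h
  ext {A φ} hA hφ _ := exists_ext_normalizer hS hF hA.1 hφ
    (fun a ha => mem_transport.2 ⟨⟨hA.2 ha, Subgroup.le_normalizer ha⟩, φ ⟨a, ha⟩,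
      ⟨(F.normalizer H).apply_mem hφ _, Subgroup.le_normalizer ⟨_, rfl⟩⟩, fun x y hxy => by
        rw [← map_inv, ← map_mul, ← map_mul]
        congr 1
        exact Subtype.ext hxy⟩)
    (fun x hx => hx.1.1) (by
      rintro n ⟨⟨-, h3⟩, k, hk, h4⟩
      exact ⟨k, hk.1, fun a => ⟨⟨n * a * n⁻¹, (Subgroup.mem_normalizer_iff.1 h3 a).1 a.2⟩, rfl,
        h4 _ _ rfl⟩⟩)

/-- Elements of the normalizer fusion system act on `H`. -/
theorem exists_aut_of_normalizer {A : Subgroup S} {φ : A →* S} {B : Subgroup S}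
    (hφ : φ ∈ (F.normalizer H).Hom A B) :
    ∃ α ∈ F.aut H, ∀ (a : A) (x : H), (x : S) = a → (α x : S) = φ a := by
  obtain ⟨hAP, hKP, hφF, ψ, hψ, h1, h2⟩ := hφ
  have hle : H ≤ A ⊔ H := le_sup_right
  obtain ⟨α, hα, h⟩ := exists_aut (F.mem_of_apply_mem (F.restrict_mem (χ := ψ.comp
    (Subgroup.inclusion hle)) hle hψ fun a b hab => congrArg ψ (Subtype.ext hab.symm)) le_top
    fun x => h2 _ x.2)
  exact ⟨α, hα, fun a x hx => (h x).trans (h1 a _ hx)⟩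

/-- The group generated by `α` and `Aut_P(A)` is a `p`-group, so it is conjugate into `Aut_P(A)`; by
orders it equals `Aut_P(A)`. -/
theorem SylowAt.mem_autBy {P : Subgroup S} {E : FusionSystem P} (hS : IsPGroup p S)
    {A : Subgroup S} (hA : E.SylowAt p A) {α : MulAut A} (hα : α ∈ E.aut A) {k : ℕ}
    (hk : α ^ p ^ k = 1) (hn : ∀ β ∈ autBy P A, α * β * α⁻¹ ∈ autBy P A) : α ∈ autBy P A := by
  have h1 : IsPGroup p (Subgroup.zpowers α ⊔ autBy P A : Subgroup (MulAut A)) := by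
    refine (isPGroup_zpowers hk).to_sup_of_normal_right' (isPGroup_autBy hS P A) ?_
    rw [Subgroup.zpowers_le]
    exact mem_normalizer_of_forall hn
  obtain ⟨γ, hγ, h⟩ := hA _ (sup_le (Subgroup.zpowers_le.2 hα) autBy_le_aut) h1
  have h2 : Nat.card (Subgroup.zpowers α ⊔ autBy P A : Subgroup (MulAut A)) ≤
      Nat.card (autBy P A) := by
    have h4 : Nat.card ((Subgroup.zpowers α ⊔ autBy P A).map (MulAut.conj γ).toMonoidHom) =
        Nat.card (Subgroup.zpowers α ⊔ autBy P A : Subgroup (MulAut A)) :=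
      Subgroup.card_map_of_injective (MulAut.conj γ).injective
    rw [← h4]
    refine Subgroup.card_le_of_le ?_
    rintro _ ⟨x, hx, rfl⟩
    exact h x hx
  have h3 := Subgroup.eq_of_le_of_card_ge (le_sup_right : autBy P A ≤ Subgroup.zpowers α ⊔ _) h2
  rw [h3]
  exact (le_sup_left : Subgroup.zpowers α ≤ _) (Subgroup.mem_zpowers α)

/-- By `sylowAt` it is enough to treat `N_S(H)`. An automorphism `x` of `p`-power order there
restricts to `α` on `H`, and `α` normalizes `Aut_S(H)`. As `H` is fully normalized in `F`, `α` is
conjugation by some `g`. Then `x` and conjugation by `g` agree on the centric subgroup `H`, so `x`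
is conjugation by `g z` with `z` in `Z(H)`. -/
theorem sylow_centricIn (hS : IsPGroup p S) (hF : F.IsSaturated p) (hHc : F.IsCentric H)
    (hHn : F.IsFullyNormalized H) : IsClosedFamily.Sylow (F.normalizer H) p (centricIn F H) := by
  intro A hA hn
  refine (isClosedFamily_centricIn hS hF).sylowAt hS ?_ hA hn
  intro _ X hX hXp
  -- No conjugation is needed: every automorphism of `p`-power order is already induced by `N_S(H)`.
  refine ⟨1, one_mem _, fun x hx => ?_⟩
  rw [one_mul, inv_one, mul_one]
  have hxE := (mem_aut_iff le_rfl).1 (hX hx)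
  obtain ⟨k, hk⟩ := hXp ⟨x, hx⟩
  have hk : x ^ p ^ k = 1 := congrArg Subtype.val hk
  have hHP : H ≤ Subgroup.normalizer (H : Set S) := Subgroup.le_normalizer
  obtain ⟨α, hα, hαx⟩ := exists_aut_of_normalizer hxE
  have hαx' : ∀ (y : H) (a : Subgroup.normalizer (H : Set S)), (a : S) = y → (α y : S) = x a :=
    fun y a hy => hαx a y hy.symm
  have hpow : ∀ (n : ℕ) (y : H) (a : Subgroup.normalizer (H : Set S)), (a : S) = y →
      ((x ^ n) a : S) = (α ^ n) y := by
    intro n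
    induction n with
    | zero => intro y a h; exact h
    | succ n ih =>
      intro y a h
      rw [pow_succ', pow_succ', MulAut.mul_apply, MulAut.mul_apply]
      exact (hαx' _ _ (ih y a h)).symm
  have hαk : α ^ p ^ k = 1 := by
    ext y
    rw [← hpow _ y ⟨y, hHP y.2⟩ rfl, hk]
    rfl
  obtain ⟨g, -, hg⟩ := SylowAt.mem_autBy hS (sylow_centric hS hF H hHc hHn) hα hαk (by
    rintro β ⟨g, -, hg⟩
    have hgn : g ∈ Subgroup.normalizer (H : Set S) := mem_normalizer_of_forall fun a ha => by
      rw [← hg ⟨a, ha⟩]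
      exact Subtype.coe_prop _
    -- Conjugating conjugation by `g` with `α` gives conjugation by `x(g)`, because `x` extends `α`
    -- to `N_S(H)`.
    refine ⟨x ⟨g, hgn⟩, trivial, fun a => ?_⟩
    rw [MulAut.mul_apply, MulAut.mul_apply]
    rw [hαx' (β (α⁻¹ a)) (⟨g, hgn⟩ * ⟨_, hHP (α⁻¹ a).2⟩ * ⟨g, hgn⟩⁻¹) (hg _).symm]
    rw [map_mul, map_mul, map_inv]
    have h3 := hαx' (α⁻¹ a) ⟨_, hHP (α⁻¹ a).2⟩ rfl
    rw [MulAut.apply_inv_self] at h3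
    simp [h3])
  have hgn : g ∈ Subgroup.normalizer (H : Set S) := mem_normalizer_of_forall fun a ha => by
    rw [← hg ⟨a, ha⟩]
    exact Subtype.coe_prop _
  have hcg : conjHom g (Subgroup.normalizer (H : Set S)) ∈ F.Hom _ ⊤ :=
    F.conj_mem le_top le_top trivial fun _ => trivial
  obtain ⟨z, hz, -, hz'⟩ := (isCentricFamily_centric hS hF).epi hHc hHP hcg
    (F.mem_top (hom_of_normalizer hxE)) (by
      intro b hb
      change g * b * g⁻¹ = x b
      rw [← hαx' ⟨b, hb⟩ b rfl, hg])
  refine ⟨g * z, mul_mem hgn (hHP hz), fun a => ?_⟩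
  have := hz' a (⟨z, hHP hz⟩ * a * ⟨z, hHP hz⟩⁻¹) rfl
  change (x a : S) = g * (z * a * z⁻¹) * g⁻¹ at this
  rw [this]
  simp [mul_assoc]

theorem isCentricFamily_centricIn (hS : IsPGroup p S) (hF : F.IsSaturated p)
    (hHc : F.IsCentric H) (hHn : F.IsFullyNormalized H) :
    (F.normalizer H).IsCentricFamily (centricIn F H) :=
  (isClosedFamily_centricIn hS hF).isCentricFamily hS (sylow_centricIn hS hF hHc hHn)

/-- A product in `E` yields a product with respect to a subfamily of the centric subgroups. -/
theorem IsProduct.isProductIn {P : Subgroup S} {E : FusionSystem P} {C : Set (Subgroup S)}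
    (hup : ∀ {A B}, A ∈ C → A ≤ B → B ≤ P → B ∈ C)
    (hiso : ∀ {A B : Subgroup S} {φ : A →* S}, A ∈ C → φ ∈ E.Hom A B → φ.range ∈ C)
    (hcen : ∀ A ∈ C, E.IsCentric A) {A K : Subgroup S} (hAP : A ≤ P) {T : Finset (Pair S)}
    {T' : Finset (Pair S)} (hTT' : ∀ q, q ∈ T' ↔ q ∈ T ∧ q.1 ∈ C)
    (hT : E.IsProduct A K T) : E.IsProductIn C A K T' := by
  -- A pair above a pair with source in `C` has its source in `C`. Hence maximality is the same in
  -- both senses, and passing to `C` just discards the pairs with source outside `C`.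
  have hle : ∀ {q r : Pair S}, q.1 ∈ C → E.IsPair A K r → PairLE A K q r → r.1 ∈ C := by
    rintro q r hq hr ⟨h, hh, k, hk, e⟩
    have hqP : q.1 ≤ P := (hcen _ hq).1
    have h3 : conjHom h⁻¹ q.1 ∈ E.Hom q.1 P :=
      E.conj_mem hqP le_rfl (inv_mem (hAP hh)) fun a =>
        mul_mem (mul_mem (inv_mem (hAP hh)) (hqP a.2)) (inv_mem (inv_mem (hAP hh)))
    refine hup (hiso hq h3) ?_ hr.1.1
    rintro _ ⟨a, rfl⟩
    have := Emb.mem e a.2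
    simpa [conjHom] using this
  have hmax : ∀ q, E.IsMaxPairIn C A K q ↔ E.IsMaxPair A K q ∧ q.1 ∈ C := by
    intro q
    constructor
    · rintro ⟨⟨h1, h2, h3⟩, h4⟩
      exact ⟨⟨⟨hcen _ h1, h2, h3⟩, fun r hr hqr => h4 r ⟨hle h1 hr hqr, hr.2⟩ hqr⟩, h1⟩
    · rintro ⟨⟨h1, h2⟩, h3⟩
      exact ⟨⟨h3, h1.2⟩, fun r hr hqr => h2 r ⟨hcen _ hr.1, hr.2⟩ hqr⟩
  refine ⟨fun q hq => ?_, fun q hq => ?_⟩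
  · rw [hTT'] at hq
    exact (hmax q).2 ⟨hT.1 q hq.1, hq.2⟩
  · obtain ⟨r, ⟨hr, h1, h2⟩, hu⟩ := hT.2 q ((hmax q).1 hq).1
    refine ⟨r, ⟨(hTT' r).2 ⟨hr, hle hq.1.1 (hT.1 r hr).1 h1⟩, h1, h2⟩, ?_⟩
    rintro r' ⟨hr', h3⟩
    exact hu r' ⟨((hTT' r').1 hr').1, h3⟩

end FusionSystem

end Saturated

/-! ### Identities between inductions, restrictions and conjugations in the biset ring -/

section MackeyRing

variable {S : Type u} [Group S] [Finite S]

theorem up_mul_one (K : Subgroup S) {A : Subgroup S} (φ : A →* S) : up K φ * ind A A = up K φ := by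
  rw [ind_eq_up]
  refine transitive_mul_one _ _ _ (fun g => ?_) (fun j => ⟨(1, j), 1, ?_, ?_⟩)
  · rw [mem_twistedDiag]
    constructor
    · exact fun h => ⟨g.2, h, rfl⟩
    · rintro ⟨t, h1, h2⟩
      rw [mem_twistedDiag] at h1 h2
      have : t = g.2 := Subtype.ext h2
      rw [h1, this]
  · simp [mem_twistedDiag]
  · simp [mem_twistedDiag]

theorem one_mul_dn (K : Subgroup S) {A : Subgroup S} (φ : A →* S) : ind A A * dn K φ = dn K φ := by
  rw [ind_eq_up]
  refine transitive_mul_one _ _ _ (fun g => ?_) (fun j => ⟨(j⁻¹, 1), j⁻¹, ?_, ?_⟩)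
  · rw [mem_twistedDiag_comap]
    constructor
    · exact fun h => ⟨g.1, rfl, h⟩
    · rintro ⟨t, h1, h2⟩
      rw [mem_twistedDiag] at h1
      rw [mem_twistedDiag_comap] at h2
      have : g.1 = t := Subtype.ext h1
      rw [h2, this]
  · simp [mem_twistedDiag]
  · simp [mem_twistedDiag]

theorem dn_subtype (A : Subgroup S) : dn A A.subtype = ind A A := by
  have : up A A.subtype * dn A A.subtype = up A A.subtype :=
    up_mul_dn (fun a => a.2) _ fun g => by
      rw [mem_twistedDiag]
      constructor
      · exact fun h => ⟨g.2, h, rfl⟩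
      · rintro ⟨a, h1, h2⟩
        exact h1.trans h2.symm
  rw [← one_mul_dn, ind_eq_up, this]

theorem one_mul_up {K A : Subgroup S} {φ : A →* S} (hφ : ∀ a, φ a ∈ K) :
    ind K K * up K φ = up K φ := by
  rw [ind_eq_up]
  exact up_mul_up hφ (fun b => b.2) fun a b h => h.symm

theorem dn_mul_one {K A : Subgroup S} {φ : A →* S} (hφ : ∀ a, φ a ∈ K) :
    dn K φ * ind K K = dn K φ := by
  rw [← dn_subtype]
  exact dn_mul_dn hφ (fun b => b.2) fun a b h => h.symm

theorem isDoubleReps_singleton {K A : Subgroup S} {k : S} (hk : k ∈ K) :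
    IsDoubleReps K K A {k} := by
  refine ⟨fun x hx => Finset.mem_singleton.1 hx ▸ hk, fun x hx => ⟨k, ⟨Finset.mem_singleton_self _,
    x * k⁻¹, mul_mem hx (inv_mem hk), 1, one_mem _, by simp⟩, fun y hy => Finset.mem_singleton.1 hy.1⟩⟩

theorem IsDoubleReps.inv [DecidableEq S] {B K A : Subgroup S} {s : Finset S}
    (hs : IsDoubleReps B K A s) : IsDoubleReps A K B (s.image fun x => x⁻¹) := by
  have key : ∀ x r : S, (∃ b ∈ B, ∃ a ∈ A, x⁻¹ = b * r * a) ↔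
      ∃ a ∈ A, ∃ b ∈ B, x = a * r⁻¹ * b := by
    intro x r
    constructor
    · rintro ⟨b, hb, a, ha, h⟩
      refine ⟨a⁻¹, inv_mem ha, b⁻¹, inv_mem hb, ?_⟩
      rw [← inv_inv x, h]
      simp [mul_assoc]
    · rintro ⟨a, ha, b, hb, h⟩
      exact ⟨b⁻¹, inv_mem hb, a⁻¹, inv_mem ha, by simp [h, mul_assoc]⟩
  refine ⟨fun k hk => ?_, fun k hk => ?_⟩
  · obtain ⟨k', hk', rfl⟩ := Finset.mem_image.1 hk
    exact inv_mem (hs.1 k' hk')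
  · obtain ⟨r, ⟨hr, h⟩, hu⟩ := hs.2 k⁻¹ (inv_mem hk)
    refine ⟨r⁻¹, ⟨Finset.mem_image_of_mem _ hr, (key k r).1 h⟩, ?_⟩
    rintro _ ⟨hy, h'⟩
    obtain ⟨y, hy', rfl⟩ := Finset.mem_image.1 hy
    rw [hu y ⟨hy', (key k y).2 h'⟩]

/-- The Mackey formula for the trivial restriction from `K` to `K`, with `k` representing the only
double coset. Hence these elements depend only on the class of `φ` in the orbit category. -/
theorem up_conj {K A : Subgroup S} {φ χ : A →* S} (hφ : ∀ a, φ a ∈ K) {k : S} (hk : k ∈ K)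
    (h : ∀ a, χ a = k * φ a * k⁻¹) : up K χ = up K φ := by
  have hr' : K.subtype.range = K := K.range_subtype
  have h1 := dn_mul_up (K := K) (φ := φ) (ψ := K.subtype) (fun b => b.2) (s := {k})
    (by rw [hr']; exact isDoubleReps_singleton hk) (fun _ => twistedDiag K A χ) (by
      intro k' hk' g
      rw [Finset.mem_singleton.1 hk', mem_twistedDiag, h]
      rfl)
  rw [Finset.sum_singleton, dn_subtype, one_mul_up hφ] at h1
  exact h1.symm

theorem dn_conj {K A : Subgroup S} {φ χ : A →* S} (hφ : ∀ a, φ a ∈ K) {k : S} (hk : k ∈ K)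
    (h : ∀ a, χ a = k * φ a * k⁻¹) : dn K χ = dn K φ := by
  classical
  have hr' : K.subtype.range = K := K.range_subtype
  have h1 := dn_mul_up (K := K) (φ := K.subtype) (ψ := φ) hφ (s := {k⁻¹})
    (by
      rw [hr']
      have := (isDoubleReps_singleton (A := φ.range) hk).inv
      rwa [Finset.image_singleton] at this)
    (fun _ => (twistedDiag K A χ).comap (MulEquiv.prodComm : A × K ≃* K × A).toMonoidHom) (by
      intro k' hk' g
      rw [Finset.mem_singleton.1 hk', mem_twistedDiag_comap, h, Subgroup.subtype_apply, inv_inv]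
      constructor
      · intro h1
        simp [h1, mul_assoc]
      · intro h1
        simp [h1, mul_assoc])
  rw [Finset.sum_singleton, ← ind_eq_up, dn_mul_one hφ] at h1
  exact h1.symm

/-- An isomorphism followed by its inverse. -/
theorem up_mul_dn_self {K A : Subgroup S} {φ : A →* S} (hK : φ.range = K) :
    up K φ * dn K φ = ind K K := by
  subst hK
  rw [ind_eq_up]
  refine up_mul_dn (fun a => (⟨a, rfl⟩ : φ a ∈ φ.range)) _ fun g => ?_
  rw [mem_twistedDiag, Subgroup.subtype_apply]
  constructor
  · intro h
    obtain ⟨a, ha⟩ := g.1.2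
    exact ⟨a, ha.symm, h ▸ ha.symm⟩
  · rintro ⟨a, h1, h2⟩
    rw [h1, h2]

/-- The inverse of `c_φ` is `c_ψ` for the inverse `ψ` of `φ`. -/
theorem dn_eq_up {K A : Subgroup S} {φ : A →* S} {ψ : K →* S}
    (h : ∀ (a : A) (b : K), (b : S) = φ a ↔ (a : S) = ψ b) :
    dn K φ = up A ψ := by
  rw [dn, up]
  congr 1
  ext g
  rw [mem_twistedDiag, mem_twistedDiag_comap]
  exact h g.1 g.2

/-- The Mackey formula, with the components given as pairs of morphisms. -/
theorem dn_mul_up' {A B K : Subgroup S} {φ : A →* S} {ψ : B →* S} (hψ : ∀ b, ψ b ∈ K)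
    {s : Finset S} (hs : IsDoubleReps ψ.range K φ.range s) (X : S → Subgroup S)
    (α β : ∀ k, X k →* S) (hβ : ∀ k ∈ s, ∀ x, β k x ∈ A)
    (h : ∀ k ∈ s, ∀ (b : B) (a : A), ψ b = k * φ a * k⁻¹ ↔ ∃ x, (b : S) = α k x ∧ (a : S) = β k x) :
    dn K ψ * up K φ = ∑ k ∈ s, up B (α k) * dn A (β k) := by
  let D : S → Subgroup (B × A) := fun k =>
    (MonoidHom.eqLocus (ψ.comp (MonoidHom.fst B A))
      (((MulAut.conj k).toMonoidHom.comp φ).comp (MonoidHom.snd B A)))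
  have hD : ∀ k, ∀ g, g ∈ D k ↔ ψ g.1 = k * φ g.2 * k⁻¹ := fun k g => Iff.rfl
  rw [dn_mul_up hψ hs D fun k _ => hD k]
  refine Finset.sum_congr rfl fun k hk => ?_
  rw [up_mul_dn (hβ k hk) (D k)]
  intro g
  rw [hD, h k hk]

end MackeyRing

/-! ### Generators of the Mackey algebras of subsystems -/

section Generators

variable {S : Type u} [Group S] [Finite S] (F : FusionSystem (⊤ : Subgroup S))

/-- `E` is a subsystem of `F`. -/
def FusionSystem.IsSub {P : Subgroup S} (E : FusionSystem P) : Prop :=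
  ∀ A B, E.Hom A B ⊆ F.Hom A B

theorem FusionSystem.IsSub.refl : F.IsSub F := fun _ _ => subset_rfl

theorem FusionSystem.isSub_normalizer (H : Subgroup S) : F.IsSub (F.normalizer H) :=
  fun _ _ _ h => FusionSystem.hom_of_normalizer h

variable {F} {P : Subgroup S} {E : FusionSystem P}

theorem FusionSystem.isSub_innerSystem (F : FusionSystem P) {H : Subgroup S} (hH : H ≤ P)
    {A B : Subgroup S} {φ : A →* S} (h : φ ∈ (innerSystem H).Hom A B) : φ ∈ F.Hom A B := by
  obtain ⟨hA, hB, hφ, g, hg, rfl⟩ := h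
  exact F.conj_mem (hA.trans hH) (hB.trans hH) (hH hg) hφ

theorem ind_mem_generators {A B : Subgroup S} (hA : A ≤ B) (hB : B ≤ P) :
    ind A B ∈ E.generators := Or.inl ⟨A, B, hA, hB, Or.inl rfl⟩

theorem up_eq_mul {A K : Subgroup S} {φ : A →* S} (hφ : ∀ a, φ a ∈ K) :
    up K φ = ind φ.range K * cnj φ := by
  rw [ind_eq_up, cnj_eq_up]
  refine (up_mul_up (fun a => (⟨a, rfl⟩ : φ a ∈ φ.range)) ?_ fun a b h => h.symm).symm
  rintro ⟨_, a, rfl⟩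
  exact hφ a

theorem dn_eq_mul {A K : Subgroup S} {φ : A →* S} (hφ : ∀ a, φ a ∈ K) :
    dn K φ = cnjInv φ * res φ.range K := by
  rw [res_eq_dn, cnjInv_eq_dn]
  refine (dn_mul_dn (fun a => (⟨a, rfl⟩ : φ a ∈ φ.range)) ?_ fun a b h => h.symm).symm
  rintro ⟨_, a, rfl⟩
  exact hφ a

theorem cnj_mem_generators {A K : Subgroup S} {φ : A →* S} (hφ : φ ∈ E.Hom A K) :
    cnj φ ∈ E.generators := Or.inr ⟨A, φ, E.onto_mem hφ, rfl⟩

theorem cnjInv_mem_generators {A K : Subgroup S} {φ : A →* S} (hφ : φ ∈ E.Hom A K) :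
    cnjInv φ ∈ E.generators := by
  obtain ⟨ψ, hψ, h⟩ := E.exists_inv (E.onto_mem hφ) rfl
  have hinv : ∀ (a : A) (b : φ.range), (b : S) = φ a ↔ (a : S) = ψ b := by
    intro a b
    obtain ⟨_, a', rfl⟩ := b
    rw [h a' _ rfl]
    constructor
    · exact fun h => congrArg Subtype.val (E.injective hφ h).symm
    · intro h
      rw [Subtype.ext h]
  have hr : ψ.range = A := by
    ext x
    constructor
    · rintro ⟨b, rfl⟩
      exact E.apply_mem hψ b
    · intro hx
      exact ⟨⟨φ ⟨x, hx⟩, ⟨x, hx⟩, rfl⟩, h ⟨x, hx⟩ _ rfl⟩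
  rw [cnjInv_eq_dn, dn_eq_up hinv]
  have := cnj_mem_generators hψ
  rw [cnj_eq_up, hr] at this
  exact this

/-- A property of the generators of the Mackey algebra that is closed under products holds for all
`up K φ` and `dn K φ`. -/
theorem up_dn_induction {p : BisetRing S → Prop} (hp : ∀ x ∈ E.generators, p x)
    (hmul : ∀ x ∈ E.generators, ∀ y ∈ E.generators, p x → p y → p (x * y)) {A K : Subgroup S}
    {φ : A →* S} (hφ : φ ∈ E.Hom A K) : p (up K φ) ∧ p (dn K φ) := by
  have hr : φ.range ≤ K := by rintro _ ⟨a, rfl⟩; exact E.apply_mem hφ a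
  have hi : ind φ.range K ∈ E.generators := ind_mem_generators hr (E.target_le hφ)
  have hres : res φ.range K ∈ E.generators :=
    Or.inl ⟨_, _, hr, E.target_le hφ, Or.inr rfl⟩
  rw [up_eq_mul (E.apply_mem hφ), dn_eq_mul (E.apply_mem hφ)]
  have h1 := cnj_mem_generators hφ
  have h2 := cnjInv_mem_generators hφ
  exact ⟨hmul _ hi _ h1 (hp _ hi) (hp _ h1), hmul _ h2 _ hres (hp _ h2) (hp _ hres)⟩

theorem generators_eq {x : BisetRing S} (hx : x ∈ E.generators) :
    ∃ (A K : Subgroup S) (φ : A →* S), φ ∈ E.Hom A K ∧ (x = up K φ ∨ x = dn K φ) := by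
  rcases hx with ⟨A, B, hA, hB, rfl | rfl⟩ | ⟨A, φ, hφ, rfl⟩
  · exact ⟨A, B, _, E.subtype_mem hA hB, Or.inl rfl⟩
  · exact ⟨A, B, _, E.subtype_mem hA hB, Or.inr (res_eq_dn A B)⟩
  · exact ⟨A, _, φ, hφ, Or.inl rfl⟩

theorem up_dn_mem_mackeyRing {A K : Subgroup S} {φ : A →* S} (hφ : φ ∈ F.Hom A K) :
    up K φ ∈ F.mackeyRing ∧ dn K φ ∈ F.mackeyRing :=
  up_dn_induction (E := F) (fun _ hx => Subring.subset_closure hx)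
    (fun _ _ _ _ hx hy => mul_mem hx hy) hφ

theorem generators_subset (hE : F.IsSub E) {x : BisetRing S} (hx : x ∈ E.generators) :
    x ∈ F.mackeyRing := by
  obtain ⟨A, K, φ, hφ, rfl | rfl⟩ := generators_eq hx
  · exact (up_dn_mem_mackeyRing (hE _ _ hφ)).1
  · exact (up_dn_mem_mackeyRing (hE _ _ hφ)).2

end Generators

/-! ### The map from the integral Mackey algebra to the Mackey algebra over `R` -/

section Elements

variable {S : Type u} [Group S] [Finite S] {R : Type v} [CommRing R]
  {F : FusionSystem (⊤ : Subgroup S)}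

theorem elt_of_mem {x : BisetRing S} (h : x ∈ F.mackeyRing) : elt R F x = 1 ⊗ₜ[ℤ] ⟨x, h⟩ :=
  dif_pos h

theorem elt_mul {x y : BisetRing S} (hx : x ∈ F.mackeyRing) (hy : y ∈ F.mackeyRing) :
    elt R F (x * y) = elt R F x * elt R F y := by
  rw [elt_of_mem hx, elt_of_mem hy, elt_of_mem (mul_mem hx hy),
    Algebra.TensorProduct.tmul_mul_tmul, one_mul]
  rfl

theorem elt_sum {ι : Type*} {s : Finset ι} {x : ι → BisetRing S}
    (hx : ∀ i ∈ s, x i ∈ F.mackeyRing) : elt R F (∑ i ∈ s, x i) = ∑ i ∈ s, elt R F (x i) := by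
  classical
  induction s using Finset.induction_on with
  | empty =>
    rw [Finset.sum_empty, Finset.sum_empty, elt_of_mem (zero_mem _)]
    exact TensorProduct.tmul_zero _ _
  | insert i s hi ih =>
    have h1 := hx i (Finset.mem_insert_self _ _)
    have h2 : ∀ j ∈ s, x j ∈ F.mackeyRing := fun j hj => hx j (Finset.mem_insert_of_mem hj)
    rw [Finset.sum_insert hi, Finset.sum_insert hi, ← ih h2, elt_of_mem h1,
      elt_of_mem (sum_mem h2), elt_of_mem (add_mem h1 (sum_mem h2)), ← TensorProduct.tmul_add]
    rfl

end Elements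

/-! ### Biset identities as identities between operators on a Mackey functor -/

section Operators

variable {S : Type u} [Group S] [Finite S] (R : Type v) [CommRing R]
  (F : FusionSystem (⊤ : Subgroup S)) (M : Type w) [AddCommGroup M] [Module (MackeyAlgebra R F) M]
  [Module R M] [IsScalarTower R (MackeyAlgebra R F) M]

/-- The action of `I c_φ` on a Mackey functor. -/
noncomputable def upAct (K : Subgroup S) {A : Subgroup S} (φ : A →* S) : Module.End R M :=
  act R F M (elt R F (up K φ))

/-- The action of `c_{φ⁻¹} R` on a Mackey functor. -/
noncomputable def dnAct (K : Subgroup S) {A : Subgroup S} (φ : A →* S) : Module.End R M :=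
  act R F M (elt R F (dn K φ))

/-- The action of `I_K^K` on a Mackey functor. -/
noncomputable def idAct (K : Subgroup S) : Module.End R M := act R F M (elt R F (ind K K))

/-- `f` commutes with the action of the Mackey algebra of `E`. -/
def IsEquivariant {P : Subgroup S} (E : FusionSystem P) (f : Module.End R M) : Prop :=
  ∀ (A K : Subgroup S) (φ : A →* S), φ ∈ E.Hom A K →
    Commute f (upAct R F M K φ) ∧ Commute f (dnAct R F M K φ)

variable {R F M}

local notation "𝕌" => upAct R F M
local notation "𝔻" => dnAct R F M
local notation "𝟙" => idAct R F M

theorem act_elt_mul {x y : BisetRing S} (hx : x ∈ F.mackeyRing) (hy : y ∈ F.mackeyRing) :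
    act R F M (elt R F (x * y)) = act R F M (elt R F x) * act R F M (elt R F y) := by
  rw [elt_mul hx hy, map_mul]

theorem ind_mem_mackeyRing (K : Subgroup S) : ind K K ∈ F.mackeyRing :=
  Subring.subset_closure (ind_mem_generators le_rfl le_top)

theorem upAct_mul_upAct {A B K : Subgroup S} {φ : A →* S} {ψ : B →* S} {χ : A →* S}
    (hφ : φ ∈ F.Hom A B) (hψ : ψ ∈ F.Hom B K)
    (hχ : ∀ (a : A) (b : B), (b : S) = φ a → χ a = ψ b) : 𝕌 K ψ * 𝕌 B φ = 𝕌 K χ := by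
  rw [upAct, upAct, upAct, ← act_elt_mul (up_dn_mem_mackeyRing hψ).1 (up_dn_mem_mackeyRing hφ).1,
    up_mul_up (F.apply_mem hφ) (F.apply_mem hψ) hχ]

theorem dnAct_mul_dnAct {A B K : Subgroup S} {φ : A →* S} {ψ : B →* S} {χ : A →* S}
    (hφ : φ ∈ F.Hom A B) (hψ : ψ ∈ F.Hom B K)
    (hχ : ∀ (a : A) (b : B), (b : S) = φ a → χ a = ψ b) : 𝔻 B φ * 𝔻 K ψ = 𝔻 K χ := by
  rw [dnAct, dnAct, dnAct, ← act_elt_mul (up_dn_mem_mackeyRing hφ).2 (up_dn_mem_mackeyRing hψ).2,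
    dn_mul_dn (F.apply_mem hφ) (F.apply_mem hψ) hχ]

theorem upAct_conj {A K : Subgroup S} {φ χ : A →* S} (hφ : ∀ a, φ a ∈ K) {k : S} (hk : k ∈ K)
    (h : ∀ a, χ a = k * φ a * k⁻¹) : 𝕌 K χ = 𝕌 K φ := by
  rw [upAct, upAct, up_conj hφ hk h]

theorem dnAct_conj {A K : Subgroup S} {φ χ : A →* S} (hφ : ∀ a, φ a ∈ K) {k : S} (hk : k ∈ K)
    (h : ∀ a, χ a = k * φ a * k⁻¹) : 𝔻 K χ = 𝔻 K φ := by
  rw [dnAct, dnAct, dn_conj hφ hk h]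

theorem upAct_mul_idAct {A K : Subgroup S} {φ : A →* S} (hφ : φ ∈ F.Hom A K) :
    𝕌 K φ * 𝟙 A = 𝕌 K φ := by
  rw [upAct, idAct, ← act_elt_mul (up_dn_mem_mackeyRing hφ).1 (ind_mem_mackeyRing A), up_mul_one]

theorem idAct_mul_dnAct {A K : Subgroup S} {φ : A →* S} (hφ : φ ∈ F.Hom A K) :
    𝟙 A * 𝔻 K φ = 𝔻 K φ := by
  rw [dnAct, idAct, ← act_elt_mul (ind_mem_mackeyRing A) (up_dn_mem_mackeyRing hφ).2, one_mul_dn]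

theorem idAct_mul_upAct {A K : Subgroup S} {φ : A →* S} (hφ : φ ∈ F.Hom A K) :
    𝟙 K * 𝕌 K φ = 𝕌 K φ := by
  rw [upAct, idAct, ← act_elt_mul (ind_mem_mackeyRing K) (up_dn_mem_mackeyRing hφ).1,
    one_mul_up (F.apply_mem hφ)]

theorem dnAct_mul_idAct {A K : Subgroup S} {φ : A →* S} (hφ : φ ∈ F.Hom A K) :
    𝔻 K φ * 𝟙 K = 𝔻 K φ := by
  rw [dnAct, idAct, ← act_elt_mul (up_dn_mem_mackeyRing hφ).2 (ind_mem_mackeyRing K),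
    dn_mul_one (F.apply_mem hφ)]

theorem act_elt_zero : act R F M (elt R F 0) = 0 := by
  rw [elt_of_mem (zero_mem _)]
  have : (1 : R) ⊗ₜ[ℤ] (⟨0, zero_mem _⟩ : F.mackeyRing) = 0 := TensorProduct.tmul_zero _ _
  rw [this, map_zero]

theorem ind_mul_ind_of_ne {K L : Subgroup S} (h : K ≠ L) : ind K K * ind L L = 0 :=
  BisetRing.single_mul_single_of_ne h _ _ _ _

theorem idAct_mul_idAct_of_ne {K L : Subgroup S} (h : K ≠ L) : 𝟙 K * 𝟙 L = 0 := by
  rw [idAct, idAct, ← act_elt_mul (ind_mem_mackeyRing K) (ind_mem_mackeyRing L),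
    ind_mul_ind_of_ne h, act_elt_zero]

theorem upAct_mul_dnAct_self {A K : Subgroup S} {φ : A →* S} (hφ : φ ∈ F.Hom A K)
    (hK : φ.range = K) : 𝕌 K φ * 𝔻 K φ = 𝟙 K := by
  rw [upAct, dnAct, ← act_elt_mul (up_dn_mem_mackeyRing hφ).1 (up_dn_mem_mackeyRing hφ).2,
    up_mul_dn_self hK]
  rfl

theorem dnAct_eq_upAct {K A : Subgroup S} {φ : A →* S} {ψ : K →* S}
    (h : ∀ (a : A) (b : K), (b : S) = φ a ↔ (a : S) = ψ b) : 𝔻 K φ = 𝕌 A ψ := by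
  rw [dnAct, upAct, dn_eq_up h]

/-- The Mackey formula for the action on a Mackey functor. -/
theorem dnAct_mul_upAct {A B K : Subgroup S} {φ : A →* S} {ψ : B →* S} (hφ : φ ∈ F.Hom A K)
    (hψ : ψ ∈ F.Hom B K) {s : Finset S} (hs : IsDoubleReps ψ.range K φ.range s)
    (X : S → Subgroup S) (α β : ∀ k, X k →* S) (hα : ∀ k ∈ s, α k ∈ F.Hom (X k) B)
    (hβ : ∀ k ∈ s, β k ∈ F.Hom (X k) A)
    (h : ∀ k ∈ s, ∀ (b : B) (a : A), ψ b = k * φ a * k⁻¹ ↔ ∃ x, (b : S) = α k x ∧ (a : S) = β k x) :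
    𝔻 K ψ * 𝕌 K φ = ∑ k ∈ s, 𝕌 B (α k) * 𝔻 A (β k) := by
  rw [upAct, dnAct, ← act_elt_mul (up_dn_mem_mackeyRing hψ).2 (up_dn_mem_mackeyRing hφ).1,
    dn_mul_up' (F.apply_mem hψ) hs X α β (fun k hk => F.apply_mem (hβ k hk)) h, elt_sum, map_sum]
  · exact Finset.sum_congr rfl fun k hk =>
      act_elt_mul (up_dn_mem_mackeyRing (hα k hk)).1 (up_dn_mem_mackeyRing (hβ k hk)).2
  · exact fun k hk =>
      mul_mem (up_dn_mem_mackeyRing (hα k hk)).1 (up_dn_mem_mackeyRing (hβ k hk)).2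

theorem idAct_eq_zero (hM : IsCentricMackeyFunctor R F M) {K : Subgroup S}
    (hK : ¬ F.IsCentric K) : 𝟙 K = 0 :=
  LinearMap.ext (hM.centric K hK)

theorem upAct_eq_zero (hM : IsCentricMackeyFunctor R F M) {A K : Subgroup S} {φ : A →* S}
    (hA : ¬ F.IsCentric A) : 𝕌 K φ = 0 := by
  by_cases h : up K φ ∈ F.mackeyRing
  · rw [upAct, ← up_mul_one, act_elt_mul h (ind_mem_mackeyRing A)]
    change _ * 𝟙 A = 0
    rw [idAct_eq_zero hM hA, mul_zero]
  -- Outside the Mackey algebra `elt` takes the default value `0`, so `φ` may be any homomorphism.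
  · rw [upAct, elt, dif_neg h, map_zero]

end Operators

/-! ### The identity element of the Mackey algebra of a subsystem -/

section Units

variable {S : Type u} [Group S] [Finite S] {R : Type v} [CommRing R]
  {F : FusionSystem (⊤ : Subgroup S)}

theorem ind_mul_self (K : Subgroup S) : ind K K * ind K K = ind K K := up_mul_one K K.subtype

theorem unitOf_mul_elt_ind {P K : Subgroup S} (hK : K ≤ P) :
    unitOf R F P * elt R F (ind K K) = elt R F (ind K K) := by
  classical
  rw [unitOf, Finset.sum_mul, Finset.sum_eq_single K]
  · rw [← elt_mul (ind_mem_mackeyRing K) (ind_mem_mackeyRing K), ind_mul_self]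
  · intro L _ hL
    rw [← elt_mul (ind_mem_mackeyRing L) (ind_mem_mackeyRing K), ind_mul_ind_of_ne hL,
      elt_of_mem (zero_mem _)]
    exact TensorProduct.tmul_zero _ _
  · intro h
    exact absurd (Finset.mem_filter.2 ⟨Finset.mem_univ K, hK⟩) h

theorem elt_ind_mul_unitOf {P K : Subgroup S} (hK : K ≤ P) :
    elt R F (ind K K) * unitOf R F P = elt R F (ind K K) := by
  classical
  rw [unitOf, Finset.mul_sum, Finset.sum_eq_single K]
  · rw [← elt_mul (ind_mem_mackeyRing K) (ind_mem_mackeyRing K), ind_mul_self]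
  · intro L _ hL
    rw [← elt_mul (ind_mem_mackeyRing K) (ind_mem_mackeyRing L), ind_mul_ind_of_ne hL.symm,
      elt_of_mem (zero_mem _)]
    exact TensorProduct.tmul_zero _ _
  · intro h
    exact absurd (Finset.mem_filter.2 ⟨Finset.mem_univ K, hK⟩) h

theorem unitOf_mul_unitOf {P Q : Subgroup S} (hQ : Q ≤ P) :
    unitOf R F P * unitOf R F Q = unitOf R F Q ∧ unitOf R F Q * unitOf R F P = unitOf R F Q := by
  classical
  constructor
  · conv_lhs => rw [unitOf.eq_1 R F Q, Finset.mul_sum]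
    rw [unitOf]
    exact Finset.sum_congr rfl fun K hK => unitOf_mul_elt_ind ((Finset.mem_filter.1 hK).2.trans hQ)
  · conv_lhs => rw [unitOf.eq_1 R F Q, Finset.sum_mul]
    rw [unitOf]
    exact Finset.sum_congr rfl fun K hK => elt_ind_mul_unitOf ((Finset.mem_filter.1 hK).2.trans hQ)

variable {P : Subgroup S} {E : FusionSystem P}

/-- `1_{μ_R(E)}` is the identity of `μ_R(E)`. -/
theorem unitOf_mul_of_mem (hE : F.IsSub E) {a : MackeyAlgebra R F} (ha : a ∈ subMackey R F E) :
    unitOf R F P * a = a ∧ a * unitOf R F P = a := by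
  induction ha using NonUnitalAlgebra.adjoin_induction with
  | mem x hx =>
    obtain ⟨x, hx, rfl⟩ := hx
    obtain ⟨A, K, φ, hφ, rfl | rfl⟩ := generators_eq hx
    · have h1 := (up_dn_mem_mackeyRing (hE _ _ hφ)).1
      constructor
      · rw [← one_mul_up (E.apply_mem hφ), elt_mul (ind_mem_mackeyRing K) h1, ← mul_assoc,
          unitOf_mul_elt_ind (E.target_le hφ)]
      · rw [← up_mul_one, elt_mul h1 (ind_mem_mackeyRing A), mul_assoc,
          elt_ind_mul_unitOf (E.source_le hφ)]
    · have h1 := (up_dn_mem_mackeyRing (hE _ _ hφ)).2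
      constructor
      · rw [← one_mul_dn, elt_mul (ind_mem_mackeyRing A) h1, ← mul_assoc,
          unitOf_mul_elt_ind (E.source_le hφ)]
      · rw [← dn_mul_one (E.apply_mem hφ), elt_mul h1 (ind_mem_mackeyRing K), mul_assoc,
          elt_ind_mul_unitOf (E.target_le hφ)]
  | add x y _ _ hx hy => exact ⟨by rw [mul_add, hx.1, hy.1], by rw [add_mul, hx.2, hy.2]⟩
  | zero => simp
  | mul x y _ _ hx hy => exact ⟨by rw [← mul_assoc, hx.1], by rw [mul_assoc, hy.2]⟩
  | smul r x _ hx => exact ⟨by rw [mul_smul_comm, hx.1], by rw [smul_mul_assoc, hx.2]⟩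

theorem elt_mem_subMackey (hE : F.IsSub E) {A K : Subgroup S} {φ : A →* S} (hφ : φ ∈ E.Hom A K) :
    elt R F (up K φ) ∈ subMackey R F E ∧ elt R F (dn K φ) ∈ subMackey R F E := by
  refine up_dn_induction (E := E) (p := fun x => elt R F x ∈ subMackey R F E)
    (fun x hx => NonUnitalAlgebra.subset_adjoin R ⟨x, hx, rfl⟩) (fun x hx y hy h1 h2 => ?_) hφ
  rw [elt_mul (generators_subset hE hx) (generators_subset hE hy)]
  exact mul_mem h1 h2

end Units

/-! ### Endomorphisms of restrictions, viewed as operators on all of `M` -/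

section Endomorphisms

variable {S : Type u} [Group S] [Finite S] {R : Type v} [CommRing R]
  {F : FusionSystem (⊤ : Subgroup S)} {M : Type w} [AddCommGroup M] [Module (MackeyAlgebra R F) M]
  [Module R M] [IsScalarTower R (MackeyAlgebra R F) M] {P : Subgroup S} {E : FusionSystem P}

theorem act_apply (a : MackeyAlgebra R F) (x : M) : act R F M a x = a • x := rfl

theorem coe_proj (x : M) : (proj R F M P x : M) = act R F M (unitOf R F P) x := rfl

theorem extend_compress (f : Module.End R M) : extend R F M P (compress R F M P f) =
    act R F M (unitOf R F P) * f * act R F M (unitOf R F P) := rfl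

theorem commute_act {f : Module.End R M} (hf : IsEquivariant R F M E f)
    {a : MackeyAlgebra R F} (ha : a ∈ subMackey R F E) : Commute f (act R F M a) := by
  induction ha using NonUnitalAlgebra.adjoin_induction with
  | mem x hx =>
    obtain ⟨x, hx, rfl⟩ := hx
    obtain ⟨A, K, φ, hφ, rfl | rfl⟩ := generators_eq hx
    · exact (hf A K φ hφ).1
    · exact (hf A K φ hφ).2
  | add x y _ _ hx hy => rw [map_add]; exact hx.add_right hy
  | zero => rw [map_zero]; exact Commute.zero_right f
  | mul x y _ _ hx hy => rw [map_mul]; exact hx.mul_right hy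
  | smul r x _ hx => rw [map_smul]; exact hx.smul_right r

/-- The projection onto the restriction is the identity element of `μ_R(E)`, so extending by zero
preserves commutation with `μ_R(E)`. Together with `compress_mem` this allows all computations to
take place in the endomorphism ring of `M`. -/
theorem isEquivariant_extend (hE : F.IsSub E) {f : Module.End R (Restr R F M P)}
    (hf : f ∈ EndRestr R F M E) : IsEquivariant R F M E (extend R F M P f) := by
  have key : ∀ a ∈ subMackey R F E, Commute (extend R F M P f) (act R F M a) := by
    intro a ha
    obtain ⟨h1, h2⟩ := unitOf_mul_of_mem hE ha
    refine LinearMap.ext fun x => ?_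
    refine hf a ha (proj R F M P x) (proj R F M P (a • x)) ?_
    rw [coe_proj, coe_proj, act_apply, act_apply, ← mul_smul, ← mul_smul, h1, h2]
  intro A K φ hφ
  obtain ⟨h1, h2⟩ := elt_mem_subMackey (R := R) hE hφ
  exact ⟨key _ h1, key _ h2⟩

theorem compress_mem (hE : F.IsSub E) {f : Module.End R M} (hf : IsEquivariant R F M E f) :
    compress R F M P f ∈ EndRestr R F M E := by
  intro a ha x y h
  obtain ⟨h1, h2⟩ := unitOf_mul_of_mem hE ha
  have h3 := LinearMap.congr_fun (commute_act hf ha).eq (x : M)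
  change unitOf R F P • f (y : M) = a • unitOf R F P • f x
  change f (a • (x : M)) = a • f x at h3
  rw [h, h3, ← mul_smul, ← mul_smul, h1, h2]

theorem IsEquivariant.mono {Q : Subgroup S} {D : FusionSystem Q} {f : Module.End R M}
    (hf : IsEquivariant R F M E f)
    (h : ∀ (A K : Subgroup S) (φ : A →* S), φ ∈ D.Hom A K → φ ∈ E.Hom A K) :
    IsEquivariant R F M D f := fun A K φ hφ => hf A K φ (h A K φ hφ)

theorem IsEquivariant.mul {f g : Module.End R M} (hf : IsEquivariant R F M E f)
    (hg : IsEquivariant R F M E g) : IsEquivariant R F M E (f * g) := fun A K φ hφ =>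
  ⟨(hf A K φ hφ).1.mul_left (hg A K φ hφ).1, (hf A K φ hφ).2.mul_left (hg A K φ hφ).2⟩

/-- Commutation passes from the generators to the ring they generate, and by `R`-linearity to all
tensors, since `r ⊗ x = r • (1 ⊗ x)`. -/
theorem mem_endMackey {f : Module.End R M} (hf : IsEquivariant R F M F f) :
    f ∈ EndMackey R F M := by
  have h0 : ∀ m : M, (0 : MackeyAlgebra R F) • m = 0 := fun m => zero_smul (MackeyAlgebra R F) m
  have h1 : ∀ x ∈ F.mackeyRing, ∀ m : M, f (elt R F x • m) = elt R F x • f m := by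
    intro x hx
    induction hx using Subring.closure_induction with
    | mem x hx =>
      obtain ⟨A, K, φ, hφ, rfl | rfl⟩ := generators_eq hx
      · exact fun m => LinearMap.congr_fun (hf A K φ hφ).1.eq m
      · exact fun m => LinearMap.congr_fun (hf A K φ hφ).2.eq m
    | zero =>
      intro m
      rw [elt_of_mem (zero_mem _)]
      have : (1 : R) ⊗ₜ[ℤ] (⟨0, zero_mem _⟩ : F.mackeyRing) = 0 := TensorProduct.tmul_zero _ _
      rw [this]
      exact (congrArg f (h0 m)).trans ((map_zero f).trans (h0 _).symm)
    | one =>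
      intro m
      rw [elt_of_mem (one_mem _)]
      have : (1 : R) ⊗ₜ[ℤ] (⟨1, one_mem _⟩ : F.mackeyRing) = 1 := rfl
      rw [this, one_smul, one_smul]
    | add x y hx hy h1 h2 =>
      intro m
      have : elt R F (x + y) = elt R F x + elt R F y := by
        rw [elt_of_mem hx, elt_of_mem hy, elt_of_mem (add_mem hx hy), ← TensorProduct.tmul_add]
        rfl
      rw [this, add_smul, add_smul, map_add, h1, h2]
    | neg x hx h1 =>
      intro m
      have : elt R F (-x) = - elt R F x := by
        rw [elt_of_mem hx, elt_of_mem (neg_mem hx), ← TensorProduct.tmul_neg]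
        rfl
      rw [this, neg_smul, neg_smul, map_neg, h1]
    | mul x y hx hy h1 h2 =>
      intro m
      rw [elt_mul hx hy, mul_smul, mul_smul, h1, h2]
  intro a m
  induction a using TensorProduct.induction_on with
  | zero => exact (congrArg f (h0 m)).trans ((map_zero f).trans (h0 _).symm)
  | add a b ha hb => rw [add_smul, add_smul, map_add, ha, hb]
  | tmul r x =>
    have : r ⊗ₜ[ℤ] x = r • elt R F (x : BisetRing S) := by
      rw [elt_of_mem x.2, TensorProduct.smul_tmul', smul_eq_mul, mul_one]
    rw [this, smul_assoc, smul_assoc, map_smul, h1 _ x.2]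

end Endomorphisms

/-! ### The summands of a transfer and their behaviour under induction and restriction -/

section Terms

variable {S : Type u} [Group S] [Finite S] {R : Type v} [CommRing R]
  {F : FusionSystem (⊤ : Subgroup S)} {M : Type w} [AddCommGroup M] [Module (MackeyAlgebra R F) M]
  [Module R M] [IsScalarTower R (MackeyAlgebra R F) M]

local notation "𝕌" => upAct R F M
local notation "𝔻" => dnAct R F M
local notation "𝟙" => idAct R F M

theorem sum_idAct : ∑ K : Subgroup S, 𝟙 K = 1 := by
  have h1 : (1 : BisetRing S) = ∑ K : Subgroup S, ind K K := rfl
  have h2 : elt R F (1 : BisetRing S) = 1 := elt_of_mem (one_mem _)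
  have h3 : act R F M (elt R F (1 : BisetRing S)) = 1 := by rw [h2, map_one]
  rw [← h3, h1, elt_sum fun K _ => ind_mem_mackeyRing K, map_sum]
  rfl

/-- The idempotents `I_K^K` sum to `1`, so endomorphisms may be compared on each `I_K^K M`
separately. -/
theorem end_ext {f g : Module.End R M} (h : ∀ K, f * 𝟙 K = g * 𝟙 K) : f = g := by
  rw [← mul_one f, ← mul_one g, ← sum_idAct (R := R) (F := F) (M := M), Finset.mul_sum,
    Finset.mul_sum]
  exact Finset.sum_congr rfl fun K _ => h K

variable (F) in
/-- The composite `I c_φ f c_{φ⁻¹} R` for `q = (A, φ)`, as an endomorphism of a Mackey functor. -/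
noncomputable def termAt (K : Subgroup S) (f : Module.End R M) (q : Pair S) : Module.End R M :=
  𝕌 K q.2 * f * 𝔻 K q.2

variable (F) in
/-- The sum of the terms `I c_φ f c_{φ⁻¹} R` over a set of pairs. -/
noncomputable def trAt (K : Subgroup S) (T : Finset (Pair S)) (f : Module.End R M) :
    Module.End R M :=
  ∑ q ∈ T, termAt F K f q

theorem termAt_eq_zero (hM : IsCentricMackeyFunctor R F M) {K : Subgroup S} (f : Module.End R M)
    {q : Pair S} (hq : ¬ F.IsCentric q.1) : termAt F K f q = 0 := by
  rw [termAt, upAct_eq_zero hM hq, zero_mul, zero_mul]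

/-- Up to an inner automorphism of `K`, `φ` is `ψ` after conjugation by `h⁻¹`. This conjugation is a
morphism of `F_H(H)`, so it commutes with `f` and cancels against its inverse. Thus the choice of
representatives does not affect a transfer. -/
theorem termAt_eq_of_emb {H K : Subgroup S} {f : Module.End R M}
    (hf : IsEquivariant R F M (innerSystem H) f) {q r : Pair S} (hq : q.1 ≤ H) (hr : r.1 ≤ H)
    (hqF : q.2 ∈ F.Hom q.1 K) (hrF : r.2 ∈ F.Hom r.1 K) {h k : S} (hh : h ∈ H) (hk : k ∈ K)
    (e : Emb q r h k) (hc : Nat.card r.1 ≤ Nat.card q.1) : termAt F K f q = termAt F K f r := by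
  obtain ⟨A, φ⟩ := q
  obtain ⟨B, ψ⟩ := r
  dsimp only at *
  have hc' : conjHom h⁻¹ A ∈ (innerSystem H).Hom A B :=
    (innerSystem H).conj_mem hq hr (inv_mem hh) fun a => by simpa [conjHom] using e.mem a.2
  have hcF := FusionSystem.isSub_innerSystem F le_top hc'
  have hr' : (conjHom h⁻¹ A).range = B := by
    ext b
    constructor
    · rintro ⟨a, rfl⟩
      exact F.apply_mem hcF a
    · intro hb
      refine ⟨⟨h * b * h⁻¹, ?_⟩, ?_⟩
      · simpa using (e.symm hc).mem (a := b) hb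
      · simp [conjHom, mul_assoc]
  have hφ : ∀ a : A, k * φ a * k⁻¹ ∈ K := fun a =>
    mul_mem (mul_mem hk (F.apply_mem hqF a)) (inv_mem hk)
  have h3 : ∀ (a : A) (b : B), (b : S) = conjHom h⁻¹ A a →
      ((MulAut.conj k).toMonoidHom.comp φ) a = ψ b := fun a b hb =>
    (e.apply a b (by simpa [conjHom] using hb)).symm
  have h4 : ∀ a, ((MulAut.conj k).toMonoidHom.comp φ) a = k * φ a * k⁻¹ := fun a => rfl
  have h1 := upAct_mul_upAct (R := R) (M := M) hcF hrF h3
  have h2 := dnAct_mul_dnAct (R := R) (M := M) hcF hrF h3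
  rw [upAct_conj (F.apply_mem hqF) hk h4] at h1
  rw [dnAct_conj (F.apply_mem hqF) hk h4] at h2
  change 𝕌 K φ * f * 𝔻 K φ = 𝕌 K ψ * f * 𝔻 K ψ
  calc 𝕌 K φ * f * 𝔻 K φ = 𝕌 K ψ * (𝕌 B (conjHom h⁻¹ A) * f) * (𝔻 B (conjHom h⁻¹ A) * 𝔻 K ψ) := by
        rw [← h1, ← h2]; simp only [mul_assoc]
    _ = 𝕌 K ψ * f * ((𝕌 B (conjHom h⁻¹ A) * 𝔻 B (conjHom h⁻¹ A)) * 𝔻 K ψ) := by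
        rw [← (hf _ _ _ hc').1.eq]; simp only [mul_assoc]
    _ = 𝕌 K ψ * f * 𝔻 K ψ := by
        rw [upAct_mul_dnAct_self hcF hr', idAct_mul_dnAct hrF]

/-- The Mackey formula runs over the double cosets `φ(A) \ K / L`, which the inverses of `s`
represent; the component at `k⁻¹` is the graph of `φ`, conjugated by `(1, k)` and intersected with
`H × L`. -/
theorem mackey_dnAct_upAct {A H K L : Subgroup S} {φ : A →* S} (hA : A ≤ H) (hφ : φ ∈ F.Hom A K)
    (hL : L ≤ K) {s : Finset S} (hs : IsDoubleReps L K φ.range s) :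
    𝔻 K φ * 𝕌 K L.subtype =
      ∑ k ∈ s, 𝕌 A (cut ⟨A, φ⟩ H L 1 k).1.subtype * 𝔻 L (cut ⟨A, φ⟩ H L 1 k).2 := by
  classical
  let q : Pair S := ⟨A, φ⟩
  have h1 := dnAct_mul_upAct (R := R) (M := M) (φ := L.subtype) (F.subtype_mem hL le_top) hφ
    (s := s.image fun x => x⁻¹) (by rw [L.range_subtype]; exact hs.inv)
    (fun k => (cut q H L 1 k⁻¹).1) (fun k => (cut q H L 1 k⁻¹).1.subtype)
    (fun k => (cut q H L 1 k⁻¹).2) (fun k _ => F.subtype_mem (fun x hx => ?_) le_top)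
    (fun k _ => FusionSystem.cut_mem hφ le_top le_top trivial trivial) (fun k _ b a => ?_)
  · rw [h1, Finset.sum_image fun x _ y _ h => inv_injective h]
    refine Finset.sum_congr rfl fun k _ => ?_
    rw [inv_inv]
  · obtain ⟨-, a, ha, -⟩ := mem_cut.1 hx
    have : x = a := by simp [ha]
    exact this ▸ a.2
  · constructor
    · intro h
      have hb : (b : S) = 1⁻¹ * b * 1 := by simp
      have hba : k⁻¹ * φ b * k⁻¹⁻¹ = a := by simp [h, mul_assoc]
      refine ⟨⟨b, mem_cut.2 ⟨hA b.2, b, hb, hba ▸ a.2⟩⟩, rfl, ?_⟩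
      rw [cut_apply _ b hb]
      exact hba.symm
    · rintro ⟨x, hx, ha⟩
      rw [cut_apply (q := q) x b (by simpa using hx)] at ha
      rw [Subgroup.subtype_apply, ha]
      simp [q, mul_assoc]

theorem mackey_dnAct_upAct' {A H K L : Subgroup S} {φ : A →* S} (hA : A ≤ H) (hφ : φ ∈ F.Hom A K)
    (hL : L ≤ K) {s : Finset S} (hs : IsDoubleReps L K φ.range s) :
    𝔻 K L.subtype * 𝕌 K φ =
      ∑ k ∈ s, 𝕌 L (cut ⟨A, φ⟩ H L 1 k).2 * 𝔻 A (cut ⟨A, φ⟩ H L 1 k).1.subtype := by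
  let q : Pair S := ⟨A, φ⟩
  refine dnAct_mul_upAct hφ (F.subtype_mem hL le_top) (by rwa [L.range_subtype])
    (fun k => (cut q H L 1 k).1) (fun k => (cut q H L 1 k).2) (fun k => (cut q H L 1 k).1.subtype)
    (fun k _ => FusionSystem.cut_mem hφ le_top le_top trivial trivial)
    (fun k _ => F.subtype_mem (fun x hx => ?_) le_top) (fun k _ b a => ?_)
  · obtain ⟨-, a, ha, -⟩ := mem_cut.1 hx
    have : x = a := by simp [ha]
    exact this ▸ a.2
  · constructor
    · intro h
      have ha : (a : S) = 1⁻¹ * a * 1 := by simp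
      refine ⟨⟨a, mem_cut.2 ⟨hA a.2, a, ha, ?_⟩⟩, ?_, rfl⟩
      · rw [← h]; exact b.2
      · rw [cut_apply _ a ha]
        exact h
    · rintro ⟨x, hb, hx⟩
      rw [cut_apply (q := q) x a (by simpa using hx)] at hb
      exact hb

/-- The square formed by a cut, its inclusions and `φ` commutes up to conjugation by `k` in `K`,
which the operators do not see. -/
theorem cut_facts {H K L : Subgroup S} {q : Pair S} (hφ : q.2 ∈ F.Hom q.1 K)
    (hL : L ≤ K) {k : S} (hk : k ∈ K) :
    (cut q H L 1 k).1 ≤ q.1 ∧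
      𝕌 K q.2 * 𝕌 q.1 (cut q H L 1 k).1.subtype = 𝕌 K L.subtype * 𝕌 L (cut q H L 1 k).2 ∧
      𝔻 q.1 (cut q H L 1 k).1.subtype * 𝔻 K q.2 = 𝔻 L (cut q H L 1 k).2 * 𝔻 K L.subtype := by
  have hle : (cut q H L 1 k).1 ≤ q.1 := fun x hx => by
    obtain ⟨-, a, ha, -⟩ := mem_cut.1 hx
    have : x = a := by simp [ha]
    exact this ▸ a.2
  have hc : (cut q H L 1 k).2 ∈ F.Hom (cut q H L 1 k).1 L :=
    FusionSystem.cut_mem hφ le_top le_top trivial trivial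
  have hs : (cut q H L 1 k).1.subtype ∈ F.Hom (cut q H L 1 k).1 q.1 := F.subtype_mem hle le_top
  have hχ : ∀ (x : (cut q H L 1 k).1) (a : q.1), (a : S) = (cut q H L 1 k).1.subtype x →
      ((MulAut.conj k⁻¹).toMonoidHom.comp (cut q H L 1 k).2) x = q.2 a := by
    intro x a ha
    change k⁻¹ * (cut q H L 1 k).2 x * k⁻¹⁻¹ = _
    rw [cut_apply x a (by simpa using ha)]
    simp [mul_assoc]
  have hK : ∀ x, (cut q H L 1 k).2 x ∈ K := fun x => hL (cut_apply_mem _ _ _ _ _ x)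
  refine ⟨hle, ?_, ?_⟩
  · rw [upAct_mul_upAct hs hφ hχ, upAct_conj hK (inv_mem hk) fun x => rfl,
      upAct_mul_upAct hc (F.subtype_mem hL le_top) fun x a ha => ha.symm]
  · rw [dnAct_mul_dnAct hs hφ hχ, dnAct_conj hK (inv_mem hk) fun x => rfl,
      dnAct_mul_dnAct hc (F.subtype_mem hL le_top) fun x a ha => ha.symm]

/-- After the Mackey formula, `f` moves past the inductions from the sources of the cuts, because
inclusions of subgroups of `H` belong to `F_H(H)`. -/
theorem termAt_mul_upAct {H K L : Subgroup S} {f : Module.End R M}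
    (hf : IsEquivariant R F M (innerSystem H) f) {q : Pair S} (hq : q.1 ≤ H)
    (hqF : q.2 ∈ F.Hom q.1 K) (hL : L ≤ K) {s : Finset S} (hs : IsDoubleReps L K q.2.range s) :
    termAt F K f q * 𝕌 K L.subtype = 𝕌 K L.subtype * ∑ k ∈ s, termAt F L f (cut q H L 1 k) := by
  rw [termAt, mul_assoc, mackey_dnAct_upAct hq hqF hL hs, Finset.mul_sum, Finset.mul_sum]
  refine Finset.sum_congr rfl fun k hk => ?_
  obtain ⟨h1, h2, -⟩ := cut_facts (R := R) (M := M) (H := H) hqF hL (hs.1 k hk)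
  have h3 := (hf _ _ _ ((innerSystem H).subtype_mem h1 hq)).1.eq
  rw [termAt, ← mul_assoc, mul_assoc _ f, h3, ← mul_assoc, h2]
  simp only [mul_assoc]

theorem dnAct_mul_termAt {H K L : Subgroup S} {f : Module.End R M}
    (hf : IsEquivariant R F M (innerSystem H) f) {q : Pair S} (hq : q.1 ≤ H)
    (hqF : q.2 ∈ F.Hom q.1 K) (hL : L ≤ K) {s : Finset S} (hs : IsDoubleReps L K q.2.range s) :
    𝔻 K L.subtype * termAt F K f q = (∑ k ∈ s, termAt F L f (cut q H L 1 k)) * 𝔻 K L.subtype := by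
  rw [termAt, mul_assoc, ← mul_assoc, mackey_dnAct_upAct' hq hqF hL hs, Finset.sum_mul,
    Finset.sum_mul]
  refine Finset.sum_congr rfl fun k hk => ?_
  obtain ⟨h1, -, h2⟩ := cut_facts (R := R) (M := M) (H := H) hqF hL (hs.1 k hk)
  have h3 := (hf _ _ _ ((innerSystem H).subtype_mem h1 hq)).2.eq
  rw [termAt, ← mul_assoc, mul_assoc _ _ f, ← h3, mul_assoc, mul_assoc f, h2]
  simp only [mul_assoc]

/-- Terms at corresponding pairs, for an isomorphism of the second factor. -/
theorem termAt_of_corr {H K L : Subgroup S} {f : Module.End R M} {e : K ≃* L}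
    (he : F.IsIso e) {q r : Pair S} (hq : q.2 ∈ F.Hom q.1 K) (h : Corr (MulEquiv.refl H) e q r) :
    𝕌 L (L.subtype.comp e.toMonoidHom) * termAt F K f q * 𝔻 L (L.subtype.comp e.toMonoidHom) =
      termAt F L f r := by
  obtain ⟨A, φ⟩ := q
  obtain ⟨B, ψ⟩ := r
  have hAB : A = B := by
    ext x
    constructor
    · intro hx
      obtain ⟨b, y, -, h1, -, h2, -⟩ := h.1 ⟨x, hx⟩
      rw [MulEquiv.refl_apply, h1] at h2
      have h3 : (b : S) = x := h2
      exact h3 ▸ b.2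
    · intro hx
      obtain ⟨a, y, -, h1, -, h2, -⟩ := h.2 ⟨x, hx⟩
      rw [MulEquiv.refl_apply, h1] at h2
      have h3 : x = a := h2
      exact h3 ▸ a.2
  subst hAB
  have h3 : ∀ (a : A) (b : K), (b : S) = φ a → ψ a = (L.subtype.comp e.toMonoidHom) b := by
    intro a b hb
    obtain ⟨a', x, y, h1, h2, h3, h4⟩ := h.1 a
    rw [MulEquiv.refl_apply, h1] at h3
    have : a' = a := Subtype.ext h3
    rw [← this, h4]
    have : y = b := Subtype.ext (h2.trans hb.symm)
    rw [this]
    rfl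
  change _ * (𝕌 K φ * f * 𝔻 K φ) * _ = 𝕌 L ψ * f * 𝔻 L ψ
  rw [← upAct_mul_upAct hq he h3, ← dnAct_mul_dnAct hq he h3]
  simp only [mul_assoc]

end Terms

/-! ### Transfers commute with the Mackey algebra -/

section Transfers

variable {S : Type u} [Group S] [Finite S] {R : Type v} [CommRing R]
  {F : FusionSystem (⊤ : Subgroup S)} {M : Type w} [AddCommGroup M] [Module (MackeyAlgebra R F) M]
  [Module R M] [IsScalarTower R (MackeyAlgebra R F) M] {p : ℕ} [Fact p.Prime]
  {P : Subgroup S} {E : FusionSystem P} {C : Set (Subgroup S)}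

local notation "𝕌" => upAct R F M
local notation "𝔻" => dnAct R F M
local notation "𝟙" => idAct R F M

theorem isInvariant_termAt (hE : F.IsSub E) {H K : Subgroup S} {f : Module.End R M}
    (hf : IsEquivariant R F M (innerSystem H) f) : E.IsInvariant C H K (termAt F K f) := by
  rintro q r hq hr ⟨h, hh, k, hk, e⟩ hle
  exact termAt_eq_of_emb hf hq.2.1 hr.2.1 (hE _ _ hq.2.2) (hE _ _ hr.2.2) hh hk e hle.card_le

variable (F) in
/-- `C` consists of the `F`-centric subgroups of `P`, to which the extension axiom for `E` applies. -/
structure IsCentricSub (E : FusionSystem P) (C : Set (Subgroup S)) : Prop where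
  isSub : F.IsSub E
  family : E.IsCentricFamily C
  mem_iff : ∀ A, A ∈ C ↔ F.IsCentric A ∧ A ≤ P

theorem termAt_eq_zero_of_notMem (hM : IsCentricMackeyFunctor R F M) (hC : IsCentricSub F E C)
    {H K : Subgroup S} (hH : H ≤ P) {f : Module.End R M} {q : Pair S} (hq : q.1 ≤ H)
    (h : q.1 ∉ C) : termAt F K f q = 0 :=
  termAt_eq_zero hM f fun h' => h ((hC.mem_iff _).2 ⟨h', hq.trans hH⟩)

theorem trAt_eq_sum_cut (hS : IsPGroup p S) (hM : IsCentricMackeyFunctor R F M)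
    (hC : IsCentricSub F E C) {H K L : Subgroup S} (hH : H ≤ P) (hK : K ≤ P) (hL : L ≤ K)
    {T T' : Finset (Pair S)} (hT : E.IsProductIn C H K T) (hT' : E.IsProductIn C H L T')
    {f : Module.End R M} (hf : IsEquivariant R F M (innerSystem H) f) {s : Pair S → Finset S}
    (hs : ∀ q ∈ T, IsDoubleReps L K q.2.range (s q)) :
    ∑ q ∈ T, ∑ k ∈ s q, termAt F L f (cut q H L 1 k) = trAt F L T' f :=
  FusionSystem.sum_cut_right hS hC.family hH hK hL hT hT' (isInvariant_termAt hC.isSub hf)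
    (fun _ hq h => termAt_eq_zero_of_notMem hM hC hH hq h) hs

theorem exists_reps {H K L : Subgroup S} (hL : L ≤ K) {T : Finset (Pair S)}
    (hT : E.IsProductIn C H K T) :
    ∃ s : Pair S → Finset S, ∀ q ∈ T, IsDoubleReps L K q.2.range (s q) := by
  have h : ∀ q : Pair S, ∃ s, q ∈ T → IsDoubleReps L K q.2.range s := by
    intro q
    by_cases hq : q ∈ T
    · obtain ⟨s, hs⟩ := exists_isDoubleReps L K q.2.range hL (by
        rintro _ ⟨a, rfl⟩
        exact E.apply_mem (hT.1 q hq).1.2.2 a)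
      exact ⟨s, fun _ => hs⟩
    · exact ⟨∅, fun h => absurd h hq⟩
  choose s hs using h
  exact ⟨s, hs⟩

/-- The Mackey formula cuts every member of `[H × K]` down to `H × L`, and by `sum_cut_right` these
cuts make up `[H × L]`. -/
theorem trAt_mul_upAct (hS : IsPGroup p S) (hM : IsCentricMackeyFunctor R F M)
    (hC : IsCentricSub F E C) {H K L : Subgroup S} (hH : H ≤ P) (hK : K ≤ P) (hL : L ≤ K)
    {T T' : Finset (Pair S)} (hT : E.IsProductIn C H K T) (hT' : E.IsProductIn C H L T')
    {f : Module.End R M} (hf : IsEquivariant R F M (innerSystem H) f) :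
    trAt F K T f * 𝕌 K L.subtype = 𝕌 K L.subtype * trAt F L T' f := by
  obtain ⟨s, hs⟩ := exists_reps hL hT
  rw [← trAt_eq_sum_cut hS hM hC hH hK hL hT hT' hf hs, trAt, Finset.sum_mul, Finset.mul_sum]
  exact Finset.sum_congr rfl fun q hq => termAt_mul_upAct hf (hT.1 q hq).1.2.1
    (hC.isSub _ _ (hT.1 q hq).1.2.2) hL (hs q hq)

theorem dnAct_mul_trAt (hS : IsPGroup p S) (hM : IsCentricMackeyFunctor R F M)
    (hC : IsCentricSub F E C) {H K L : Subgroup S} (hH : H ≤ P) (hK : K ≤ P) (hL : L ≤ K)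
    {T T' : Finset (Pair S)} (hT : E.IsProductIn C H K T) (hT' : E.IsProductIn C H L T')
    {f : Module.End R M} (hf : IsEquivariant R F M (innerSystem H) f) :
    𝔻 K L.subtype * trAt F K T f = trAt F L T' f * 𝔻 K L.subtype := by
  obtain ⟨s, hs⟩ := exists_reps hL hT
  rw [← trAt_eq_sum_cut hS hM hC hH hK hL hT hT' hf hs, trAt, Finset.sum_mul, Finset.mul_sum]
  exact Finset.sum_congr rfl fun q hq => dnAct_mul_termAt hf (hT.1 q hq).1.2.1
    (hC.isSub _ _ (hT.1 q hq).1.2.2) hL (hs q hq)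

theorem idAct_mul_trAt {K : Subgroup S} {T : Finset (Pair S)}
    (hT : ∀ q ∈ T, q.2 ∈ F.Hom q.1 K) (f : Module.End R M) :
    𝟙 K * trAt F K T f = trAt F K T f := by
  rw [trAt, Finset.mul_sum]
  refine Finset.sum_congr rfl fun q hq => ?_
  rw [termAt, ← mul_assoc, ← mul_assoc, idAct_mul_upAct (hT q hq)]

theorem trAt_mul_idAct {K : Subgroup S} {T : Finset (Pair S)}
    (hT : ∀ q ∈ T, q.2 ∈ F.Hom q.1 K) (f : Module.End R M) :
    trAt F K T f * 𝟙 K = trAt F K T f := by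
  rw [trAt, Finset.sum_mul]
  refine Finset.sum_congr rfl fun q hq => ?_
  rw [termAt, mul_assoc, dnAct_mul_idAct (hT q hq)]

theorem FusionSystem.IsProductIn.hom (hE : F.IsSub E) {H K : Subgroup S} {T : Finset (Pair S)}
    (hT : E.IsProductIn C H K T) : ∀ q ∈ T, q.2 ∈ F.Hom q.1 K :=
  fun q hq => hE _ _ (hT.1 q hq).1.2.2

/-- Composition with `e` identifies `[H × K]` with `[H × L]`. -/
theorem idAct_conj (hC : IsCentricSub F E C) {H K L : Subgroup S} (hH : H ≤ P)
    {T T' : Finset (Pair S)} (hT : E.IsProductIn C H K T) (hT' : E.IsProductIn C H L T')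
    {e : K ≃* L} (he : E.IsIso e) {f : Module.End R M}
    (hf : IsEquivariant R F M (innerSystem H) f) :
    𝕌 L (L.subtype.comp e.toMonoidHom) * trAt F K T f * 𝔻 L (L.subtype.comp e.toMonoidHom) =
      trAt F L T' f := by
  rw [trAt, trAt, Finset.mul_sum, Finset.sum_mul]
  have h1 : H.subtype.comp (MulEquiv.refl H).toMonoidHom ∈ E.Hom H H :=
    E.subtype_mem le_rfl hH
  exact FusionSystem.sum_corr hC.family (η := MulEquiv.refl H) (κ := e) h1 he h1 he.symm hT hT'
    (isInvariant_termAt hC.isSub hf)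
    fun q r hq hr h => termAt_of_corr (hC.isSub _ _ he) (hC.isSub _ _ hq.2.2) h

theorem dnAct_eq_upAct_symm {A K : Subgroup S} (e : A ≃* K) :
    𝔻 K (K.subtype.comp e.toMonoidHom) = 𝕌 A (A.subtype.comp e.symm.toMonoidHom) := by
  refine dnAct_eq_upAct fun a b => ⟨fun h => ?_, fun h => ?_⟩
  · have : b = e a := Subtype.ext h
    subst this
    exact congrArg Subtype.val (e.symm_apply_apply a).symm
  · have : a = e.symm b := Subtype.ext h
    subst this
    exact congrArg Subtype.val (e.apply_symm_apply b).symm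

theorem dnAct_mul_upAct_self {A K : Subgroup S} {e : A ≃* K} (he : F.IsIso e) :
    𝔻 K (K.subtype.comp e.toMonoidHom) * 𝕌 K (K.subtype.comp e.toMonoidHom) = 𝟙 A := by
  have h1 : 𝕌 K (K.subtype.comp e.toMonoidHom) = 𝔻 A (A.subtype.comp e.symm.toMonoidHom) :=
    (dnAct_eq_upAct_symm e.symm).symm
  rw [h1, dnAct_eq_upAct_symm, upAct_mul_dnAct_self he.symm]
  ext x
  constructor
  · rintro ⟨a, rfl⟩
    exact (e.symm a).2
  · exact fun hx => ⟨e ⟨x, hx⟩, by simp⟩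

/-- `g` is the transfer of `f` with respect to the products `T`. -/
def IsTransfer (F : FusionSystem (⊤ : Subgroup S)) [Module (MackeyAlgebra R F) M]
    [IsScalarTower R (MackeyAlgebra R F) M] (C : Set (Subgroup S)) (T : Subgroup S → Finset (Pair S))
    (f g : Module.End R M) : Prop :=
  ∀ K, (K ∈ C → g * idAct R F M K = trAt F K (T K) f ∧ idAct R F M K * g = trAt F K (T K) f) ∧
    (K ∉ C → g * idAct R F M K = 0 ∧ idAct R F M K * g = 0)

/-- Every morphism is an isomorphism followed by an inclusion. Inclusions are handled by
`trAt_mul_upAct` and `dnAct_mul_trAt`, isomorphisms by `idAct_conj`, and morphisms from sources that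
are not `F`-centric act by zero. -/
theorem IsTransfer.isEquivariant (hS : IsPGroup p S) (hM : IsCentricMackeyFunctor R F M)
    (hC : IsCentricSub F E C) {H : Subgroup S} (hH : H ≤ P) {T : Subgroup S → Finset (Pair S)}
    (hT : ∀ K ∈ C, E.IsProductIn C H K (T K)) {f g : Module.End R M}
    (hf : IsEquivariant R F M (innerSystem H) f) (hg : IsTransfer F C T f g) :
    IsEquivariant R F M E g := by
  have hnc : ∀ A, A ≤ P → A ∉ C → ¬ F.IsCentric A := fun A hA h h' => h ((hC.mem_iff _).2 ⟨h', hA⟩)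
  have hzero : ∀ {A K : Subgroup S} {φ : A →* S}, φ ∈ E.Hom A K → A ∉ C →
      Commute g (𝕌 K φ) ∧ Commute g (𝔻 K φ) := by
    intro A K φ hφ hA
    have h1 := hnc A (E.source_le hφ) hA
    rw [upAct_eq_zero hM h1, ← idAct_mul_dnAct (hC.isSub _ _ hφ), idAct_eq_zero hM h1, zero_mul]
    exact ⟨Commute.zero_right g, Commute.zero_right g⟩
  have hsub : ∀ {A K : Subgroup S}, A ∈ C → A ≤ K → K ≤ P →
      Commute g (𝕌 K A.subtype) ∧ Commute g (𝔻 K A.subtype) := by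
    intro A K hA hAK hKP
    have hs := F.subtype_mem hAK (le_top (a := K))
    have hK := hC.family.up hA hAK hKP
    have h1 := trAt_mul_upAct hS hM hC hH hKP hAK (hT K hK) (hT A hA) hf
    have h2 := dnAct_mul_trAt hS hM hC hH hKP hAK (hT K hK) (hT A hA) hf
    constructor
    · rw [Commute, SemiconjBy, ← idAct_mul_upAct hs, ← mul_assoc, ((hg K).1 hK).1, h1,
        ← ((hg A).1 hA).2, ← mul_assoc, upAct_mul_idAct hs, idAct_mul_upAct hs]
    · rw [Commute, SemiconjBy, ← dnAct_mul_idAct hs, mul_assoc _ _ g, ((hg K).1 hK).2, h2,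
        ← ((hg A).1 hA).1, dnAct_mul_idAct hs, mul_assoc, idAct_mul_dnAct hs]
  have hiso : ∀ {A K : Subgroup S} {e : A ≃* K}, A ∈ C → E.IsIso e →
      Commute g (𝕌 K (K.subtype.comp e.toMonoidHom)) := by
    intro A K e hA he
    have heF := hC.isSub _ _ he
    have hK : K ∈ C := by
      have := hC.family.iso hA he
      have h1 : (K.subtype.comp e.toMonoidHom).range = K := by
        ext x
        constructor
        · rintro ⟨a, rfl⟩
          exact (e a).2
        · exact fun hx => ⟨e.symm ⟨x, hx⟩, by simp⟩
      rwa [h1] at this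
    have h1 := idAct_conj hC hH (hT A hA) (hT K hK) he hf
    have h2 := dnAct_mul_upAct_self (R := R) (M := M) heF
    rw [Commute, SemiconjBy, ← idAct_mul_upAct heF, ← mul_assoc, ((hg K).1 hK).1, ← h1, mul_assoc,
      h2, mul_assoc, trAt_mul_idAct ((hT A hA).hom hC.isSub), ← ((hg A).1 hA).2, ← mul_assoc,
      upAct_mul_idAct heF, idAct_mul_upAct heF]
  intro A K φ hφ
  by_cases hA : A ∈ C
  · have hφF := hC.isSub _ _ hφ
    obtain ⟨e, he, hφe⟩ := FusionSystem.exists_isIso (E.onto_mem hφ) rfl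
    have hr : φ.range ≤ K := by rintro _ ⟨a, rfl⟩; exact E.apply_mem hφ a
    have hrC := hC.family.iso hA hφ
    have heF := hC.isSub _ _ he
    have hχ : ∀ (a : A) (b : φ.range), (b : S) = (φ.range.subtype.comp e.toMonoidHom) a →
        φ a = φ.range.subtype b := by
      intro a b hb
      rw [Subgroup.subtype_apply, hb]
      exact (hφe a).symm
    have h1 := upAct_mul_upAct (R := R) (M := M) heF (F.subtype_mem hr le_top) hχ
    have h2 := dnAct_mul_dnAct (R := R) (M := M) heF (F.subtype_mem hr le_top) hχ
    rw [dnAct_eq_upAct_symm] at h2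
    obtain ⟨h3, h4⟩ := hsub hrC hr (E.target_le hφ)
    rw [← h1, ← h2]
    exact ⟨h3.mul_right (hiso hA he), (hiso hrC he.symm).mul_right h4⟩
  · exact hzero hφ hA

end Transfers

/-! ### The formula for the transfer in terms of operators -/

section TransferMaps

variable {S : Type u} [Group S] [Finite S] {R : Type v} [CommRing R]
  {F : FusionSystem (⊤ : Subgroup S)} {M : Type w} [AddCommGroup M] [Module (MackeyAlgebra R F) M]
  [Module R M] [IsScalarTower R (MackeyAlgebra R F) M] {p : ℕ} [Fact p.Prime]
  {P : Subgroup S} {E : FusionSystem P} {C : Set (Subgroup S)}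

local notation "𝕌" => upAct R F M
local notation "𝔻" => dnAct R F M
local notation "𝟙" => idAct R F M

theorem act_elt_ind_mul_cnj {A K : Subgroup S} {φ : A →* S} (hφ : φ ∈ F.Hom A K) :
    act R F M (elt R F (ind φ.range K) * elt R F (cnj φ)) = 𝕌 K φ := by
  have hr : φ.range ≤ K := by rintro _ ⟨a, rfl⟩; exact F.apply_mem hφ a
  rw [upAct, up_eq_mul (F.apply_mem hφ), elt_mul (Subring.subset_closure
    (ind_mem_generators hr le_top)) (Subring.subset_closure (cnj_mem_generators hφ))]

theorem act_elt_cnjInv_mul_res {A K : Subgroup S} {φ : A →* S} (hφ : φ ∈ F.Hom A K) :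
    act R F M (elt R F (cnjInv φ) * elt R F (res φ.range K)) = 𝔻 K φ := by
  have hr : φ.range ≤ K := by rintro _ ⟨a, rfl⟩; exact F.apply_mem hφ a
  rw [dnAct, dn_eq_mul (F.apply_mem hφ), elt_mul (Subring.subset_closure
    (cnjInv_mem_generators hφ)) (Subring.subset_closure (Or.inl ⟨_, _, hr, le_top, Or.inr rfl⟩))]

open Classical in
theorem transfer_eq_sum (hE : F.IsSub E) {H : Subgroup S} {T : Subgroup S → Finset (Pair S)}
    (hT : ∀ K, E.IsCentric K → E.IsProduct H K (T K)) (f : Module.End R (Restr R F M H)) :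
    transfer R F M E H T f =
      ∑ K : Subgroup S with E.IsCentric K, trAt F K (T K) (extend R F M H f) := by
  rw [transfer, LinearMap.sum_apply]
  refine Finset.sum_congr rfl fun K hK => ?_
  rw [LinearMap.sum_apply, trAt]
  refine Finset.sum_congr rfl fun q hq => ?_
  have hq' := hE _ _ ((hT K (Finset.mem_filter.1 hK).2).1 q hq).1.2.2
  rw [act_elt_ind_mul_cnj hq', act_elt_cnjInv_mul_res hq', termAt, mul_assoc]
  rfl

-- An `E`-centric subgroup of `P` need not be `F`-centric. Those that are not act by zero on `M`,
-- both as `K` and as the source of a pair, so the sums may be restricted to `C`.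
open Classical in
theorem isTransfer_transfer (hM : IsCentricMackeyFunctor R F M) (hC : IsCentricSub F E C)
    (hCE : ∀ A ∈ C, E.IsCentric A) {H : Subgroup S} (hH : H ≤ P)
    {T : Subgroup S → Finset (Pair S)} (hT : ∀ K, E.IsCentric K → E.IsProduct H K (T K))
    (f : Module.End R (Restr R F M H)) :
    IsTransfer F C (fun K => (T K).filter fun q => q.1 ∈ C) (extend R F M H f)
      (transfer R F M E H T f) := by
  have hhom : ∀ K, E.IsCentric K → ∀ q ∈ T K, q.2 ∈ F.Hom q.1 K := fun K hK q hq =>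
    hC.isSub _ _ ((hT K hK).1 q hq).1.2.2
  have hne : ∀ K L, K ≠ L → E.IsCentric L → trAt F L (T L) (extend R F M H f) * 𝟙 K = 0 ∧
      𝟙 K * trAt F L (T L) (extend R F M H f) = 0 := by
    intro K L h hL
    rw [← trAt_mul_idAct (hhom L hL), mul_assoc, idAct_mul_idAct_of_ne h.symm, mul_zero,
      trAt_mul_idAct (hhom L hL), ← idAct_mul_trAt (hhom L hL), ← mul_assoc,
      idAct_mul_idAct_of_ne h, zero_mul]
    exact ⟨rfl, rfl⟩
  intro K
  rw [transfer_eq_sum hC.isSub hT, Finset.sum_mul, Finset.mul_sum]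
  constructor
  · intro hK
    have hKE := hCE K hK
    have hmem : K ∈ Finset.univ.filter fun K : Subgroup S => E.IsCentric K :=
      Finset.mem_filter.2 ⟨Finset.mem_univ K, hKE⟩
    have h1 : trAt F K (T K) (extend R F M H f) =
        trAt F K ((T K).filter fun q => q.1 ∈ C) (extend R F M H f) := by
      rw [trAt, trAt, Finset.sum_filter_of_ne]
      intro q hq h
      by_contra h'
      exact h (termAt_eq_zero_of_notMem hM hC hH ((hT K hKE).1 q hq).1.2.1 h')
    rw [Finset.sum_eq_single_of_mem K hmem fun L hL h =>
      (hne K L h.symm (Finset.mem_filter.1 hL).2).1, Finset.sum_eq_single_of_mem K hmem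
      fun L hL h => (hne K L h.symm (Finset.mem_filter.1 hL).2).2, trAt_mul_idAct (hhom K hKE),
      idAct_mul_trAt (hhom K hKE), h1]
    exact ⟨rfl, rfl⟩
  · intro hK
    by_cases hKE : E.IsCentric K
    · have : 𝟙 K = 0 := idAct_eq_zero hM fun h => hK ((hC.mem_iff K).2 ⟨h, hKE.1⟩)
      rw [this]
      simp
    · have : ∀ L, E.IsCentric L → K ≠ L := fun L hL h => hKE (h ▸ hL)
      rw [Finset.sum_eq_zero fun L hL => (hne K L (this L (Finset.mem_filter.1 hL).2)
        (Finset.mem_filter.1 hL).2).1, Finset.sum_eq_zero fun L hL =>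
        (hne K L (this L (Finset.mem_filter.1 hL).2) (Finset.mem_filter.1 hL).2).2]
      exact ⟨rfl, rfl⟩

end TransferMaps

/-! ### Pullback of a pair along a morphism -/

section Pullback

variable {S : Type u} [Group S]

theorem pair_ext {q r : Pair S} (h₁ : q.1 = r.1)
    (h₂ : ∀ (a : q.1) (b : r.1), (a : S) = b → q.2 a = r.2 b) : q = r := by
  obtain ⟨A, φ⟩ := q
  obtain ⟨B, ψ⟩ := r
  dsimp only at h₁
  subst h₁
  have : φ = ψ := MonoidHom.ext fun a => h₂ a a rfl
  rw [this]

/-- The pullback of `y = (B, ψ)` along `r = (A, φ)`: the composite `ψ φ` on `φ⁻¹(B)`. -/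
noncomputable def pull (r y : Pair S) : Pair S :=
  ⟨(y.1.comap r.2).map r.1.subtype, y.2.comp ((r.2.comp (Subgroup.inclusion
    (Subgroup.map_subtype_le (y.1.comap r.2)))).codRestrict y.1 (by
      rintro ⟨_, a, ha, rfl⟩
      exact ha))⟩

theorem mem_pull {r y : Pair S} {x : S} :
    x ∈ (pull r y).1 ↔ ∃ a : r.1, (a : S) = x ∧ r.2 a ∈ y.1 := by
  constructor
  · rintro ⟨a, ha, rfl⟩
    exact ⟨a, rfl, ha⟩
  · rintro ⟨a, rfl, ha⟩
    exact ⟨a, ha, rfl⟩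

theorem pull_le (r y : Pair S) : (pull r y).1 ≤ r.1 := Subgroup.map_subtype_le _

theorem pull_apply {r y : Pair S} (x : (pull r y).1) (a : r.1) (b : y.1) (ha : (a : S) = x)
    (hb : (b : S) = r.2 a) : (pull r y).2 x = y.2 b := by
  change y.2 _ = y.2 b
  congr 1
  refine Subtype.ext ?_
  rw [hb]
  change r.2 _ = r.2 a
  congr 1
  exact Subtype.ext ha.symm

theorem emb_pull {r y y' : Pair S} {a : r.1} {k : S} (e : Emb y y' (r.2 a) k) :
    Emb (pull r y) (pull r y') a k := by
  intro x
  obtain ⟨c, hc, hc'⟩ := mem_pull.1 x.2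
  obtain ⟨b, hb, hb'⟩ := e ⟨r.2 c, hc'⟩
  have h1 : r.2 (a⁻¹ * c * a) = b := by rw [hb]; simp
  have h2 : (a : S)⁻¹ * x * a ∈ (pull r y').1 :=
    mem_pull.2 ⟨a⁻¹ * c * a, by simp [hc], h1 ▸ b.2⟩
  refine ⟨⟨_, h2⟩, rfl, ?_⟩
  rw [pull_apply ⟨_, h2⟩ (a⁻¹ * c * a) b (by simp [hc]) h1.symm, hb', pull_apply x c ⟨_, hc'⟩ hc rfl]

end Pullback

/-! ### The double coset formula for composites of transfers -/

section Double

variable {S : Type u} [Group S] [Finite S] {R : Type v} [CommRing R]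
  {F : FusionSystem (⊤ : Subgroup S)} {M : Type w} [AddCommGroup M] [Module (MackeyAlgebra R F) M]
  [Module R M] [IsScalarTower R (MackeyAlgebra R F) M] {p : ℕ} [Fact p.Prime]
  {P : Subgroup S} {E : FusionSystem P} {C D : Set (Subgroup S)}

local notation "𝕌" => upAct R F M
local notation "𝔻" => dnAct R F M
local notation "𝟙" => idAct R F M

theorem pull_mem_hom {K : Subgroup S} {r y : Pair S} {L : Subgroup S} (hr : r.2 ∈ F.Hom r.1 L)
    (hy : y.2 ∈ F.Hom y.1 K) : (pull r y).2 ∈ F.Hom (pull r y).1 K := by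
  let φ : (pull r y).1 →* S := r.2.comp (Subgroup.inclusion (pull_le r y))
  have h1 : φ ∈ F.Hom (pull r y).1 L := F.restrict_mem (pull_le r y) hr fun a b hab =>
    congrArg r.2 (Subtype.ext hab.symm)
  have h2 : φ ∈ F.Hom (pull r y).1 y.1 := F.mem_of_apply_mem h1 le_top fun a => by
    obtain ⟨b, hb, hb'⟩ := mem_pull.1 a.2
    have : Subgroup.inclusion (pull_le r y) a = b := Subtype.ext hb.symm
    change r.2 _ ∈ y.1
    rwa [this]
  refine F.comp_mem_of h2 hy fun a b hb => ?_
  exact pull_apply a (Subgroup.inclusion (pull_le r y) a) b rfl hb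

theorem isInvariant_pull {H K : Subgroup S} {f : Module.End R M}
    (hf : IsEquivariant R F M (innerSystem H) f) {r : Pair S} (hr : r.1 ≤ H) {L : Subgroup S}
    (hrL : r.2 ∈ F.Hom r.1 L) :
    F.IsInvariant D r.2.range K fun y => termAt F K f (pull r y) := by
  rintro y y' hy hy' ⟨_, ⟨a, rfl⟩, k, hk, e⟩ ⟨_, ⟨a', rfl⟩, k', hk', e'⟩
  exact termAt_eq_of_emb hf ((pull_le _ _).trans hr) ((pull_le _ _).trans hr)
    (pull_mem_hom hrL hy.2.2) (pull_mem_hom hrL hy'.2.2) (hr a.2) hk (emb_pull e)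
    (emb_pull e').card_le

/-- As `y` lives inside the image of `r`, the morphism of `r` maps the source of the pullback
isomorphically onto that of `y`, and centricity is invariant under isomorphism. -/
theorem isCentric_of_pull {r y : Pair S} {L : Subgroup S}
    (hrL : r.2 ∈ F.Hom r.1 L) (hy : y.1 ≤ r.2.range) (h : F.IsCentric (pull r y).1) :
    F.IsCentric y.1 := by
  let φ : (pull r y).1 →* S := r.2.comp (Subgroup.inclusion (pull_le r y))
  have h1 : φ ∈ F.Hom (pull r y).1 L := F.restrict_mem (pull_le r y) hrL fun a b hab =>
    congrArg r.2 (Subtype.ext hab.symm)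
  have h2 : φ.range = y.1 := by
    ext x
    constructor
    · rintro ⟨a, rfl⟩
      obtain ⟨b, hb, hb'⟩ := mem_pull.1 a.2
      have : Subgroup.inclusion (pull_le r y) a = b := Subtype.ext hb.symm
      change r.2 _ ∈ y.1
      rwa [this]
    · intro hx
      obtain ⟨a, rfl⟩ := hy hx
      exact ⟨⟨a, mem_pull.2 ⟨a, rfl, hx⟩⟩, rfl⟩
  exact FusionSystem.IsCentric.isConj h ⟨φ, h2 ▸ F.onto_mem h1, h2⟩

/-- The composite of the term at `q` with the component of `r` at the source of `q`. -/
theorem upAct_mul_termAt_mul_dnAct {H K Q : Subgroup S} (f : Module.End R M) {q r : Pair S}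
    (hq : q.2 ∈ F.Hom q.1 K) (hr : r.2 ∈ F.Hom r.1 Q) (hrH : r.1 ≤ H) (k : S) :
    𝕌 K q.2 * termAt F q.1 f (cut r H q.1 1 k) * 𝔻 K q.2 =
      termAt F K f (pull r (cut q r.2.range K k⁻¹ 1)) := by
  let c := cut r H q.1 1 k
  have hc : c.2 ∈ F.Hom c.1 q.1 := FusionSystem.cut_mem hr le_top le_top trivial trivial
  let χ : c.1 →* S := q.2.comp (c.2.codRestrict q.1 (F.apply_mem hc))
  have hχ : ∀ (a : c.1) (b : q.1), (b : S) = c.2 a → χ a = q.2 b := by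
    intro a b hb
    exact congrArg q.2 (Subtype.ext hb.symm)
  -- Both are the map sending `x` to the image under `q` of `k r(x) k⁻¹`, defined where this element
  -- lies in the source of `q`.
  have h1 : pull r (cut q r.2.range K k⁻¹ 1) = ⟨c.1, χ⟩ := by
    refine pair_ext ?_ ?_
    · ext x
      rw [mem_pull, mem_cut]
      constructor
      · rintro ⟨a, rfl, ha⟩
        obtain ⟨-, b, hb, -⟩ := mem_cut.1 ha
        refine ⟨hrH a.2, a, by simp, ?_⟩
        rw [inv_inv] at hb
        exact hb ▸ b.2
      · rintro ⟨hx, a, ha, hb⟩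
        have ha : (a : S) = x := by simpa using ha
        refine ⟨a, ha, mem_cut.2 ⟨⟨a, rfl⟩, ⟨_, hb⟩, by simp, ?_⟩⟩
        simpa using F.apply_mem hq _
    · intro x y hxy
      obtain ⟨a, ha, hb⟩ := mem_pull.1 x.2
      obtain ⟨-, b, hb', -⟩ := mem_cut.1 hb
      rw [pull_apply x a ⟨_, hb⟩ ha rfl, cut_apply _ b hb', one_mul, inv_one, mul_one, hχ y b]
      rw [cut_apply (q := r) y a (by simp [ha, hxy]), hb', inv_inv]
  rw [h1]
  change 𝕌 K q.2 * (𝕌 q.1 c.2 * f * 𝔻 q.1 c.2) * 𝔻 K q.2 = 𝕌 K χ * f * 𝔻 K χ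
  rw [← upAct_mul_upAct hc hq hχ, ← dnAct_mul_dnAct hc hq hχ]
  simp only [mul_assoc]

/-- The morphism of `r = (A, φ)` is an isomorphism onto its image, and pulling back along it
identifies `[φ(A) × K]` with `[A × K]`. -/
theorem sum_pull (hD : F.IsCentricFamily D) {H K L : Subgroup S}
    {f : Module.End R M} (hf : IsEquivariant R F M (innerSystem H) f) {r : Pair S} (hr : r.1 ≤ H)
    (hrL : r.2 ∈ F.Hom r.1 L) {T T' : Finset (Pair S)} (hT : F.IsProductIn D r.1 K T)
    (hT' : F.IsProductIn D r.2.range K T') :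
    trAt F K T f = ∑ y ∈ T', termAt F K f (pull r y) := by
  obtain ⟨e, he, hre⟩ := FusionSystem.exists_isIso (F.onto_mem hrL) rfl
  have h1 : K.subtype.comp (MulEquiv.refl K).toMonoidHom ∈ F.Hom K K :=
    F.subtype_mem le_rfl le_top
  refine FusionSystem.sum_corr hD (η := e) (κ := MulEquiv.refl K) he h1 he.symm h1 hT hT'
    (isInvariant_pull hf hr hrL) fun q y hq hy h => ?_
  have h2 : q = pull r y := by
    refine pair_ext ?_ ?_
    · ext x
      rw [mem_pull]
      constructor
      · intro hx
        obtain ⟨b, z, w, h1, -, h3, -⟩ := h.1 ⟨x, hx⟩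
        exact ⟨z, h1, by rw [← hre, ← h3]; exact b.2⟩
      · rintro ⟨a, rfl, ha⟩
        obtain ⟨b, z, w, h1, -, h3, -⟩ := h.2 ⟨_, ha⟩
        have h4 : e a = e z := Subtype.ext ((hre a).trans h3)
        rw [e.injective h4, h1]
        exact b.2
    · intro a x hax
      obtain ⟨b, z, w, h1, h2, h3, h4⟩ := h.1 a
      rw [pull_apply x z b (h1.trans hax) (h3.trans (hre z)), h4, ← h2]
      rfl
  rw [h2]

/-- The transfer from `Q` of a transfer from `H`. -/
theorem sum_transfer (hS : IsPGroup p S) (hM : IsCentricMackeyFunctor R F M)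
    (hC : IsCentricSub F E C) (hD : IsCentricSub F F D) {H K Q : Subgroup S} (hH : H ≤ P)
    (hQ : Q ≤ P) (hQC : Q ∈ C) {T : Subgroup S → Finset (Pair S)}
    (hT : ∀ K ∈ C, E.IsProductIn C H K (T K))
    {f g : Module.End R M} (hf : IsEquivariant R F M (innerSystem H) f) (hg : IsTransfer F C T f g)
    {U : Finset (Pair S)} (hU : F.IsProductIn D Q K U) {V : Subgroup S → Finset (Pair S)}
    (hV : ∀ A ∈ D, F.IsProductIn D A K (V A)) :
    trAt F K U g = ∑ r ∈ T Q, trAt F K (V r.1) f := by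
  classical
  have hs : ∀ (B : Subgroup S) (r : Pair S), ∃ s, B ≤ Q → r ∈ T Q →
      IsDoubleReps B Q r.2.range s := by
    intro B r
    by_cases h : B ≤ Q ∧ r ∈ T Q
    · obtain ⟨s, hs⟩ := exists_isDoubleReps B Q r.2.range h.1 (by
        rintro _ ⟨a, rfl⟩
        exact E.apply_mem ((hT Q hQC).1 r h.2).1.2.2 a)
      exact ⟨s, fun _ _ => hs⟩
    · exact ⟨∅, fun h1 h2 => absurd ⟨h1, h2⟩ h⟩
  choose s hs using hs
  -- At the source of `q` the operator `g` is a transfer over `[H × q.1]`, which consists of the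
  -- cuts of the members of `[H × Q]`.
  have h1 : ∀ q ∈ U, termAt F K g q = ∑ r ∈ T Q, ∑ k ∈ s q.1 r,
      termAt F K f (pull r (cut q r.2.range K k⁻¹ 1)) := by
    intro q hq
    have hq' := (hU.1 q hq).1
    have hqC : q.1 ∈ C := (hC.mem_iff _).2 ⟨((hD.mem_iff _).1 hq'.1).1, hq'.2.1.trans hQ⟩
    rw [termAt, ← idAct_mul_dnAct hq'.2.2, ← mul_assoc, mul_assoc _ g, ((hg q.1).1 hqC).1,
      ← trAt_eq_sum_cut hS hM hC hH hQ hq'.2.1 (hT Q hQC) (hT _ hqC) hf (s := s q.1)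
        fun r hr => hs _ _ hq'.2.1 hr, Finset.mul_sum, Finset.sum_mul]
    refine Finset.sum_congr rfl fun r hr => ?_
    rw [Finset.mul_sum, Finset.sum_mul]
    have hr' := ((hT Q hQC).1 r hr).1
    exact Finset.sum_congr rfl fun k _ =>
      upAct_mul_termAt_mul_dnAct f hq'.2.2 (hC.isSub _ _ hr'.2.2) hr'.2.1 k
  rw [trAt, Finset.sum_congr rfl h1, Finset.sum_comm]
  refine Finset.sum_congr rfl fun r hr => ?_
  have hr' := ((hT Q hQC).1 r hr).1
  have hrF := hC.isSub _ _ hr'.2.2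
  have hrD : r.1 ∈ D := (hD.mem_iff _).2 ⟨((hC.mem_iff _).1 hr'.1).1, le_top⟩
  have hrange : r.2.range ≤ Q := by
    rintro _ ⟨a, rfl⟩
    exact F.apply_mem hrF a
  have hrD' := hD.family.iso hrD hrF
  -- After exchanging the sums, for fixed `r` the indices `q` and `k` run over the cuts of `[Q × K]`
  -- to the image of `r` times `K`. These form the product of that image with `K`, which is pulled
  -- back along `r`.
  rw [sum_pull hD.family hf hr'.2.1 hrF (hV _ hrD) (hV _ hrD'),
    ← FusionSystem.sum_cut_left hS hD.family le_top le_top hrange hU (hV _ hrD')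
      (isInvariant_pull hf hr'.2.1 hrF) (fun y hy hyD => termAt_eq_zero hM f fun h =>
        hyD ((hD.mem_iff _).2 ⟨isCentric_of_pull hrF hy h, le_top⟩))
      (s := fun q => (s q.1 r).image fun k => k⁻¹) fun q hq => (hs _ _ (hU.1 q hq).1.2.1 hr).inv]
  · refine Finset.sum_congr rfl fun q _ => ?_
    rw [Finset.sum_image fun x _ y _ h => inv_injective h]

/-- Conjugation by `h` identifies the two products, and `f` commutes with it. Hence the transfer
from a subgroup of `H` depends only on its `H`-conjugacy class. -/
theorem trAt_eq_of_conj (hD : F.IsCentricFamily D) {H K A B : Subgroup S}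
    {f : Module.End R M} (hf : IsEquivariant R F M (innerSystem H) f) (hA : A ≤ H) (hB : B ≤ H)
    {T T' : Finset (Pair S)} (hT : F.IsProductIn D A K T) (hT' : F.IsProductIn D B K T') {h : S}
    (hh : h ∈ H) (hAB : ∀ a ∈ A, h⁻¹ * a * h ∈ B) (hBA : ∀ b ∈ B, h * b * h⁻¹ ∈ A) :
    trAt F K T f = trAt F K T' f := by
  let e : A ≃* B :=
    { toFun := fun a => ⟨h⁻¹ * a * h, hAB a a.2⟩
      invFun := fun b => ⟨h * b * h⁻¹, hBA b b.2⟩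
      left_inv := fun a => Subtype.ext (by simp [mul_assoc])
      right_inv := fun a => Subtype.ext (by simp [mul_assoc])
      map_mul' := fun a b => Subtype.ext (by simp [mul_assoc]) }
  have he : F.IsIso e := FusionSystem.isIso_conj le_top le_top (g := h⁻¹) trivial fun a => by
    simp [e]
  have h1 : K.subtype.comp (MulEquiv.refl K).toMonoidHom ∈ F.Hom K K :=
    F.subtype_mem le_rfl le_top
  have key : ∀ q y : Pair S, Corr e (MulEquiv.refl K) q y → Emb q y h 1 := by
    intro q y hqy a
    obtain ⟨b, z, w, h1, h2, h3, h4⟩ := hqy.1 a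
    refine ⟨b, by rw [h3, ← h1]; rfl, ?_⟩
    rw [h4, ← h2]
    simp
  refine FusionSystem.sum_corr hD (η := e) (κ := MulEquiv.refl K) he h1 he.symm h1 hT hT'
    ?_ fun q y hq hy hqy => ?_
  · rintro q r hq hr ⟨h, hh, k, hk, e⟩ hle
    exact termAt_eq_of_emb hf (hq.2.1.trans hB) (hr.2.1.trans hB) hq.2.2 hr.2.2 (hB hh) hk e
      hle.card_le
  · refine termAt_eq_of_emb hf (hq.2.1.trans hA) (hy.2.1.trans hB) hq.2.2 hy.2.2 hh (one_mem _)
      (key q y hqy) ?_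
    refine Nat.card_le_card_of_injective (fun b : y.1 => (⟨h * b * h⁻¹, ?_⟩ : q.1)) ?_
    · obtain ⟨a, z, w, h1, h2, h3, h4⟩ := hqy.2 b
      have : h * b * h⁻¹ = a := by rw [h3, ← h1]; simp [e, mul_assoc]
      exact this ▸ a.2
    · intro b b' hbb
      have := congrArg Subtype.val hbb
      exact Subtype.ext (by simpa using this)

end Double

/-! ### Decomposition of `[H × S]` through the normalizers `N_φ`, and existence of tops -/

section NormProducts

variable {S : Type u} [Group S] [Finite S] {p : ℕ} [Fact p.Prime]
  {F : FusionSystem (⊤ : Subgroup S)} {H : Subgroup S} {C D : Set (Subgroup S)}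

namespace FusionSystem

theorem IsMaxPairIn.corr {P : Subgroup S} {E : FusionSystem P} (hC : E.IsCentricFamily C)
    {H K H' K' : Subgroup S} {η : H ≃* H'} {κ : K ≃* K'} (hη : E.IsIso η) (hκ : E.IsIso κ)
    {q r : Pair S} (hq : E.IsMaxPairIn C H K q) (hr : E.IsPairIn C H' K' r) (h : Corr η κ q r) :
    E.IsMaxPairIn C H' K' r := by
  refine ⟨hr, fun r' hr' hle => ?_⟩
  obtain ⟨q', hq', hqr'⟩ := exists_corr hC hη.symm hκ.symm hr'
  exact hqr'.symm.pairLE h (hq.2 q' hq' (h.symm.pairLE hqr' hle))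

theorem apply_mem_of_normalizer {A B : Subgroup S} {φ : A →* S}
    (hφ : φ ∈ (F.normalizer H).Hom A B) (a : A) (ha : (a : S) ∈ H) : φ a ∈ H := by
  obtain ⟨α, -, h⟩ := exists_aut_of_normalizer hφ
  rw [← h a ⟨a, ha⟩ rfl]
  exact (α _).2

theorem aut_restrict_mem {α : MulAut H} (hα : α ∈ F.aut H) {A B : Subgroup S} (hA : A ≤ H)
    (hB : B ≤ Subgroup.normalizer (H : Set S)) {φ : A →* S}
    (hφ : ∀ (a : A) (x : H), (x : S) = a → φ a = α x) (hφB : ∀ a, φ a ∈ B) :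
    φ ∈ (F.normalizer H).Hom A B := by
  have hαF := hα le_top
  refine ⟨hA.trans Subgroup.le_normalizer, hB, F.mem_of_apply_mem (F.restrict_mem hA hαF
    fun a b hab => hφ a b hab) le_top hφB, ?_⟩
  have hle : A ⊔ H ≤ H := sup_le hA le_rfl
  refine ⟨(H.subtype.comp α.toMonoidHom).comp (Subgroup.inclusion hle), F.mem_of_apply_mem
    (F.restrict_mem hle hαF fun a b hab => congrArg (H.subtype.comp α.toMonoidHom)
      (Subtype.ext hab.symm)) le_top fun x => ?_, fun a x hx => ?_, fun x _ => ?_⟩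
  · exact (le_sup_right : H ≤ B ⊔ H) (α _).2
  · rw [hφ a (Subgroup.inclusion hle x) hx]
    rfl
  · exact (α _).2

theorem normBefore_le (q : Pair S) :
    F.normBefore H ⊤ q ≤ Subgroup.normalizer (H : Set S) := fun _ hx => hx.1.1

theorem le_normBefore {q : Pair S} (hq : q.1 ≤ H) : q.1 ≤ F.normBefore H ⊤ q := by
  intro a ha
  have haN : a ∈ Subgroup.normalizer (q.1 : Set S) := Subgroup.le_normalizer ha
  have hconj : ∀ x y : q.1, (y : S) = a * x * a⁻¹ → q.2 y = q.2 ⟨a, ha⟩ * q.2 x * (q.2 ⟨a, ha⟩)⁻¹ := by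
    intro x y hxy
    rw [← map_inv, ← map_mul, ← map_mul]
    congr 1
    exact Subtype.ext hxy
  refine mem_transport.2 ⟨⟨Subgroup.le_normalizer (hq ha), haN⟩, q.2 ⟨a, ha⟩, ?_, hconj⟩
  obtain ⟨α, hα⟩ := exists_mulAut_conj haN
  refine ⟨⟨trivial, Subgroup.le_normalizer ⟨_, rfl⟩⟩, α, ?_, fun x => hconj x (α x) (hα x)⟩
  exact autBy_le_aut ⟨a, Subgroup.le_normalizer (hq ha), hα⟩

/-- Elements of the normalizer before `q` act on the source of `q`. -/
theorem exists_of_mem_normBefore {q : Pair S} {x : S} (hx : x ∈ F.normBefore H ⊤ q) :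
    ∃ z, ∀ a : q.1, ∃ b : q.1, (b : S) = x * a * x⁻¹ ∧ q.2 b = z * q.2 a * z⁻¹ := by
  obtain ⟨⟨-, hN⟩, z, -, h⟩ := mem_transport.1 hx
  exact ⟨z, fun a => ⟨⟨_, (Subgroup.mem_normalizer_iff.1 hN a).1 a.2⟩, rfl, h _ _ rfl⟩⟩

/-- An element of `H ∩ N_φ` gives a self-embedding of the maximal pair `q`, so it lies in its
source. With `le_normBefore` this says that `H ∩ N_φ` is the source `A` of `q`. -/
theorem IsMaxPairIn.inf_normBefore_le (hD : F.IsCentricFamily D) {q : Pair S}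
    (hq : F.IsMaxPairIn D H ⊤ q) {x : S} (hx : x ∈ F.normBefore H ⊤ q) (hxH : x ∈ H) :
    x ∈ q.1 := by
  obtain ⟨z, hz⟩ := exists_of_mem_normBefore (inv_mem hx)
  refine hq.mem_of_emb hD le_top hxH (m := z) trivial fun a => ?_
  obtain ⟨b, hb, hb'⟩ := hz a
  exact ⟨b, by rw [hb, inv_inv], hb'⟩

/-- Morphisms of `N_F(H)` preserve `H`, so the image lies in `H ∩ N_φ`, the source of `q`. -/
theorem IsPairIn.apply_mem (hD : F.IsCentricFamily D) {q r : Pair S}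
    (hq : F.IsMaxPairIn D H ⊤ q)
    (hr : (F.normalizer H).IsPairIn C H (F.normBefore H ⊤ q) r) (a : r.1) : r.2 a ∈ q.1 :=
  hq.inf_normBefore_le hD ((F.normalizer H).apply_mem hr.2.2 a)
    (apply_mem_of_normalizer hr.2.2 a (hr.2.1 a.2))

theorem IsPairIn.card_le (hD : F.IsCentricFamily D) {q r : Pair S}
    (hq : F.IsMaxPairIn D H ⊤ q)
    (hr : (F.normalizer H).IsPairIn C H (F.normBefore H ⊤ q) r) :
    Nat.card r.1 ≤ Nat.card q.1 := by
  refine Nat.card_le_card_of_injective (fun a : r.1 => (⟨r.2 a, hr.apply_mem hD hq a⟩ : q.1)) ?_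
  intro a b hab
  exact (F.normalizer H).injective hr.2.2 (congrArg Subtype.val hab)

/-- No pair between `H` and `N_φ` has a source larger than that of `q`, so a pair that attains this
order is maximal. -/
theorem isMaxPairIn_of_range_eq (hD : F.IsCentricFamily D) {q r : Pair S}
    (hq : F.IsMaxPairIn D H ⊤ q)
    (hr : (F.normalizer H).IsPairIn C H (F.normBefore H ⊤ q) r) (hrq : r.2.range = q.1) :
    (F.normalizer H).IsMaxPairIn C H (F.normBefore H ⊤ q) r := by
  refine ⟨hr, fun r' hr' hle => hle.symm ((hr'.card_le hD hq).trans ?_)⟩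
  rw [← hrq]
  exact (Nat.card_congr (MonoidHom.ofInjective ((F.normalizer H).injective hr.2.2)).toEquiv).ge

/-- The maximal pairs between `H` and the normalizer before `q` are isomorphisms onto the source
of `q`. -/
theorem IsMaxPairIn.exists_aut (hC : IsCentricSub F (F.normalizer H) C)
    (hD : IsCentricSub F F D) {q r : Pair S} (hq : F.IsMaxPairIn D H ⊤ q)
    (hr : (F.normalizer H).IsMaxPairIn C H (F.normBefore H ⊤ q) r) :
    ∃ α ∈ F.aut H, (∀ (a : r.1) (x : H), (x : S) = a → (α x : S) = r.2 a) ∧ r.2.range = q.1 := by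
  obtain ⟨α, hα, h⟩ := exists_aut_of_normalizer hr.1.2.2
  refine ⟨α, hα, h, ?_⟩
  -- `A` is the preimage of the source of `q` under `α`. The restriction of `α` to `A` is a pair
  -- above `r`, hence has the same source by maximality.
  let A := ((q.1.comap H.subtype).comap α.toMonoidHom).map H.subtype
  have hAH : A ≤ H := Subgroup.map_subtype_le _
  have hmem : ∀ x : H, (x : S) ∈ A ↔ (α x : S) ∈ q.1 := by
    intro x
    constructor
    · rintro ⟨y, hy, hyx⟩
      have : y = x := Subtype.ext hyx
      exact this ▸ hy
    · exact fun hx => ⟨x, hx, rfl⟩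
  let φ : A →* S := (H.subtype.comp α.toMonoidHom).comp (Subgroup.inclusion hAH)
  have hφα : ∀ (a : A) (x : H), (x : S) = a → φ a = α x := by
    intro a x hx
    have : x = Subgroup.inclusion hAH a := Subtype.ext hx
    rw [this]
    rfl
  have hφq : ∀ a, φ a ∈ q.1 := fun a => (hmem (Subgroup.inclusion hAH a)).1 a.2
  have hφ : φ ∈ (F.normalizer H).Hom A (F.normBefore H ⊤ q) :=
    aut_restrict_mem hα hAH (normBefore_le q) hφα fun a => le_normBefore hq.1.2.1 (hφq a)
  have hr' : φ.range = q.1 := by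
    ext y
    constructor
    · rintro ⟨a, rfl⟩
      exact hφq a
    · intro hy
      have h1 : (α (α⁻¹ ⟨y, hq.1.2.1 hy⟩) : S) = y := by rw [MulAut.apply_inv_self]
      have h2 := (hmem (α⁻¹ ⟨y, hq.1.2.1 hy⟩)).2 (by rw [h1]; exact hy)
      exact ⟨⟨_, h2⟩, (hφα ⟨_, h2⟩ _ rfl).trans h1⟩
  have hAC : A ∈ C := by
    have h1 : F.IsConj A q.1 := ⟨φ, hr' ▸ F.onto_mem (hom_of_normalizer hφ), hr'⟩
    exact (hC.mem_iff A).2 ⟨IsCentric.isConj ((hD.mem_iff _).1 hq.1.1).1 h1.symm,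
      hAH.trans Subgroup.le_normalizer⟩
  have hle : PairLE H (F.normBefore H ⊤ q) r ⟨A, φ⟩ := by
    refine ⟨1, one_mem _, 1, one_mem _, fun a => ?_⟩
    have h1 : (α ⟨a, hr.1.2.1 a.2⟩ : S) = r.2 a := h a _ rfl
    have h2 := (hmem ⟨a, hr.1.2.1 a.2⟩).2 (by rw [h1]; exact hr.1.apply_mem hD.family hq a)
    refine ⟨⟨a, h2⟩, by simp, ?_⟩
    rw [hφα ⟨a, h2⟩ ⟨a, hr.1.2.1 a.2⟩ rfl, h1]
    simp
  have hcard := (hr.2 ⟨A, φ⟩ ⟨hAC, hAH, hφ⟩ hle).card_le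
  have hrA : r.1 ≤ A := fun x hx => (hmem ⟨x, hr.1.2.1 hx⟩).2
    (by rw [h ⟨x, hx⟩ _ rfl]; exact hr.1.apply_mem hD.family hq _)
  have heq : r.1 = A := Subgroup.eq_of_le_of_card_ge hrA hcard
  refine le_antisymm ?_ ?_
  · rintro _ ⟨a, rfl⟩
    exact hr.1.apply_mem hD.family hq a
  · intro y hy
    rw [← hr'] at hy
    obtain ⟨a, rfl⟩ := hy
    have ha : (a : S) ∈ r.1 := by rw [heq]; exact a.2
    exact ⟨⟨a, ha⟩, (h ⟨a, ha⟩ ⟨a, hAH a.2⟩ rfl).symm.trans (hφα a ⟨a, hAH a.2⟩ rfl).symm⟩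

theorem pull_fst {q r : Pair S} (h : ∀ a, r.2 a ∈ q.1) : (pull r q).1 = r.1 :=
  le_antisymm (pull_le r q) fun x hx => mem_pull.2 ⟨⟨x, hx⟩, rfl, h _⟩

/-- The composite of an isomorphism in the normalizer with a maximal pair is a maximal pair. -/
theorem IsMaxPairIn.pull (hD : IsCentricSub F F D) {q r : Pair S}
    (hq : F.IsMaxPairIn D H ⊤ q) {L : Subgroup S} (hrL : r.2 ∈ F.Hom r.1 L) (hrH : r.1 ≤ H)
    {α : MulAut H} (hα : α ∈ F.aut H)
    (h : ∀ (a : r.1) (x : H), (x : S) = a → (α x : S) = r.2 a) (hr : r.2.range = q.1) :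
    F.IsMaxPairIn D H ⊤ (FusionMackey.pull r q) := by
  have hmem : ∀ a, r.2 a ∈ q.1 := fun a => hr ▸ ⟨a, rfl⟩
  have h1 := pull_fst hmem
  have hr1 : F.IsConj r.1 q.1 := ⟨r.2, hr ▸ F.onto_mem hrL, hr⟩
  have hp : F.IsPairIn D H ⊤ (FusionMackey.pull r q) := by
    refine ⟨?_, (pull_le r q).trans hrH, pull_mem_hom hrL hq.1.2.2⟩
    rw [h1]
    exact (hD.mem_iff _).2 ⟨IsCentric.isConj ((hD.mem_iff _).1 hq.1.1).1 hr1.symm, le_top⟩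
  have hval : ∀ (b : (FusionMackey.pull r q).1) (a : q.1) (x : H), (x : S) = b → (a : S) = α x →
      (FusionMackey.pull r q).2 b = q.2 a := by
    intro b a x hx ha
    refine pull_apply b ⟨b, pull_le r q b.2⟩ a rfl ?_
    rw [ha, h ⟨b, pull_le r q b.2⟩ x hx]
  refine hq.corr hD.family (η := (α : H ≃* H).symm) (κ := MulEquiv.refl (⊤ : Subgroup S))
    (IsIso.symm ((mem_aut_iff le_top).1 hα)) (F.subtype_mem le_rfl le_rfl) hp ⟨?_, ?_⟩
  · rintro ⟨a, ha⟩
    obtain ⟨b, hb⟩ : a ∈ r.2.range := hr ▸ ha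
    have hbH := hrH b.2
    have hb2 := h b ⟨b, hbH⟩ rfl
    refine ⟨⟨b, h1.ge b.2⟩, ⟨a, hq.1.2.1 ha⟩, ⟨q.2 ⟨a, ha⟩, trivial⟩, rfl, rfl, ?_, ?_⟩
    · have : (⟨a, hq.1.2.1 ha⟩ : H) = (α : H ≃* H) ⟨b, hbH⟩ := Subtype.ext (hb.symm.trans hb2.symm)
      rw [this, MulEquiv.symm_apply_apply]
    · exact hval _ ⟨a, ha⟩ ⟨b, hbH⟩ rfl (hb.symm.trans hb2.symm)
  · rintro ⟨b, hb⟩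
    have hb' : b ∈ r.1 := pull_le r q hb
    have hb2 := h ⟨b, hb'⟩ ⟨b, hrH hb'⟩ rfl
    refine ⟨⟨r.2 ⟨b, hb'⟩, hmem _⟩, α ⟨b, hrH hb'⟩, ⟨q.2 ⟨r.2 ⟨b, hb'⟩, hmem _⟩, trivial⟩, hb2, rfl, ?_, ?_⟩
    · exact (congrArg Subtype.val ((α : H ≃* H).symm_apply_apply ⟨b, hrH hb'⟩)).symm
    · exact hval _ _ ⟨b, hrH hb'⟩ rfl hb2.symm

theorem isConj_of_emb_card {A B : Subgroup S} {h : S} (hAB : ∀ a ∈ A, h⁻¹ * a * h ∈ B)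
    (hc : Nat.card B ≤ Nat.card A) : ∀ b ∈ B, h * b * h⁻¹ ∈ A := by
  intro b hb
  let f : A → B := fun a => ⟨h⁻¹ * a * h, hAB a a.2⟩
  have hf : Function.Injective f := by
    intro a b hab
    have := congrArg Subtype.val hab
    exact Subtype.ext (by simpa [f] using this)
  have hcard : Nat.card A = Nat.card B := le_antisymm (Nat.card_le_card_of_injective f hf) hc
  obtain ⟨a, ha⟩ := ((Nat.bijective_iff_injective_and_card f).2 ⟨hf, hcard⟩).2 ⟨b, hb⟩
  have : h⁻¹ * a * h = b := congrArg Subtype.val ha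
  rw [← this]
  simp [mul_assoc]

/-- The isomorphism of `N_F(H)` from `t` to `q` is conjugation by `h⁻¹` followed by the morphism of
`r`. -/
theorem normEquiv_of_emb {q r t : Pair S} {L : Subgroup S}
    (hr : r.2 ∈ (F.normalizer H).Hom r.1 L) (hrq : r.2.range = q.1)
    (hq : q.1 ≤ Subgroup.normalizer (H : Set S)) (ht : t.1 ≤ H) {h k : S} (hh : h ∈ H)
    (e : Emb t (FusionMackey.pull r q) h k) (hc : Nat.card r.1 ≤ Nat.card t.1) :
    F.NormEquiv H ⊤ t q := by
  have hmem : ∀ a, r.2 a ∈ q.1 := fun a => hrq ▸ ⟨a, rfl⟩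
  have h1 := pull_fst hmem
  have htr : ∀ a ∈ t.1, h⁻¹ * a * h ∈ r.1 := fun a ha => h1.le (e.mem ha)
  have hc1 : conjHom h⁻¹ t.1 ∈ (F.normalizer H).Hom t.1 r.1 :=
    (F.normalizer H).conj_mem (ht.trans Subgroup.le_normalizer) ((F.normalizer H).source_le hr)
      (inv_mem (Subgroup.le_normalizer hh)) fun a => by simpa [conjHom] using htr a a.2
  let θ : t.1 →* S := r.2.comp ((conjHom h⁻¹ t.1).codRestrict r.1 ((F.normalizer H).apply_mem hc1))
  have hθ : ∀ (a : t.1) (b : r.1), (b : S) = h⁻¹ * a * h → θ a = r.2 b := by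
    intro a b hb
    refine congrArg r.2 (Subtype.ext ?_)
    rw [hb]
    simp [conjHom]
  have hθ1 : θ ∈ (F.normalizer H).Hom t.1 q.1 :=
    (F.normalizer H).mem_of_apply_mem ((F.normalizer H).comp_mem hc1 hr) hq fun a => hmem _
  refine ⟨θ, hθ1, le_antisymm ?_ ?_, k, trivial, fun a b hb => ?_⟩
  · rintro _ ⟨a, rfl⟩
    exact (F.normalizer H).apply_mem hθ1 a
  · intro y hy
    rw [← hrq] at hy
    obtain ⟨b, rfl⟩ := hy
    exact ⟨⟨_, isConj_of_emb_card htr hc b b.2⟩, hθ _ b (by simp [mul_assoc])⟩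
  · obtain ⟨c, hc, hc'⟩ := e a
    rw [← hc']
    exact (pull_apply c ⟨c, pull_le r q c.2⟩ b rfl (hb.trans (hθ a _ hc))).symm

/-- The embedding induces an automorphism of the source of `q` in `N_F(H)` which after `φ` becomes
conjugation by `k`, so `k` belongs to the normalizer after `φ`. As `φ` is its own top, some `x` in
`N_φ` induces the same automorphism, and `x` serves as the target coordinate. -/
theorem pairLE_of_emb_pull {q r₁ r₂ : Pair S} {L : Subgroup S} (hq : Function.Injective q.2)
    (htop : F.IsTop H ⊤ q) (hr₁ : r₁.2 ∈ (F.normalizer H).Hom r₁.1 L)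
    (hr₂ : r₂.2 ∈ (F.normalizer H).Hom r₂.1 L) (h₁ : r₁.2.range = q.1) (h₂ : r₂.2.range = q.1)
    {h k : S} (hh : h ∈ H)
    (e : Emb (FusionMackey.pull r₁ q) (FusionMackey.pull r₂ q) h k) :
    PairLE H (F.normBefore H ⊤ q) r₁ r₂ := by
  have hmem₁ : ∀ a, r₁.2 a ∈ q.1 := fun a => h₁ ▸ ⟨a, rfl⟩
  have hmem₂ : ∀ a, r₂.2 a ∈ q.1 := fun a => h₂ ▸ ⟨a, rfl⟩
  have hf₁ := pull_fst hmem₁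
  have hf₂ := pull_fst hmem₂
  have htr : ∀ a ∈ r₁.1, h⁻¹ * a * h ∈ r₂.1 := fun a ha => hf₂.le (e.mem (hf₁.ge ha))
  obtain ⟨e₁, he₁, hre₁⟩ := exists_isIso ((F.normalizer H).onto_mem hr₁) rfl
  obtain ⟨e₂, he₂, hre₂⟩ := exists_isIso ((F.normalizer H).onto_mem hr₂) rfl
  have hcard : Nat.card r₂.1 ≤ Nat.card r₁.1 := by
    rw [Nat.card_congr e₁.toEquiv, Nat.card_congr e₂.toEquiv, h₁, h₂]
  have htr' := isConj_of_emb_card htr hcard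
  let δ : r₁.1 ≃* r₂.1 :=
    { toFun := fun a => ⟨h⁻¹ * a * h, htr a a.2⟩
      invFun := fun b => ⟨h * b * h⁻¹, htr' b b.2⟩
      left_inv := fun a => Subtype.ext (by simp [mul_assoc])
      right_inv := fun a => Subtype.ext (by simp [mul_assoc])
      map_mul' := fun a b => Subtype.ext (by simp [mul_assoc]) }
  have hδ : (F.normalizer H).IsIso δ := isIso_conj ((F.normalizer H).source_le hr₁)
    ((F.normalizer H).source_le hr₂) (g := h⁻¹) (inv_mem (Subgroup.le_normalizer hh)) fun a => by
      simp [δ]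
  have hval : ∀ a : r₁.1, q.2 ⟨r₂.2 (δ a), hmem₂ _⟩ = k * q.2 ⟨r₁.2 a, hmem₁ a⟩ * k⁻¹ := by
    intro a
    have := e.apply ⟨a, hf₁.ge a.2⟩ ⟨δ a, hf₂.ge (δ a).2⟩ rfl
    rwa [pull_apply (r := r₂) (y := q) _ (δ a) ⟨r₂.2 (δ a), hmem₂ _⟩ rfl rfl,
      pull_apply (r := r₁) (y := q) _ a ⟨r₁.2 a, hmem₁ a⟩ rfl rfl] at this
  have hβ : ∃ β ∈ (F.normalizer H).aut q.1, ∀ (a : r₁.1) (x : q.1), (x : S) = r₁.2 a →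
      (β x : S) = r₂.2 (δ a) := by
    have h3 := he₁.symm.trans (hδ.trans he₂)
    have h4 : ∃ φ ∈ (F.normalizer H).Hom r₁.2.range r₂.2.range,
        ∀ (a : r₁.1) (x : r₁.2.range), (x : S) = r₁.2 a → φ x = r₂.2 (δ a) := by
      refine ⟨_, h3, fun a x hx => ?_⟩
      have : x = e₁ a := Subtype.ext (hx.trans (hre₁ a).symm)
      rw [this]
      change ((e₂ (δ (e₁.symm (e₁ a))) : r₂.2.range) : S) = _
      rw [MulEquiv.symm_apply_apply, hre₂]
    rw [h₁, h₂] at h4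
    obtain ⟨φ, hφ, hφ'⟩ := h4
    obtain ⟨β, hβ, hβ'⟩ := FusionSystem.exists_aut hφ
    exact ⟨β, hβ, fun a x hx => (hβ' x).trans (hφ' a x hx)⟩
  obtain ⟨β, hβ, hβ'⟩ := hβ
  have hk : ∀ x : q.1, q.2 (β x) = k * q.2 x * k⁻¹ := by
    intro x
    obtain ⟨a, ha⟩ : (x : S) ∈ r₁.2.range := by rw [h₁]; exact x.2
    have h3 : β x = ⟨r₂.2 (δ a), hmem₂ _⟩ := Subtype.ext (hβ' a x ha.symm)
    have h4 : x = ⟨r₁.2 a, hmem₁ a⟩ := Subtype.ext ha.symm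
    rw [h3, hval, ← h4]
  have hkN : k ∈ F.normAfter H ⊤ q := by
    refine ⟨⟨trivial, mem_normalizer_of_forall ?_⟩, β, hβ, hk⟩
    rintro _ ⟨x, rfl⟩
    exact ⟨β x, hk x⟩
  obtain ⟨x, hx, hxk⟩ := htop.2 k hkN
  refine ⟨h, hh, x, hx, fun a => ⟨δ a, rfl, ?_⟩⟩
  have hxN := hx.1.2
  have hc := (Subgroup.mem_normalizer_iff.1 hxN (r₁.2 a)).1 (hmem₁ a)
  have h3 := hxk ⟨r₁.2 a, hmem₁ a⟩ ⟨_, hc⟩ rfl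
  rw [← hval] at h3
  exact (congrArg Subtype.val (hq h3)).symm

/-- The products of `H` with the normalizers before the elements of `[N_F(H) × S]` decompose the
product of `H` and `S`. -/
theorem sum_isNormProduct (hC : IsCentricSub F (F.normalizer H) C) (hD : IsCentricSub F F D)
    {T X : Finset (Pair S)} (hT : F.IsProductIn D H ⊤ T) (hX : F.IsNormProduct H ⊤ T X)
    {T' : Subgroup S → Finset (Pair S)}
    (hT' : ∀ Q ∈ C, (F.normalizer H).IsProductIn C H Q (T' Q)) {V : Type*} [AddCommMonoid V]
    (τ : Subgroup S → V) (hτ : ∀ q ∈ T, ∀ A ∈ C, A ≤ H → ∀ h ∈ H, (∀ a ∈ A, h⁻¹ * a * h ∈ q.1) →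
      (∀ b ∈ q.1, h * b * h⁻¹ ∈ A) → τ A = τ q.1) :
    ∑ q ∈ X, ∑ r ∈ T' (F.normBefore H ⊤ q), τ r.1 = ∑ t ∈ T, τ t.1 := by
  classical
  have hXm : ∀ q ∈ X, F.IsMaxPairIn D H ⊤ q := fun q hq => hT.1 q (hX.1 hq)
  have hNC : ∀ q ∈ X, F.normBefore H ⊤ q ∈ C := fun q hq => hC.family.up
    ((hC.mem_iff q.1).2 ⟨((hD.mem_iff _).1 (hXm q hq).1.1).1,
      (hXm q hq).1.2.1.trans Subgroup.le_normalizer⟩)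
    (le_normBefore (hXm q hq).1.2.1) (normBefore_le q)
  have hTm : ∀ q ∈ X, ∀ r ∈ T' (F.normBefore H ⊤ q),
      (F.normalizer H).IsMaxPairIn C H (F.normBefore H ⊤ q) r := fun q hq r hr =>
    (hT' _ (hNC q hq)).1 r hr
  have hpull : ∀ q ∈ X, ∀ r ∈ T' (F.normBefore H ⊤ q),
      F.IsMaxPairIn D H ⊤ (FusionMackey.pull r q) ∧ r.2.range = q.1 := by
    intro q hq r hr
    obtain ⟨α, hα, h, hrange⟩ := (hXm q hq).exists_aut hC hD (hTm q hq r hr)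
    exact ⟨(hXm q hq).pull hD (hom_of_normalizer (hTm q hq r hr).1.2.2) (hTm q hq r hr).1.2.1 hα h
      hrange, hrange⟩
  have happly : ∀ q ∈ X, ∀ r ∈ T' (F.normBefore H ⊤ q), ∀ a, r.2 a ∈ q.1 := fun q hq r hr =>
    (hTm q hq r hr).1.apply_mem hD.family (hXm q hq)
  rw [Finset.sum_sigma']
  refine sum_eq_sum_of_rel (fun (x : Σ _ : Pair S, Pair S) t =>
    PairLE H ⊤ (FusionMackey.pull x.2 x.1) t ∧ PairLE H ⊤ t (FusionMackey.pull x.2 x.1))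
    ?_ ?_ ?_
  · rintro ⟨q, r⟩ hx
    rw [Finset.mem_sigma] at hx
    exact hT.2 _ (hpull q hx.1 r hx.2).1
  · intro t ht
    have htm := hT.1 t ht
    -- The class of `t` has a representative `q` in `X`, and the isomorphism `θ` onto the source of
    -- `q` is itself a maximal pair of `H × N_φ`; `r` is its representative.
    obtain ⟨q, ⟨hq, θ, hθ, hθr, k, -, hk⟩, hqu⟩ := hX.2.2 t ht
    have hθN : θ ∈ (F.normalizer H).Hom t.1 (F.normBefore H ⊤ q) :=
      (F.normalizer H).mem_of_apply_mem hθ (normBefore_le q) fun a =>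
        le_normBefore (hXm q hq).1.2.1 ((F.normalizer H).apply_mem hθ a)
    have hpair : (F.normalizer H).IsPairIn C H (F.normBefore H ⊤ q) ⟨t.1, θ⟩ :=
      ⟨(hC.mem_iff _).2 ⟨((hD.mem_iff _).1 htm.1.1).1, htm.1.2.1.trans Subgroup.le_normalizer⟩,
        htm.1.2.1, hθN⟩
    have hmax := isMaxPairIn_of_range_eq hD.family (hXm q hq) hpair hθr
    obtain ⟨r, ⟨hr, hle, -⟩, -⟩ := (hT' _ (hNC q hq)).2 _ hmax
    have hle' : PairLE H ⊤ t (FusionMackey.pull r q) := by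
      obtain ⟨h, hh, n, hn, e⟩ := hle
      obtain ⟨z, hz⟩ := exists_of_mem_normBefore hn
      refine ⟨h, hh, z * k, trivial, fun a => ?_⟩
      obtain ⟨b, hb, hb'⟩ := e a
      obtain ⟨c, hc, hc'⟩ := hz ⟨θ a, (F.normalizer H).apply_mem hθ a⟩
      have hbp : (b : S) ∈ (FusionMackey.pull r q).1 := (pull_fst (happly q hq r hr)).ge b.2
      refine ⟨⟨b, hbp⟩, hb, ?_⟩
      refine (pull_apply (r := r) (y := q) ⟨b, hbp⟩ b c rfl (hc.trans hb'.symm)).trans ?_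
      rw [hc', hk a _ rfl]
      simp [mul_assoc]
    refine ⟨⟨q, r⟩, ⟨Finset.mem_sigma.2 ⟨hq, hr⟩, htm.2 _ (hpull q hq r hr).1.1 hle', hle'⟩, ?_⟩
    rintro ⟨q₁, r₁⟩ ⟨hx, hle₁, hle₁'⟩
    rw [Finset.mem_sigma] at hx
    obtain ⟨hq₁, hr₁⟩ := hx
    dsimp only at hq₁ hr₁ hle₁ hle₁'
    -- Any other preimage of `t` has its first component in the class of `t`, which meets `X` only
    -- once.
    have heq : q₁ = q := by
      refine hqu q₁ ⟨hq₁, ?_⟩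
      obtain ⟨h, hh, k, hk, e⟩ := hle₁'
      have hc := hle₁.card_le
      rw [pull_fst (happly q₁ hq₁ r₁ hr₁)] at hc
      exact normEquiv_of_emb (hTm q₁ hq₁ r₁ hr₁).1.2.2 (hpull q₁ hq₁ r₁ hr₁).2
        ((hXm q₁ hq₁).1.2.1.trans Subgroup.le_normalizer) hpair.2.1 hh e hc
    subst heq
    -- With the same `q`, comparable pullbacks come from comparable pairs because `q` is its own
    -- top.
    have heq : r₁ = r := by
      refine (hT' _ (hNC q₁ hq)).eq_of_le hr₁ hr ?_
      obtain ⟨h, hh, k, -, e⟩ := hle₁.trans hle'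
      exact pairLE_of_emb_pull (F.injective (hXm q₁ hq).1.2.2) (hX.2.1 q₁ hq)
        (hTm q₁ hq r₁ hr₁).1.2.2 (hTm q₁ hq r hr).1.2.2 (hpull q₁ hq r₁ hr₁).2
        (hpull q₁ hq r hr).2 hh e
    rw [heq]
  · rintro ⟨q, r⟩ hx t ht ⟨⟨h, hh, k, hk, e⟩, hle⟩
    rw [Finset.mem_sigma] at hx
    have h1 := pull_fst (happly q hx.1 r hx.2)
    refine hτ t ht r.1 (hTm q hx.1 r hx.2).1.1 (hTm q hx.1 r hx.2).1.2.1 h hh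
      (fun a ha => Emb.mem e (h1.ge ha)) (isConj_of_emb_card (fun a ha => Emb.mem e (h1.ge ha)) ?_)
    have := hle.card_le
    dsimp only at this
    rwa [h1] at this

theorem NormEquiv.symm {q r : Pair S} (h : F.NormEquiv H ⊤ q r) : F.NormEquiv H ⊤ r q := by
  obtain ⟨θ, hθ, hr, k, -, hk⟩ := h
  obtain ⟨ψ, hψ, hψ'⟩ := (F.normalizer H).exists_inv hθ hr
  have hinv : ∀ b : r.1, ∃ a : q.1, (b : S) = θ a := by
    intro b
    obtain ⟨a, ha⟩ : (b : S) ∈ θ.range := by rw [hr]; exact b.2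
    exact ⟨a, ha.symm⟩
  refine ⟨ψ, hψ, le_antisymm ?_ fun x hx => ?_, k⁻¹, trivial, fun b a ha => ?_⟩
  · rintro _ ⟨b, rfl⟩
    exact (F.normalizer H).apply_mem hψ b
  · exact ⟨⟨θ ⟨x, hx⟩, (F.normalizer H).apply_mem hθ _⟩, hψ' ⟨x, hx⟩ _ rfl⟩
  · obtain ⟨a', ha'⟩ := hinv b
    have : a = a' := Subtype.ext (ha.trans (hψ' a' b ha'))
    rw [this, hk a' b ha']
    simp [mul_assoc]

theorem NormEquiv.trans {q r t : Pair S} (h : F.NormEquiv H ⊤ q r) (h' : F.NormEquiv H ⊤ r t) :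
    F.NormEquiv H ⊤ q t := by
  obtain ⟨θ, hθ, hr, k, -, hk⟩ := h
  obtain ⟨θ', hθ', hr', k', -, hk'⟩ := h'
  refine ⟨_, (F.normalizer H).comp_mem hθ hθ', ?_, k' * k, trivial, fun a b hb => ?_⟩
  · rw [← hr']
    ext x
    constructor
    · rintro ⟨a, rfl⟩
      exact ⟨_, rfl⟩
    · rintro ⟨b, rfl⟩
      obtain ⟨a, ha⟩ : (b : S) ∈ θ.range := by rw [hr]; exact b.2
      exact ⟨a, congrArg θ' (Subtype.ext ha)⟩
  · rw [hk' ⟨θ a, (F.normalizer H).apply_mem hθ a⟩ b hb, hk a _ rfl]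
    simp [mul_assoc]

/-- The representative is chosen as a function of the class, taken as a finite set, so that
equivalent pairs receive the same one. -/
theorem exists_isNormProduct_of_exists {T : Finset (Pair S)}
    (h : ∀ t ∈ T, ∃ r ∈ T, F.IsTop H ⊤ r ∧ F.NormEquiv H ⊤ t r) :
    ∃ X, F.IsNormProduct H ⊤ T X := by
  classical
  let cls : Pair S → Finset (Pair S) := fun t => T.filter fun r => F.NormEquiv H ⊤ t r
  have hc : ∀ s : Finset (Pair S), ∃ r, (∃ r' ∈ s, F.IsTop H ⊤ r') → r ∈ s ∧ F.IsTop H ⊤ r := by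
    intro s
    by_cases hs : ∃ r' ∈ s, F.IsTop H ⊤ r'
    · obtain ⟨r, hr⟩ := hs
      exact ⟨r, fun _ => hr⟩
    -- A default value for sets that contain no top.
    · exact ⟨⟨⊥, 1⟩, fun h => absurd h hs⟩
  choose c hc using hc
  have hct : ∀ t ∈ T, c (cls t) ∈ T ∧ F.NormEquiv H ⊤ t (c (cls t)) ∧ F.IsTop H ⊤ (c (cls t)) := by
    intro t ht
    obtain ⟨r, hr, h1, h2⟩ := h t ht
    obtain ⟨h3, h4⟩ := hc (cls t) ⟨r, Finset.mem_filter.2 ⟨hr, h2⟩, h1⟩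
    obtain ⟨h5, h6⟩ := Finset.mem_filter.1 h3
    exact ⟨h5, h6, h4⟩
  refine ⟨T.image fun t => c (cls t), fun q hq => ?_, fun q hq => ?_, fun t ht =>
    ⟨c (cls t), ⟨Finset.mem_image_of_mem _ ht, (hct t ht).2.1⟩, ?_⟩⟩
  · obtain ⟨t, ht, rfl⟩ := Finset.mem_image.1 hq
    exact (hct t ht).1
  · obtain ⟨t, ht, rfl⟩ := Finset.mem_image.1 hq
    exact (hct t ht).2.2
  · rintro _ ⟨hr, hr'⟩
    obtain ⟨t', ht', rfl⟩ := Finset.mem_image.1 hr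
    have h1 : F.NormEquiv H ⊤ t' t := (hct t' ht').2.1.trans hr'.symm
    have h2 : cls t' = cls t := Finset.filter_congr fun r _ =>
      ⟨fun h => h1.symm.trans h, fun h => h1.trans h⟩
    rw [h2]

/-- `A` and `B` have the same `E`-conjugates, and conjugation by `h⁻¹` maps `N_P(A)` into `N_P(B)`.
-/
theorem IsFullyNormalized.of_conj {P : Subgroup S} {E : FusionSystem P} {A B : Subgroup S}
    (hA : E.IsFullyNormalized A) {h : S} (hh : h ∈ P) (hAB : ∀ a ∈ A, h⁻¹ * a * h ∈ B)
    (hBA : ∀ b ∈ B, h * b * h⁻¹ ∈ A) : E.IsFullyNormalized B := by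
  have hB : B ≤ P := fun b hb => by
    have := mul_mem (mul_mem (inv_mem hh) (hA.1 (hBA b hb))) hh
    simpa [mul_assoc] using this
  let δ : A ≃* B :=
    { toFun := fun a => ⟨h⁻¹ * a * h, hAB a a.2⟩
      invFun := fun b => ⟨h * b * h⁻¹, hBA b b.2⟩
      left_inv := fun a => Subtype.ext (by simp [mul_assoc])
      right_inv := fun a => Subtype.ext (by simp [mul_assoc])
      map_mul' := fun a b => Subtype.ext (by simp [mul_assoc]) }
  have hδ : E.IsIso δ := isIso_conj hA.1 hB (g := h⁻¹) (inv_mem hh) fun a => by simp [δ]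
  refine ⟨hB, fun D hD => (hA.2 D (hδ.isConj.trans hD)).trans ?_⟩
  refine Nat.card_le_card_of_injective
    (fun x : (P ⊓ Subgroup.normalizer (A : Set S) : Subgroup S) =>
      (⟨h⁻¹ * x * h, P.mul_mem (P.mul_mem (P.inv_mem hh) x.2.1) hh, ?_⟩ :
        (P ⊓ Subgroup.normalizer (B : Set S) : Subgroup S))) ?_
  · refine mem_normalizer_of_forall fun b hb => ?_
    have := hAB _ ((Subgroup.mem_normalizer_iff.1 x.2.2 _).1 (hBA b hb))
    simpa [mul_assoc] using this
  · intro x y hxy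
    have := congrArg Subtype.val hxy
    exact Subtype.ext (by simpa using this)

/-- A criterion for a pair to equal its top. -/
theorem isTop_of_forall {q : Pair S} (hn : (F.normalizer H).IsFullyNormalized q.1)
    (h : ∀ α ∈ (F.normalizer H).aut q.1, (∃ y, ∀ a, q.2 (α a) = y * q.2 a * y⁻¹) →
      α ∈ autBy (Subgroup.normalizer (H : Set S)) q.1) : F.IsTop H ⊤ q := by
  refine ⟨hn, fun y hy => ?_⟩
  obtain ⟨α, hα, hαy⟩ := hy.2
  obtain ⟨g, hg, hgα⟩ := h α hα ⟨y, hαy⟩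
  have hval : ∀ a b : q.1, (b : S) = g * a * g⁻¹ → q.2 b = y * q.2 a * y⁻¹ := by
    intro a b hb
    rw [← hαy]
    exact congrArg q.2 (Subtype.ext (hb.trans (hgα a).symm))
  refine ⟨g, mem_transport.2 ⟨⟨hg, mem_normalizer_of_forall fun a ha => ?_⟩, y, hy, hval⟩, hval⟩
  rw [← hgα ⟨a, ha⟩]
  exact (α _).2

/-- The automorphisms of the source of `q` that become inner after `q`. -/
def autAfter {P : Subgroup S} (E : FusionSystem P) (q : Pair S) : Subgroup (MulAut q.1) where
  carrier := {α | α ∈ E.aut q.1 ∧ ∃ y, ∀ a, q.2 (α a) = y * q.2 a * y⁻¹}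
  one_mem' := ⟨one_mem _, 1, fun a => by simp⟩
  mul_mem' := by
    rintro α β ⟨hα, y, hy⟩ ⟨hβ, z, hz⟩
    exact ⟨mul_mem hα hβ, y * z, fun a => by simp [hy, hz, mul_assoc]⟩
  inv_mem' := by
    rintro α ⟨hα, y, hy⟩
    refine ⟨inv_mem hα, y⁻¹, fun a => ?_⟩
    have := hy (α⁻¹ a)
    rw [MulAut.apply_inv_self] at this
    simp [this, mul_assoc]

/-- After the injective `φ` such an automorphism is conjugation by some `y` in `S`, so its order
divides that of `y`. -/
theorem isPGroup_autAfter (hS : IsPGroup p S) {P : Subgroup S} (E : FusionSystem P) {q : Pair S}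
    (hq : Function.Injective q.2) : IsPGroup p (autAfter E q) := by
  rintro ⟨α, hα, y, hy⟩
  obtain ⟨k, hk⟩ := hS y
  have key : ∀ n : ℕ, ∀ a, q.2 ((α ^ n) a) = y ^ n * q.2 a * (y ^ n)⁻¹ := by
    intro n
    induction n with
    | zero => intro a; simp
    | succ n ih =>
      intro a
      rw [pow_succ, MulAut.mul_apply, ih, hy, pow_succ]
      simp [mul_assoc]
  refine ⟨k, Subtype.ext (MulEquiv.ext fun a => hq ?_)⟩
  change q.2 ((α ^ p ^ k) a) = q.2 a
  rw [key, hk]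
  simp

/-- The source `A` is moved to a fully `N_F(H)`-normalized `B`, by an isomorphism which the Sylow
property corrects so that all automorphisms becoming inner after the transported morphism come from
`N_S(H)`. The resulting pair on `B` is still maximal. Its representative in `T` has an `H`-conjugate
source and inherits the property. -/
theorem exists_isTop (hS : IsPGroup p S) (hC : IsCentricSub F (F.normalizer H) C)
    (hD : IsCentricSub F F D) (hsyl : IsClosedFamily.Sylow (F.normalizer H) p C)
    {T : Finset (Pair S)} (hT : F.IsProductIn D H ⊤ T) {t : Pair S} (ht : t ∈ T) :
    ∃ r ∈ T, F.IsTop H ⊤ r ∧ F.NormEquiv H ⊤ t r := by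
  obtain ⟨A, φ⟩ := t
  have htm := hT.1 _ ht
  have hAH : A ≤ H := htm.1.2.1
  have hAP : A ≤ Subgroup.normalizer (H : Set S) := hAH.trans Subgroup.le_normalizer
  have hφ : φ ∈ F.Hom A ⊤ := htm.1.2.2
  obtain ⟨B, hB, hAB⟩ := exists_isFullyNormalized (E := F.normalizer H) hAP
  obtain ⟨e, he⟩ := isConj_iff.1 hAB
  have hAC : A ∈ C := (hC.mem_iff A).2 ⟨((hD.mem_iff _).1 htm.1.1).1, hAP⟩
  have hBC : B ∈ C := (hC.mem_iff B).2 ⟨IsCentric.isConj ((hC.mem_iff A).1 hAC).1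
    (IsIso.isConj (hC.isSub _ _ he)), hB.1⟩
  let φ' : B →* S := φ.comp e.symm.toMonoidHom
  have hφ'inj : Function.Injective φ' := (F.injective hφ).comp e.symm.injective
  -- The automorphisms of `B` that become inner after `φ'` form a `p`-group, so some `γ` conjugates
  -- all of them into `Aut_{N_S(H)}(B)`. Replacing `e` by its composite `ε` with `γ` corrects the
  -- pair.
  obtain ⟨γ, hγ, hγ'⟩ := hsyl B hBC hB (autAfter (F.normalizer H) ⟨B, φ'⟩) (fun α hα => hα.1)
    (isPGroup_autAfter hS (F.normalizer H) (q := ⟨B, φ'⟩) hφ'inj)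
  have hγI := (mem_aut_iff hB.1).1 hγ
  have hε := he.trans hγI
  let ε : A ≃* B := e.trans (γ : B ≃* B)
  have hεs : (F.normalizer H).IsIso ε.symm := IsIso.symm hε
  obtain ⟨α, hα, hα'⟩ := exists_aut_of_normalizer hεs
  have hBH : B ≤ H := by
    intro b hb
    have := apply_mem_of_normalizer hε (ε.symm ⟨b, hb⟩) (hAH (ε.symm ⟨b, hb⟩).2)
    have h1 : (B.subtype.comp (e.trans (γ : B ≃* B)).toMonoidHom) (ε.symm ⟨b, hb⟩) = b :=
      congrArg Subtype.val (ε.apply_symm_apply ⟨b, hb⟩)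
    rwa [h1] at this
  let r₀ : Pair S := ⟨B, A.subtype.comp ε.symm.toMonoidHom⟩
  have hr₀ : r₀.2.range = A := by
    ext x
    constructor
    · rintro ⟨b, rfl⟩
      exact (ε.symm b).2
    · exact fun hx => ⟨ε ⟨x, hx⟩, congrArg Subtype.val (ε.symm_apply_apply ⟨x, hx⟩)⟩
  have hmax := htm.pull hD (r := r₀) (L := A) (hC.isSub _ _ hεs) hBH hα hα' hr₀
  obtain ⟨r, ⟨hrT, hle, hle'⟩, -⟩ := hT.2 _ hmax
  have hrm := hT.1 r hrT
  have hp1 : (FusionMackey.pull r₀ ⟨A, φ⟩).1 = B :=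
    pull_fst (q := ⟨A, φ⟩) (r := r₀) fun b => (ε.symm b).2
  obtain ⟨h, hh, k, -, emb⟩ := hle
  have hBr : ∀ b ∈ B, h⁻¹ * b * h ∈ r.1 := fun b hb => Emb.mem emb (hp1.ge hb)
  have hrB : ∀ b ∈ r.1, h * b * h⁻¹ ∈ B := isConj_of_emb_card hBr (by
    have := hle'.card_le
    rwa [hp1] at this)
  have hhP : h ∈ Subgroup.normalizer (H : Set S) := Subgroup.le_normalizer hh
  have hval : ∀ (a : A) (c : r.1), (c : S) = h⁻¹ * ε a * h → r.2 c = k * φ a * k⁻¹ := by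
    intro a c hc
    rw [Emb.apply emb ⟨ε a, hp1.ge (ε a).2⟩ c hc,
      pull_apply (r := r₀) (y := ⟨A, φ⟩) ⟨ε a, hp1.ge (ε a).2⟩ (ε a) a rfl
        (congrArg Subtype.val (ε.symm_apply_apply a).symm)]
  have hnB := hB.of_conj hhP hBr hrB
  let δ : B ≃* r.1 :=
    { toFun := fun a => ⟨h⁻¹ * a * h, hBr a a.2⟩
      invFun := fun b => ⟨h * b * h⁻¹, hrB b b.2⟩
      left_inv := fun a => Subtype.ext (by simp [mul_assoc])
      right_inv := fun a => Subtype.ext (by simp [mul_assoc])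
      map_mul' := fun a b => Subtype.ext (by simp [mul_assoc]) }
  have hδ : (F.normalizer H).IsIso δ := isIso_conj hB.1 hnB.1 (g := h⁻¹) (inv_mem hhP) fun a => by
    simp [δ]
  have hθ := hε.trans hδ
  refine ⟨r, hrT, isTop_of_forall hnB fun β hβ => ?_, r.1.subtype.comp (ε.trans δ).toMonoidHom, hθ,
    ?_, k, trivial, fun a b hb => hval a b hb⟩
  · rintro ⟨y, hy⟩
    have hβI := (mem_aut_iff hnB.1).1 hβ
    let σ : A ≃* r.1 := ε.trans δ
    have hσ : (F.normalizer H).IsIso σ := hθ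
    -- `x` is `β` transported to `B` along the uncorrected isomorphism `e`. Conjugation by `γ` then
    -- turns it into `β` transported along `δ`.
    let x : MulAut B := e.symm.trans (σ.trans ((β : r.1 ≃* r.1).trans (σ.symm.trans e)))
    have hx : x ∈ autAfter (F.normalizer H) ⟨B, φ'⟩ := by
      refine ⟨(mem_aut_iff hB.1).2 (he.symm.trans (hσ.trans (hβI.trans (hσ.symm.trans he)))),
        k⁻¹ * y * k, fun b => ?_⟩
      have h1 := hval (e.symm b) (σ (e.symm b)) rfl
      have h2 := hval (σ.symm (β (σ (e.symm b)))) (β (σ (e.symm b)))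
        (congrArg Subtype.val (σ.apply_symm_apply (β (σ (e.symm b)))).symm)
      rw [hy, h1] at h2
      have h3 : φ' (x b) = φ (σ.symm (β (σ (e.symm b)))) :=
        congrArg φ (e.symm_apply_apply _)
      change φ' (x b) = k⁻¹ * y * k * φ (e.symm b) * (k⁻¹ * y * k)⁻¹
      rw [h3]
      have h4 := congrArg (fun z => k⁻¹ * z * k) h2
      simpa [mul_assoc] using h4.symm
    obtain ⟨g, hg, hgx⟩ := hγ' x hx
    refine ⟨h⁻¹ * g * h, mul_mem (mul_mem (inv_mem hhP) hg) hhP, fun c => ?_⟩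
    have h5 := hgx (δ.symm c)
    have h6 : (γ * x * γ⁻¹) (δ.symm c) = δ.symm (β c) := by
      have h7 : ∀ b : B, e.symm (γ⁻¹ b) = ε.symm b := fun b => rfl
      change γ (e (σ.symm (β (σ (e.symm (γ⁻¹ (δ.symm c))))))) = δ.symm (β c)
      rw [h7]
      have h8 : σ (ε.symm (δ.symm c)) = c := σ.apply_symm_apply c
      rw [h8]
      exact ε.apply_symm_apply (δ.symm (β c))
    rw [h6] at h5
    have h9 : h * (β c : S) * h⁻¹ = g * (h * c * h⁻¹) * g⁻¹ := h5
    have h10 := congrArg (fun z => h⁻¹ * z * h) h9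
    simpa [mul_assoc] using h10
  · ext x
    constructor
    · rintro ⟨a, rfl⟩
      exact Subtype.coe_prop _
    · exact fun hx => ⟨(ε.trans δ).symm ⟨x, hx⟩,
        congrArg Subtype.val ((ε.trans δ).apply_symm_apply ⟨x, hx⟩)⟩

end FusionSystem

end NormProducts

/-! ### The number of isomorphisms in `[S × K]` modulo `p` -/

section Counting

variable {S : Type u} [Group S] [Finite S] {p : ℕ} [Fact p.Prime]
  {F : FusionSystem (⊤ : Subgroup S)} {D : Set (Subgroup S)}

open Classical in
/-- The characteristic function of the pairs `(A, φ)` in `[S × K]` with `φ(A) = K`. -/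
noncomputable def isoIndicator (p : ℕ) (D : Set (Subgroup S)) (K : Subgroup S) (q : Pair S) : ZMod p :=
  if q.1 ∈ D ∧ Nat.card q.1 = Nat.card K then 1 else 0

theorem card_range_eq {A : Subgroup S} {φ : A →* S} (hφ : Function.Injective φ) :
    Nat.card φ.range = Nat.card A :=
  (Nat.card_congr (MonoidHom.ofInjective hφ).toEquiv).symm

/-- If `K` is normal in `Q` and `K ≤ A`, then double cosets are cosets. -/
theorem IsDoubleReps.card_eq {Q K A : Subgroup S} (hKQ : Q ≤ Subgroup.normalizer (K : Set S))
    (hKA : K ≤ A) {s : Finset S} (hs : IsDoubleReps K Q A s) :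
    s.card = (A.subgroupOf Q).index := by
  rw [Subgroup.index_eq_card, ← Nat.card_eq_finsetCard s]
  refine Nat.card_eq_of_bijective
    (fun k : s => (QuotientGroup.mk (⟨k, hs.1 k k.2⟩ : Q) : Q ⧸ A.subgroupOf Q)) ⟨?_, ?_⟩
  · intro k l h
    have h1 := QuotientGroup.eq.1 h
    rw [Subgroup.mem_subgroupOf] at h1
    refine Subtype.ext ((hs.2 l (hs.1 l l.2)).unique
      ⟨k.2, 1, one_mem _, (k⁻¹ : S) * l, h1, by simp⟩ ⟨l.2, 1, one_mem _, 1, one_mem _, by simp⟩)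
  · intro c
    obtain ⟨x, rfl⟩ := QuotientGroup.mk_surjective c
    obtain ⟨r, ⟨hr, b, hb, a, ha, h⟩, -⟩ := hs.2 x x.2
    refine ⟨⟨r, hr⟩, QuotientGroup.eq.2 ?_⟩
    rw [Subgroup.mem_subgroupOf]
    have h1 := (Subgroup.mem_normalizer_iff'.1 (hKQ (hs.1 r hr)) (r⁻¹ * b)).2 (by simpa using hb)
    have h2 : ((⟨r, hs.1 r hr⟩ : Q)⁻¹ * x : Q) = (r⁻¹ * b * r : S) * a := by
      simp [h, mul_assoc]
    rw [h2]
    exact mul_mem (hKA h1) ha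

/-- As `K` is normal in `Q`, the cut at `k` maps onto `K` exactly if `K` is contained in the image
of `q`, whatever `k` is. Then the sum is the index of this image in `Q`, a power of `p`, which
vanishes modulo `p` unless the image is `Q`. -/
theorem sum_isoIndicator_cut (hS : IsPGroup p S) (hD : IsCentricSub F F D) {K Q : Subgroup S}
    (hK : K ∈ D) (hQ : K ≤ Q) (hQN : Q ≤ Subgroup.normalizer (K : Set S)) {q : Pair S}
    (hq : F.IsPairIn D ⊤ Q q) {s : Finset S} (hs : IsDoubleReps K Q q.2.range s) :
    ∑ k ∈ s, isoIndicator p D K (cut q ⊤ K 1 k) = isoIndicator p D Q q := by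
  classical
  have hinj := F.injective hq.2.2
  have hrange : q.2.range ≤ Q := by rintro _ ⟨a, rfl⟩; exact F.apply_mem hq.2.2 a
  have hmem : ∀ k ∈ s, ∀ x : q.1, ((x : S) ∈ (cut q ⊤ K 1 k).1 ↔ q.2 x ∈ K) := by
    intro k hk x
    rw [mem_cut, Subgroup.mem_normalizer_iff.1 (hQN (hs.1 k hk)) (q.2 x)]
    constructor
    · rintro ⟨-, a, ha, h⟩
      have : a = x := Subtype.ext (by simpa using ha)
      exact this ▸ h
    · exact fun h => ⟨trivial, x, by simp, h⟩
  have hle : ∀ k, (cut q ⊤ K 1 k).1 ≤ q.1 := by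
    intro k x hx
    obtain ⟨-, a, ha, -⟩ := mem_cut.1 hx
    have : x = a := by simp [ha]
    exact this ▸ a.2
  by_cases hKA : K ≤ q.2.range
  · have h1 : ∀ k ∈ s, isoIndicator p D K (cut q ⊤ K 1 k) = 1 := by
      intro k hk
      let φ : (cut q ⊤ K 1 k).1 →* S := q.2.comp (Subgroup.inclusion (hle k))
      have hφ : φ ∈ F.Hom (cut q ⊤ K 1 k).1 Q := F.restrict_mem (hle k) hq.2.2 fun a b hab =>
        congrArg q.2 (Subtype.ext hab.symm)
      have hr : φ.range = K := by
        ext y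
        constructor
        · rintro ⟨a, rfl⟩
          exact (hmem k hk (Subgroup.inclusion (hle k) a)).1 a.2
        · intro hy
          obtain ⟨x, rfl⟩ := hKA hy
          exact ⟨⟨x, (hmem k hk x).2 hy⟩, rfl⟩
      have hc : F.IsConj (cut q ⊤ K 1 k).1 K := ⟨φ, F.mem_of_apply_mem hφ le_top fun a => hr.le ⟨a, rfl⟩, hr⟩
      refine if_pos ⟨(hD.mem_iff _).2 ⟨?_, le_top⟩, hc.card_eq⟩
      exact FusionSystem.IsCentric.isConj ((hD.mem_iff K).1 hK).1 hc.symm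
    rw [Finset.sum_congr rfl h1, Finset.sum_const, hs.card_eq hQN hKA, nsmul_one,
      isoIndicator]
    by_cases hA : q.2.range = Q
    · rw [if_pos ⟨hq.1, by rw [← card_range_eq hinj, hA]⟩, hA, Subgroup.subgroupOf_self,
        Subgroup.index_top, Nat.cast_one]
    · rw [if_neg, ZMod.natCast_eq_zero_iff]
      · obtain ⟨n, hn⟩ := (hS.to_subgroup Q).index (q.2.range.subgroupOf Q)
        have hne : n ≠ 0 := by
          rintro rfl
          rw [pow_zero, Subgroup.index_eq_one, Subgroup.subgroupOf_eq_top] at hn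
          exact hA (le_antisymm hrange hn)
        rw [hn]
        exact dvd_pow_self p hne
      · rintro ⟨-, h⟩
        rw [← card_range_eq hinj] at h
        exact hA (Subgroup.eq_of_le_of_card_ge hrange h.ge)
  · rw [isoIndicator, if_neg]
    · refine Finset.sum_eq_zero fun k hk => if_neg ?_
      rintro ⟨-, h⟩
      refine hKA ?_
      let f : (cut q ⊤ K 1 k).1 → K := fun x => ⟨q.2 ⟨x, hle k x.2⟩, (hmem k hk _).1 x.2⟩
      have hf : Function.Injective f := by
        intro x y hxy
        have := hinj (congrArg Subtype.val hxy)
        exact Subtype.ext (congrArg (fun z : q.1 => (z : S)) this)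
      intro y hy
      obtain ⟨x, hx⟩ := ((Nat.bijective_iff_injective_and_card f).2 ⟨hf, h⟩).2 ⟨y, hy⟩
      exact ⟨⟨x, hle k x.2⟩, congrArg Subtype.val hx⟩
    · rintro ⟨-, h⟩
      rw [← card_range_eq hinj] at h
      exact hKA (Subgroup.eq_of_le_of_card_ge hrange h.ge ▸ hQ)

theorem isInvariant_isoIndicator (K : Subgroup S) :
    F.IsInvariant D ⊤ K (isoIndicator p D K) := by
  intro q r hq hr h h'
  have : Nat.card q.1 = Nat.card r.1 := le_antisymm h.card_le h'.card_le
  rw [isoIndicator, isoIndicator, this]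
  simp [hq.1, hr.1]

/-- The pair `(S, α)` given by an automorphism of `S`. -/
def autPair (α : F.aut ⊤) : Pair S :=
  ⟨⊤, (⊤ : Subgroup S).subtype.comp (α : MulAut (⊤ : Subgroup S)).toMonoidHom⟩

theorem autPair_apply (α : F.aut ⊤) (x : (⊤ : Subgroup S)) :
    (autPair α).2 x = ((α : MulAut (⊤ : Subgroup S)) x : S) := rfl

theorem pairLE_autPair_iff {Q : Subgroup (F.aut ⊤)}
    (hQ : Q = (MulAut.conj : (⊤ : Subgroup S) →* MulAut (⊤ : Subgroup S)).range.subgroupOf (F.aut ⊤))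
    (α β : F.aut ⊤) :
    PairLE ⊤ ⊤ (autPair α) (autPair β) ↔ (QuotientGroup.mk α : F.aut ⊤ ⧸ Q) = QuotientGroup.mk β := by
  rw [QuotientGroup.eq, hQ, Subgroup.mem_subgroupOf]
  constructor
  · rintro ⟨h, hh, k, hk, e⟩
    -- The embedding reads `β(x) = k α(h x h⁻¹) k⁻¹`, so `β` is `α` after conjugation by `α⁻¹(k
    -- α(h))`.
    refine ⟨(α : MulAut (⊤ : Subgroup S))⁻¹ (⟨k, hk⟩ * (α : MulAut (⊤ : Subgroup S)) ⟨h, hh⟩), ?_⟩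
    ext x : 1
    apply (α : MulAut (⊤ : Subgroup S)).injective
    have h1 : ((β : MulAut (⊤ : Subgroup S)) ⟨h⁻¹ * (h * x * h⁻¹) * h, trivial⟩ : S) =
        k * (α : MulAut (⊤ : Subgroup S)) ⟨h * x * h⁻¹, trivial⟩ * k⁻¹ :=
      Emb.apply (q := autPair α) (r := autPair β) e ⟨h * x * h⁻¹, trivial⟩
        ⟨h⁻¹ * (h * x * h⁻¹) * h, trivial⟩ rfl
    have h2 : (⟨h⁻¹ * (h * x * h⁻¹) * h, trivial⟩ : (⊤ : Subgroup S)) = x := by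
      ext; simp [mul_assoc]
    have h3 : (⟨h * x * h⁻¹, trivial⟩ : (⊤ : Subgroup S)) = ⟨h, hh⟩ * x * ⟨h, hh⟩⁻¹ := rfl
    rw [h2, h3] at h1
    ext
    simp [h1, mul_assoc, MulAut.mul_apply]
  · rintro ⟨g, hg⟩
    refine ⟨g, g.2, 1, one_mem _, fun (a : (⊤ : Subgroup S)) => ⟨g⁻¹ * a * g, rfl, ?_⟩⟩
    have h1 : (β : MulAut (⊤ : Subgroup S)) =
        (α : MulAut (⊤ : Subgroup S)) * MulAut.conj g := by
      rw [hg]; simp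
    rw [autPair_apply, autPair_apply, h1, MulAut.mul_apply, MulAut.conj_apply, one_mul, inv_one,
      mul_one]
    congr 2
    simp [mul_assoc]

theorem exists_eq_autPair {q : Pair S} (hq : q.2 ∈ F.Hom q.1 ⊤)
    (hc : Nat.card q.1 = Nat.card (⊤ : Subgroup S)) : ∃ α : F.aut ⊤, q = autPair α := by
  obtain ⟨A, φ⟩ := q
  obtain rfl : A = ⊤ := Subgroup.eq_of_le_of_card_ge le_top hc.ge
  have hinj := F.injective hq
  let f : (⊤ : Subgroup S) →* (⊤ : Subgroup S) := φ.codRestrict ⊤ fun _ => trivial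
  have hf : Function.Bijective f := Finite.injective_iff_bijective.1 fun x y h =>
    hinj (congrArg Subtype.val h)
  exact ⟨⟨MulEquiv.ofBijective f hf, fun _ => hq⟩, rfl⟩

theorem isMaxPairIn_autPair (htop : (⊤ : Subgroup S) ∈ D) (α : F.aut ⊤) :
    F.IsMaxPairIn D ⊤ ⊤ (autPair α) :=
  ⟨⟨htop, le_rfl, α.2 le_rfl⟩, fun _ _ h => h.symm (Subgroup.card_le_of_le le_top)⟩

/-- The number of classes of automorphisms of `S` modulo inner automorphisms is prime to `p`. -/
theorem sum_isoIndicator_top_ne_zero (hF : F.IsSaturated p) (htop : (⊤ : Subgroup S) ∈ D)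
    {T : Finset (Pair S)} (hT : F.IsProductIn D ⊤ ⊤ T) :
    ∑ q ∈ T, isoIndicator p D ⊤ q ≠ 0 := by
  classical
  obtain ⟨Q, hQ⟩ := hF.sylow
  have hfin : Finite (MulAut (⊤ : Subgroup S)) := Finite.of_injective
    (fun (α : MulAut (⊤ : Subgroup S)) x => α x) fun α β h => MulEquiv.ext fun x => congrFun h x
  have := Fintype.ofFinite (F.aut ⊤ ⧸ (Q : Subgroup (F.aut ⊤)))
  have hcard : ∀ q ∈ T, Nat.card q.1 = Nat.card (⊤ : Subgroup S) → ∃ α : F.aut ⊤, q = autPair α :=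
    fun q hq => exists_eq_autPair (hT.1 q hq).1.2.2
  have h1 : ∑ q ∈ T, isoIndicator p D ⊤ q =
      ∑ q ∈ T with Nat.card q.1 = Nat.card (⊤ : Subgroup S), (1 : ZMod p) := by
    rw [Finset.sum_filter]
    refine Finset.sum_congr rfl fun q hq => ?_
    rw [isoIndicator]
    simp [(hT.1 q hq).1.1]
  -- Pairs with source `S` are automorphisms of `S`, and their classes are the cosets of `Inn(S)`, a
  -- Sylow subgroup of `Aut_F(S)` by saturation.
  have h2 : ∑ q ∈ T with Nat.card q.1 = Nat.card (⊤ : Subgroup S), (1 : ZMod p) =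
      ∑ _c : F.aut ⊤ ⧸ (Q : Subgroup (F.aut ⊤)), (1 : ZMod p) := by
    refine sum_eq_sum_of_rel (fun q c => ∃ α : F.aut ⊤, q = autPair α ∧ QuotientGroup.mk α = c)
      (fun q hq => ?_) (fun c _ => ?_) fun _ _ _ _ _ => rfl
    · obtain ⟨hq, hc⟩ := Finset.mem_filter.1 hq
      obtain ⟨α, rfl⟩ := hcard q hq hc
      refine ⟨QuotientGroup.mk α, ⟨Finset.mem_univ _, α, rfl, rfl⟩, ?_⟩
      rintro _ ⟨-, β, hβ, rfl⟩
      exact (pairLE_autPair_iff hQ β α).1 (hβ ▸ PairLE.refl _ _ _)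
    · obtain ⟨α, rfl⟩ := QuotientGroup.mk_surjective c
      obtain ⟨r, ⟨hr, h3, h4⟩, -⟩ := hT.2 _ (isMaxPairIn_autPair htop α)
      have hc := le_antisymm h4.card_le h3.card_le
      obtain ⟨β, rfl⟩ := hcard r hr hc
      refine ⟨autPair β, ⟨Finset.mem_filter.2 ⟨hr, hc⟩, β, rfl,
        (pairLE_autPair_iff hQ β α).1 h4⟩, ?_⟩
      rintro _ ⟨hq, γ, rfl, hγ⟩
      exact hT.eq_of_le (Finset.mem_filter.1 hq).1 hr
        (((pairLE_autPair_iff hQ γ α).2 hγ).trans h3)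
  rw [h1, h2, Finset.sum_const, nsmul_one, Finset.card_univ, ← Nat.card_eq_fintype_card,
    ← Subgroup.index_eq_card, Ne, ZMod.natCast_eq_zero_iff]
  exact Q.not_dvd_index

/-- The number of the pairs `(A, φ)` in `[S × K]` with `φ(A) = K` is prime to `p`. -/
theorem sum_isoIndicator_ne_zero (hS : IsPGroup p S) (hF : F.IsSaturated p)
    (hD : IsCentricSub F F D) {T : Subgroup S → Finset (Pair S)}
    (hT : ∀ K ∈ D, F.IsProductIn D ⊤ K (T K)) {K : Subgroup S} (hK : K ∈ D) :
    ∑ q ∈ T K, isoIndicator p D K q ≠ 0 := by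
  induction h : Nat.card S - Nat.card K using Nat.strong_induction_on generalizing K with
  | _ n ih =>
    by_cases hKt : K = ⊤
    · subst hKt
      exact sum_isoIndicator_top_ne_zero hF hK (hT ⊤ hK)
    · have hlt : K < ⊤ := lt_top_iff_ne_top.2 hKt
      obtain ⟨x, -, hxK, hxN⟩ := exists_mem_normalizer_of_lt (hS.to_subgroup ⊤) hlt
      -- Cutting `[S × N_S(K)]` down to `S × K` shows that the counts for `K` and for the larger
      -- group `N_S(K)` agree modulo `p`.
      let Q := Subgroup.normalizer (K : Set S)
      have hKQ : K ≤ Q := Subgroup.le_normalizer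
      have hQD : Q ∈ D := hD.family.up hK hKQ le_top
      have hcard : Nat.card K < Nat.card Q := by
        refine lt_of_le_of_ne (Subgroup.card_le_of_le hKQ) fun hc => hxK ?_
        rw [Subgroup.eq_of_le_of_card_ge hKQ hc.ge]
        exact hxN
      have hQS : Nat.card Q ≤ Nat.card S := Subgroup.card_le_card_group Q
      have h1 := ih (Nat.card S - Nat.card Q) (by omega) hQD rfl
      obtain ⟨s, hs⟩ := exists_reps hKQ (hT Q hQD)
      rw [← FusionSystem.sum_cut_right hS hD.family le_top le_top hKQ (hT Q hQD) (hT K hK)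
        (isInvariant_isoIndicator K) (fun q _ hq => if_neg fun h => hq h.1) hs,
        Finset.sum_congr rfl fun q hq => sum_isoIndicator_cut hS hD hK hKQ le_rfl
          ((hT Q hQD).1 q hq).1 (hs q hq)]
      exact h1

end Counting

/-! ### Invertibility of the class of `S` -/

section Unit

theorem isUnit_natCast_of_not_dvd {R : Type*} [CommRing R] {p : ℕ} [hp : Fact p.Prime]
    (hR : ∀ q : ℕ, q.Prime → q ≠ p → IsUnit (q : R)) {n : ℕ} (hn : ¬ p ∣ n) : IsUnit (n : R) := by
  induction n using induction_on_primes with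
  | zero => exact absurd (dvd_zero p) hn
  | one => rw [Nat.cast_one]; exact isUnit_one
  | prime_mul q a hq ih =>
    rw [Nat.cast_mul]
    refine (hR q hq ?_).mul (ih fun h => hn (h.mul_left q))
    rintro rfl
    exact hn (dvd_mul_right q a)

/-- Writing `P = Q X + P(0)` gives `Q(s) s = -P(0)`, a unit, and `Q(s)` commutes with `s`. -/
theorem isUnit_of_aeval_eq_zero {R A : Type*} [CommRing R] [Ring A] [Algebra R A] {s : A}
    {P : Polynomial R} (hP : Polynomial.aeval s P = 0) (h0 : IsUnit (P.coeff 0)) : IsUnit s := by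
  rw [← Polynomial.divX_mul_X_add P, map_add, map_mul, Polynomial.aeval_X, Polynomial.aeval_C] at hP
  have h1 : Polynomial.aeval s P.divX * s = algebraMap R A (-P.coeff 0) := by
    rw [map_neg]
    exact eq_neg_of_add_eq_zero_left hP
  have h2 : Commute (Polynomial.aeval s P.divX) s := by
    have := (Commute.all P.divX Polynomial.X).map (Polynomial.aeval s)
    rwa [Polynomial.aeval_X] at this
  have h3 : IsUnit (Polynomial.aeval s P.divX * s) := by
    rw [h1]
    exact h0.neg.map _
  exact ((Commute.isUnit_mul_iff h2).1 h3).2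

variable {S : Type u} [Group S] [Finite S] {R : Type v} [CommRing R]
  {F : FusionSystem (⊤ : Subgroup S)} {M : Type w} [AddCommGroup M] [Module (MackeyAlgebra R F) M]
  [Module R M] [IsScalarTower R (MackeyAlgebra R F) M] {p : ℕ} [Fact p.Prime]
  {D : Set (Subgroup S)}

local notation "𝕌" => upAct R F M
local notation "𝔻" => dnAct R F M
local notation "𝟙" => idAct R F M

theorem commute_idAct {s : Module.End R M} (hs : IsEquivariant R F M F s) (K : Subgroup S) :
    Commute s (𝟙 K) := (hs K K _ (F.subtype_mem le_rfl le_top)).1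

/-- The isomorphism of `A` onto `φ(A)` cancels against its inverse. -/
theorem upAct_mul_dnAct_eq {A K : Subgroup S} {φ : A →* S} (hφ : φ ∈ F.Hom A K) :
    𝕌 K φ * 𝔻 K φ = 𝕌 K φ.range.subtype * 𝔻 K φ.range.subtype := by
  have hr : φ.range ≤ K := by rintro _ ⟨a, rfl⟩; exact F.apply_mem hφ a
  have h1 := F.subtype_mem hr (le_top (a := K))
  have h2 := F.onto_mem hφ
  have h3 : ∀ (a : A) (b : φ.range), (b : S) = φ a → φ a = φ.range.subtype b := fun a b h => h.symm
  rw [← upAct_mul_upAct h2 h1 h3, ← dnAct_mul_dnAct h2 h1 h3, mul_assoc, ← mul_assoc (𝕌 φ.range φ),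
    upAct_mul_dnAct_self h2 rfl, idAct_mul_dnAct h1]

/-- The transfer of the identity is invertible. -/
theorem isUnit_of_isTransfer_one (hS : IsPGroup p S) (hF : F.IsSaturated p)
    (hR : ∀ q : ℕ, q.Prime → q ≠ p → IsUnit (q : R)) (hM : IsCentricMackeyFunctor R F M)
    (hD : IsCentricSub F F D) {T : Subgroup S → Finset (Pair S)}
    (hT : ∀ K ∈ D, F.IsProductIn D ⊤ K (T K)) {s : Module.End R M}
    (hs : IsTransfer F D T 1 s) : IsUnit s := by
  classical
  have hone : IsEquivariant R F M (innerSystem (⊤ : Subgroup S)) (1 : Module.End R M) :=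
    fun A K φ _ => ⟨Commute.one_left _, Commute.one_left _⟩
  have hseq : IsEquivariant R F M F s := hs.isEquivariant hS hM hD le_top hT hone
  let n : Subgroup S → ℕ := fun K => ((T K).filter fun q => Nat.card q.1 = Nat.card K).card
  have hn : ∀ K ∈ D, IsUnit (n K : R) := by
    intro K hK
    refine isUnit_natCast_of_not_dvd hR fun h => sum_isoIndicator_ne_zero hS hF hD hT hK ?_
    rw [← ZMod.natCast_eq_zero_iff, ← Finset.sum_boole] at h
    rw [← h]
    refine Finset.sum_congr rfl fun q hq => ?_
    rw [isoIndicator]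
    simp [((hT K hK).1 q hq).1.1]
  -- Each of the `n K` pairs with image `K` contributes the identity of `I_K^K M`; the others factor
  -- through proper subgroups of `K`.
  have hsK : ∀ K ∈ D, (s - algebraMap R (Module.End R M) (n K)) * 𝟙 K =
      ∑ q ∈ (T K).filter fun q => ¬ Nat.card q.1 = Nat.card K,
        𝕌 K q.2.range.subtype * 𝔻 K q.2.range.subtype := by
    intro K hK
    rw [sub_mul, ((hs K).1 hK).1, trAt, sub_eq_iff_eq_add',
      ← Finset.sum_filter_add_sum_filter_not (T K) fun q => Nat.card q.1 = Nat.card K]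
    congr 1
    · have : ∀ q ∈ (T K).filter fun q => Nat.card q.1 = Nat.card K, termAt F K 1 q = 𝟙 K := by
        intro q hq
        obtain ⟨hq, hc⟩ := Finset.mem_filter.1 hq
        have hqF := ((hT K hK).1 q hq).1.2.2
        rw [termAt, mul_one, upAct_mul_dnAct_self hqF]
        refine Subgroup.eq_of_le_of_card_ge ?_ ?_
        · rintro _ ⟨a, rfl⟩
          exact F.apply_mem hqF a
        · rw [card_range_eq (F.injective hqF), hc]
      rw [Finset.sum_congr rfl this, Finset.sum_const, map_natCast, nsmul_eq_mul]
    · refine Finset.sum_congr rfl fun q hq => ?_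
      rw [termAt, mul_one, upAct_mul_dnAct_eq ((hT K hK).1 q (Finset.mem_filter.1 hq).1).1.2.2]
  -- On `I_K^K M` the factor `X - n K` at `s` passes to strictly smaller subgroups. So `G(s) ^ m`
  -- kills `I_K^K M` whenever `K` has order at most `m`, and the exponent `|S|` kills all of `M`,
  -- while the constant term is up to sign a product of the units `n K`.
  let G : Polynomial R := ∏ K : Subgroup S with K ∈ D, (Polynomial.X - Polynomial.C (n K : R))
  have hcomm : ∀ (P : Polynomial R) (x : Module.End R M), Commute s x →
      Commute (Polynomial.aeval s P) x := by
    intro P x hx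
    induction P using Polynomial.induction_on with
    | C a => rw [Polynomial.aeval_C]; exact Algebra.commutes a x
    | add P Q hP hQ => rw [map_add]; exact hP.add_left hQ
    | monomial k a _ =>
      rw [map_mul, Polynomial.aeval_C, map_pow, Polynomial.aeval_X]
      have h : Commute (algebraMap R _ a) x := Algebra.commutes a x
      exact h.mul_left (hx.pow_left _)
  have key : ∀ m : ℕ, ∀ K ∈ D, Nat.card K ≤ m → Polynomial.aeval s (G ^ m) * 𝟙 K = 0 := by
    intro m
    induction m with
    | zero => exact fun K _ h => absurd (Nat.card_pos (α := K)) (by omega)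
    | succ m ih =>
      intro K hK hc
      obtain ⟨G', hG'⟩ : ∃ G', G = G' * (Polynomial.X - Polynomial.C (n K : R)) := by
        have h1 : K ∈ Finset.univ.filter fun K : Subgroup S => K ∈ D :=
          Finset.mem_filter.2 ⟨Finset.mem_univ K, hK⟩
        exact ⟨_, (Finset.prod_erase_mul _ _ h1).symm⟩
      have h1 : G ^ (m + 1) = G' * G ^ m * (Polynomial.X - Polynomial.C (n K : R)) := by
        rw [pow_succ]
        nth_rewrite 2 [hG']
        ring
      rw [h1, map_mul, map_mul, map_sub, Polynomial.aeval_X, Polynomial.aeval_C, mul_assoc,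
        hsK K hK, Finset.mul_sum]
      refine Finset.sum_eq_zero fun q hq => ?_
      obtain ⟨hq, hne⟩ := Finset.mem_filter.1 hq
      have hq' := ((hT K hK).1 q hq).1
      have hr : q.2.range ≤ K := by rintro _ ⟨a, rfl⟩; exact F.apply_mem hq'.2.2 a
      have hrF := F.subtype_mem hr (le_top (a := K))
      have hcr := card_range_eq (F.injective hq'.2.2)
      have hle := Subgroup.card_le_of_le hr
      have h2 := ih q.2.range (hD.family.iso hq'.1 hq'.2.2) (by omega)
      rw [← upAct_mul_idAct hrF, mul_assoc, mul_assoc, ← mul_assoc (Polynomial.aeval s (G ^ m)),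
        (hcomm (G ^ m) _ (hseq _ _ _ hrF).1).eq, mul_assoc (𝕌 K _), ← mul_assoc (Polynomial.aeval s (G ^ m)), h2,
        zero_mul, mul_zero, mul_zero]
  refine isUnit_of_aeval_eq_zero (P := G ^ Nat.card S) (end_ext (F := F) (M := M) fun K => ?_) ?_
  · rw [zero_mul]
    by_cases hK : K ∈ D
    · exact key _ K hK (Subgroup.card_le_card_group K)
    · rw [idAct_eq_zero hM fun h => hK ((hD.mem_iff K).2 ⟨h, le_top⟩), mul_zero]
  · rw [Polynomial.coeff_zero_eq_eval_zero, Polynomial.eval_pow, Polynomial.eval_prod]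
    refine IsUnit.pow _ ?_
    refine Finset.prod_induction _ IsUnit (fun a b ha hb => ha.mul hb) isUnit_one fun K hK => ?_
    rw [Polynomial.eval_sub, Polynomial.eval_X, Polynomial.eval_C, zero_sub]
    exact (hn K (Finset.mem_filter.1 hK).2).neg

end Unit

/-! ### The composition formula -/

section Main

variable {S : Type u} [Group S] [Finite S] {p : ℕ} [Fact p.Prime] {R : Type v} [CommRing R]
  {F : FusionSystem (⊤ : Subgroup S)} {M : Type w} [AddCommGroup M] [Module (MackeyAlgebra R F) M]
  [Module R M] [IsScalarTower R (MackeyAlgebra R F) M] {P : Subgroup S} {E : FusionSystem P}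
  {C : Set (Subgroup S)}

local notation "𝕌" => upAct R F M
local notation "𝔻" => dnAct R F M
local notation "𝟙" => idAct R F M

theorem isCentricSub_centric (hS : IsPGroup p S) (hF : F.IsSaturated p) :
    IsCentricSub F F {A | F.IsCentric A} :=
  ⟨FusionSystem.IsSub.refl F, FusionSystem.isCentricFamily_centric hS hF,
    fun _ => ⟨fun h => ⟨h, le_top⟩, fun h => h.1⟩⟩

theorem isCentricSub_centricIn {H : Subgroup S} (hS : IsPGroup p S) (hF : F.IsSaturated p)
    (hHc : F.IsCentric H) (hHn : F.IsFullyNormalized H) :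
    IsCentricSub F (F.normalizer H) (FusionSystem.centricIn F H) :=
  ⟨FusionSystem.isSub_normalizer F H, FusionSystem.isCentricFamily_centricIn hS hF hHc hHn,
    fun _ => Iff.rfl⟩

open Classical in
theorem IsCentricSub.isProductIn (hC : IsCentricSub F E C) (hCE : ∀ A ∈ C, E.IsCentric A)
    {A K : Subgroup S} (hA : A ≤ P) {T : Finset (Pair S)} (hT : E.IsProduct A K T) :
    E.IsProductIn C A K (T.filter fun q => q.1 ∈ C) :=
  hT.isProductIn hC.family.up hC.family.iso hCE hA fun _ => Finset.mem_filter

theorem isProductIn_centric (hS : IsPGroup p S) (hF : F.IsSaturated p) {A K : Subgroup S}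
    {T : Finset (Pair S)} (hT : F.IsProduct A K T) :
    F.IsProductIn {A | F.IsCentric A} A K T :=
  have hC := FusionSystem.isCentricFamily_centric hS hF
  hT.isProductIn hC.up hC.iso (fun _ h => h) le_top fun q =>
    ⟨fun h => ⟨h, (hT.1 q h).1.1⟩, fun h => h.1⟩

theorem isTransfer_transfer_centric (hS : IsPGroup p S) (hF : F.IsSaturated p)
    (hM : IsCentricMackeyFunctor R F M) {H : Subgroup S} {T : Subgroup S → Finset (Pair S)}
    (hT : ∀ K, F.IsCentric K → F.IsProduct H K (T K)) (f : Module.End R (Restr R F M H)) :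
    IsTransfer F {A | F.IsCentric A} T (extend R F M H f) (transfer R F M F H T f) := by
  classical
  intro K
  have h := isTransfer_transfer hM (isCentricSub_centric hS hF) (fun _ h => h) le_top hT f K
  refine ⟨fun hK => ?_, h.2⟩
  have h1 : ((T K).filter fun q => q.1 ∈ {A | F.IsCentric A}) = T K :=
    Finset.filter_true_of_mem fun q hq => ((hT K hK).1 q hq).1.1
  have h2 := h.1 hK
  simp only [h1] at h2
  exact h2

theorem isEquivariant_transfer (hS : IsPGroup p S) (hF : F.IsSaturated p)
    (hM : IsCentricMackeyFunctor R F M) {H : Subgroup S} {T : Subgroup S → Finset (Pair S)}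
    (hT : ∀ K, F.IsCentric K → F.IsProduct H K (T K)) {f : Module.End R (Restr R F M H)}
    (hf : f ∈ EndRestr R F M (innerSystem H)) :
    IsEquivariant R F M F (transfer R F M F H T f) :=
  (isTransfer_transfer_centric hS hF hM hT f).isEquivariant hS hM (isCentricSub_centric hS hF)
    le_top (fun K hK => isProductIn_centric hS hF (hT K hK))
    (isEquivariant_extend (fun _ _ _ h => FusionSystem.isSub_innerSystem F le_top h) hf)

theorem unitOf_top_act : act R F M (unitOf R F ⊤) = 1 :=
  end_ext (F := F) fun K => by
    rw [one_mul, idAct, ← map_mul, unitOf_mul_elt_ind le_top]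

theorem extend_top_one : extend R F M ⊤ 1 = 1 :=
  unitOf_top_act

theorem isEquivariant_transferTo {H : Subgroup S} (hS : IsPGroup p S) (hF : F.IsSaturated p)
    (hHc : F.IsCentric H) (hHn : F.IsFullyNormalized H) (hM : IsCentricMackeyFunctor R F M)
    {T' : Subgroup S → Finset (Pair S)}
    (hT' : ∀ K, (F.normalizer H).IsCentric K → (F.normalizer H).IsProduct H K (T' K))
    {f : Module.End R (Restr R F M H)} (hf : f ∈ EndRestr R F M (innerSystem H)) :
    IsEquivariant R F M (F.normalizer H) (transfer R F M (F.normalizer H) H T' f) := by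
  classical
  have hC := isCentricSub_centricIn hS hF hHc hHn
  have hCE : ∀ A ∈ FusionSystem.centricIn F H, (F.normalizer H).IsCentric A := fun A hA =>
    FusionSystem.IsCentric.normalizer hA.1 hA.2
  exact (isTransfer_transfer hM hC hCE Subgroup.le_normalizer hT' f).isEquivariant hS hM hC
    Subgroup.le_normalizer (fun K hK => hC.isProductIn hCE Subgroup.le_normalizer (hT' K (hCE K hK)))
    (isEquivariant_extend (fun _ _ _ h => FusionSystem.isSub_innerSystem F le_top h) hf)

/-- The sources of the pairs lie in `Q`, so truncating `f` to the restriction of `M` to `Q` does not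
change the terms. -/
theorem trAt_unitOf_mul {K Q : Subgroup S} {U : Finset (Pair S)}
    (hU : ∀ q ∈ U, q.1 ≤ Q ∧ q.2 ∈ F.Hom q.1 K) (f : Module.End R M) :
    trAt F K U (act R F M (unitOf R F Q) * f * act R F M (unitOf R F Q)) = trAt F K U f := by
  refine Finset.sum_congr rfl fun q hq => ?_
  obtain ⟨hqQ, hφ⟩ := hU q hq
  have h1 : 𝕌 K q.2 * act R F M (unitOf R F Q) = 𝕌 K q.2 := by
    rw [← upAct_mul_idAct hφ, mul_assoc, idAct, ← map_mul, elt_ind_mul_unitOf hqQ]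
  have h2 : act R F M (unitOf R F Q) * 𝔻 K q.2 = 𝔻 K q.2 := by
    rw [← idAct_mul_dnAct hφ, ← mul_assoc, idAct, ← map_mul, unitOf_mul_elt_ind hqQ]
  rw [termAt, termAt, ← mul_assoc, ← mul_assoc, h1, mul_assoc, h2]

/-- The idempotent of `Q` absorbs that of the larger group `P`, so restriction to `Q` forgets the
earlier truncation to `P`. -/
theorem extend_resMap_compress {Q : Subgroup S} (hQ : Q ≤ P) (g : Module.End R M) :
    extend R F M Q (resMap R F M P Q (compress R F M P g)) =
      act R F M (unitOf R F Q) * g * act R F M (unitOf R F Q) := by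
  obtain ⟨h1, h2⟩ := unitOf_mul_unitOf (R := R) (F := F) hQ
  rw [resMap, LinearMap.comp_apply, extend_compress, extend_compress, ← mul_assoc, ← mul_assoc,
    ← map_mul, h2, mul_assoc _ (act R F M (unitOf R F P)), ← map_mul, h1]

theorem resMap_mem {Q : Subgroup S} (hE : F.IsSub E) (hQ : Q ≤ P) {g : Module.End R (Restr R F M P)}
    (hg : g ∈ EndRestr R F M E) : resMap R F M P Q g ∈ EndRestr R F M (innerSystem Q) :=
  compress_mem (F := F) (fun _ _ _ h => FusionSystem.isSub_innerSystem F le_top h) <| (isEquivariant_extend hE hg).mono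
    fun _ _ _ hφ => FusionSystem.isSub_innerSystem E hQ hφ

/-- An operator commuting with restrictions can be moved inside every term. This is the Frobenius
relation that turns multiplication by the class of `S` into a transfer from `S`. -/
theorem trAt_one_mul {K : Subgroup S} {U : Finset (Pair S)} (hU : ∀ q ∈ U, q.2 ∈ F.Hom q.1 K)
    {g : Module.End R M} (hg : IsEquivariant R F M F g) : trAt F K U 1 * g = trAt F K U g := by
  rw [trAt, trAt, Finset.sum_mul]
  refine Finset.sum_congr rfl fun q hq => ?_
  rw [termAt, termAt, mul_one, mul_assoc, ← (hg _ _ _ (hU q hq)).2.eq, mul_assoc]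

variable {H : Subgroup S} {T : Subgroup S → Subgroup S → Finset (Pair S)}
  {T' : Subgroup S → Finset (Pair S)} {X : Finset (Pair S)}

theorem isCentric_normBefore (hS : IsPGroup p S) (hF : F.IsSaturated p)
    (hT : F.IsProduct H ⊤ (T H ⊤)) (hX : F.IsNormProduct H ⊤ (T H ⊤) X) {q : Pair S} (hq : q ∈ X) :
    F.IsCentric (F.normBefore H ⊤ q) :=
  have h := (hT.1 q (hX.1 hq)).1
  (FusionSystem.isCentricFamily_centric hS hF).up h.1 (FusionSystem.le_normBefore h.2.1) le_top

theorem isTransfer_burnsideS (hS : IsPGroup p S) (hF : F.IsSaturated p)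
    (hM : IsCentricMackeyFunctor R F M) {T : Subgroup S → Finset (Pair S)}
    (hT : ∀ K, F.IsCentric K → F.IsProduct ⊤ K (T K)) :
    IsTransfer F {A | F.IsCentric A} T 1 (burnsideS R F M T) := by
  have h := isTransfer_transfer_centric hS hF hM hT (1 : Module.End R (Restr R F M ⊤))
  rwa [extend_top_one] at h

theorem isEquivariant_one (E : FusionSystem P) : IsEquivariant R F M E 1 := fun _ _ _ _ =>
  ⟨Commute.one_left _, Commute.one_left _⟩

/-- The transfer of a map to the normalizer and then to `F`, before inverting the class of `S`. -/
theorem sum_transfer_resMap (hS : IsPGroup p S) (hF : F.IsSaturated p) (hHc : F.IsCentric H)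
    (hHn : F.IsFullyNormalized H) (hM : IsCentricMackeyFunctor R F M)
    (hT : ∀ A B, F.IsCentric A → F.IsCentric B → F.IsProduct A B (T A B))
    (hT' : ∀ K, (F.normalizer H).IsCentric K → (F.normalizer H).IsProduct H K (T' K))
    (hX : F.IsNormProduct H ⊤ (T H ⊤) X) {f : Module.End R (Restr R F M H)}
    (hf : f ∈ EndRestr R F M (innerSystem H)) :
    ∑ q ∈ X, transfer R F M F (F.normBefore H ⊤ q) (T (F.normBefore H ⊤ q))
        (resMap R F M (Subgroup.normalizer (H : Set S)) (F.normBefore H ⊤ q)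
          (transferTo R F M (F.normalizer H) H T' f)) =
      burnsideS R F M (T ⊤) * transfer R F M F H (T H) f := by
  classical
  have hD := isCentricSub_centric hS hF
  have hC := isCentricSub_centricIn hS hF hHc hHn
  have htop : F.IsCentric ⊤ := hD.family.up (A := H) hHc le_top le_top
  have hCE : ∀ A ∈ FusionSystem.centricIn F H, (F.normalizer H).IsCentric A := fun A hA =>
    FusionSystem.IsCentric.normalizer hA.1 hA.2
  have hHN : H ≤ Subgroup.normalizer (H : Set S) := Subgroup.le_normalizer
  have hTD : ∀ A B, F.IsCentric A → F.IsCentric B →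
      F.IsProductIn {A | F.IsCentric A} A B (T A B) := fun A B hA hB =>
    isProductIn_centric hS hF (hT A B hA hB)
  have hTC : ∀ K ∈ FusionSystem.centricIn F H, (F.normalizer H).IsProductIn
      (FusionSystem.centricIn F H) H K ((T' K).filter fun q => q.1 ∈ FusionSystem.centricIn F H) :=
    fun K hK => hC.isProductIn hCE hHN (hT' K (hCE K hK))
  have hf' := isEquivariant_extend (F := F)
    (fun _ _ _ h => FusionSystem.isSub_innerSystem F le_top h) hf
  have hg := isEquivariant_transfer hS hF hM (fun K hK => hT H K hHc hK) hf
  refine end_ext (F := F) fun K => ?_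
  by_cases hK : F.IsCentric K
  swap
  · rw [idAct_eq_zero hM hK, mul_zero, mul_zero]
  -- The class of `S` times `tr_H(f)` is the transfer from `S` of `tr_H(f)`, to which the double
  -- coset formula with `Q = S` applies.
  have hright : burnsideS R F M (T ⊤) * transfer R F M F H (T H) f * 𝟙 K =
      ∑ t ∈ T H ⊤, trAt F K (T t.1 K) (extend R F M H f) := by
    rw [mul_assoc, (commute_idAct hg K).eq, ← mul_assoc,
      ((isTransfer_burnsideS hS hF hM fun K hK => hT ⊤ K htop hK) K).1 hK |>.1,
      trAt_one_mul (fun q hq => ((hT ⊤ K htop hK).1 q hq).1.2.2) hg]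
    exact sum_transfer hS hM hD hD le_top le_rfl htop (fun K hK => hTD H K hHc hK) hf'
      (isTransfer_transfer_centric hS hF hM (fun K hK => hT H K hHc hK) f) (hTD ⊤ K htop hK)
      fun A hA => hTD A K hA hK
  -- The sum over `[H × S]` is regrouped along `X`. Each group is then the double coset formula for
  -- `Q = N_φ` with the inner transfer taken in `N_F(H)`.
  rw [hright, Finset.sum_mul, ← FusionSystem.sum_isNormProduct hC hD (hTD H ⊤ hHc htop) hX hTC
    (fun A => trAt F K (T A K) (extend R F M H f))]
  · refine Finset.sum_congr rfl fun q hq => ?_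
    have hQ := isCentric_normBefore hS hF (hT H ⊤ hHc htop) hX hq
    have hQN := F.normBefore_le (H := H) q
    rw [((isTransfer_transfer_centric hS hF hM (fun K hK => hT _ K hQ hK) _) K).1 hK |>.1,
      transferTo, LinearMap.comp_apply, extend_resMap_compress hQN, trAt_unitOf_mul fun r hr =>
        ((hT _ K hQ hK).1 r hr).1.2]
    exact sum_transfer hS hM hC hD hHN hQN ⟨hQ, hQN⟩ hTC hf'
      (isTransfer_transfer hM hC hCE hHN hT' f) (hTD _ K hQ hK) fun A hA => hTD A K hA hK
  · intro q hq A hA hAH h hh hAB hBA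
    exact trAt_eq_of_conj hD.family hf' hAH (hTD H ⊤ hHc htop |>.1 q hq).1.2.1 (hTD A K hA.1 hK)
      (hTD _ K (hTD H ⊤ hHc htop |>.1 q hq).1.1 hK) hh hAB hBA

/-- For a non-unit `Ring.inverse` is `0`, so commutation persists in both cases. -/
theorem _root_.Commute.ringInverse_left {A : Type*} [MonoidWithZero A] {s x : A}
    (h : Commute s x) : Commute (Ring.inverse s) x := by
  by_cases hs : IsUnit s
  · obtain ⟨t, rfl⟩ := hs
    rw [Ring.inverse_unit]
    exact h.units_inv_left
  · rw [Ring.inverse_non_unit s hs]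
    exact Commute.zero_left x

theorem IsEquivariant.ringInverse {s : Module.End R M} (hs : IsEquivariant R F M E s) :
    IsEquivariant R F M E (Ring.inverse s) := fun A K φ hφ =>
  ⟨Commute.ringInverse_left (hs A K φ hφ).1, Commute.ringInverse_left (hs A K φ hφ).2⟩

theorem IsEquivariant.sum {ι : Type*} {s : Finset ι} {f : ι → Module.End R M}
    (hf : ∀ i ∈ s, IsEquivariant R F M E (f i)) : IsEquivariant R F M E (∑ i ∈ s, f i) :=
  fun A K φ hφ => ⟨Commute.sum_left _ _ _ fun i hi => (hf i hi A K φ hφ).1,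
    Commute.sum_left _ _ _ fun i hi => (hf i hi A K φ hφ).2⟩

theorem transferNorm_apply (g : Module.End R (Restr R F M (Subgroup.normalizer (H : Set S)))) :
    transferNorm R F M H T X g = Ring.inverse (burnsideS R F M (T ⊤)) *
      ∑ q ∈ X, transfer R F M F (F.normBefore H ⊤ q) (T (F.normBefore H ⊤ q))
        (resMap R F M (Subgroup.normalizer (H : Set S)) (F.normBefore H ⊤ q) g) := by
  rw [transferNorm, LinearMap.comp_apply, LinearMap.sum_apply]
  rfl

end Main

end FusionMackey

theorem mainTheorem9 {S : Type*} [Group S] [Finite S] (p : ℕ) [Fact p.Prime] (hS : IsPGroup p S)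
    (F : FusionSystem (⊤ : Subgroup S)) (hF : F.IsSaturated p)
    (H : Subgroup S) (hHc : F.IsCentric H) (hHn : F.IsFullyNormalized H)
    (R : Type*) [CommRing R] (hR : ∀ q : ℕ, q.Prime → q ≠ p → IsUnit (q : R))
    (M : Type*) [AddCommGroup M] [Module (MackeyAlgebra R F) M] [Module R M]
    [IsScalarTower R (MackeyAlgebra R F) M] (hM : IsCentricMackeyFunctor R F M)
    (T : Subgroup S → Subgroup S → Finset (Pair S))
    (hT : ∀ A B, F.IsCentric A → F.IsCentric B → F.IsProduct A B (T A B))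
    (T' : Subgroup S → Finset (Pair S))
    (hT' : ∀ K, (F.normalizer H).IsCentric K → (F.normalizer H).IsProduct H K (T' K)) :
    IsUnit (burnsideS R F M (T ⊤)) ∧
    (∃ X, F.IsNormProduct H ⊤ (T H ⊤) X) ∧
    ∀ X, F.IsNormProduct H ⊤ (T H ⊤) X →
      (∀ f ∈ EndRestr R F M (innerSystem H), transfer R F M F H (T H) f ∈ EndMackey R F M) ∧
      (∀ f ∈ EndRestr R F M (innerSystem H),
        transferTo R F M (F.normalizer H) H T' f ∈ EndRestr R F M (F.normalizer H)) ∧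
      (∀ g ∈ EndRestr R F M (F.normalizer H), transferNorm R F M H T X g ∈ EndMackey R F M) ∧
      (∀ f ∈ EndRestr R F M (innerSystem H),
        transferNorm R F M H T X (transferTo R F M (F.normalizer H) H T' f) =
          transfer R F M F H (T H) f) ∧
      ((EndRestr R F M (innerSystem H)).map (transferTo R F M (F.normalizer H) H T')).map
          (transferNorm R F M H T X) =
        (EndRestr R F M (innerSystem H)).map (transfer R F M F H (T H)) := by
  have hC := isCentricSub_centricIn hS hF hHc hHn
  have hD := isCentricSub_centric hS hF
  have htop : F.IsCentric ⊤ := hD.family.up (A := H) hHc le_top le_top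
  have hHN : H ≤ Subgroup.normalizer (H : Set S) := Subgroup.le_normalizer
  have hE := FusionSystem.isSub_normalizer F H
  have hTH : ∀ K, F.IsCentric K → F.IsProduct H K (T H K) := fun K hK => hT H K hHc hK
  have hTS : ∀ K, F.IsCentric K → F.IsProduct ⊤ K (T ⊤ K) := fun K hK => hT ⊤ K htop hK
  have hs := isTransfer_burnsideS (R := R) (M := M) hS hF hM hTS
  have hTS' := fun K (hK : F.IsCentric K) => isProductIn_centric hS hF (hTS K hK)
  have hseq := hs.isEquivariant hS hM hD le_top hTS' (isEquivariant_one _)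
  have hunit : IsUnit (burnsideS R F M (T ⊤)) := isUnit_of_isTransfer_one hS hF hR hM hD hTS' hs
  have hTHS := isProductIn_centric hS hF (hTH ⊤ htop)
  refine ⟨hunit, FusionSystem.exists_isNormProduct_of_exists fun t ht =>
    FusionSystem.exists_isTop hS hC hD (FusionSystem.sylow_centricIn hS hF hHc hHn) hTHS ht,
    fun X hX => ?_⟩
  have hcomp : ∀ f ∈ EndRestr R F M (innerSystem H),
      transferNorm R F M H T X (transferTo R F M (F.normalizer H) H T' f) =
        transfer R F M F H (T H) f := by
    intro f hf
    rw [transferNorm_apply, sum_transfer_resMap hS hF hHc hHn hM hT hT' hX hf,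
      Ring.inverse_mul_cancel_left _ _ hunit]
  refine ⟨fun f hf => mem_endMackey (isEquivariant_transfer hS hF hM hTH hf), fun f hf => ?_,
    fun g hg => ?_, hcomp, ?_⟩
  · exact compress_mem hE (isEquivariant_transferTo hS hF hHc hHn hM hT' hf)
  · rw [transferNorm_apply]
    refine mem_endMackey (hseq.ringInverse.mul (IsEquivariant.sum fun q hq => ?_))
    have hQ := isCentric_normBefore hS hF (hTH ⊤ htop) hX hq
    exact isEquivariant_transfer hS hF hM (fun K hK => hT _ K hQ hK)
      (resMap_mem hE (FusionSystem.normBefore_le q) hg)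
  · ext g
    simp only [Submodule.mem_map, exists_exists_and_eq_and]
    exact exists_congr fun f => and_congr_right fun hf => by rw [hcomp f hf]
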